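/- **Setting.** Let $d\ge 2$, $1<\alpha<2$, $\lambda>0$. Points of $\mathbb R^{d+1}$ are written $(t,x)$, $t\in\mathbb R$, $x\in\mathbb R^d$; $\nabla=\nabla_x$, $\Delta=\Delta_x$; all functions are real-valued; $\langle g,h\rangle=\int_{\mathbb R^{d+1}}gh$; $p'=p/(p-1)$. Put $A_\lambda=\lambda+\partial_t+(-\Delta)^{\alpha/2}$ and $A^*_\lambda=\lambda-\partial_t+(-\Delta)^{\alpha/2}$. For $s>0$, $$A_\lambda^{-s}g(t,x)=\frac1{\Gamma(s)}\int_{-\infty}^t\int_{\mathbb R^d}(t-r)^{s-1}e^{-\lambda(t-r)}\,e^{-(t-r)(-\Delta)^{\alpha/2}}(x-y)\,g(r,y)\,dy\,dr ,$$ and $(A_\lambda^*)^{-s}$ is the same with $t$ and $r$ exchanged in the kernel; on test functions $A_\lambda^{s}=A_\lambda^{-(1-s)}A_\lambda$ and $(A_\lambda^*)^{s}=(A_\lambda^*)^{-(1-s)}A_\lambda^*$ for $0<s<1$. For $\gamma\in\mathbb R$ let $\mathbb W_\alpha^{\gamma,p}=A_\lambda^{-\gamma/2}L^p(\mathbb R^{d+1})$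 with norm $\|g\|_{\mathbb W_\alpha^{\gamma,p}}=\|A_\lambda^{\gamma/2}g\|_p$; for $-2<\gamma<0$ its elements are the distributions $f$ of the form $f(\varphi)=\langle F,(A_\lambda^*)^{-\gamma/2}\varphi\rangle$, $\varphi\in C_c^\infty(\mathbb R^{d+1})$, with $F=:A_\lambda^{\gamma/2}f\in L^p$. For $q>1$, $$\|v\|_{E_q}=\sup_{\rho>0,\,(t,x)}\rho\Big(\frac1{|C_\rho(t,x)|}\int_{C_\rho(t,x)}|v|^q\Big)^{1/q},\qquad C_\rho(t,x)=\{(s,y):t\le s\le t+\rho^\alpha,\ |y-x|\le\rho\}.$$ For a vector field $b$ put $b^{1/p}=b|b|^{-1+1/p}$. Let $\gamma_\epsilon(z)=\epsilon^{-(d+1)}\gamma(z/\epsilon)$ be a Friedrichs mollifier on $\mathbb R^{d+1}$ and $$b_n=\gamma_{\epsilon_n}*(\mathbf 1_nb),\qquad \mathbf 1_n=\text{indicator of }\{|t|\le n,\ |x|\le n,\ |b(t,x)|\le n\},$$ where $\epsilon_n\downarrow0$ sufficiently rapidly, that is, $0<\epsilon_n\le\delta_n$ for a certain sequence $\delta_n>0$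 that depends on $b$, its decomposition below, $p$ and $\gamma$, but not on $\lambda$, $f$, $f_n$. **Theorem.** Let $b=b_{\mathfrak s}+b_{\mathfrak b}:\mathbb R^{d+1}\to\mathbb R^d$ with $|b_{\mathfrak b}|\in L^\infty(\mathbb R^{d+1})$ and $|b_{\mathfrak s}|^{\frac1{\alpha-1}}\in E_q$ for some $1<q<d+\alpha$. (i) For every $1<p<\infty$ there are constants $c_{d,\alpha,p,q}>0$ and $\lambda_{d,\alpha,p,q,\|b_{\mathfrak b}\|_\infty}\ge0$ such that, if $\||b_{\mathfrak s}|^{\frac1{\alpha-1}}\|_{E_q}<c_{d,\alpha,p,q}$, then for every $\lambda>\lambda_{d,\alpha,p,q,\|b_{\mathfrak b}\|_\infty}$ the operators $$R_p=b^{\frac1p}\cdot\nabla A_\lambda^{-\frac1\alpha+(-1+\frac1\alpha)\frac1p},\qquad Q_p=A_\lambda^{(-1+\frac1\alpha)\frac1{p'}}|b|^{\frac1{p'}}$$ ($\nabla$ the weak gradient, $Q_p$ an integral operator whose integrals converge absolutely a.e.) are bounded on $L^p(\mathbb R^{d+1})$ and $\|R_p\|_{p\to p}\|Q_p\|_{p\to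 p}<1$, so that $1+Q_pR_p$ and $1+R_pQ_p$ are invertible and $(1+Q_pR_p)^{-1}=\sum_{k\ge0}(-Q_pR_p)^k$. Let $f\in\mathbb W_\alpha^{(-1+\frac1\alpha)\frac2{p'},p}$ and let $f_n\in L^\infty(\mathbb R^{d+1})$ with $f_n\to f$ in $\mathbb W_\alpha^{(-1+\frac1\alpha)\frac2{p'},p}$. Then the equations $$\lambda u_n+\partial_tu_n+(-\Delta)^{\frac\alpha2}u_n+b_n\cdot\nabla u_n=f_n\quad\text{on }\mathbb R^{d+1}$$ have solutions (in the sense of distributions, with $u_n,|\nabla u_n|\in L^p$), and any such solutions $u_n$ converge in $\mathbb W_\alpha^{\frac2\alpha+\frac{\alpha-1}\alpha\frac2p,p}$ to $$u=A_\lambda^{-\frac1\alpha+(-1+\frac1\alpha)\frac1p}(1+Q_pR_p)^{-1}A_\lambda^{(-1+\frac1\alpha)\frac1{p'}}f .$$ In particular $u\in\mathbb W_\alpha^{\frac2\alpha+\frac{\alpha-1}\alpha\frac2p,p}$. If $p>d+1$, then (after modification on null sets) $u$ and $u_n$ are bounded and continuous and $u_n\to u$ uniformly on $\mathbb R^{d+1}$.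 (ii) Under the same conditions, also $$u=A_\lambda^{-1}f-A_\lambda^{-\frac1\alpha+(-1+\frac1\alpha)\frac1p}\,Q_p(1+R_pQ_p)^{-1}R_p\,A_\lambda^{(-1+\frac1\alpha)\frac1{p'}}f,$$ where $A_\lambda^{-1}f\in L^p$ solves $A_\lambda v=f$ in the sense of distributions. (iii) Let $p=2$, with $c_{d,\alpha,2,q}$ and $\lambda$ as in (i), and $f\in\mathbb W_\alpha^{-1+\frac1\alpha,2}$. Then $u$ is the unique weak solution of $\lambda u+\partial_tu+(-\Delta)^{\frac\alpha2}u+b\cdot\nabla u=f$, i.e. the unique $u\in\mathbb W_\alpha^{1+\frac1\alpha,2}$ such that for all $\eta\in C_c^\infty(\mathbb R^{d+1})$ $$\big\langle A_\lambda^{\frac12+\frac1{2\alpha}}u,A_\lambda^{\frac12+\frac1{2\alpha}}\eta\big\rangle+\big\langle R_2A_\lambda^{\frac12+\frac1{2\alpha}}u,\,Q_2^*A_\lambda^{\frac12+\frac1{2\alpha}}\eta\big\rangle=\big\langle A_\lambda^{-\frac12+\frac1{2\alpha}}f,A_\lambda^{\frac12+\frac1{2\alpha}}\eta\big\rangle .$$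 -/

import Mathlib

open MeasureTheory Filter Topology
open scoped ENNReal FourierTransform Distributions ContDiff InnerProductSpace BoundedContinuousFunction

noncomputable section

namespace StableDrift

/-- The space `ℝ^d` with its Euclidean norm. -/
abbrev Sp (d : ℕ) := EuclideanSpace ℝ (Fin d)

/-- Space-time `ℝ^{d+1}`, points are pairs `(t, x)`. -/
abbrev ST (d : ℕ) := ℝ × Sp d

/-- Real test functions `C_c^∞(ℝ^{d+1})`. -/
abbrev Test (d : ℕ) := 𝓓((⊤ : TopologicalSpace.Opens (ST d)), ℝ)

/-- Real distributions on `ℝ^{d+1}`. -/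
abbrev Distr (d : ℕ) := 𝓓'((⊤ : TopologicalSpace.Opens (ST d)), ℝ)

/-- The real Lebesgue space `L^p(ℝ^{d+1})`. -/
abbrev LL (d : ℕ) (p : ℝ≥0∞) := Lp ℝ p (volume : Measure (ST d))

/-! ### Parabolic Morrey norm -/

/-- The parabolic cylinder `C_ρ(t,x) = {(s,y) : t ≤ s ≤ t + ρ^α, |y - x| ≤ ρ}`. -/
def cylinder {d : ℕ} (α ρ : ℝ) (z : ST d) : Set (ST d) :=
  {w | z.1 ≤ w.1 ∧ w.1 ≤ z.1 + ρ ^ α ∧ ‖w.2 - z.2‖ ≤ ρ}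

/-- `‖v‖_{E_q} = sup_{ρ > 0, z} ρ (|C_ρ(z)|⁻¹ ∫_{C_ρ(z)} |v|^q)^{1/q}`, with values in `[0,∞]`. -/
def morreyNorm {d : ℕ} (α q : ℝ) (v : ST d → ℝ) : ℝ≥0∞ :=
  ⨆ (ρ : ℝ) (_ : 0 < ρ) (z : ST d),
    ENNReal.ofReal ρ *
      ((∫⁻ w in cylinder α ρ z, ‖v w‖ₑ ^ q) / volume (cylinder α ρ z)) ^ (1 / q)

/-! ### The operators `λ ± ∂_t + (-Δ)^{α/2}` and their fractional powers -/

/-- `(-Δ)^{α/2} φ` on `ℝ^d`: the Fourier multiplier `|2πξ|^α`. -/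
def fracLap {d : ℕ} (α : ℝ) (φ : Sp d → ℝ) (x : Sp d) : ℝ :=
  (𝓕⁻ (fun ξ : Sp d =>
    (((2 * Real.pi * ‖ξ‖) ^ α : ℝ) : ℂ) * 𝓕 (fun y : Sp d => (φ y : ℂ)) ξ) x).re

/-- `(λ + ∂_t + (-Δ)^{α/2}) φ` for a test function. -/
def fwdOp {d : ℕ} (α lam : ℝ) (φ : Test d) (z : ST d) : ℝ :=
  lam * φ z + deriv (fun r => φ (r, z.2)) z.1 + fracLap α (fun y => φ (z.1, y)) z.2

/-- `(λ - ∂_t + (-Δ)^{α/2}) φ` for a test function. -/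
def bwdOp {d : ℕ} (α lam : ℝ) (φ : Test d) (z : ST d) : ℝ :=
  lam * φ z - deriv (fun r => φ (r, z.2)) z.1 + fracLap α (fun y => φ (z.1, y)) z.2

/-- The heat kernel `e^{-t(-Δ)^{α/2}}(x)`, the inverse Fourier transform of `e^{-t|2πξ|^α}`. -/
def heatKernel {d : ℕ} (α t : ℝ) (x : Sp d) : ℝ :=
  ∫ ξ : Sp d, Real.exp (-t * (2 * Real.pi * ‖ξ‖) ^ α) * Real.cos (2 * Real.pi * ⟪x, ξ⟫_ℝ)

/-- The integral kernel of
`(λ + ∂_t + (-Δ)^{α/2})^{-s} = Γ(s)⁻¹ ∫_0^∞ r^{s-1} e^{-r(λ + ∂_t + (-Δ)^{α/2})} dr`, `s > 0`. -/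
def potKernel {d : ℕ} (α lam s : ℝ) (z : ST d) : ℝ :=
  if 0 < z.1 then
    z.1 ^ (s - 1) / Real.Gamma s * Real.exp (-lam * z.1) * heatKernel α z.1 z.2
  else 0

/-- `(λ + ∂_t + (-Δ)^{α/2})^{-s} f`, `s > 0`. -/
def pot {d : ℕ} (α lam s : ℝ) (f : ST d → ℝ) (z : ST d) : ℝ :=
  ∫ w : ST d, potKernel α lam s (z - w) * f w

/-- `(λ - ∂_t + (-Δ)^{α/2})^{-s} f`, `s > 0`. -/
def bwdPot {d : ℕ} (α lam s : ℝ) (f : ST d → ℝ) (z : ST d) : ℝ :=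
  ∫ w : ST d, potKernel α lam s (w - z) * f w

/-- `(λ + ∂_t + (-Δ)^{α/2})^s φ = (λ + ∂_t + (-Δ)^{α/2})^{-(1-s)} (λ + ∂_t + (-Δ)^{α/2}) φ`,
`0 < s < 1`, for a test function. -/
def fwdPow {d : ℕ} (α lam s : ℝ) (φ : Test d) : ST d → ℝ :=
  pot α lam (1 - s) (fwdOp α lam φ)

/-- `(λ - ∂_t + (-Δ)^{α/2})^s φ`, `0 < s < 1`, for a test function. -/
def bwdPow {d : ℕ} (α lam s : ℝ) (φ : Test d) : ST d → ℝ :=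
  bwdPot α lam (1 - s) (bwdOp α lam φ)

/-! ### Parabolic Bessel potential spaces -/

/-- For `s > 0`: the function `u` lies in `𝕎_α^{2s,p} = (λ + ∂_t + (-Δ)^{α/2})^{-s} L^p`, and
`w = (λ + ∂_t + (-Δ)^{α/2})^s u ∈ L^p`; the norm of `u` is `‖w‖_p`. -/
def IsPosBessel {d : ℕ} {p : ℝ≥0∞} (α lam s : ℝ) (u : ST d → ℝ) (w : LL d p) : Prop :=
  u =ᵐ[volume] pot α lam s w

/-- For `0 < s < 1`: the distribution `T` lies in `𝕎_α^{-2s,p} = (λ + ∂_t + (-Δ)^{α/2})^s L^p`, and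
`F = (λ + ∂_t + (-Δ)^{α/2})^{-s} T ∈ L^p`, that is,
`⟨T, φ⟩ = ⟨F, (λ - ∂_t + (-Δ)^{α/2})^s φ⟩` for test functions `φ`; the norm of `T` is `‖F‖_p`. -/
def IsNegBessel {d : ℕ} {p : ℝ≥0∞} (α lam s : ℝ) (T : Test d → ℝ) (F : LL d p) : Prop :=
  ∀ φ : Test d, T φ = ∫ z, F z * bwdPow α lam s φ z

/-- The distribution defined by a function. -/
def funDistr {d : ℕ} (f : ST d → ℝ) (φ : Test d) : ℝ := ∫ z, f z * φ z

/-- The exponent `1/α + (1 - 1/α)/p`. -/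
def ordU (α : ℝ) (p : ℝ≥0∞) : ℝ := 1 / α + (1 - 1 / α) * (1 / p.toReal)

/-- The exponent `(1 - 1/α)/p'`, with `1/p' = 1 - 1/p`. -/
def ordF (α : ℝ) (p : ℝ≥0∞) : ℝ := (1 - 1 / α) * (1 - 1 / p.toReal)

/-! ### The operators `R_p` and `Q_p` -/

/-- `G = ∇_x v` in the sense of distributions on `ℝ^{d+1}`. -/
def IsWeakGrad {d : ℕ} (v : ST d → ℝ) (G : ST d → Sp d) : Prop :=
  LocallyIntegrable v ∧ LocallyIntegrable G ∧
    ∀ (φ : Test d) (e : Sp d),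
      ∫ z, v z * fderiv ℝ (φ : ST d → ℝ) z (0, e) = -∫ z, ⟪G z, e⟫_ℝ * φ z

/-- `b^{1/p} = b |b|^{-1+1/p}`. -/
def rootField {d : ℕ} (p : ℝ≥0∞) (b : ST d → Sp d) (z : ST d) : Sp d :=
  (‖b z‖ ^ (-1 + 1 / p.toReal)) • b z

/-- `R = R_p = b^{1/p} · ∇ (λ + ∂_t + (-Δ)^{α/2})^{-1/α + (-1+1/α)/p}` on `L^p`. -/
def IsOpR {d : ℕ} {p : ℝ≥0∞} [Fact (1 ≤ p)] (α lam : ℝ) (b : ST d → Sp d)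
    (R : LL d p →L[ℝ] LL d p) : Prop :=
  ∀ g : LL d p, ∃ G : ST d → Sp d,
    IsWeakGrad (pot α lam (ordU α p) g) G ∧ ∀ᵐ z, R g z = ⟪rootField p b z, G z⟫_ℝ

/-- `Q = Q_p = (λ + ∂_t + (-Δ)^{α/2})^{(-1+1/α)/p'} |b|^{1/p'}` on `L^p`, an absolutely
convergent integral. -/
def IsOpQ {d : ℕ} {p : ℝ≥0∞} [Fact (1 ≤ p)] (α lam : ℝ) (b : ST d → Sp d)
    (Q : LL d p →L[ℝ] LL d p) : Prop :=
  ∀ g : LL d p,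
    (∀ᵐ z, Integrable (fun w =>
      potKernel α lam (ordF α p) (z - w) * (‖b w‖ ^ (1 - 1 / p.toReal) * g w))) ∧
    Q g =ᵐ[volume] pot α lam (ordF α p) (fun w => ‖b w‖ ^ (1 - 1 / p.toReal) * g w)

/-! ### Regularized drifts and solutions -/

/-- A Friedrichs mollifier profile on `ℝ^{d+1}`. -/
structure IsMollifier {d : ℕ} (γ : ST d → ℝ) : Prop where
  smooth : ContDiff ℝ ∞ γ
  nonneg : ∀ z, 0 ≤ γ z
  supp : ∀ z, 1 < ‖z‖ → γ z = 0
  integral_eq_one : ∫ z, γ z = 1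

/-- `γ_ε(z) = ε^{-(d+1)} γ(z/ε)`. -/
def mollifier {d : ℕ} (γ : ST d → ℝ) (ε : ℝ) (z : ST d) : ℝ :=
  (ε ^ (d + 1))⁻¹ * γ (ε⁻¹ • z)

/-- `1_n b`, with `1_n` the indicator function of `{|t| ≤ n, |x| ≤ n, |b| ≤ n}`. -/
def truncField {d : ℕ} (b : ST d → Sp d) (n : ℕ) : ST d → Sp d :=
  Set.indicator {z | |z.1| ≤ n ∧ ‖z.2‖ ≤ n ∧ ‖b z‖ ≤ n} b

/-- `γ_ε * (1_n b)`. -/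
def regField {d : ℕ} (γ : ST d → ℝ) (b : ST d → Sp d) (ε : ℝ) (n : ℕ) (z : ST d) : Sp d :=
  ∫ w, mollifier γ ε (z - w) • truncField b n w

/-- `u ∈ L^p` with `∇_x u ∈ L^p` solves `λu + ∂_t u + (-Δ)^{α/2} u + b·∇u = f` on `ℝ^{d+1}` in the
sense of distributions. -/
def IsSolution {d : ℕ} (p : ℝ≥0∞) (α lam : ℝ) (b : ST d → Sp d) (f u : ST d → ℝ) : Prop :=
  MemLp u p ∧ ∃ G : ST d → Sp d, IsWeakGrad u G ∧ MemLp G p ∧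
    ∀ φ : Test d, (∫ z, u z * bwdOp α lam φ z) + ∫ z, ⟪b z, G z⟫_ℝ * φ z = ∫ z, f z * φ z

/-- `v = (λ + ∂_t + (-Δ)^{α/2})^{-1} f`: the solution `v ∈ L^p` of the equation without drift. -/
def IsFreeResolvent {d : ℕ} (p : ℝ≥0∞) (α lam : ℝ) (f : Distr d) (v : ST d → ℝ) : Prop :=
  MemLp v p ∧ ∀ φ : Test d, ∫ z, v z * bwdOp α lam φ z = f φ

/-- Weak solutions `u ∈ 𝕎_α^{1+1/α,2}`, where `R = R_2`, `Q = Q_2` and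
`F = (λ + ∂_t + (-Δ)^{α/2})^{-1/2+1/(2α)} f`; here `w = (λ + ∂_t + (-Δ)^{α/2})^{1/2+1/(2α)} u` and
`ζ = (λ + ∂_t + (-Δ)^{α/2})^{1/2+1/(2α)} η`. -/
def IsWeakSolution {d : ℕ} (α lam : ℝ) (R Q : LL d 2 →L[ℝ] LL d 2) (F : LL d 2)
    (u : ST d → ℝ) : Prop :=
  ∃ w : LL d 2, IsPosBessel α lam (1 / 2 + 1 / (2 * α)) u w ∧
    ∀ η : Test d, ∃ ζ : LL d 2, ζ =ᵐ[volume] fwdPow α lam (1 / 2 + 1 / (2 * α)) η ∧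
      ⟪w, ζ⟫_ℝ + ⟪R w, ContinuousLinearMap.adjoint Q ζ⟫_ℝ = ⟪F, ζ⟫_ℝ

end StableDrift

end

open StableDrift

/-! Write A for λ + ∂_t + (-Δ)^{α/2}, s for `ordU α p` and s' for `ordF α p`. Since s + s' = 1, the
resolvent factors as A^{-1} = A^{-s} A^{-s'}, and the drift factors as b·∇ = |b|^{1/p'} (b^{1/p}·∇).
Looking for u = A^{-s} w therefore turns Au + b·∇u = f into the equation w + QRw = F in L^p with F =
A^{-s'} f. Once R and Q have norm at most 1/2, a Neumann series solves it, and the algebraic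
identity (1 + QR)^{-1} = 1 - Q (1 + RQ)^{-1} R yields the second formula for u.

The bounds on R and Q come from a trace inequality. Up to a constant independent of λ, the kernels
of ∇A^{-s} and A^{-s'} are dominated by parabolic Riesz kernels of orders (α-1)/p and (α-1)/p'
(`exists_potKernel_le_rieszKernel`). For a weight V with ∫ V^r ≤ ρ^{d+α-βpr} on parabolic balls of
radius ρ, r > 1, the operator V^{1/p} I_β and its transpose are bounded
(`exists_riesz_trace_bound`). The proof is Schur's test with powers of U = I_θ(V^r), θ = β(r-1): the
mean of U over a ball is at most a constant times its value at the centre, so I_β sends powers of U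
to powers of U. The norms scale like N^{1/p} and N^{1/p'} in the Morrey size N of the singular
drift, hence are small with it. The bounded drift is absorbed by large λ, because the L^1 norms of
the kernels decay in λ.

The kernel estimates rest on subordination. The function exp(-t u^{α/2}) is approximated by Laplace
transforms of shifted compound Poisson laws, so the stable kernel and its gradient are limits of
Gaussian mixtures, and Gaussian bounds integrate to C t |x|^{-d-α} and C t |x|^{-d-1-α}
(`exists_heatKernel_decay`).

For test functions A^{-1}A is the identity: after a Fourier transform in x this is the fundamental
theorem of calculus in t (`Adm.pot_one_fwdOp`). By duality an L^p function orthogonal to every A*φ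
vanishes. Consequently, for bounded drifts, distributional solutions are exactly the functions
A^{-s}w with w + QRw = F. The same argument with (A)^s in place of A* identifies weak solutions when
p = 2.

For the convergence, truncating b to a set S_n turns R into 1_{S_n}R and Q into Q1_{S_n}, which
converge strongly. Mollifying the truncated field changes it by a bounded field of small L^1 norm;
such a field has small Morrey norm because q < d + α, so it perturbs R and Q by operators of small
norm, uniformly in λ. Strong convergence of uniformly contractive operators gives w_n → w. When p >
d + 1 the kernel of A^{-s} lies in L^{p'}, and convergence in L^p becomes uniform convergence of
u_n. -/

noncomputable section

namespace StableDrift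

/-! ### Laplace transforms of measures on the half-line -/

open scoped NNReal

/-- The Laplace transform of a measure on the half-line. -/
def laplace (μ : Measure ℝ≥0) (u : ℝ) : ℝ≥0∞ := ∫⁻ r, ENNReal.ofReal (Real.exp (-(u * r))) ∂μ

/-- Convolution powers. -/
def convPow (ν : Measure ℝ≥0) : ℕ → Measure ℝ≥0
  | 0 => Measure.dirac 0
  | k + 1 => (convPow ν k).conv ν

instance sFinite_convPow (ν : Measure ℝ≥0) [SFinite ν] (k : ℕ) : SFinite (convPow ν k) := by
  induction k with
  | zero => unfold convPow; infer_instance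
  | succ k ih => unfold convPow; infer_instance

theorem laplace_conv (μ ν : Measure ℝ≥0) [SFinite μ] [SFinite ν] (u : ℝ) :
    laplace (μ.conv ν) u = laplace μ u * laplace ν u := by
  unfold laplace
  rw [Measure.lintegral_conv (by fun_prop), ← lintegral_mul_const _ (by fun_prop)]
  congr 1; ext x
  rw [← lintegral_const_mul _ (by fun_prop)]
  congr 1; ext y
  rw [← ENNReal.ofReal_mul (Real.exp_nonneg _), ← Real.exp_add]
  push_cast
  ring_nf

theorem laplace_convPow (ν : Measure ℝ≥0) [SFinite ν] (k : ℕ) (u : ℝ) :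
    laplace (convPow ν k) u = laplace ν u ^ k := by
  induction k with
  | zero => simp [laplace, convPow]
  | succ k ih => rw [convPow, laplace_conv, ih, pow_succ]

/-- The measure whose Laplace transform is the exponential of that of `ν`. -/
def expMeasure (ν : Measure ℝ≥0) : Measure ℝ≥0 :=
  Measure.sum fun k : ℕ => ENNReal.ofReal (1 / (k.factorial : ℝ)) • convPow ν k

/-- Convolution powers have Laplace transforms `g ^ k`, so the sum is the exponential series. With
values in `ℝ≥0∞` the interchange of sum and integral costs nothing. -/
theorem laplace_expMeasure (ν : Measure ℝ≥0) [SFinite ν] {u g : ℝ} (hg : 0 ≤ g)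
    (h : laplace ν u = ENNReal.ofReal g) :
    laplace (expMeasure ν) u = ENNReal.ofReal (Real.exp g) := by
  unfold laplace expMeasure
  rw [lintegral_sum_measure]
  have : ∀ k : ℕ, ∫⁻ r, ENNReal.ofReal (Real.exp (-(u * r)))
      ∂(ENNReal.ofReal (1 / (k.factorial : ℝ)) • convPow ν k) =
      ENNReal.ofReal (g ^ k / k.factorial) := by
    intro k
    rw [lintegral_smul_measure, ← laplace, laplace_convPow, h, smul_eq_mul,
      ← ENNReal.ofReal_pow hg, ← ENNReal.ofReal_mul (by positivity)]
    congr 1; ring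
  simp_rw [this]
  rw [← ENNReal.ofReal_tsum_of_nonneg (fun k => by positivity) (Real.summable_pow_div_factorial g),
    Real.exp_eq_exp_ℝ, NormedSpace.exp_eq_tsum_div]

/-! ### The Lévy representation of `u ^ a` -/

/-- Near the origin the factor is at most u r, leaving r^{-a} with a < 1; at infinity it is at most
1, leaving r^{-1-a} with a > 0. -/
theorem integrableOn_levy {a : ℝ} (ha : 0 < a) (ha1 : a < 1) {u : ℝ} (hu : 0 ≤ u) :
    IntegrableOn (fun r : ℝ => (1 - Real.exp (-(u * r))) * r ^ (-1 - a)) (Set.Ioi 0) := by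
  have hmeas : Measurable fun r : ℝ => (1 - Real.exp (-(u * r))) * r ^ (-1 - a) := by fun_prop
  have hle : ∀ r : ℝ, 0 < r → 0 ≤ 1 - Real.exp (-(u * r)) ∧ 1 - Real.exp (-(u * r)) ≤ u * r ∧
      1 - Real.exp (-(u * r)) ≤ 1 := by
    intro r hr
    have h1 : Real.exp (-(u * r)) ≤ 1 := Real.exp_le_one_iff.2 (by nlinarith [mul_nonneg hu hr.le])
    have h2 := Real.add_one_le_exp (-(u * r))
    have h3 := Real.exp_pos (-(u * r))
    exact ⟨by linarith, by linarith, by linarith⟩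
  rw [← Set.Ioc_union_Ioi_eq_Ioi zero_le_one, integrableOn_union]
  constructor
  · have hi : IntegrableOn (fun r : ℝ => u * r ^ (-a)) (Set.Ioc 0 1) := by
      have := (intervalIntegral.intervalIntegrable_rpow' (a := 0) (b := 1)
        (by linarith : -1 < -a))
      rw [intervalIntegrable_iff_integrableOn_Ioc_of_le zero_le_one] at this
      exact this.const_mul u
    refine hi.mono' hmeas.aestronglyMeasurable ((ae_restrict_mem measurableSet_Ioc).mono ?_)
    intro r hr
    obtain ⟨h1, h2, -⟩ := hle r hr.1
    rw [Real.norm_of_nonneg (mul_nonneg h1 (Real.rpow_nonneg hr.1.le _))]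
    calc _ ≤ u * r * r ^ (-1 - a) := by gcongr; exact Real.rpow_nonneg hr.1.le _
      _ = u * r ^ (-a) := by
        rw [mul_assoc, ← Real.rpow_one_add' hr.1.le (by linarith)]; ring_nf
  · refine (integrableOn_Ioi_rpow_of_lt (by linarith : -1 - a < -1) one_pos).mono'
      hmeas.aestronglyMeasurable ((ae_restrict_mem measurableSet_Ioi).mono ?_)
    intro r hr
    have hr0 : 0 < r := one_pos.trans hr
    obtain ⟨h1, -, h3⟩ := hle r hr0
    have := Real.rpow_nonneg hr0.le (-1 - a)
    rw [Real.norm_of_nonneg (mul_nonneg h1 this)]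
    nlinarith

/-- The constant in the Lévy representation of `u ^ a`. -/
def levyConst (a : ℝ) : ℝ := ∫ r in Set.Ioi (0 : ℝ), (1 - Real.exp (-r)) * r ^ (-1 - a)

theorem levyConst_pos {a : ℝ} (ha : 0 < a) (ha1 : a < 1) : 0 < levyConst a := by
  have hint := integrableOn_levy ha ha1 zero_le_one
  simp only [one_mul] at hint
  unfold levyConst
  rw [setIntegral_pos_iff_support_of_nonneg_ae]
  · have : Set.Ioi 0 ⊆ (Function.support fun r : ℝ => (1 - Real.exp (-r)) * r ^ (-1 - a)) := by
      intro r hr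
      have hr0 : (0 : ℝ) < r := hr
      have h1 : Real.exp (-r) < 1 := by simpa using hr0
      exact (mul_pos (by linarith) (Real.rpow_pos_of_pos hr0 _)).ne'
    rw [Set.inter_eq_right.2 this]
    simp
  · refine (ae_restrict_mem measurableSet_Ioi).mono fun r hr => ?_
    have hr0 : (0 : ℝ) < r := hr
    have h1 : Real.exp (-r) < 1 := by simpa using hr0
    exact (mul_pos (by linarith) (Real.rpow_pos_of_pos hr0 _)).le
  · exact hint

/-- Scaling r ↦ u r extracts the homogeneity; `levyConst` is the value at u = 1. -/
theorem integral_levy {a : ℝ} (ha : 0 < a) {u : ℝ} (hu : 0 ≤ u) :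
    ∫ r in Set.Ioi (0 : ℝ), (1 - Real.exp (-(u * r))) * r ^ (-1 - a) = levyConst a * u ^ a := by
  rcases hu.eq_or_lt with rfl | hu
  · simp [Real.zero_rpow ha.ne']
  have := integral_comp_mul_left_Ioi (fun r => (1 - Real.exp (-r)) * r ^ (-1 - a)) 0 hu
  rw [mul_zero, ← levyConst, smul_eq_mul] at this
  have e : ∫ r in Set.Ioi (0 : ℝ), (1 - Real.exp (-(u * r))) * (u * r) ^ (-1 - a) =
      u ^ (-1 - a) * ∫ r in Set.Ioi (0 : ℝ), (1 - Real.exp (-(u * r))) * r ^ (-1 - a) := by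
    rw [← integral_const_mul]
    refine setIntegral_congr_fun measurableSet_Ioi fun r hr => ?_
    rw [Real.mul_rpow hu.le (le_of_lt hr)]; ring
  rw [e] at this
  have h2 : u ^ a * u ^ (-1 - a) = u⁻¹ := by
    rw [← Real.rpow_add hu, ← Real.rpow_neg_one]; congr 1; ring
  have h3 : 0 < u ^ (-1 - a) := Real.rpow_pos_of_pos hu _
  apply mul_left_cancel₀ h3.ne'
  rw [this, ← h2]; ring

/-- `exp (-t u ^ a)` is approximated from below by Laplace transforms of probability measures
concentrated away from the origin. -/
theorem exists_laplace_approx {a : ℝ} (ha : 0 < a) (ha1 : a < 1) {t η : ℝ} (ht : 0 < t)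
    (hη : 0 < η) : ∃ ε : ℝ, 0 < ε ∧ ∃ μ : Measure ℝ≥0, IsProbabilityMeasure μ ∧ ∀ u : ℝ, 0 ≤ u →
      Real.exp (-(t * u ^ a) - η * u) ≤ ∫ r, Real.exp (-(u * (r + ε))) ∂μ ∧
      ∫ r, Real.exp (-(u * (r + ε))) ∂μ ≤ Real.exp (-(t * u ^ a)) := by
  have hc := levyConst_pos ha ha1
  set c := levyConst a with hcdef
  -- Jumps shorter than k are replaced by a deterministic drift ε. Its size is the integral of r
  -- against the Lévy density (t/c) r^{-1-a} on (0, k], which tends to 0 with k.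
  obtain ⟨k, hk0, hk⟩ : ∃ k : ℝ, 0 < k ∧ t / c * (k ^ (1 - a) / (1 - a)) ≤ η := by
    have : Tendsto (fun k : ℝ => t / c * (k ^ (1 - a) / (1 - a))) (𝓝[>] 0)
        (𝓝 (t / c * (0 ^ (1 - a) / (1 - a)))) := by
      have h1 : ContinuousAt (fun k : ℝ => k ^ (1 - a)) 0 :=
        Real.continuousAt_rpow_const _ _ (Or.inr (by linarith))
      exact ((h1.div_const _).const_mul _).tendsto.mono_left nhdsWithin_le_nhds
    rw [Real.zero_rpow (by linarith), zero_div, mul_zero] at this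
    have h2 := (this.eventually (ge_mem_nhds hη)).and self_mem_nhdsWithin
    obtain ⟨k, h3, h4⟩ := h2.exists
    exact ⟨k, h4, h3⟩
  set ε := t / c * (k ^ (1 - a) / (1 - a)) with hε
  have h1a : 0 < 1 - a := by linarith
  have hε0 : 0 < ε := by rw [hε]; positivity
  -- The Lévy density restricted to r > k has finite mass, so it drives a compound Poisson law.
  set ρ : ℝ → ℝ := fun r => t / c * r ^ (-1 - a) with hρ
  have hρm : Measurable ρ := by rw [hρ]; fun_prop
  have hρi : IntegrableOn ρ (Set.Ioi k) :=
    (integrableOn_Ioi_rpow_of_lt (by linarith : -1 - a < -1) hk0).const_mul _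
  have hρ0 : ∀ r ∈ Set.Ioi k, 0 ≤ ρ r := fun r hr => by
    have : 0 < r := hk0.trans hr
    rw [hρ]; positivity
  set ν : Measure ℝ≥0 := Measure.map Real.toNNReal
    ((volume.restrict (Set.Ioi k)).withDensity fun r => ENNReal.ofReal (ρ r)) with hν
  set g : ℝ → ℝ := fun u => ∫ r in Set.Ioi k, Real.exp (-(u * r)) * ρ r with hg
  have hgi : ∀ u, 0 ≤ u → IntegrableOn (fun r => Real.exp (-(u * r)) * ρ r) (Set.Ioi k) := by
    intro u hu
    refine hρi.mono' (by fun_prop) ((ae_restrict_mem measurableSet_Ioi).mono fun r hr => ?_)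
    have : 0 < r := hk0.trans hr
    rw [Real.norm_of_nonneg (mul_nonneg (Real.exp_nonneg _) (hρ0 r hr))]
    have h1 : Real.exp (-(u * r)) ≤ 1 := Real.exp_le_one_iff.2 (by nlinarith [mul_nonneg hu this.le])
    nlinarith [hρ0 r hr]
  have hg0 : ∀ u, 0 ≤ g u := fun u =>
    setIntegral_nonneg measurableSet_Ioi fun r hr => mul_nonneg (Real.exp_nonneg _) (hρ0 r hr)
  have hL : ∀ u, 0 ≤ u → laplace ν u = ENNReal.ofReal (g u) := by
    intro u hu
    rw [laplace, hν, lintegral_map (by fun_prop) (by fun_prop),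
      lintegral_withDensity_eq_lintegral_mul _ (by fun_prop) (by fun_prop), hg,
      ofReal_integral_eq_lintegral_ofReal (hgi u hu)
        ((ae_restrict_mem measurableSet_Ioi).mono fun r hr =>
          mul_nonneg (Real.exp_nonneg _) (hρ0 r hr))]
    refine setLIntegral_congr_fun measurableSet_Ioi fun r hr => ?_
    have : 0 < r := hk0.trans hr
    simp only [Pi.mul_apply]
    rw [← ENNReal.ofReal_mul (hρ0 r hr), Real.coe_toNNReal _ this.le, mul_comm]
  -- The compound Poisson law: the exponential of the jump measure, normalised by the exponential of
  -- minus its mass `g 0`.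
  set μ : Measure ℝ≥0 := ENNReal.ofReal (Real.exp (-g 0)) • expMeasure ν with hμ
  have hνf : SFinite ν := by rw [hν]; infer_instance
  have hLμ : ∀ u, 0 ≤ u → laplace μ u = ENNReal.ofReal (Real.exp (-(g 0 - g u))) := by
    intro u hu
    rw [laplace, hμ, lintegral_smul_measure, ← laplace, laplace_expMeasure ν (hg0 u) (hL u hu),
      smul_eq_mul, ← ENNReal.ofReal_mul (Real.exp_nonneg _), ← Real.exp_add]
    congr 2; ring
  have hprob : IsProbabilityMeasure μ := by
    constructor
    have := hLμ 0 le_rfl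
    simpa [laplace] using this
  have hdiff : ∀ u, 0 ≤ u → g 0 - g u = t / c * ∫ r in Set.Ioi k,
      (1 - Real.exp (-(u * r))) * r ^ (-1 - a) := by
    intro u hu
    rw [hg, ← integral_sub (hgi 0 le_rfl) (hgi u hu), ← integral_const_mul]
    congr 1; ext r
    simp only [hρ, zero_mul, neg_zero, Real.exp_zero]; ring
  -- The exponent t u^a is the compound Poisson exponent plus the contribution of the removed jumps.
  -- The latter lies between 0 and ε u, so putting the drift ε in its place only lowers the Laplace
  -- transform, by at most the factor exp(-η u).
  have hsplit : ∀ u, 0 ≤ u → t * u ^ a = (t / c * ∫ r in Set.Ioc 0 k,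
      (1 - Real.exp (-(u * r))) * r ^ (-1 - a)) + (g 0 - g u) := by
    intro u hu
    rw [hdiff u hu, ← mul_add, ← setIntegral_union (Set.Ioc_disjoint_Ioi le_rfl) measurableSet_Ioi
      ((integrableOn_levy ha ha1 hu).mono_set Set.Ioc_subset_Ioi_self)
      ((integrableOn_levy ha ha1 hu).mono_set (Set.Ioi_subset_Ioi hk0.le)),
      Set.Ioc_union_Ioi_eq_Ioi hk0.le, integral_levy ha hu, ← hcdef]
    field_simp
  have hrem : ∀ u, 0 ≤ u → 0 ≤ (t / c * ∫ r in Set.Ioc 0 k,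
      (1 - Real.exp (-(u * r))) * r ^ (-1 - a)) ∧ (t / c * ∫ r in Set.Ioc 0 k,
      (1 - Real.exp (-(u * r))) * r ^ (-1 - a)) ≤ ε * u := by
    intro u hu
    have hpt : ∀ r ∈ Set.Ioc 0 k, 0 ≤ (1 - Real.exp (-(u * r))) * r ^ (-1 - a) ∧
        (1 - Real.exp (-(u * r))) * r ^ (-1 - a) ≤ u * r ^ (-a) := by
      intro r hr
      have h1 : Real.exp (-(u * r)) ≤ 1 :=
        Real.exp_le_one_iff.2 (by nlinarith [mul_nonneg hu hr.1.le])
      have h2 := Real.add_one_le_exp (-(u * r))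
      have h4 := Real.rpow_nonneg hr.1.le (-1 - a)
      refine ⟨mul_nonneg (by linarith) h4, ?_⟩
      calc _ ≤ u * r * r ^ (-1 - a) := by gcongr; linarith
        _ = u * r ^ (-a) := by
          rw [mul_assoc, ← Real.rpow_one_add' hr.1.le (by linarith)]; ring_nf
    refine ⟨mul_nonneg (by positivity) (setIntegral_nonneg measurableSet_Ioc fun r hr =>
      (hpt r hr).1), ?_⟩
    have hi : IntegrableOn (fun r : ℝ => u * r ^ (-a)) (Set.Ioc 0 k) := by
      have := (intervalIntegral.intervalIntegrable_rpow' (a := 0) (b := k)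
        (by linarith : -1 < -a))
      rw [intervalIntegrable_iff_integrableOn_Ioc_of_le hk0.le] at this
      exact this.const_mul u
    have h1 := setIntegral_mono_on ((integrableOn_levy ha ha1 hu).mono_set
      Set.Ioc_subset_Ioi_self) hi measurableSet_Ioc fun r hr => (hpt r hr).2
    have h2 : ∫ r in Set.Ioc 0 k, r ^ (-a) = k ^ (1 - a) / (1 - a) := by
      rw [← intervalIntegral.integral_of_le hk0.le, integral_rpow (Or.inl (by linarith)),
        Real.zero_rpow (by linarith), sub_zero, show -a + 1 = 1 - a by ring]
    rw [integral_const_mul, h2] at h1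
    calc _ ≤ t / c * (u * (k ^ (1 - a) / (1 - a))) := by
          gcongr
      _ = _ := by rw [hε]; ring
  refine ⟨ε, hε0, μ, hprob, fun u hu => ?_⟩
  have hI : ∫ r : ℝ≥0, Real.exp (-(u * (r + ε))) ∂μ =
      Real.exp (-(ε * u)) * Real.exp (-(g 0 - g u)) := by
    have h1 : ∀ r : ℝ≥0, Real.exp (-(u * (r + ε))) = Real.exp (-(ε * u)) * Real.exp (-(u * r)) := by
      intro r; rw [← Real.exp_add]; ring_nf
    simp_rw [h1]
    rw [integral_const_mul, integral_eq_lintegral_of_nonneg_ae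
      (ae_of_all _ fun _ => Real.exp_nonneg _) (by fun_prop), ← laplace, hLμ u hu,
      ENNReal.toReal_ofReal (Real.exp_nonneg _)]
  obtain ⟨h1, h2⟩ := hrem u hu
  have h3 := hsplit u hu
  rw [hI, ← Real.exp_add, Real.exp_le_exp, Real.exp_le_exp]
  have h4 : ε * u ≤ η * u := by gcongr
  constructor <;> linarith

/-! ### Cosine transforms -/

open scoped NNReal

section
variable {d : ℕ}

/-- The cosine transform. -/
def cosT (g : Sp d → ℝ) (x : Sp d) : ℝ := ∫ ξ, g ξ * Real.cos (2 * Real.pi * ⟪x, ξ⟫_ℝ)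

/-- The gradient of the cosine transform. -/
def gradT (g : Sp d → ℝ) (x : Sp d) : Sp d :=
  ∫ ξ, (-(2 * Real.pi) * (g ξ * Real.sin (2 * Real.pi * ⟪x, ξ⟫_ℝ))) • ξ

theorem integrable_cosT_integrand {g : Sp d → ℝ} (hg : Integrable g) (x : Sp d) :
    Integrable fun ξ => g ξ * Real.cos (2 * Real.pi * ⟪x, ξ⟫_ℝ) :=
  hg.mul_bdd (c := 1) (Continuous.aestronglyMeasurable (by fun_prop))
    (ae_of_all _ fun ξ => by simpa using Real.abs_cos_le_one _)

theorem norm_gradT_integrand_le (g : Sp d → ℝ) (x ξ : Sp d) :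
    ‖(-(2 * Real.pi) * (g ξ * Real.sin (2 * Real.pi * ⟪x, ξ⟫_ℝ))) • ξ‖ ≤ 2 * Real.pi * (‖ξ‖ * ‖g ξ‖) := by
  rw [norm_smul, norm_mul, norm_mul, norm_neg, Real.norm_of_nonneg (by positivity : 0 ≤ 2 * Real.pi)]
  have h1 : ‖Real.sin (2 * Real.pi * ⟪x, ξ⟫_ℝ)‖ ≤ 1 := by simpa using Real.abs_sin_le_one _
  calc 2 * Real.pi * (‖g ξ‖ * ‖Real.sin (2 * Real.pi * ⟪x, ξ⟫_ℝ)‖) * ‖ξ‖ ≤ 2 * Real.pi * (‖g ξ‖ * 1) * ‖ξ‖ := by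
        gcongr
    _ = _ := by ring

theorem integrable_gradT_integrand {g : Sp d → ℝ} (hg : AEStronglyMeasurable g)
    (hg1 : Integrable fun ξ => ‖ξ‖ * ‖g ξ‖) (x : Sp d) :
    Integrable fun ξ => (-(2 * Real.pi) * (g ξ * Real.sin (2 * Real.pi * ⟪x, ξ⟫_ℝ))) • ξ := by
  refine (hg1.const_mul (2 * Real.pi)).mono' ?_ (ae_of_all _ fun ξ => norm_gradT_integrand_le g x ξ)
  exact (((hg.mul (Continuous.aestronglyMeasurable (by fun_prop))).const_mul _).smul
    aestronglyMeasurable_id)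

theorem hasFDerivAt_cosT {g : Sp d → ℝ} (hg : Integrable g)
    (hg1 : Integrable fun ξ => ‖ξ‖ * ‖g ξ‖) (x : Sp d) :
    HasFDerivAt (cosT g) (innerSL ℝ (gradT g x)) x := by
  have h := hasFDerivAt_integral_of_dominated_of_fderiv_le (μ := (volume : Measure (Sp d)))
    (F := fun x ξ => g ξ * Real.cos (2 * Real.pi * ⟪x, ξ⟫_ℝ))
    (F' := fun x ξ => innerSL ℝ ((-(2 * Real.pi) * (g ξ * Real.sin (2 * Real.pi * ⟪x, ξ⟫_ℝ))) • ξ))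
    (x₀ := x) (s := Set.univ) (bound := fun ξ => 2 * Real.pi * (‖ξ‖ * ‖g ξ‖)) Filter.univ_mem
    (Eventually.of_forall fun y => (integrable_cosT_integrand hg y).aestronglyMeasurable)
    (integrable_cosT_integrand hg x)
    ((innerSL ℝ).continuous.comp_aestronglyMeasurable
      (integrable_gradT_integrand hg.aestronglyMeasurable hg1 x).aestronglyMeasurable)
    (ae_of_all _ fun ξ y _ => by
      rw [innerSL_apply_norm]; exact norm_gradT_integrand_le g y ξ)
    (hg1.const_mul _)
    (ae_of_all _ fun ξ y _ => by
      have h1 : HasFDerivAt (fun y : Sp d => 2 * Real.pi * ⟪y, ξ⟫_ℝ) ((2 * Real.pi) • innerSL ℝ ξ) y := by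
        have h0 : (fun y : Sp d => 2 * Real.pi * ⟪y, ξ⟫_ℝ) = fun y => ((2 * Real.pi) • innerSL ℝ ξ) y := by
          ext y; simp [real_inner_comm]
        rw [h0]; exact ContinuousLinearMap.hasFDerivAt _
      have h2 := (h1.cos).const_mul (g ξ)
      refine h2.congr_fderiv (ContinuousLinearMap.ext fun v => ?_)
      simp
      ring)
  have e : (∫ ξ, innerSL ℝ ((-(2 * Real.pi) * (g ξ * Real.sin (2 * Real.pi * ⟪x, ξ⟫_ℝ))) • ξ)) =
      innerSL ℝ (gradT g x) :=
    (innerSL (E := Sp d) ℝ).integral_comp_comm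
      (integrable_gradT_integrand hg.aestronglyMeasurable hg1 x)
  rw [e] at h
  exact h

theorem abs_cosT_sub_le {g h : Sp d → ℝ} (hg : Integrable g) (hh : Integrable h) (x : Sp d) :
    |cosT g x - cosT h x| ≤ ∫ ξ, |g ξ - h ξ| := by
  unfold cosT
  rw [← integral_sub (integrable_cosT_integrand hg x) (integrable_cosT_integrand hh x)]
  rw [← Real.norm_eq_abs]
  refine norm_integral_le_of_norm_le (hg.sub hh).abs (ae_of_all _ fun ξ => ?_)
  rw [← sub_mul, norm_mul]
  have h1 : ‖Real.cos (2 * Real.pi * ⟪x, ξ⟫_ℝ)‖ ≤ 1 := by simpa using Real.abs_cos_le_one _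
  calc _ ≤ ‖g ξ - h ξ‖ * 1 := by gcongr
    _ = _ := by simp

theorem norm_gradT_sub_le {g h : Sp d → ℝ} (hgm : AEStronglyMeasurable g)
    (hhm : AEStronglyMeasurable h) (hg : Integrable fun ξ => ‖ξ‖ * ‖g ξ‖)
    (hh : Integrable fun ξ => ‖ξ‖ * ‖h ξ‖) (x : Sp d) :
    ‖gradT g x - gradT h x‖ ≤ ∫ ξ, 2 * Real.pi * (‖ξ‖ * |g ξ - h ξ|) := by
  unfold gradT
  rw [← integral_sub (integrable_gradT_integrand hgm hg x) (integrable_gradT_integrand hhm hh x)]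
  refine norm_integral_le_of_norm_le ?_ (ae_of_all _ fun ξ => ?_)
  · refine (((hg.add hh).const_mul (2 * Real.pi))).mono' ?_ (ae_of_all _ fun ξ => ?_)
    · exact ((continuous_norm (E := Sp d)).aestronglyMeasurable.mul (hgm.sub hhm).norm).const_mul _
    · rw [Real.norm_of_nonneg (by positivity)]
      simp only [Pi.add_apply]
      rw [← mul_add]
      gcongr
      exact norm_sub_le (g ξ) (h ξ)
  · rw [← sub_smul, ← mul_sub, ← sub_mul]
    exact norm_gradT_integrand_le (fun ξ => g ξ - h ξ) x ξ

/-! ### Gaussians -/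

/-- The Fourier multiplier of the Gaussian semigroup. -/
def gaussMult (s : ℝ) (ξ : Sp d) : ℝ := Real.exp (-((2 * Real.pi * ‖ξ‖) ^ 2 * s))

theorem gaussMult_eq (s : ℝ) (ξ : Sp d) :
    gaussMult s ξ = Real.exp (-(4 * Real.pi ^ 2 * s) * ‖ξ‖ ^ 2) := by
  unfold gaussMult; congr 1; ring

/-- Radial functions with a power weight and a stretched exponential are integrable. -/
theorem integrable_norm_pow_mul_exp (hd : 0 < d) (k : ℕ) {p b : ℝ} (hp : 0 < p) (hb : 0 < b) :
    Integrable fun ξ : Sp d => ‖ξ‖ ^ k * Real.exp (-b * ‖ξ‖ ^ p) := by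
  have : Nonempty (Fin d) := ⟨⟨0, hd⟩⟩
  have : Nontrivial (Sp d) := inferInstance
  rw [integrable_fun_norm_addHaar (E := Sp d) volume
    (f := fun r => r ^ k * Real.exp (-b * r ^ p))]
  refine (integrableOn_rpow_mul_exp_neg_mul_rpow (s := (d - 1 + k : ℕ)) (by
    have : (0 : ℝ) ≤ ((d - 1 + k : ℕ) : ℝ) := by positivity
    linarith) hp hb).congr_fun (fun r hr => ?_) measurableSet_Ioi
  simp only [Real.rpow_natCast, finrank_euclideanSpace, Fintype.card_fin, smul_eq_mul]
  ring

theorem integrable_norm_mul_gaussMult (hd : 0 < d) (k : ℕ) {s : ℝ} (hs : 0 < s) :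
    Integrable fun ξ : Sp d => ‖ξ‖ ^ k * gaussMult s ξ := by
  have := integrable_norm_pow_mul_exp hd k (p := 2) (b := 4 * Real.pi ^ 2 * s) two_pos (by positivity)
  refine this.congr (ae_of_all _ fun ξ => ?_)
  simp only [gaussMult_eq, Real.rpow_two]

/-- The real part of the complex Gaussian Fourier transform, evaluated at the parameter 4π²s. -/
theorem cosT_gaussMult {s : ℝ} (hs : 0 < s) (x : Sp d) :
    cosT (gaussMult s) x = (4 * Real.pi * s) ^ (-(d / 2 : ℝ)) * Real.exp (-‖x‖ ^ 2 / (4 * s)) := by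
  have hb : 0 < ((4 * Real.pi ^ 2 * s : ℝ) : ℂ).re := by
    rw [Complex.ofReal_re]; positivity
  have h := fourier_gaussian_innerProductSpace hb x
  rw [Real.fourier_eq'] at h
  have h2 := congrArg Complex.re h
  have hint : Integrable fun v : Sp d =>
      Complex.exp (((-2 * Real.pi * ⟪v, x⟫_ℝ : ℝ) : ℂ) * Complex.I) •
        Complex.exp (-((4 * Real.pi ^ 2 * s : ℝ) : ℂ) * ‖v‖ ^ 2) := by
    have h1 := GaussianFourier.integrable_cexp_neg_mul_sq_norm_add (V := Sp d) hb
      (-(2 * Real.pi : ℝ) * Complex.I) x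
    refine h1.congr (ae_of_all _ fun v => ?_)
    simp only [smul_eq_mul]
    rw [← Complex.exp_add]
    congr 1
    rw [real_inner_comm]
    push_cast; ring
  have e1 : (∫ v : Sp d, Complex.exp (((-2 * Real.pi * ⟪v, x⟫_ℝ : ℝ) : ℂ) * Complex.I) •
        Complex.exp (-((4 * Real.pi ^ 2 * s : ℝ) : ℂ) * ‖v‖ ^ 2)).re = cosT (gaussMult s) x := by
    rw [← Complex.reCLM_apply, ← ContinuousLinearMap.integral_comp_comm _ hint]
    unfold cosT
    congr 1; ext v
    rw [Complex.reCLM_apply, smul_eq_mul, gaussMult_eq]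
    have : Complex.exp (-((4 * Real.pi ^ 2 * s : ℝ) : ℂ) * ‖v‖ ^ 2) =
        ((Real.exp (-(4 * Real.pi ^ 2 * s) * ‖v‖ ^ 2) : ℝ) : ℂ) := by push_cast; rfl
    rw [this, mul_comm, Complex.re_ofReal_mul, Complex.exp_ofReal_mul_I_re, ← Real.cos_neg,
      real_inner_comm]
    congr 2; ring
  rw [e1] at h2
  rw [h2]
  have e2 : ((Real.pi : ℂ) / ((4 * Real.pi ^ 2 * s : ℝ) : ℂ)) ^ ((Module.finrank ℝ (Sp d) : ℂ) / 2) *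
      Complex.exp (-(Real.pi : ℂ) ^ 2 * (‖x‖ : ℂ) ^ 2 / ((4 * Real.pi ^ 2 * s : ℝ) : ℂ)) =
      (((Real.pi / (4 * Real.pi ^ 2 * s)) ^ (d / 2 : ℝ) *
        Real.exp (-Real.pi ^ 2 * ‖x‖ ^ 2 / (4 * Real.pi ^ 2 * s)) : ℝ) : ℂ) := by
    have e3 : (((Real.pi / (4 * Real.pi ^ 2 * s)) ^ (d / 2 : ℝ) : ℝ) : ℂ) =
        ((Real.pi / (4 * Real.pi ^ 2 * s) : ℝ) : ℂ) ^ ((d / 2 : ℝ) : ℂ) :=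
      Complex.ofReal_cpow (by positivity) _
    rw [finrank_euclideanSpace, Fintype.card_fin,
      Complex.ofReal_mul ((Real.pi / (4 * Real.pi ^ 2 * s)) ^ (d / 2 : ℝ)), e3]
    push_cast; rfl
  rw [e2, Complex.ofReal_re, Real.rpow_neg (by positivity), ← Real.inv_rpow (by positivity)]
  have hpi := Real.pi_pos
  congr 2 <;> field_simp

/-- The cosine transform can be differentiated under the integral or in its explicit Gaussian form;
uniqueness of the derivative identifies the two gradients. -/
theorem gradT_gaussMult (hd : 0 < d) {s : ℝ} (hs : 0 < s) (x : Sp d) :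
    gradT (gaussMult s) x = -(cosT (gaussMult s) x / (2 * s)) • x := by
  have hg : Integrable (gaussMult (d := d) s) := by
    simpa using integrable_norm_mul_gaussMult hd 0 hs
  have hg1 : Integrable fun ξ : Sp d => ‖ξ‖ * ‖gaussMult s ξ‖ := by
    refine (integrable_norm_mul_gaussMult hd 1 hs).congr (ae_of_all _ fun ξ => ?_)
    simp [gaussMult]
  have h1 := hasFDerivAt_cosT hg hg1 x
  have h2 : HasFDerivAt (cosT (gaussMult (d := d) s))
      (innerSL ℝ (-(cosT (gaussMult s) x / (2 * s)) • x)) x := by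
    have e : cosT (gaussMult (d := d) s) = fun x =>
        (4 * Real.pi * s) ^ (-(d / 2 : ℝ)) * Real.exp (-‖x‖ ^ 2 / (4 * s)) := by
      ext x; exact cosT_gaussMult hs x
    have h3 : HasFDerivAt (fun x : Sp d => -‖x‖ ^ 2 / (4 * s))
        ((-(1 / (2 * s))) • innerSL ℝ x) x := by
      have := ((hasStrictFDerivAt_norm_sq x).hasFDerivAt.const_mul (-(1 / (4 * s))))
      have e0 : (fun x : Sp d => -‖x‖ ^ 2 / (4 * s)) = fun y => -(1 / (4 * s)) * ‖y‖ ^ 2 := by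
        ext y; ring
      rw [e0]
      exact this.congr_fderiv (ContinuousLinearMap.ext fun v => by simp; ring)
    have h4 := (h3.exp).const_mul ((4 * Real.pi * s) ^ (-(d / 2 : ℝ)))
    rw [e]
    refine h4.congr_fderiv (ContinuousLinearMap.ext fun v => ?_)
    simp
    ring
  have h5 := h1.unique h2
  exact (innerSL_inj (𝕜 := ℝ)).1 h5

/-- The right side is at least C/(1 + y), while y^σ (1 + y) e^{-y/4} is bounded. With y = |x|²/s
this trades a Gaussian for 1 - e^{-s/|x|²}, an expression whose average over s is read off from a
Laplace transform. -/
theorem exists_rpow_mul_exp_le (σ : ℝ) (hσ : 0 ≤ σ) : ∃ C : ℝ, 0 < C ∧ ∀ y : ℝ, 0 < y →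
    y ^ σ * Real.exp (-y / 4) ≤ C * (1 - Real.exp (-y⁻¹)) := by
  obtain ⟨n, hn⟩ := exists_nat_ge σ
  have key : ∀ (m : ℕ) (y : ℝ), 0 < y → y ^ m * Real.exp (-y / 4) ≤ 4 ^ m * m.factorial := by
    intro m y hy
    have h := Real.pow_div_factorial_le_exp (x := y / 4) (by positivity) m
    rw [div_pow, div_div, div_le_iff₀ (by positivity)] at h
    rw [show -y / 4 = -(y / 4) by ring, Real.exp_neg, ← div_eq_mul_inv,
      div_le_iff₀ (Real.exp_pos _)]
    linarith
  -- From y^σ ≤ 1 + y^n, multiplied by 1 + y, arise the monomials of degree 0, 1, n and n + 1; each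
  -- contributes its bound from `key`.
  set C : ℝ := 4 ^ 0 * (0).factorial + 4 ^ 1 * (1).factorial + 4 ^ n * n.factorial +
    4 ^ (n + 1) * (n + 1).factorial with hC
  refine ⟨C, by positivity, fun y hy => ?_⟩
  have hpow : y ^ σ ≤ 1 + y ^ n := by
    rcases le_total y 1 with h | h
    · have := Real.rpow_le_one hy.le h hσ
      have : 0 < y ^ n := by positivity
      linarith
    · have := Real.rpow_le_rpow_of_exponent_le h hn
      rw [Real.rpow_natCast] at this; linarith
  have h1 : 1 / (1 + y) ≤ 1 - Real.exp (-y⁻¹) := by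
    have h2 := Real.add_one_le_exp (y⁻¹)
    have h3 : Real.exp (-y⁻¹) ≤ 1 / (y⁻¹ + 1) := by
      rw [Real.exp_neg, ← one_div]
      exact one_div_le_one_div_of_le (by positivity) h2
    have h4 : 1 - 1 / (y⁻¹ + 1) = 1 / (1 + y) := by field_simp; ring
    linarith
  have h5 : y ^ σ * Real.exp (-y / 4) * (1 + y) ≤ C := by
    have he := Real.exp_pos (-y / 4)
    calc y ^ σ * Real.exp (-y / 4) * (1 + y) ≤ (1 + y ^ n) * Real.exp (-y / 4) * (1 + y) := by
          gcongr
      _ = y ^ 0 * Real.exp (-y / 4) + y ^ 1 * Real.exp (-y / 4) + y ^ n * Real.exp (-y / 4) +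
          y ^ (n + 1) * Real.exp (-y / 4) := by ring
      _ ≤ _ := by
          rw [hC]
          linarith [key 0 y hy, key 1 y hy, key n y hy, key (n + 1) y hy]
  calc y ^ σ * Real.exp (-y / 4) ≤ C * (1 / (1 + y)) := by
        rw [mul_one_div, le_div_iff₀ (by positivity)]; exact h5
    _ ≤ _ := by gcongr

/-- In the variable y = |x|²/s the Gaussian is |x|^{-d} y^{d/2} e^{-y/4} up to a constant, and its
gradient has one more factor y/|x|. Both are then in the form treated by `exists_rpow_mul_exp_le`.
-/
theorem exists_gauss_bounds (hd : 0 < d) : ∃ C : ℝ, 0 < C ∧ ∀ s : ℝ, 0 < s → ∀ x : Sp d, x ≠ 0 →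
    cosT (gaussMult s) x ≤ C * ‖x‖ ^ (-(d : ℝ)) * (1 - Real.exp (-((‖x‖ ^ 2)⁻¹ * s))) ∧
    ‖gradT (gaussMult s) x‖ ≤
      C * ‖x‖ ^ (-(d + 1 : ℝ)) * (1 - Real.exp (-((‖x‖ ^ 2)⁻¹ * s))) := by
  obtain ⟨C₁, hC₁, h₁⟩ := exists_rpow_mul_exp_le (d / 2) (by positivity)
  obtain ⟨C₂, hC₂, h₂⟩ := exists_rpow_mul_exp_le (d / 2 + 1) (by positivity)
  set K : ℝ := (4 * Real.pi) ^ (-(d / 2 : ℝ)) with hK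
  have hK0 : 0 < K := by have := Real.pi_pos; rw [hK]; positivity
  refine ⟨K * C₁ + K * C₂, by positivity, fun s hs x hx => ?_⟩
  have hx0 : 0 < ‖x‖ := norm_pos_iff.2 hx
  set y : ℝ := ‖x‖ ^ 2 / s with hy
  have hy0 : 0 < y := by rw [hy]; positivity
  have hyinv : (‖x‖ ^ 2)⁻¹ * s = y⁻¹ := by rw [hy, inv_div]; ring
  have hG : cosT (gaussMult s) x = K * ‖x‖ ^ (-(d : ℝ)) * (y ^ (d / 2 : ℝ) * Real.exp (-y / 4)) := by
    rw [cosT_gaussMult hs, Real.mul_rpow (by have := Real.pi_pos; positivity) hs.le, ← hK, hy,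
      Real.div_rpow (by positivity) hs.le, ← Real.rpow_natCast, ← Real.rpow_mul hx0.le,
      Real.rpow_neg hs.le, Real.rpow_neg hx0.le]
    have e1 : ((2 : ℕ) : ℝ) * (d / 2 : ℝ) = d := by push_cast; ring
    rw [e1]
    have e2 : -‖x‖ ^ ((2 : ℕ) : ℝ) / (4 * s) = -(‖x‖ ^ ((2 : ℕ) : ℝ) / s) / 4 := by
      field_simp
    rw [e2]
    have : ‖x‖ ^ (d : ℝ) ≠ 0 := (Real.rpow_pos_of_pos hx0 _).ne'
    field_simp
  have hnn : 0 ≤ 1 - Real.exp (-y⁻¹) := by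
    have : Real.exp (-y⁻¹) ≤ 1 := Real.exp_le_one_iff.2 (by simp [hy0.le])
    linarith
  rw [hyinv]
  constructor
  · rw [hG]
    calc _ ≤ K * ‖x‖ ^ (-(d : ℝ)) * (C₁ * (1 - Real.exp (-y⁻¹))) := by
          exact mul_le_mul_of_nonneg_left (h₁ y hy0) (by positivity)
      _ = K * C₁ * ‖x‖ ^ (-(d : ℝ)) * (1 - Real.exp (-y⁻¹)) := by ring
      _ ≤ _ := by gcongr; linarith [mul_pos hK0 hC₂]
  · rw [gradT_gaussMult hd hs, norm_smul, norm_neg, Real.norm_of_nonneg (by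
      rw [hG]; positivity), hG]
    -- The factor |x|/(2s) of the gradient equals y/(2|x|).
    have e : K * ‖x‖ ^ (-(d : ℝ)) * (y ^ (d / 2 : ℝ) * Real.exp (-y / 4)) / (2 * s) * ‖x‖ =
        (1 / 2) * (K * ‖x‖ ^ (-(d + 1 : ℝ)) * (y ^ (d / 2 + 1 : ℝ) * Real.exp (-y / 4))) := by
      rw [Real.rpow_add hy0, Real.rpow_one, show (-(d + 1 : ℝ)) = -(d : ℝ) - 1 by ring,
        Real.rpow_sub hx0, Real.rpow_one]
      have : y * s = ‖x‖ ^ 2 := by rw [hy]; field_simp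
      field_simp
      rw [← this]
    rw [e]
    have h3 := h₂ y hy0
    calc _ ≤ 1 * (K * ‖x‖ ^ (-(d + 1 : ℝ)) * (C₂ * (1 - Real.exp (-y⁻¹)))) := by
          gcongr; norm_num
      _ = K * C₂ * ‖x‖ ^ (-(d + 1 : ℝ)) * (1 - Real.exp (-y⁻¹)) := by ring
      _ ≤ _ := by gcongr; linarith [mul_pos hK0 hC₁]

end

/-! ### Bounds for the heat kernel -/

open scoped NNReal

section
variable {d : ℕ}

/-- The Fourier multiplier of the stable semigroup. -/
def heatMult (α t : ℝ) (ξ : Sp d) : ℝ := Real.exp (-t * (2 * Real.pi * ‖ξ‖) ^ α)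

/-- The gradient of the heat kernel. -/
def gradHeat (α t : ℝ) (x : Sp d) : Sp d := gradT (heatMult α t) x

theorem continuous_heatMult {α : ℝ} (hα : 0 < α) (t : ℝ) : Continuous (heatMult (d := d) α t) := by
  unfold heatMult
  have : Continuous fun ξ : Sp d => (2 * Real.pi * ‖ξ‖) ^ α :=
    (by fun_prop : Continuous fun ξ : Sp d => 2 * Real.pi * ‖ξ‖).rpow_const fun _ => Or.inr hα.le
  fun_prop

theorem heatMult_pos (α t : ℝ) (ξ : Sp d) : 0 < heatMult α t ξ := Real.exp_pos _

theorem heatMult_eq (α t : ℝ) (ξ : Sp d) :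
    heatMult α t ξ = Real.exp (-(t * (2 * Real.pi) ^ α) * ‖ξ‖ ^ α) := by
  unfold heatMult
  rw [Real.mul_rpow (by positivity) (norm_nonneg _)]
  ring_nf

theorem integrable_norm_pow_mul_heatMult (hd : 0 < d) (k : ℕ) {α t : ℝ} (hα : 0 < α) (ht : 0 < t) :
    Integrable fun ξ : Sp d => ‖ξ‖ ^ k * heatMult α t ξ := by
  simp_rw [heatMult_eq]
  have := Real.pi_pos
  exact integrable_norm_pow_mul_exp hd k hα (by positivity)

theorem integrable_heatMult (hd : 0 < d) {α t : ℝ} (hα : 0 < α) (ht : 0 < t) :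
    Integrable (heatMult (d := d) α t) := by
  simpa using integrable_norm_pow_mul_heatMult hd 0 hα ht

theorem integrable_norm_mul_norm_heatMult (hd : 0 < d) {α t : ℝ} (hα : 0 < α) (ht : 0 < t) :
    Integrable fun ξ : Sp d => ‖ξ‖ * ‖heatMult α t ξ‖ := by
  refine (integrable_norm_pow_mul_heatMult hd 1 hα ht).congr (ae_of_all _ fun ξ => ?_)
  simp [heatMult]

theorem hasFDerivAt_heatKernel (hd : 0 < d) {α t : ℝ} (hα : 0 < α) (ht : 0 < t) (x : Sp d) :
    HasFDerivAt (heatKernel (d := d) α t) (innerSL ℝ (gradHeat α t x)) x :=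
  hasFDerivAt_cosT (integrable_heatMult hd hα ht) (integrable_norm_mul_norm_heatMult hd hα ht) x

section Mixture

variable (μ : Measure ℝ≥0) [IsProbabilityMeasure μ] (ε : ℝ)

/-- A mixture of Gaussian multipliers. -/
def mixMult (ξ : Sp d) : ℝ := ∫ r : ℝ≥0, gaussMult (r + ε) ξ ∂μ

theorem gaussMult_add_le (r : ℝ≥0) (ξ : Sp d) : gaussMult (r + ε) ξ ≤ gaussMult ε ξ := by
  unfold gaussMult
  gcongr
  have := r.coe_nonneg
  linarith

theorem measurable_gaussMult_add :
    Measurable fun q : Sp d × ℝ≥0 => gaussMult (q.2 + ε) q.1 := by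
  unfold gaussMult; fun_prop

/-- Fubini applies because the shift ε > 0 dominates all the multipliers by a single integrable
Gaussian. -/
theorem cosT_mixMult (hd : 0 < d) (hε : 0 < ε) (x : Sp d) :
    cosT (mixMult μ ε) x = ∫ r : ℝ≥0, cosT (gaussMult (r + ε)) x ∂μ := by
  unfold cosT mixMult
  simp_rw [← integral_mul_const]
  rw [integral_integral_swap]
  have hi : Integrable (gaussMult (d := d) ε) := by
    simpa using integrable_norm_mul_gaussMult hd 0 hε
  refine (hi.comp_fst μ).mono' (Measurable.aestronglyMeasurable ?_) (ae_of_all _ fun q => ?_)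
  · exact (measurable_gaussMult_add ε).mul (by fun_prop)
  · have h1 : ‖Real.cos (2 * Real.pi * ⟪x, q.1⟫_ℝ)‖ ≤ 1 := by simpa using Real.abs_cos_le_one _
    have h2 : 0 ≤ gaussMult (q.2 + ε) q.1 := (Real.exp_pos _).le
    simp only [Function.uncurry, norm_mul, Real.norm_of_nonneg h2]
    calc _ ≤ gaussMult ε q.1 * 1 :=
          mul_le_mul (gaussMult_add_le ε q.2 q.1) h1 (norm_nonneg _) (Real.exp_pos _).le
      _ = _ := mul_one _

theorem gradT_mixMult (hd : 0 < d) (hε : 0 < ε) (x : Sp d) :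
    gradT (mixMult μ ε) x = ∫ r : ℝ≥0, gradT (gaussMult (r + ε)) x ∂μ := by
  unfold gradT mixMult
  simp_rw [← integral_mul_const, ← integral_const_mul, ← integral_smul_const]
  rw [integral_integral_swap]
  have hi : Integrable fun ξ : Sp d => 2 * Real.pi * (‖ξ‖ * ‖gaussMult ε ξ‖) := by
    refine ((integrable_norm_mul_gaussMult hd 1 hε).congr (ae_of_all _ fun ξ => ?_)).const_mul _
    simp [gaussMult]
  refine (hi.comp_fst μ).mono' (Measurable.aestronglyMeasurable ?_) (ae_of_all _ fun q => ?_)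
  · exact (((measurable_gaussMult_add ε).mul (by fun_prop)).const_mul _).smul measurable_fst
  · refine (norm_gradT_integrand_le (gaussMult (q.2 + ε)) x q.1).trans ?_
    have h2 : 0 ≤ gaussMult (q.2 + ε) q.1 := (Real.exp_pos _).le
    have h3 : 0 ≤ gaussMult ε q.1 := (Real.exp_pos _).le
    rw [Real.norm_of_nonneg h2, Real.norm_of_nonneg h3]
    gcongr
    exact gaussMult_add_le ε q.2 q.1

end Mixture

/-- Subordination: the stable kernel is a limit of Gaussian mixtures. Each mixture inherits
nonnegativity and the Gaussian bounds, in which the averaged factor is at most t|x|^{-α} plus an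
error tending to 0. The limits of the kernel and of its gradient are taken on the frequency side,
where the mixture multipliers increase at most to the stable one and dominated convergence applies.
-/
theorem exists_heatKernel_decay (hd : 0 < d) {α : ℝ} (hα : 0 < α) (hα2 : α < 2) :
    ∃ C : ℝ, 0 < C ∧ ∀ t : ℝ, 0 < t → ∀ x : Sp d, x ≠ 0 →
      0 ≤ heatKernel α t x ∧ heatKernel α t x ≤ C * t * ‖x‖ ^ (-(d + α)) ∧
      ‖gradHeat α t x‖ ≤ C * t * ‖x‖ ^ (-(d + 1 + α)) := by
  obtain ⟨C, hC, hG⟩ := exists_gauss_bounds hd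
  refine ⟨C, hC, fun t ht x hx => ?_⟩
  have hx0 : 0 < ‖x‖ := norm_pos_iff.2 hx
  set v : ℝ := (‖x‖ ^ 2)⁻¹ with hv
  have hv0 : 0 < v := by rw [hv]; positivity
  set η : ℕ → ℝ := fun n => 1 / ((n : ℝ) + 1) with hη
  have hη0 : ∀ n, 0 < η n := fun n => by rw [hη]; positivity
  have hηlim : Tendsto η atTop (𝓝 0) := tendsto_one_div_add_atTop_nhds_zero_nat
  choose ε hε μ hμ hL using fun n =>
    exists_laplace_approx (a := α / 2) (by linarith) (by linarith) ht (hη0 n)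
  set g : ℕ → Sp d → ℝ := fun n => mixMult (μ n) (ε n) with hg
  have hpow : ∀ ξ : Sp d, ((2 * Real.pi * ‖ξ‖) ^ 2) ^ (α / 2) = (2 * Real.pi * ‖ξ‖) ^ α := by
    intro ξ
    have := Real.pi_pos
    rw [← Real.rpow_natCast, ← Real.rpow_mul (by positivity)]
    congr 1; push_cast; ring
  -- The two-sided Laplace bound at u = (2π|ξ|)²; since u^{α/2} = (2π|ξ|)^α, the stable multiplier
  -- appears.
  have hgb : ∀ n ξ, heatMult α t ξ * Real.exp (-(η n * (2 * Real.pi * ‖ξ‖) ^ 2)) ≤ g n ξ ∧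
      g n ξ ≤ heatMult α t ξ := by
    intro n ξ
    have h := hL n ((2 * Real.pi * ‖ξ‖) ^ 2) (by positivity)
    rw [hpow] at h
    refine ⟨le_trans (le_of_eq ?_) h.1, h.2.trans (le_of_eq ?_)⟩
    · unfold heatMult; rw [← Real.exp_add]; ring_nf
    · unfold heatMult; ring_nf
  have hhi := integrable_heatMult hd hα ht
  have hhi1 := integrable_norm_mul_norm_heatMult hd hα ht
  have hgm : ∀ n, AEStronglyMeasurable (g n) := by
    intro n
    exact ((measurable_gaussMult_add (ε n)).stronglyMeasurable.integral_prod_right'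
      (ν := μ n)).aestronglyMeasurable
  have hg0 : ∀ n ξ, 0 ≤ g n ξ := fun n ξ => integral_nonneg fun r => (Real.exp_pos _).le
  have hgi : ∀ n, Integrable (g n) := fun n =>
    hhi.mono' (hgm n) (ae_of_all _ fun ξ => by
      rw [Real.norm_of_nonneg (hg0 n ξ)]; exact (hgb n ξ).2)
  have hgi1 : ∀ n, Integrable fun ξ => ‖ξ‖ * ‖g n ξ‖ := fun n =>
    hhi1.mono' ((continuous_norm (E := Sp d)).aestronglyMeasurable.mul (hgm n).norm)
      (ae_of_all _ fun ξ => by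
        rw [Real.norm_of_nonneg (by positivity), Real.norm_of_nonneg (hg0 n ξ),
          Real.norm_of_nonneg (heatMult_pos α t ξ).le]
        gcongr
        exact (hgb n ξ).2)
  have hptlim : ∀ ξ : Sp d, Tendsto (fun n => |g n ξ - heatMult α t ξ|) atTop (𝓝 0) := by
    intro ξ
    have h1 : Tendsto (fun n => heatMult α t ξ * Real.exp (-(η n * (2 * Real.pi * ‖ξ‖) ^ 2)))
        atTop (𝓝 (heatMult α t ξ * Real.exp (-(0 * (2 * Real.pi * ‖ξ‖) ^ 2)))) :=
      ((Real.continuous_exp.tendsto _).comp ((hηlim.mul_const _).neg)).const_mul _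
    rw [zero_mul, neg_zero, Real.exp_zero, mul_one] at h1
    have h2 := tendsto_of_tendsto_of_tendsto_of_le_of_le h1 tendsto_const_nhds
      (fun n => (hgb n ξ).1) (fun n => (hgb n ξ).2)
    have h3 := (h2.sub_const (heatMult α t ξ)).abs
    simpa using h3
  have hdom : ∀ n ξ, |g n ξ - heatMult α t ξ| ≤ heatMult α t ξ := by
    intro n ξ
    rw [abs_le]
    constructor <;> linarith [hg0 n ξ, (hgb n ξ).2, heatMult_pos α t ξ]
  have hlim : Tendsto (fun n => cosT (g n) x) atTop (𝓝 (heatKernel α t x)) := by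
    rw [tendsto_iff_norm_sub_tendsto_zero]
    have h1 : Tendsto (fun n => ∫ ξ, |g n ξ - heatMult α t ξ|) atTop (𝓝 (∫ _ : Sp d, (0 : ℝ))) :=
      tendsto_integral_of_dominated_convergence (heatMult α t)
        (fun n => ((hgm n).sub hhi.aestronglyMeasurable).norm) hhi
        (fun n => ae_of_all _ fun ξ => by
          rw [Real.norm_eq_abs, abs_abs]; exact hdom n ξ)
        (ae_of_all _ hptlim)
    rw [integral_zero] at h1
    exact squeeze_zero (fun _ => norm_nonneg _) (fun n => abs_cosT_sub_le (hgi n) hhi x) h1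
  have hlimg : Tendsto (fun n => gradT (g n) x) atTop (𝓝 (gradHeat α t x)) := by
    rw [tendsto_iff_norm_sub_tendsto_zero]
    have h1 : Tendsto (fun n => ∫ ξ, 2 * Real.pi * (‖ξ‖ * |g n ξ - heatMult α t ξ|)) atTop
        (𝓝 (∫ _ : Sp d, (0 : ℝ))) := by
      refine tendsto_integral_of_dominated_convergence
        (fun ξ => 2 * Real.pi * (‖ξ‖ * ‖heatMult α t ξ‖))
        (fun n => ((continuous_norm (E := Sp d)).aestronglyMeasurable.mul
          ((hgm n).sub hhi.aestronglyMeasurable).norm).const_mul _) (hhi1.const_mul _)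
        (fun n => ae_of_all _ fun ξ => ?_) (ae_of_all _ fun ξ => ?_)
      · rw [Real.norm_of_nonneg (by positivity), Real.norm_of_nonneg (heatMult_pos α t ξ).le]
        gcongr
        exact hdom n ξ
      · simpa using ((hptlim ξ).const_mul ‖ξ‖).const_mul (2 * Real.pi)
    rw [integral_zero] at h1
    exact squeeze_zero (fun _ => norm_nonneg _) (fun n => norm_gradT_sub_le (hgm n)
      hhi.aestronglyMeasurable (hgi1 n) hhi1 x) h1
  -- The lower Laplace bound at v = |x|^{-2}, followed by 1 - e^{-y} ≤ y; here v^{α/2} = |x|^{-α}.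
  have hmass : ∀ n, Integrable (fun r : ℝ≥0 => 1 - Real.exp (-(v * (r + ε n)))) (μ n) ∧
      ∫ r : ℝ≥0, (1 - Real.exp (-(v * (r + ε n)))) ∂(μ n) ≤ t * v ^ (α / 2) + η n * v := by
    intro n
    have hi : Integrable (fun r : ℝ≥0 => Real.exp (-(v * (r + ε n)))) (μ n) := by
      refine (integrable_const (1 : ℝ)).mono' (by fun_prop) (ae_of_all _ fun r => ?_)
      rw [Real.norm_of_nonneg (Real.exp_pos _).le, Real.exp_le_one_iff, neg_nonpos]
      exact mul_nonneg hv0.le (add_nonneg r.coe_nonneg (hε n).le)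
    refine ⟨(integrable_const (1 : ℝ)).sub hi, ?_⟩
    rw [integral_sub (integrable_const (1 : ℝ)) hi]
    have h1 := (hL n v hv0.le).1
    have h2 := Real.add_one_le_exp (-(t * v ^ (α / 2)) - η n * v)
    simp only [integral_const, probReal_univ, smul_eq_mul, mul_one]
    linarith
  have hvα : v ^ (α / 2) = ‖x‖ ^ (-α) := by
    rw [hv, ← Real.rpow_natCast, ← Real.rpow_neg hx0.le, ← Real.rpow_mul hx0.le]
    congr 1; push_cast; ring
  have hbd : Tendsto (fun n => t * v ^ (α / 2) + η n * v) atTop (𝓝 (t * ‖x‖ ^ (-α))) := by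
    have := (hηlim.mul_const v).const_add (t * v ^ (α / 2))
    rw [zero_mul, add_zero, hvα] at this
    rw [hvα]; exact this
  refine ⟨?_, ?_, ?_⟩
  · refine ge_of_tendsto' hlim fun n => ?_
    rw [hg, cosT_mixMult _ _ hd (hε n)]
    refine integral_nonneg fun r => ?_
    have : 0 < r + ε n := add_pos_of_nonneg_of_pos r.coe_nonneg (hε n)
    simp only [Pi.zero_apply]
    rw [cosT_gaussMult this]
    have := Real.pi_pos
    positivity
  · have e : C * t * ‖x‖ ^ (-(d + α)) = C * ‖x‖ ^ (-(d : ℝ)) * (t * ‖x‖ ^ (-α)) := by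
      rw [show -(d + α) = -(d : ℝ) + -α by ring, Real.rpow_add hx0]; ring
    rw [e]
    refine le_of_tendsto_of_tendsto' hlim (hbd.const_mul _) fun n => ?_
    rw [hg, cosT_mixMult _ _ hd (hε n)]
    calc ∫ r : ℝ≥0, cosT (gaussMult (r + ε n)) x ∂(μ n)
        ≤ ∫ r : ℝ≥0, C * ‖x‖ ^ (-(d : ℝ)) * (1 - Real.exp (-(v * (r + ε n)))) ∂(μ n) := by
          refine integral_mono_of_nonneg (ae_of_all _ fun r => ?_) ((hmass n).1.const_mul _)
            (ae_of_all _ fun r => ?_)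
          · have h1 : 0 < r + ε n := add_pos_of_nonneg_of_pos r.coe_nonneg (hε n)
            simp only [Pi.zero_apply]
            rw [cosT_gaussMult h1]
            have := Real.pi_pos
            positivity
          · exact (hG _ (add_pos_of_nonneg_of_pos r.coe_nonneg (hε n)) x hx).1
      _ ≤ _ := by
          rw [integral_const_mul]
          gcongr
          exact (hmass n).2
  · have e : C * t * ‖x‖ ^ (-(d + 1 + α)) = C * ‖x‖ ^ (-(d + 1 : ℝ)) * (t * ‖x‖ ^ (-α)) := by
      rw [show -(d + 1 + α) = -(d + 1 : ℝ) + -α by ring, Real.rpow_add hx0]; ring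
    rw [e]
    refine le_of_tendsto_of_tendsto' hlimg.norm (hbd.const_mul _) fun n => ?_
    rw [hg, gradT_mixMult _ _ hd (hε n)]
    calc ‖∫ r : ℝ≥0, gradT (gaussMult (r + ε n)) x ∂(μ n)‖
        ≤ ∫ r : ℝ≥0, C * ‖x‖ ^ (-(d + 1 : ℝ)) * (1 - Real.exp (-(v * (r + ε n)))) ∂(μ n) := by
          refine norm_integral_le_of_norm_le ((hmass n).1.const_mul _) (ae_of_all _ fun r => ?_)
          exact (hG _ (add_pos_of_nonneg_of_pos r.coe_nonneg (hε n)) x hx).2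
      _ ≤ _ := by
          rw [integral_const_mul]
          gcongr
          exact (hmass n).2

theorem integral_norm_pow_mul_heatMult {α t : ℝ} (hα : 0 < α) (ht : 0 < t) (k : ℕ) :
    ∫ ξ : Sp d, ‖ξ‖ ^ k * heatMult α t ξ =
      t ^ (-(d + k) / α) * ∫ ξ : Sp d, ‖ξ‖ ^ k * heatMult α 1 ξ := by
  have hR : 0 < t ^ (1 / α) := Real.rpow_pos_of_pos ht _
  have h := Measure.integral_comp_smul (volume : Measure (Sp d))
    (fun ξ => ‖ξ‖ ^ k * heatMult α 1 ξ) (t ^ (1 / α))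
  have e : ∀ ξ : Sp d, ‖t ^ (1 / α) • ξ‖ ^ k * heatMult α 1 (t ^ (1 / α) • ξ) =
      t ^ (k / α : ℝ) * (‖ξ‖ ^ k * heatMult α t ξ) := by
    intro ξ
    have h1 : heatMult α 1 (t ^ (1 / α) • ξ) = heatMult α t ξ := by
      unfold heatMult
      rw [norm_smul, Real.norm_of_nonneg hR.le, mul_left_comm, Real.mul_rpow hR.le (by
        have := Real.pi_pos; positivity), ← Real.rpow_mul ht.le, one_div_mul_cancel hα.ne',
        Real.rpow_one]
      ring_nf
    rw [h1, norm_smul, Real.norm_of_nonneg hR.le, mul_pow, ← Real.rpow_natCast,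
      ← Real.rpow_mul ht.le, show 1 / α * (k : ℝ) = k / α by ring]
    ring
  simp_rw [e] at h
  rw [integral_const_mul, finrank_euclideanSpace, Fintype.card_fin, smul_eq_mul,
    abs_of_nonneg (by positivity), ← Real.rpow_natCast (t ^ (1 / α)), ← Real.rpow_mul ht.le,
    ← Real.rpow_neg ht.le] at h
  have h2 : t ^ (k / α : ℝ) ≠ 0 := (Real.rpow_pos_of_pos ht _).ne'
  apply mul_left_cancel₀ h2
  rw [h, ← mul_assoc, ← Real.rpow_add ht]
  congr 2
  field_simp
  ring

/-- The oscillating factors are at most 1, so the sup norms are bounded by moments of the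
multiplier, whose dependence on t is a scaling. -/
theorem exists_heatKernel_sup_bound (hd : 0 < d) {α : ℝ} (hα : 0 < α) :
    ∃ C : ℝ, 0 < C ∧ ∀ t : ℝ, 0 < t → ∀ x : Sp d,
      |heatKernel α t x| ≤ C * t ^ (-d / α) ∧ ‖gradHeat α t x‖ ≤ C * t ^ (-(d + 1) / α) := by
  set I₀ := ∫ ξ : Sp d, ‖ξ‖ ^ 0 * heatMult α 1 ξ with hI₀
  set I₁ := ∫ ξ : Sp d, ‖ξ‖ ^ 1 * heatMult α 1 ξ with hI₁
  have hI₀' : 0 ≤ I₀ := integral_nonneg fun ξ => mul_nonneg (by positivity) (heatMult_pos _ _ _).le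
  have hI₁' : 0 ≤ I₁ := integral_nonneg fun ξ => mul_nonneg (by positivity) (heatMult_pos _ _ _).le
  have hpi := Real.pi_pos
  refine ⟨I₀ + 2 * Real.pi * I₁ + 1, by positivity, fun t ht x => ⟨?_, ?_⟩⟩
  · have h1 : |heatKernel α t x| ≤ ∫ ξ : Sp d, ‖ξ‖ ^ 0 * heatMult α t ξ := by
      rw [← Real.norm_eq_abs]
      refine norm_integral_le_of_norm_le (integrable_norm_pow_mul_heatMult hd 0 hα ht)
        (ae_of_all _ fun ξ => ?_)
      rw [pow_zero, one_mul, norm_mul, Real.norm_of_nonneg (Real.exp_pos _).le]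
      have h1 : ‖Real.cos (2 * Real.pi * ⟪x, ξ⟫_ℝ)‖ ≤ 1 := by simpa using Real.abs_cos_le_one _
      calc _ ≤ heatMult α t ξ * 1 := mul_le_mul_of_nonneg_left h1 (Real.exp_pos _).le
        _ = _ := mul_one _
    rw [integral_norm_pow_mul_heatMult hα ht 0, ← hI₀] at h1
    refine h1.trans ?_
    have h2 : 0 ≤ t ^ (-d / α : ℝ) := by positivity
    rw [show (-(d + (0 : ℕ)) / α : ℝ) = -d / α by simp]
    nlinarith [mul_nonneg (mul_nonneg (mul_nonneg zero_le_two hpi.le) hI₁') h2]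
  · have h1 : ‖gradHeat α t x‖ ≤ ∫ ξ : Sp d, 2 * Real.pi * (‖ξ‖ ^ 1 * heatMult α t ξ) := by
      refine norm_integral_le_of_norm_le
        ((integrable_norm_pow_mul_heatMult hd 1 hα ht).const_mul _) (ae_of_all _ fun ξ => ?_)
      refine (norm_gradT_integrand_le (heatMult α t) x ξ).trans (le_of_eq ?_)
      rw [Real.norm_of_nonneg (heatMult_pos α t ξ).le, pow_one]
    rw [integral_const_mul, integral_norm_pow_mul_heatMult hα ht 1, ← hI₁] at h1
    refine h1.trans ?_
    have h2 : 0 ≤ t ^ (-(d + 1) / α : ℝ) := by positivity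
    rw [show (-(d + (1 : ℕ)) / α : ℝ) = -(d + 1) / α by simp]
    nlinarith [mul_nonneg hI₀' h2]

end

/-! ### Schur's test -/

theorem ENNReal.mul_rpow_conj {x : ℝ≥0∞} (hx0 : x ≠ 0) (hx : x ≠ ⊤) {p p' : ℝ}
    (hpq : p.HolderConjugate p') : x ^ (1 / p') * (x ^ (-(p - 1))) ^ (1 / p) = 1 := by
  rw [← ENNReal.rpow_mul, ← ENNReal.rpow_add _ _ hx0 hx]
  have : 1 / p' + -(p - 1) * (1 / p) = 0 := by
    have h1 := hpq.inv_add_inv_eq_one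
    have h2 := hpq.pos.ne'
    rw [one_div, one_div, neg_mul, sub_mul, mul_inv_cancel₀ h2]
    linarith
  rw [this, ENNReal.rpow_zero]

/-- Hölder against the weight φ, then Tonelli. The alternative in `h₀` allows φ to be 0 or ∞ at
points whose kernel column vanishes. -/
theorem schur_test {X Y : Type*} [MeasurableSpace X] [MeasurableSpace Y] {μ : Measure X}
    {ν : Measure Y} [SFinite μ] [SFinite ν] {p p' : ℝ} (hpq : p.HolderConjugate p')
    {K : X → Y → ℝ≥0∞} (hK : Measurable (Function.uncurry K)) {φ : Y → ℝ≥0∞} {ψ : X → ℝ≥0∞}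
    (hφ : Measurable φ) (hψ : Measurable ψ) {B : ℝ≥0∞}
    (h₁ : ∀ᵐ z ∂μ, ∫⁻ w, K z w * φ w ∂ν ≤ ψ z)
    (h₂ : ∀ᵐ w ∂ν, ∫⁻ z, K z w * ψ z ^ (p - 1) ∂μ ≤ B * φ w ^ (p - 1))
    (h₀ : ∀ᵐ w ∂ν, (φ w ≠ 0 ∧ φ w ≠ ⊤) ∨ ∀ z, K z w = 0)
    {f : Y → ℝ≥0∞} (hf : Measurable f) :
    ∫⁻ z, (∫⁻ w, K z w * f w ∂ν) ^ p ∂μ ≤ B * ∫⁻ w, f w ^ p ∂ν := by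
  have hp := hpq.pos
  have hp' := hpq.symm.pos
  have hKz : ∀ z, Measurable (K z) := fun z => hK.comp measurable_prodMk_left
  have hKw : ∀ w, Measurable (fun z => K z w) := fun w => hK.comp measurable_prodMk_right
  have key : ∀ᵐ z ∂μ, (∫⁻ w, K z w * f w ∂ν) ^ p ≤
      ∫⁻ w, ψ z ^ (p - 1) * (K z w * (f w ^ p * φ w ^ (-(p - 1)))) ∂ν := by
    filter_upwards [h₁] with z hz
    -- The product φ^{1/p'} · φ^{-(p-1)/p} equals 1 and is inserted before splitting K = K^{1/p'}
    -- K^{1/p}.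
    have e1 : ∫⁻ w, K z w * f w ∂ν ≤
        ∫⁻ w, ((fun w => (K z w * φ w) ^ (1 / p')) *
          (fun w => (K z w * (f w ^ p * φ w ^ (-(p - 1)))) ^ (1 / p))) w ∂ν := by
      apply lintegral_mono_ae
      filter_upwards [h₀] with w hw
      rcases hw with hw | hw
      · have a1 : (K z w) ^ (1 / p') * (K z w) ^ (1 / p) = K z w := by
          rw [← ENNReal.rpow_add_of_nonneg _ _ (by positivity) (by positivity)]
          have := hpq.inv_add_inv_eq_one
          rw [one_div, one_div, add_comm, this, ENNReal.rpow_one]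
        have a2 : (f w ^ p) ^ (1 / p) = f w := by
          rw [← ENNReal.rpow_mul, mul_one_div_cancel hp.ne', ENNReal.rpow_one]
        rw [Pi.mul_apply, ENNReal.mul_rpow_of_nonneg _ _ (by positivity),
          ENNReal.mul_rpow_of_nonneg _ _ (by positivity : 0 ≤ 1 / p),
          ENNReal.mul_rpow_of_nonneg _ _ (by positivity : 0 ≤ 1 / p), a2]
        have a3 := ENNReal.mul_rpow_conj hw.1 hw.2 hpq
        calc K z w * f w = (K z w ^ (1 / p') * K z w ^ (1 / p)) * f w *
              (φ w ^ (1 / p') * (φ w ^ (-(p - 1))) ^ (1 / p)) := by rw [a1, a3, mul_one]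
          _ ≤ _ := by apply le_of_eq; ring
      · simp [hw]
    have e2 := ENNReal.lintegral_mul_le_Lp_mul_Lq ν hpq.symm
      (f := fun w => (K z w * φ w) ^ (1 / p'))
      (g := fun w => (K z w * (f w ^ p * φ w ^ (-(p - 1)))) ^ (1 / p))
      (((hKz z).mul hφ).pow_const _).aemeasurable
      (((hKz z).mul ((hf.pow_const _).mul (hφ.pow_const _))).pow_const _).aemeasurable
    simp only [← ENNReal.rpow_mul, one_div_mul_cancel hp.ne', one_div_mul_cancel hp'.ne',
      ENNReal.rpow_one] at e2
    calc (∫⁻ w, K z w * f w ∂ν) ^ p ≤ _ := ENNReal.rpow_le_rpow (e1.trans e2) hp.le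
      _ = (∫⁻ w, K z w * φ w ∂ν) ^ (p - 1) *
          ∫⁻ w, K z w * (f w ^ p * φ w ^ (-(p - 1))) ∂ν := by
        rw [ENNReal.mul_rpow_of_nonneg _ _ hp.le, ← ENNReal.rpow_mul, ← ENNReal.rpow_mul,
          one_div_mul_cancel hp.ne', ENNReal.rpow_one]
        congr 2
        have := hpq.inv_add_inv_eq_one
        field_simp at this ⊢
        linarith
      _ ≤ ψ z ^ (p - 1) * ∫⁻ w, K z w * (f w ^ p * φ w ^ (-(p - 1))) ∂ν := by
        gcongr
        linarith [hpq.lt]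
      _ = _ := by
        rw [lintegral_const_mul _ (by have := hKz z; fun_prop)]
  calc ∫⁻ z, (∫⁻ w, K z w * f w ∂ν) ^ p ∂μ
      ≤ ∫⁻ z, ∫⁻ w, ψ z ^ (p - 1) * (K z w * (f w ^ p * φ w ^ (-(p - 1)))) ∂ν ∂μ :=
        lintegral_mono_ae key
    _ = ∫⁻ w, ∫⁻ z, ψ z ^ (p - 1) * (K z w * (f w ^ p * φ w ^ (-(p - 1)))) ∂μ ∂ν := by
        refine lintegral_lintegral_swap (Measurable.aemeasurable ?_)
        exact ((hψ.comp measurable_fst).pow_const _).mul (hK.mul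
          (((hf.comp measurable_snd).pow_const _).mul ((hφ.comp measurable_snd).pow_const _)))
    _ ≤ ∫⁻ w, B * f w ^ p ∂ν := by
        apply lintegral_mono_ae
        filter_upwards [h₂] with w hw
        calc ∫⁻ z, ψ z ^ (p - 1) * (K z w * (f w ^ p * φ w ^ (-(p - 1)))) ∂μ
            = (f w ^ p * φ w ^ (-(p - 1))) * ∫⁻ z, K z w * ψ z ^ (p - 1) ∂μ := by
              rw [← lintegral_const_mul _ (by have := hKw w; fun_prop)]
              congr 1; ext z; ring
          _ ≤ (f w ^ p * φ w ^ (-(p - 1))) * (B * φ w ^ (p - 1)) := by gcongr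
          _ = B * f w ^ p * ((φ w ^ (p - 1))⁻¹ * φ w ^ (p - 1)) := by
              rw [ENNReal.rpow_neg]; ring
          _ ≤ B * f w ^ p * 1 := by gcongr; exact ENNReal.inv_mul_le_one _
          _ = _ := mul_one _
    _ = _ := lintegral_const_mul _ (hf.pow_const _)

/-- Because (p-1)(p'-1) = 1, the hypotheses for K with weights φ, ψ are hypotheses for the transpose
with weights ψ^{p-1}, Bφ^{p-1}; the constant becomes B^{p'-1}. -/
theorem schur_test_transpose {X Y : Type*} [MeasurableSpace X] [MeasurableSpace Y] {μ : Measure X}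
    {ν : Measure Y} [SFinite μ] [SFinite ν] {p p' : ℝ} (hpq : p.HolderConjugate p')
    {K : X → Y → ℝ≥0∞} (hK : Measurable (Function.uncurry K)) {φ : Y → ℝ≥0∞} {ψ : X → ℝ≥0∞}
    (hφ : Measurable φ) (hψ : Measurable ψ) {B : ℝ≥0∞}
    (h₁ : ∀ᵐ z ∂μ, ∫⁻ w, K z w * φ w ∂ν ≤ ψ z)
    (h₂ : ∀ᵐ w ∂ν, ∫⁻ z, K z w * ψ z ^ (p - 1) ∂μ ≤ B * φ w ^ (p - 1))
    (h₀ : ∀ᵐ z ∂μ, (ψ z ≠ 0 ∧ ψ z ≠ ⊤) ∨ ∀ w, K z w = 0)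
    {f : X → ℝ≥0∞} (hf : Measurable f) :
    ∫⁻ w, (∫⁻ z, K z w * f z ∂μ) ^ p' ∂ν ≤ B ^ (p' - 1) * ∫⁻ z, f z ^ p' ∂μ := by
  have h1 : 0 < p - 1 := by linarith [hpq.lt]
  have h1' : 0 < p' - 1 := by linarith [hpq.symm.lt]
  have hmul : (p - 1) * (p' - 1) = 1 := by
    have := hpq.mul_eq_add; linarith
  refine schur_test hpq.symm (K := fun w z => K z w) (φ := fun z => ψ z ^ (p - 1))
    (ψ := fun w => B * φ w ^ (p - 1)) (hK.comp measurable_swap) (hψ.pow_const _)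
    (measurable_const.mul (hφ.pow_const _)) h₂ ?_ ?_ hf
  · filter_upwards [h₁] with z hz
    have e : ∀ w, K z w * (B * φ w ^ (p - 1)) ^ (p' - 1) = B ^ (p' - 1) * (K z w * φ w) := by
      intro w
      rw [ENNReal.mul_rpow_of_nonneg _ _ h1'.le, ← ENNReal.rpow_mul, hmul, ENNReal.rpow_one]
      ring
    simp_rw [e]
    have hKz : Measurable (K z) := hK.comp measurable_prodMk_left
    rw [lintegral_const_mul _ (by fun_prop), ← ENNReal.rpow_mul, hmul,
      ENNReal.rpow_one]
    gcongr
  · filter_upwards [h₀] with z hz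
    refine hz.imp (fun h => ⟨?_, ?_⟩) id
    · simp [ENNReal.rpow_eq_zero_iff, h.1, h.2]
    · simp [ENNReal.rpow_eq_top_iff, h.1, h.2]

/-! ### One-dimensional integrals of powers -/

theorem lintegral_Ioc_rpow {s R : ℝ} (hs : 0 < s) (hR : 0 < R) :
    ∫⁻ ρ in Set.Ioc 0 R, ENNReal.ofReal (ρ ^ (s - 1)) = ENNReal.ofReal (R ^ s / s) := by
  have hint : IntegrableOn (fun ρ : ℝ => ρ ^ (s - 1)) (Set.Ioc 0 R) := by
    have := (intervalIntegral.intervalIntegrable_rpow' (a := 0) (b := R)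
      (by linarith : -1 < s - 1))
    rwa [intervalIntegrable_iff_integrableOn_Ioc_of_le hR.le] at this
  rw [← ofReal_integral_eq_lintegral_ofReal hint, ← intervalIntegral.integral_of_le hR.le,
    integral_rpow (Or.inl (by linarith))]
  · simp [Real.zero_rpow hs.ne']
  · exact (ae_restrict_mem measurableSet_Ioc).mono fun x hx => Real.rpow_nonneg hx.1.le _

theorem lintegral_Ioi_rpow {s R : ℝ} (hs : 0 < s) (hR : 0 < R) :
    ∫⁻ ρ in Set.Ioi R, ENNReal.ofReal (ρ ^ (-s - 1)) = ENNReal.ofReal (R ^ (-s) / s) := by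
  rw [← ofReal_integral_eq_lintegral_ofReal (integrableOn_Ioi_rpow_of_lt (by linarith) hR),
    integral_Ioi_rpow_of_lt (by linarith) hR]
  · congr 1
    rw [sub_add_cancel, neg_div_neg_eq]
  · exact (ae_restrict_mem measurableSet_Ioi).mono fun x hx =>
      Real.rpow_nonneg (hR.trans hx).le _

/-- Below the crossing radius the constant branch is integrable since b > 0; above it the power
branch is integrable since στ > b. Both pieces are multiples of the same power of Y. -/
theorem lintegral_rpow_mul_min_le {b σ τ : ℝ} (hb : 0 < b) (hσ : 0 < σ) (hτ : b < σ * τ)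
    {Y : ℝ≥0∞} (hY0 : Y ≠ 0) :
    ∫⁻ ρ in Set.Ioi (0 : ℝ), ENNReal.ofReal (ρ ^ (b - 1)) *
      (min (ENNReal.ofReal (ρ ^ (-σ))) Y) ^ τ ≤
      ENNReal.ofReal (1 / b + 1 / (σ * τ - b)) * Y ^ (τ - b / σ) := by
  have hτ0 : 0 < τ := by
    by_contra h
    have : σ * τ ≤ 0 := mul_nonpos_of_nonneg_of_nonpos hσ.le (not_lt.1 h)
    linarith
  have hexp : 0 < τ - b / σ := by
    rw [sub_pos, div_lt_iff₀ hσ]; linarith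
  have hst : 0 < σ * τ - b := by linarith
  by_cases hYt : Y = ⊤
  · subst hYt
    rw [ENNReal.top_rpow_of_pos hexp, ENNReal.mul_top]
    · exact le_top
    · rw [Ne, ENNReal.ofReal_eq_zero, not_le]; positivity
  obtain ⟨y, hy, rfl⟩ : ∃ y : ℝ, 0 < y ∧ Y = ENNReal.ofReal y :=
    ⟨Y.toReal, ENNReal.toReal_pos hY0 hYt, (ENNReal.ofReal_toReal hYt).symm⟩
  -- The radius at which the two branches of the minimum agree.
  set R := y ^ (-1 / σ) with hR
  have hRpos : 0 < R := Real.rpow_pos_of_pos hy _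
  rw [← Set.Ioc_union_Ioi_eq_Ioi hRpos.le, lintegral_union measurableSet_Ioi
    (Set.Ioc_disjoint_Ioi le_rfl)]
  have A : ∫⁻ ρ in Set.Ioc (0 : ℝ) R, ENNReal.ofReal (ρ ^ (b - 1)) *
      (min (ENNReal.ofReal (ρ ^ (-σ))) (ENNReal.ofReal y)) ^ τ ≤
      ENNReal.ofReal (1 / b) * ENNReal.ofReal y ^ (τ - b / σ) := by
    calc _ ≤ ∫⁻ ρ in Set.Ioc (0 : ℝ) R, ENNReal.ofReal (ρ ^ (b - 1)) * ENNReal.ofReal y ^ τ := by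
          gcongr; exact min_le_right _ _
      _ = ENNReal.ofReal (R ^ b / b) * ENNReal.ofReal y ^ τ := by
          rw [lintegral_mul_const'' _ (by fun_prop), lintegral_Ioc_rpow hb hRpos]
      _ = _ := by
          rw [ENNReal.ofReal_rpow_of_pos hy, ENNReal.ofReal_rpow_of_pos hy,
            ← ENNReal.ofReal_mul (by positivity), ← ENNReal.ofReal_mul (by positivity), hR,
            ← Real.rpow_mul hy.le, Real.rpow_sub hy]
          congr 1
          rw [show -1 / σ * b = -(b / σ) by ring, Real.rpow_neg hy.le]
          field_simp
  have A' : ∫⁻ ρ in Set.Ioi R, ENNReal.ofReal (ρ ^ (b - 1)) *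
      (min (ENNReal.ofReal (ρ ^ (-σ))) (ENNReal.ofReal y)) ^ τ ≤
      ENNReal.ofReal (1 / (σ * τ - b)) * ENNReal.ofReal y ^ (τ - b / σ) := by
    calc _ ≤ ∫⁻ ρ in Set.Ioi R, ENNReal.ofReal (ρ ^ (-(σ * τ - b) - 1)) := by
          refine setLIntegral_mono' measurableSet_Ioi fun ρ hρ => ?_
          have hρ0 : 0 < ρ := hRpos.trans hρ
          calc _ ≤ ENNReal.ofReal (ρ ^ (b - 1)) * (ENNReal.ofReal (ρ ^ (-σ))) ^ τ := by
                gcongr; exact min_le_left _ _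
            _ = _ := by
                rw [ENNReal.ofReal_rpow_of_pos (by positivity), ← ENNReal.ofReal_mul (by positivity),
                  ← Real.rpow_mul hρ0.le, ← Real.rpow_add hρ0]
                congr 2; ring
      _ = ENNReal.ofReal (R ^ (-(σ * τ - b)) / (σ * τ - b)) := lintegral_Ioi_rpow hst hRpos
      _ = _ := by
          rw [ENNReal.ofReal_rpow_of_pos hy, ← ENNReal.ofReal_mul (by positivity), hR,
            ← Real.rpow_mul hy.le, show -1 / σ * -(σ * τ - b) = τ - b / σ by field_simp]
          congr 1; ring
  calc _ ≤ _ := add_le_add A A'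
    _ = _ := by rw [← add_mul, ← ENNReal.ofReal_add (by positivity) (by positivity)]

/-- Jensen's inequality for `x ↦ x ^ a`, `0 < a < 1`, on a set of finite measure. -/
theorem lintegral_rpow_le_measure_mul {X : Type*} [MeasurableSpace X] {μ : Measure X} {a : ℝ}
    (ha : 0 < a) (ha1 : a < 1) {f : X → ℝ≥0∞} (hf : AEMeasurable f μ) :
    ∫⁻ x, f x ^ a ∂μ ≤ μ Set.univ ^ (1 - a) * (∫⁻ x, f x ∂μ) ^ a := by
  have hpq : (1 / a).HolderConjugate (1 / (1 - a)) := by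
    rw [Real.holderConjugate_iff]
    refine ⟨by rw [lt_div_iff₀ ha]; linarith, by simp⟩
  have := ENNReal.lintegral_mul_le_Lp_mul_Lq μ hpq (f := fun x => f x ^ a) (g := fun _ => 1)
    (hf.pow_const _) aemeasurable_const
  simp only [Pi.mul_apply, mul_one, ← ENNReal.rpow_mul, mul_one_div_cancel ha.ne', ENNReal.rpow_one,
    ENNReal.one_rpow, lintegral_one, one_div_one_div] at this
  rwa [mul_comm]

/-! ### Parabolic balls and Riesz potentials -/

/-- The two-sided parabolic ball. -/
def pball {d : ℕ} (α ρ : ℝ) (z : ST d) : Set (ST d) :=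
  {w | |w.1 - z.1| ≤ ρ ^ α ∧ ‖w.2 - z.2‖ ≤ ρ}

section
variable {d : ℕ} {α : ℝ}

theorem mem_pball_comm {ρ : ℝ} {z w : ST d} : w ∈ pball α ρ z ↔ z ∈ pball α ρ w := by
  simp only [pball, Set.mem_ofPred_eq]
  rw [abs_sub_comm, norm_sub_rev]

/-- The triangle inequality in time needs 2R^α ≤ (2R)^α, which is where α ≥ 1 enters. -/
theorem mem_pball_of_mem_of_mem (hα : 1 ≤ α) {ρ R : ℝ} {x y w : ST d} (hρ : 0 < ρ) (hρR : ρ ≤ R)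
    (hy : y ∈ pball α R x) (hw : w ∈ pball α ρ y) : w ∈ pball α (2 * R) x := by
  have hR : 0 < R := hρ.trans_le hρR
  have h1 : ρ ^ α ≤ R ^ α := Real.rpow_le_rpow hρ.le hρR (by linarith)
  have h2 : 2 * R ^ α ≤ (2 * R) ^ α := by
    rw [Real.mul_rpow (by norm_num) hR.le]
    gcongr
    calc (2 : ℝ) = 2 ^ (1 : ℝ) := by simp
      _ ≤ 2 ^ α := Real.rpow_le_rpow_of_exponent_le (by norm_num) hα
  refine ⟨?_, ?_⟩
  · calc |w.1 - x.1| ≤ |w.1 - y.1| + |y.1 - x.1| := abs_sub_le _ _ _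
      _ ≤ ρ ^ α + R ^ α := add_le_add hw.1 hy.1
      _ ≤ _ := by linarith
  · calc ‖w.2 - x.2‖ ≤ ‖w.2 - y.2‖ + ‖y.2 - x.2‖ := norm_sub_le_norm_sub_add_norm_sub _ _ _
      _ ≤ ρ + R := add_le_add hw.2 hy.2
      _ ≤ _ := by linarith

theorem pball_subset_pball (hα : 0 ≤ α) {ρ R : ℝ} (hρ : 0 ≤ ρ) (h : ρ ≤ R) (z : ST d) :
    pball α ρ z ⊆ pball α R z := fun _ hw =>
  ⟨hw.1.trans (Real.rpow_le_rpow hρ h hα), hw.2.trans h⟩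

variable (d α) in
theorem measurableSet_pball_graph :
    MeasurableSet {q : ℝ × ST d × ST d | q.2.2 ∈ pball α q.1 q.2.1} := by
  exact (measurableSet_le (by fun_prop : Measurable fun q : ℝ × ST d × ST d => |q.2.2.1 - q.2.1.1|)
      (by fun_prop : Measurable fun q : ℝ × ST d × ST d => q.1 ^ α)).inter
    (measurableSet_le (by fun_prop : Measurable fun q : ℝ × ST d × ST d => ‖q.2.2.2 - q.2.1.2‖)
      (by fun_prop : Measurable fun q : ℝ × ST d × ST d => q.1))

theorem measurableSet_pball (ρ : ℝ) (z : ST d) : MeasurableSet (pball α ρ z) :=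
  (measurableSet_pball_graph d α).preimage
    (f := fun w => (ρ, z, w)) (by fun_prop)

/-- The volume of the parabolic unit ball. -/
def unitVol (d : ℕ) : ℝ≥0∞ := 2 * volume (Metric.ball (0 : Sp d) 1)

theorem unitVol_ne_zero : unitVol d ≠ 0 :=
  mul_ne_zero two_ne_zero (Metric.measure_ball_pos _ _ one_pos).ne'

theorem unitVol_ne_top : unitVol d ≠ ⊤ :=
  ENNReal.mul_ne_top ENNReal.ofNat_ne_top measure_ball_lt_top.ne

theorem volume_pball {ρ : ℝ} (hρ : 0 < ρ) (z : ST d) :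
    volume (pball α ρ z) = unitVol d * ENNReal.ofReal (ρ ^ (d + α)) := by
  have : pball α ρ z = Set.Icc (z.1 - ρ ^ α) (z.1 + ρ ^ α) ×ˢ Metric.closedBall z.2 ρ := by
    ext w
    simp only [pball, Set.mem_ofPred_eq, Set.mem_prod, Set.mem_Icc, Metric.mem_closedBall,
      dist_eq_norm, abs_le]
    constructor <;> rintro ⟨⟨h1, h2⟩, h3⟩ <;> exact ⟨⟨by linarith, by linarith⟩, h3⟩
  rw [this, Measure.volume_eq_prod, Measure.prod_prod, Real.volume_Icc,
    Measure.addHaar_closedBall _ _ hρ.le, finrank_euclideanSpace, Fintype.card_fin, unitVol,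
    Real.rpow_add hρ, Real.rpow_natCast, show z.1 + ρ ^ α - (z.1 - ρ ^ α) = 2 * ρ ^ α by ring,
    ENNReal.ofReal_mul (by norm_num), ENNReal.ofReal_mul (by positivity)]
  simp only [ENNReal.ofReal_ofNat]
  ring

theorem measurable_lintegral_pball {f : ST d → ℝ≥0∞} (hf : Measurable f) :
    Measurable fun q : ℝ × ST d => ∫⁻ w in pball α q.1 q.2, f w := by
  have h : (fun q : ℝ × ST d => ∫⁻ w in pball α q.1 q.2, f w) = fun q : ℝ × ST d =>
      ∫⁻ w, ({q : ℝ × ST d × ST d | q.2.2 ∈ pball α q.1 q.2.1}.indicator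
        (fun q => f q.2.2)) (q.1, q.2, w) := by
    ext q
    rw [← lintegral_indicator (measurableSet_pball _ _)]
    rfl
  rw [h]
  refine Measurable.lintegral_prod_right' (f := fun x : (ℝ × ST d) × ST d =>
    ({q : ℝ × ST d × ST d | q.2.2 ∈ pball α q.1 q.2.1}.indicator
        (fun q => f q.2.2)) (x.1.1, x.1.2, x.2)) ?_
  exact ((by fun_prop : Measurable fun q : ℝ × ST d × ST d => f q.2.2).indicator
    (measurableSet_pball_graph d α)).comp (by fun_prop)

/-- The parabolic Riesz potential of order `β`. -/
def riesz (α β : ℝ) (f : ST d → ℝ≥0∞) (x : ST d) : ℝ≥0∞ :=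
  ∫⁻ ρ in Set.Ioi (0 : ℝ), ENNReal.ofReal (ρ ^ (β - (d + α) - 1)) * ∫⁻ w in pball α ρ x, f w

/-- The kernel of the parabolic Riesz potential of order `β`. -/
def rieszKernel (α β : ℝ) (x w : ST d) : ℝ≥0∞ :=
  ∫⁻ ρ in Set.Ioi (0 : ℝ), ENNReal.ofReal (ρ ^ (β - (d + α) - 1)) *
    (pball α ρ x).indicator 1 w

theorem measurable_riesz {β : ℝ} {f : ST d → ℝ≥0∞} (hf : Measurable f) :
    Measurable (riesz α β f) := by
  refine Measurable.lintegral_prod_right' (f := fun q : ST d × ℝ =>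
    ENNReal.ofReal (q.2 ^ (β - (d + α) - 1)) * ∫⁻ w in pball α q.2 q.1, f w) ?_
  exact (by fun_prop : Measurable fun q : ST d × ℝ =>
    ENNReal.ofReal (q.2 ^ (β - (d + α) - 1))).mul
    ((measurable_lintegral_pball hf).comp measurable_swap)

theorem measurable_rieszKernel_integrand (β : ℝ) :
    Measurable fun q : (ST d × ST d) × ℝ => ENNReal.ofReal (q.2 ^ (β - (d + α) - 1)) *
      (pball α q.2 q.1.1).indicator (1 : ST d → ℝ≥0∞) q.1.2 := by
  refine (by fun_prop : Measurable fun q : (ST d × ST d) × ℝ =>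
    ENNReal.ofReal (q.2 ^ (β - (d + α) - 1))).mul ?_
  exact ((measurable_const (a := (1 : ℝ≥0∞))).indicator (measurableSet_pball_graph d α)).comp
    (by fun_prop : Measurable fun q : (ST d × ST d) × ℝ => (q.2, q.1.1, q.1.2))

theorem measurable_rieszKernel (β : ℝ) :
    Measurable (Function.uncurry (rieszKernel (d := d) α β)) :=
  Measurable.lintegral_prod_right' (f := fun q : (ST d × ST d) × ℝ =>
    ENNReal.ofReal (q.2 ^ (β - (d + α) - 1)) *
      (pball α q.2 q.1.1).indicator (1 : ST d → ℝ≥0∞) q.1.2) (measurable_rieszKernel_integrand β)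

theorem rieszKernel_comm (β : ℝ) (x w : ST d) : rieszKernel α β x w = rieszKernel α β w x := by
  unfold rieszKernel
  congr 1; ext ρ
  congr 1
  by_cases h : w ∈ pball α ρ x
  · simp [h, mem_pball_comm.1 h]
  · simp [h, mt mem_pball_comm.1 h]

theorem riesz_eq_lintegral_kernel {β : ℝ} {f : ST d → ℝ≥0∞} (hf : Measurable f) (x : ST d) :
    riesz α β f x = ∫⁻ w, rieszKernel α β x w * f w := by
  have hm := measurable_rieszKernel_integrand (d := d) (α := α) β
  have h1 : ∀ w, rieszKernel α β x w * f w = ∫⁻ ρ in Set.Ioi (0 : ℝ),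
      ENNReal.ofReal (ρ ^ (β - (d + α) - 1)) * (pball α ρ x).indicator 1 w * f w := by
    intro w
    rw [rieszKernel, lintegral_mul_const]
    exact hm.comp (by fun_prop : Measurable fun ρ : ℝ => ((x, w), ρ))
  simp_rw [h1]
  rw [lintegral_lintegral_swap]
  · unfold riesz
    congr 1; ext ρ
    rw [← lintegral_indicator (measurableSet_pball _ _), ← lintegral_const_mul _
      (hf.indicator (measurableSet_pball _ _))]
    congr 1; ext w
    by_cases h : w ∈ pball α ρ x <;> simp [h]
  · exact ((hm.comp (by fun_prop : Measurable fun q : ST d × ℝ => ((x, q.1), q.2))).mul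
      (hf.comp measurable_fst)).aemeasurable

theorem lintegral_comp_two_mul (g : ℝ → ℝ≥0∞) (hg : Measurable g) :
    ∫⁻ ρ, g (2 * ρ) = ENNReal.ofReal 2⁻¹ * ∫⁻ ρ, g ρ := by
  have := Real.map_volume_mul_left (a := 2) two_ne_zero
  rw [← lintegral_map (f := g) (g := fun ρ => 2 * ρ) hg (by fun_prop), this]
  rw [lintegral_smul_measure, abs_of_pos (by norm_num)]
  rfl

theorem setLIntegral_Ioi_comp_two_mul {R : ℝ} (g : ℝ → ℝ≥0∞) (hg : Measurable g) :
    ∫⁻ ρ in Set.Ioi R, g (2 * ρ) = ENNReal.ofReal 2⁻¹ * ∫⁻ ρ in Set.Ioi (2 * R), g ρ := by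
  rw [← lintegral_indicator measurableSet_Ioi, ← lintegral_indicator measurableSet_Ioi,
    ← lintegral_comp_two_mul _ (hg.indicator measurableSet_Ioi)]
  congr 1; ext ρ
  simp [Set.indicator_apply]

/-- The balls increase with the radius, so the radii beyond ρ alone already contribute this much to
the potential. -/
theorem lintegral_pball_le_rpow_mul_riesz {θ : ℝ} (hα : 0 ≤ α) (hθ : θ < d + α)
    {f : ST d → ℝ≥0∞} {ρ : ℝ} (hρ : 0 < ρ) (x : ST d) :
    ∫⁻ w in pball α ρ x, f w ≤
      ENNReal.ofReal ((d + α - θ) * ρ ^ (d + α - θ)) * riesz α θ f x := by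
  have hD : 0 < d + α - θ := by linarith
  have h1 : ENNReal.ofReal (ρ ^ (-(d + α - θ)) / (d + α - θ)) * ∫⁻ w in pball α ρ x, f w ≤
      riesz α θ f x := by
    rw [← lintegral_Ioi_rpow hD hρ, ← lintegral_mul_const'' _ (by fun_prop)]
    calc _ ≤ ∫⁻ s in Set.Ioi ρ, ENNReal.ofReal (s ^ (θ - (d + α) - 1)) *
          ∫⁻ w in pball α s x, f w := by
          refine setLIntegral_mono' measurableSet_Ioi fun s hs => ?_
          rw [show -(d + α - θ) - 1 = θ - (d + α) - 1 by ring]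
          gcongr
          exact pball_subset_pball hα hρ.le (le_of_lt hs) x
      _ ≤ _ := lintegral_mono_set (Set.Ioi_subset_Ioi hρ.le)
  calc ∫⁻ w in pball α ρ x, f w = ENNReal.ofReal ((d + α - θ) * ρ ^ (d + α - θ)) *
      (ENNReal.ofReal (ρ ^ (-(d + α - θ)) / (d + α - θ)) * ∫⁻ w in pball α ρ x, f w) := by
        rw [← mul_assoc, ← ENNReal.ofReal_mul (by positivity), Real.rpow_neg hρ.le]
        have : (d + α - θ) * ρ ^ (d + α - θ) * ((ρ ^ (d + α - θ))⁻¹ / (d + α - θ)) = 1 := by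
          have := (Real.rpow_pos_of_pos hρ (d + α - θ)).ne'
          field_simp
        rw [this]; simp
    _ ≤ _ := by gcongr

/-- After exchanging the integrals, each w is counted with at most the volume of a ball of radius ρ,
and only w within 2R of x occur. -/
theorem lintegral_lintegral_pball_le_of_le (hα : 1 ≤ α) {f : ST d → ℝ≥0∞} (hf : Measurable f)
    {ρ R : ℝ} (hρ : 0 < ρ) (hρR : ρ ≤ R) (x : ST d) :
    ∫⁻ y in pball α R x, ∫⁻ w in pball α ρ y, f w ≤
      unitVol d * ENNReal.ofReal (ρ ^ (d + α)) * ∫⁻ w in pball α (2 * R) x, f w := by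
  have hg := measurableSet_pball_graph d α
  calc ∫⁻ y in pball α R x, ∫⁻ w in pball α ρ y, f w
      ≤ ∫⁻ y in pball α R x, ∫⁻ w in pball α (2 * R) x, (pball α ρ w).indicator 1 y * f w := by
        refine setLIntegral_mono' (measurableSet_pball _ _) fun y hy => ?_
        rw [← lintegral_indicator (measurableSet_pball _ _),
          ← lintegral_indicator (measurableSet_pball _ _)]
        refine lintegral_mono fun w => ?_
        by_cases hw : w ∈ pball α ρ y
        · simp [hw, mem_pball_comm.1 hw, mem_pball_of_mem_of_mem hα hρ hρR hy hw]
        · simp [hw]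
    _ ≤ ∫⁻ y, ∫⁻ w in pball α (2 * R) x, (pball α ρ w).indicator 1 y * f w :=
        setLIntegral_le_lintegral _ _
    _ = ∫⁻ w in pball α (2 * R) x, ∫⁻ y, (pball α ρ w).indicator 1 y * f w := by
        refine lintegral_lintegral_swap (Measurable.aemeasurable ?_)
        exact (((measurable_const (a := (1 : ℝ≥0∞))).indicator hg).comp
          (by fun_prop : Measurable fun q : ST d × ST d => (ρ, q.2, q.1))).mul
            (hf.comp measurable_snd)
    _ = ∫⁻ w in pball α (2 * R) x, unitVol d * ENNReal.ofReal (ρ ^ (d + α)) * f w := by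
        congr 1; ext w
        rw [lintegral_mul_const _ (measurable_one.indicator (measurableSet_pball _ _)), lintegral_indicator_one (measurableSet_pball _ _),
          volume_pball hρ]
    _ = _ := lintegral_const_mul _ hf

/-- For ρ ≥ R all the inner balls lie in the one ball of radius 2ρ about x, so the inner mass is
bounded independently of y. -/
theorem lintegral_lintegral_pball_le_of_ge (hα : 1 ≤ α) {f : ST d → ℝ≥0∞}
    {ρ R : ℝ} (hR : 0 < R) (hρR : R ≤ ρ) (x : ST d) :
    ∫⁻ y in pball α R x, ∫⁻ w in pball α ρ y, f w ≤
      unitVol d * ENNReal.ofReal (R ^ (d + α)) * ∫⁻ w in pball α (2 * ρ) x, f w := by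
  have hρ : 0 < ρ := hR.trans_le hρR
  calc ∫⁻ y in pball α R x, ∫⁻ w in pball α ρ y, f w
      ≤ ∫⁻ y in pball α R x, ∫⁻ w in pball α (2 * ρ) x, f w := by
        refine setLIntegral_mono' (measurableSet_pball _ _) fun y hy => ?_
        refine lintegral_mono_set fun w hw => ?_
        exact mem_pball_of_mem_of_mem hα hρ le_rfl
          (pball_subset_pball (by linarith) hR.le hρR x hy) hw
    _ = _ := by
        rw [setLIntegral_const, volume_pball hR, mul_comm]

/-- The radial integral defining the potential is split at R, and the two preceding regimes are used
on the two sides. -/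
theorem lintegral_pball_riesz_le (hα : 1 ≤ α) {θ : ℝ} (hθ : 0 < θ) {f : ST d → ℝ≥0∞}
    (hf : Measurable f) {R : ℝ} (hR : 0 < R) (x : ST d) :
    ∫⁻ y in pball α R x, riesz α θ f y ≤
      unitVol d * (ENNReal.ofReal (R ^ θ / θ) * ∫⁻ w in pball α (2 * R) x, f w) +
      unitVol d * (ENNReal.ofReal (R ^ (d + α)) *
        ∫⁻ ρ in Set.Ioi R, ENNReal.ofReal (ρ ^ (θ - (d + α) - 1)) *
          ∫⁻ w in pball α (2 * ρ) x, f w) := by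
  have hm := measurable_lintegral_pball (α := α) hf
  unfold riesz
  rw [lintegral_lintegral_swap]
  swap
  · exact ((by fun_prop : Measurable fun q : ST d × ℝ =>
      ENNReal.ofReal (q.2 ^ (θ - (d + α) - 1))).mul (hm.comp measurable_swap)).aemeasurable
  have e : ∀ ρ : ℝ, ∫⁻ y in pball α R x, ENNReal.ofReal (ρ ^ (θ - (d + α) - 1)) *
      ∫⁻ w in pball α ρ y, f w = ENNReal.ofReal (ρ ^ (θ - (d + α) - 1)) *
      ∫⁻ y in pball α R x, ∫⁻ w in pball α ρ y, f w := fun ρ =>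
    lintegral_const_mul _ (hm.comp (by fun_prop : Measurable fun y : ST d => (ρ, y)))
  simp_rw [e]
  rw [← Set.Ioc_union_Ioi_eq_Ioi hR.le, lintegral_union measurableSet_Ioi
    (Set.Ioc_disjoint_Ioi le_rfl)]
  refine add_le_add ?_ ?_
  · calc _ ≤ ∫⁻ ρ in Set.Ioc 0 R, ENNReal.ofReal (ρ ^ (θ - 1)) *
          (unitVol d * ∫⁻ w in pball α (2 * R) x, f w) := by
          refine setLIntegral_mono' measurableSet_Ioc fun ρ hρ => ?_
          calc _ ≤ ENNReal.ofReal (ρ ^ (θ - (d + α) - 1)) * (unitVol d *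
                ENNReal.ofReal (ρ ^ (d + α)) * ∫⁻ w in pball α (2 * R) x, f w) := by
                gcongr
                exact lintegral_lintegral_pball_le_of_le hα hf hρ.1 hρ.2 x
            _ = (ENNReal.ofReal (ρ ^ (θ - (d + α) - 1)) * ENNReal.ofReal (ρ ^ (d + α))) *
                (unitVol d * ∫⁻ w in pball α (2 * R) x, f w) := by ring
            _ = _ := by
                rw [← ENNReal.ofReal_mul (Real.rpow_nonneg hρ.1.le _), ← Real.rpow_add hρ.1]
                congr 3; ring
      _ = _ := by
          rw [lintegral_mul_const'' _ (by fun_prop), lintegral_Ioc_rpow hθ hR]; ring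
  · calc _ ≤ ∫⁻ ρ in Set.Ioi R, (unitVol d * ENNReal.ofReal (R ^ (d + α))) *
          (ENNReal.ofReal (ρ ^ (θ - (d + α) - 1)) * ∫⁻ w in pball α (2 * ρ) x, f w) := by
          refine setLIntegral_mono' measurableSet_Ioi fun ρ hρ => ?_
          calc _ ≤ ENNReal.ofReal (ρ ^ (θ - (d + α) - 1)) * (unitVol d *
                ENNReal.ofReal (R ^ (d + α)) * ∫⁻ w in pball α (2 * ρ) x, f w) := by
                gcongr
                exact lintegral_lintegral_pball_le_of_ge hα hR (le_of_lt hρ) x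
            _ = _ := by ring
      _ = _ := by
          rw [lintegral_const_mul]
          · ring
          · exact (by fun_prop : Measurable fun ρ : ℝ =>
              ENNReal.ofReal (ρ ^ (θ - (d + α) - 1))).mul
                (hm.comp (by fun_prop : Measurable fun ρ : ℝ => (2 * ρ, x)))

end

/-! ### The trace inequality for Morrey weights -/

section
variable {d : ℕ} {α : ℝ}

theorem ofReal_rpow_mul_rpow {ρ : ℝ} (hρ : 0 < ρ) (a b : ℝ) :
    ENNReal.ofReal (ρ ^ a) * ENNReal.ofReal (ρ ^ b) = ENNReal.ofReal (ρ ^ (a + b)) := by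
  rw [← ENNReal.ofReal_mul (by positivity), ← Real.rpow_add hρ]

theorem ofReal_rpow_rpow {ρ : ℝ} (hρ : 0 < ρ) (a b : ℝ) :
    ENNReal.ofReal (ρ ^ a) ^ b = ENNReal.ofReal (ρ ^ (a * b)) := by
  rw [ENNReal.ofReal_rpow_of_pos (by positivity), ← Real.rpow_mul hρ.le]

/-- This is the Muckenhoupt A₁ property of Riesz potentials together with the bound that the Morrey
condition gives at every scale. Keeping the smaller of the two makes it possible later to integrate
over all radii, since one controls small radii and the other large ones. -/
theorem exists_lintegral_pball_riesz_le_min (d : ℕ) (hα : 1 ≤ α) {θ q : ℝ} (hθ : 0 < θ)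
    (hθq : θ < q) (hq : q < d + α) :
    ∃ C : ℝ≥0∞, C ≠ ⊤ ∧ ∀ g : ST d → ℝ≥0∞, Measurable g →
      (∀ ρ : ℝ, 0 < ρ → ∀ x, ∫⁻ w in pball α ρ x, g w ≤ ENNReal.ofReal (ρ ^ (d + α - q))) →
      ∀ (R : ℝ), 0 < R → ∀ x, ∫⁻ y in pball α R x, riesz α θ g y ≤
        C * (ENNReal.ofReal (R ^ (d + α)) *
          min (ENNReal.ofReal (R ^ (-(q - θ)))) (riesz α θ g x)) := by
  have hD : 0 < d + α - θ := by linarith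
  have hDq : 0 < d + α - q := by linarith
  have hσ : 0 < q - θ := by linarith
  set C₁ : ℝ≥0∞ := unitVol d * ENNReal.ofReal ((d + α - θ) * 2 ^ (d + α - θ) / θ) +
    unitVol d * ENNReal.ofReal (2 ^ (d + α - θ)) with hC₁
  set C₂ : ℝ≥0∞ := unitVol d * ENNReal.ofReal (2 ^ (d + α - q) / θ) +
    unitVol d * ENNReal.ofReal (2 ^ (d + α - q) / (q - θ)) with hC₂
  have ht := unitVol_ne_top (d := d)
  refine ⟨max C₁ C₂, ?_, fun g hg hM R hR x => ?_⟩
  · rw [← lt_top_iff_ne_top, max_lt_iff]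
    constructor <;>
    · refine ENNReal.add_lt_top.2 ⟨ENNReal.mul_lt_top ht.lt_top ENNReal.ofReal_lt_top,
        ENNReal.mul_lt_top ht.lt_top ENNReal.ofReal_lt_top⟩
  have hm := measurable_lintegral_pball (α := α) hg
  have base := lintegral_pball_riesz_le hα hθ hg hR x
  -- Both terms of `base` are controlled by the potential at x: the first through the mass of the
  -- doubled ball, the second because ρ ↦ 2ρ makes it a part of the same radial integral.
  have b₁ : ∫⁻ y in pball α R x, riesz α θ g y ≤
      C₁ * (ENNReal.ofReal (R ^ (d + α)) * riesz α θ g x) := by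
    refine base.trans ?_
    rw [hC₁, add_mul]
    refine add_le_add ?_ ?_
    · rw [mul_assoc]
      gcongr unitVol d * ?_
      calc _ ≤ ENNReal.ofReal (R ^ θ / θ) * (ENNReal.ofReal ((d + α - θ) *
            (2 * R) ^ (d + α - θ)) * riesz α θ g x) := by
            gcongr
            exact lintegral_pball_le_rpow_mul_riesz (by linarith) (by linarith) (by linarith) x
        _ = _ := by
            rw [← mul_assoc, ← mul_assoc, ← ENNReal.ofReal_mul (by positivity),
              ← ENNReal.ofReal_mul (by positivity), Real.mul_rpow (by norm_num) hR.le]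
            congr 2
            rw [show (d + α : ℝ) = θ + (d + α - θ) by ring, Real.rpow_add hR]
            ring_nf
    · rw [mul_assoc]
      gcongr unitVol d * ?_
      rw [mul_left_comm]
      gcongr ENNReal.ofReal (R ^ (d + α)) * ?_
      have e := setLIntegral_Ioi_comp_two_mul (R := R)
        (fun ρ => ENNReal.ofReal ((ρ / 2) ^ (θ - (d + α) - 1)) * ∫⁻ w in pball α ρ x, g w)
        ((by fun_prop : Measurable fun ρ : ℝ => ENNReal.ofReal ((ρ / 2) ^ (θ - (d + α) - 1))).mul
          (hm.comp (by fun_prop : Measurable fun ρ : ℝ => (ρ, x))))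
      simp only [mul_div_cancel_left₀ _ (two_ne_zero (α := ℝ))] at e
      rw [e]
      calc _ = ENNReal.ofReal 2⁻¹ * ∫⁻ ρ in Set.Ioi (2 * R),
            ENNReal.ofReal (2 ^ (d + α - θ + 1)) * (ENNReal.ofReal (ρ ^ (θ - (d + α) - 1)) *
              ∫⁻ w in pball α ρ x, g w) := by
            congr 1
            refine setLIntegral_congr_fun measurableSet_Ioi fun ρ hρ => ?_
            have hρ0 : 0 < ρ := by have : 2 * R < ρ := hρ; linarith
            rw [← mul_assoc, ← ENNReal.ofReal_mul (by positivity),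
              Real.div_rpow hρ0.le (by norm_num), div_eq_mul_inv, ← Real.rpow_neg (by norm_num),
              mul_comm (ρ ^ (θ - (d + α) - 1))]
            congr 4; ring
        _ ≤ ENNReal.ofReal 2⁻¹ * (ENNReal.ofReal (2 ^ (d + α - θ + 1)) * riesz α θ g x) := by
            rw [lintegral_const_mul]
            · gcongr
              exact lintegral_mono_set (Set.Ioi_subset_Ioi (by linarith))
            · exact (by fun_prop : Measurable fun ρ : ℝ =>
                ENNReal.ofReal (ρ ^ (θ - (d + α) - 1))).mul
                  (hm.comp (by fun_prop : Measurable fun ρ : ℝ => (ρ, x)))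
        _ = _ := by
            rw [← mul_assoc, ← ENNReal.ofReal_mul (by positivity), Real.rpow_add_one (by norm_num)]
            congr 2; ring
  -- Here the Morrey bound is inserted into both terms of `base`; the tail converges because q > θ.
  have b₂ : ∫⁻ y in pball α R x, riesz α θ g y ≤
      C₂ * (ENNReal.ofReal (R ^ (d + α)) * ENNReal.ofReal (R ^ (-(q - θ)))) := by
    refine base.trans ?_
    rw [hC₂, add_mul]
    refine add_le_add ?_ ?_
    · rw [mul_assoc]
      gcongr unitVol d * ?_
      calc _ ≤ ENNReal.ofReal (R ^ θ / θ) * ENNReal.ofReal ((2 * R) ^ (d + α - q)) := by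
            gcongr
            exact hM _ (by linarith) x
        _ = _ := by
            rw [ofReal_rpow_mul_rpow hR, ← ENNReal.ofReal_mul (by positivity),
              ← ENNReal.ofReal_mul (by positivity), Real.mul_rpow (by norm_num) hR.le]
            congr 1
            rw [show d + α + -(q - θ) = θ + (d + α - q) by ring, Real.rpow_add hR]
            ring
    · rw [mul_assoc]
      gcongr unitVol d * ?_
      rw [mul_left_comm]
      gcongr ENNReal.ofReal (R ^ (d + α)) * ?_
      calc _ ≤ ∫⁻ ρ in Set.Ioi R, ENNReal.ofReal (2 ^ (d + α - q)) *
            ENNReal.ofReal (ρ ^ (-(q - θ) - 1)) := by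
            refine setLIntegral_mono' measurableSet_Ioi fun ρ hρ => ?_
            have hρ0 : 0 < ρ := hR.trans hρ
            calc _ ≤ ENNReal.ofReal (ρ ^ (θ - (d + α) - 1)) *
                  ENNReal.ofReal ((2 * ρ) ^ (d + α - q)) := by
                  gcongr
                  exact hM _ (by linarith) x
              _ = _ := by
                  rw [Real.mul_rpow (by norm_num) hρ0.le, ENNReal.ofReal_mul (by positivity),
                    mul_left_comm, ofReal_rpow_mul_rpow hρ0]
                  congr 3; ring
        _ = ENNReal.ofReal (2 ^ (d + α - q)) * ENNReal.ofReal (R ^ (-(q - θ)) / (q - θ)) := by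
            rw [lintegral_const_mul _ (by fun_prop), lintegral_Ioi_rpow hσ hR]
        _ = _ := by
            rw [← ENNReal.ofReal_mul (by positivity), ← ENNReal.ofReal_mul (by positivity)]
            congr 1; ring
  rcases le_total (ENNReal.ofReal (R ^ (-(q - θ)))) (riesz α θ g x) with h | h
  · rw [min_eq_left h]
    exact b₂.trans (by gcongr; exact le_max_right _ _)
  · rw [min_eq_right h]
    exact b₁.trans (by gcongr; exact le_max_left _ _)

/-- A Hedberg-type argument: with ball masses controlled by a minimum, the radial integral is the
one of `lintegral_rpow_mul_min_le`, and the potential is a power of Y. -/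
theorem riesz_le_of_lintegral_pball_le {β η σ τ : ℝ} (hβ : η < β) (hσ : 0 < σ)
    (hτ : β - η < σ * τ) {f : ST d → ℝ≥0∞} {x : ST d} {C Y : ℝ≥0∞} (hC : C ≠ ⊤) (hY : Y ≠ 0)
    (h : ∀ ρ : ℝ, 0 < ρ → ∫⁻ w in pball α ρ x, f w ≤ C * (ENNReal.ofReal (ρ ^ (d + α - η)) *
      min (ENNReal.ofReal (ρ ^ (-σ))) Y ^ τ)) :
    riesz α β f x ≤ C * ENNReal.ofReal (1 / (β - η) + 1 / (σ * τ - (β - η))) *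
      Y ^ (τ - (β - η) / σ) := by
  calc riesz α β f x ≤ ∫⁻ ρ in Set.Ioi (0 : ℝ), C * (ENNReal.ofReal (ρ ^ (β - η - 1)) *
        min (ENNReal.ofReal (ρ ^ (-σ))) Y ^ τ) := by
        refine setLIntegral_mono' measurableSet_Ioi fun ρ hρ => ?_
        calc _ ≤ ENNReal.ofReal (ρ ^ (β - (d + α) - 1)) * (C * (ENNReal.ofReal (ρ ^ (d + α - η)) *
            min (ENNReal.ofReal (ρ ^ (-σ))) Y ^ τ)) := by gcongr; exact h ρ hρ
          _ = C * ((ENNReal.ofReal (ρ ^ (β - (d + α) - 1)) * ENNReal.ofReal (ρ ^ (d + α - η))) *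
            min (ENNReal.ofReal (ρ ^ (-σ))) Y ^ τ) := by ring
          _ = _ := by
            rw [ofReal_rpow_mul_rpow hρ]
            congr 4; ring
    _ = C * ∫⁻ ρ in Set.Ioi (0 : ℝ), ENNReal.ofReal (ρ ^ (β - η - 1)) *
        min (ENNReal.ofReal (ρ ^ (-σ))) Y ^ τ := lintegral_const_mul' _ _ hC
    _ ≤ _ := by
        rw [mul_assoc]
        gcongr
        exact lintegral_rpow_mul_min_le (by linarith) hσ hτ hY

theorem ae_of_forall_pball (hα : 0 < α) {P : ST d → Prop}
    (h : ∀ ρ : ℝ, 0 < ρ → ∀ᵐ w ∂(volume.restrict (pball α ρ 0)), P w) : ∀ᵐ w, P w := by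
  have hU : (⋃ n : ℕ, pball α (n + 1 : ℝ) (0 : ST d)) = Set.univ := by
    refine Set.eq_univ_of_forall fun w => Set.mem_iUnion.2 ?_
    obtain ⟨n, hn⟩ := exists_nat_ge (max (|w.1| ^ (1 / α)) ‖w.2‖)
    refine ⟨n, ?_, ?_⟩
    · have h1 : |w.1| ^ (1 / α) ≤ (n + 1 : ℝ) := (le_max_left _ _).trans (hn.trans (by linarith))
      have := Real.rpow_le_rpow (by positivity) h1 hα.le
      rw [← Real.rpow_mul (abs_nonneg _), one_div_mul_cancel hα.ne', Real.rpow_one] at this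
      simpa using this
    · have h1 : ‖w.2‖ ≤ (n + 1 : ℝ) := (le_max_right _ _).trans (hn.trans (by linarith))
      simpa using h1
  rw [← Measure.restrict_univ (μ := (volume : Measure (ST d))), ← hU, ae_restrict_iUnion_iff]
  exact fun n => h _ (by positivity)

set_option maxHeartbeats 1000000 in
/-- Trace inequality for parabolic Riesz potentials and weights in a Morrey class, together with
its dual. -/
theorem exists_riesz_trace_bound (d : ℕ) (hα : 1 ≤ α) {p p' β r : ℝ} (hpq : p.HolderConjugate p')
    (hβ : 0 < β) (hr : 1 < r) (hq : β * p * r < d + α) :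
    ∃ B : ℝ≥0∞, B ≠ ⊤ ∧ ∀ V : ST d → ℝ≥0∞, Measurable V →
      (∀ ρ : ℝ, 0 < ρ → ∀ x, ∫⁻ w in pball α ρ x, V w ^ r ≤
        ENNReal.ofReal (ρ ^ (d + α - β * p * r))) →
      (∀ f : ST d → ℝ≥0∞, Measurable f →
        ∫⁻ z, (V z ^ (1 / p) * riesz α β f z) ^ p ≤ B * ∫⁻ z, f z ^ p) ∧
      (∀ f : ST d → ℝ≥0∞, Measurable f →
        ∫⁻ z, (riesz α β (fun w => V w ^ (1 / p) * f w) z) ^ p' ≤ B * ∫⁻ z, f z ^ p') := by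
  have hp1 : 0 < p - 1 := by linarith [hpq.lt]
  have hp0 := hpq.pos
  have hp1' : 0 < p' - 1 := by linarith [hpq.symm.lt]
  have hr1 : 0 < r - 1 := by linarith
  have hr0 : 0 < r := by linarith
  -- With θ = β(r-1) one has q - θ = β s₀, so applying I_β to a power of U lowers the exponent by
  -- 1/s₀. This fixes a = c + 1/s₀ in the Schur weights U^a and V^{1/p} U^c.
  set s₀ : ℝ := r * (p - 1) + 1 with hs₀
  have hs₀1 : 1 < s₀ := by rw [hs₀]; linarith [mul_pos hr0 hp1]
  have hs₀0 : 0 < s₀ := by linarith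
  set θ : ℝ := β * (r - 1) with hθ
  have hθ0 : 0 < θ := mul_pos hβ hr1
  set q : ℝ := β * p * r with hqdef
  have hσeq : q - θ = β * s₀ := by rw [hqdef, hθ, hs₀]; ring
  have hσ0 : 0 < q - θ := by rw [hσeq]; positivity
  -- Two constraints bound c: Jensen for U^a needs a < 1, that is c < 1 - 1/s₀; Hölder followed by
  -- Jensen for V U^{c(p-1)} needs c(p-1) < 1 - 1/r = 1/r'. Half the smaller bound satisfies both
  -- strictly.
  set c : ℝ := min (1 - 1 / s₀) ((1 - 1 / r) / (p - 1)) / 2 with hc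
  have hx1 : 0 < 1 - 1 / s₀ := by rw [sub_pos, div_lt_one hs₀0]; exact hs₀1
  have hx2 : 0 < 1 - 1 / r := by rw [sub_pos, div_lt_one hr0]; exact hr
  have hmin : 0 < min (1 - 1 / s₀) ((1 - 1 / r) / (p - 1)) := lt_min hx1 (by positivity)
  have hc0 : 0 < c := by rw [hc]; positivity
  have hc1 : c < 1 - 1 / s₀ := by
    have := min_le_left (1 - 1 / s₀) ((1 - 1 / r) / (p - 1)); rw [hc]; linarith
  have hc2 : c * (p - 1) < 1 - 1 / r := by
    have := min_le_right (1 - 1 / s₀) ((1 - 1 / r) / (p - 1))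
    rw [← lt_div_iff₀ hp1, hc]; linarith
  set a : ℝ := c + 1 / s₀ with ha
  have ha0 : 0 < a := by rw [ha]; positivity
  have ha1 : a < 1 := by rw [ha]; linarith
  set e : ℝ := c * (p - 1) with he
  have he0 : 0 < e := mul_pos hc0 hp1
  set r' : ℝ := (1 - 1 / r)⁻¹ with hr'
  have hr'0 : 0 < r' := by rw [hr']; positivity
  have hrr' : r.HolderConjugate r' := by
    rw [Real.holderConjugate_iff]; exact ⟨hr, by rw [hr', inv_inv]; ring⟩
  have her0 : 0 < e * r' := by positivity
  have her1 : e * r' < 1 := by rw [hr', ← div_eq_mul_inv, div_lt_one hx2]; exact hc2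
  obtain ⟨C, hC, hCU⟩ := exists_lintegral_pball_riesz_le_min d hα hθ0 (by linarith) hq
  have hut := unitVol_ne_top (d := d)
  set C₀ : ℝ≥0∞ := max 1 (ENNReal.ofReal (d + α - θ)) with hC₀
  have hC₀t : C₀ ≠ ⊤ := by
    rw [← lt_top_iff_ne_top, hC₀, max_lt_iff]
    exact ⟨ENNReal.one_lt_top, ENNReal.ofReal_lt_top⟩
  set J : ℝ → ℝ≥0∞ := fun s => unitVol d ^ (1 - s) * C ^ s with hJ
  have hJt : ∀ s, 0 < s → s < 1 → J s ≠ ⊤ := fun s h0 h1 =>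
    ENNReal.mul_ne_top (ENNReal.rpow_ne_top_of_nonneg (by linarith) hut)
      (ENNReal.rpow_ne_top_of_nonneg h0.le hC)
  clear_value J
  set C₁ : ℝ≥0∞ := J a * ENNReal.ofReal (1 / (β - 0) + 1 / ((q - θ) * a - (β - 0))) with hC₁
  have hC₁t : C₁ ≠ ⊤ := ENNReal.mul_ne_top (hJt a ha0 ha1) ENNReal.ofReal_ne_top
  clear_value C₁
  set C₃ : ℝ≥0∞ := C₀ ^ (1 / r) * J (e * r') ^ (1 / r') with hC₃
  have hC₃t : C₃ ≠ ⊤ := ENNReal.mul_ne_top (ENNReal.rpow_ne_top_of_nonneg (by positivity) hC₀t)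
    (ENNReal.rpow_ne_top_of_nonneg (by positivity) (hJt _ her0 her1))
  set C₂ : ℝ≥0∞ := C₃ * ENNReal.ofReal (1 / (β - θ / r) + 1 / ((q - θ) * (1 / r + e) -
    (β - θ / r))) with hC₂
  have hC₂t : C₂ ≠ ⊤ := ENNReal.mul_ne_top hC₃t ENNReal.ofReal_ne_top
  set B₀ : ℝ≥0∞ := C₁ ^ (p - 1) * C₂ with hB₀
  have hB₀t : B₀ ≠ ⊤ := ENNReal.mul_ne_top (ENNReal.rpow_ne_top_of_nonneg hp1.le hC₁t) hC₂t
  refine ⟨max B₀ (B₀ ^ (p' - 1)), ?_, fun V hV hM => ?_⟩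
  · rw [← lt_top_iff_ne_top, max_lt_iff]
    exact ⟨hB₀t.lt_top, (ENNReal.rpow_ne_top_of_nonneg hp1'.le hB₀t).lt_top⟩
  have hVr : Measurable fun w => V w ^ r := hV.pow_const _
  -- The auxiliary weight whose powers serve in Schur's test.
  set U : ST d → ℝ≥0∞ := riesz α θ (fun w => V w ^ r) with hU
  have hUm : Measurable U := measurable_riesz hVr
  -- The Schur weights need U > 0, which fails only when V vanishes almost everywhere; in that case
  -- both left sides are zero.
  by_cases hV0 : ∀ᵐ w, V w = 0
  · refine ⟨fun f hf => ?_, fun f hf => ?_⟩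
    · have : ∫⁻ z, (V z ^ (1 / p) * riesz α β f z) ^ p = 0 := by
        rw [lintegral_eq_zero_iff' (by have := measurable_riesz (α := α) (β := β) hf; fun_prop)]
        filter_upwards [hV0] with z hz
        simp [hz, hp0]
      rw [this]; exact zero_le
    · have : ∀ z, riesz α β (fun w => V w ^ (1 / p) * f w) z = 0 := by
        intro z
        unfold riesz
        have h0 : ∀ ρ : ℝ, ∫⁻ w in pball α ρ z, V w ^ (1 / p) * f w = 0 := by
          intro ρ
          rw [lintegral_eq_zero_iff' (by fun_prop)]
          filter_upwards [ae_restrict_of_ae hV0] with w hw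
          simp [hw, hp0]
        simp only [h0, mul_zero, lintegral_zero]
      simp only [this, ENNReal.zero_rpow_of_pos hpq.symm.pos, lintegral_zero, zero_le]
  -- A zero of U at x forces V = 0 almost everywhere on every ball about x, and these balls exhaust
  -- space-time.
  have hU0 : ∀ x, U x ≠ 0 := by
    intro x hx
    apply hV0
    have hall : ∀ ρ : ℝ, 0 < ρ → ∀ᵐ w ∂(volume.restrict (pball α ρ x)), V w = 0 := by
      intro ρ hρ
      have h1 := lintegral_pball_le_rpow_mul_riesz (α := α) (f := fun w => V w ^ r)
        (by linarith) (by linarith : θ < d + α) hρ x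
      rw [show riesz α θ (fun w => V w ^ r) x = 0 from hx, mul_zero, nonpos_iff_eq_zero,
        lintegral_eq_zero_iff' (by fun_prop)] at h1
      filter_upwards [h1] with w hw
      simpa [hr0, hr0.le, not_lt.2 hr0.le] using hw
    refine ae_of_forall_pball (α := α) (by linarith) fun ρ hρ => ?_
    set T := max ρ (max (|x.1| ^ (1 / α)) ‖x.2‖) with hT
    have hT0 : 0 < T := hρ.trans_le (le_max_left _ _)
    refine ae_restrict_of_ae_restrict_of_subset ?_ (hall (2 * T) (by positivity))
    intro w hw
    refine mem_pball_of_mem_of_mem hα hρ (le_max_left _ _) (y := 0) ?_ hw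
    refine ⟨?_, ?_⟩
    · have h1 : |x.1| ^ (1 / α) ≤ T := (le_max_left _ _).trans (le_max_right _ _)
      have := Real.rpow_le_rpow (by positivity) h1 (by linarith : 0 ≤ α)
      rw [← Real.rpow_mul (abs_nonneg _), one_div_mul_cancel (by linarith), Real.rpow_one] at this
      simpa using this
    · have h1 : ‖x.2‖ ≤ T := (le_max_right _ _).trans (le_max_right _ _)
      simpa using h1
  -- The Morrey branch of the minimum makes U locally integrable, hence finite almost everywhere.
  have hUfin : ∀ᵐ x, U x ≠ ⊤ := by
    refine ae_of_forall_pball (α := α) (by linarith) fun ρ hρ => ?_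
    have h1 := hCU _ hVr hM ρ hρ 0
    have h2 : ∫⁻ y in pball α ρ 0, U y ≠ ⊤ := by
      refine (h1.trans_lt ?_).ne
      refine ENNReal.mul_lt_top hC.lt_top (ENNReal.mul_lt_top ENNReal.ofReal_lt_top ?_)
      exact min_lt_of_left_lt ENNReal.ofReal_lt_top
    filter_upwards [ae_lt_top hUm h2] with y hy using hy.ne
  -- Jensen transfers the ball bound for U to its powers of exponent less than 1.
  have hJens : ∀ s, 0 < s → s < 1 → ∀ ρ : ℝ, 0 < ρ → ∀ x, ∫⁻ y in pball α ρ x, U y ^ s ≤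
      J s * (ENNReal.ofReal (ρ ^ (d + α)) * min (ENNReal.ofReal (ρ ^ (-(q - θ)))) (U x) ^ s) := by
    intro s hs0 hs1 ρ hρ x
    set m := min (ENNReal.ofReal (ρ ^ (-(q - θ)))) (U x) with hm
    calc ∫⁻ y in pball α ρ x, U y ^ s
        ≤ (volume.restrict (pball α ρ x)) Set.univ ^ (1 - s) *
          (∫⁻ y in pball α ρ x, U y) ^ s := lintegral_rpow_le_measure_mul hs0 hs1 hUm.aemeasurable
      _ ≤ (unitVol d * ENNReal.ofReal (ρ ^ (d + α))) ^ (1 - s) *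
          (C * (ENNReal.ofReal (ρ ^ (d + α)) * m)) ^ s := by
          rw [Measure.restrict_apply_univ, volume_pball hρ]
          gcongr
          exact hCU _ hVr hM ρ hρ x
      _ = _ := by
          rw [ENNReal.mul_rpow_of_nonneg _ _ (by linarith), ENNReal.mul_rpow_of_nonneg _ _ hs0.le,
            ENNReal.mul_rpow_of_nonneg _ _ hs0.le, ofReal_rpow_rpow hρ, ofReal_rpow_rpow hρ, hJ]
          simp only
          have := ofReal_rpow_mul_rpow hρ ((d + α) * (1 - s)) ((d + α) * s)
          rw [show (d + α) * (1 - s) + (d + α) * s = d + α by ring] at this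
          rw [← this]
          ring
  -- First Schur inequality: the exponent drops from a to a - β/(q-θ) = a - 1/s₀ = c.
  have hS₁ : ∀ x, riesz α β (fun w => U w ^ a) x ≤ C₁ * U x ^ c := by
    intro x
    have := riesz_le_of_lintegral_pball_le (α := α) (β := β) (η := 0) (σ := q - θ) (τ := a)
      (f := fun w => U w ^ a) (x := x) (C := J a) (Y := U x) hβ hσ0
      (by rw [hσeq, ha, sub_zero]; field_simp; linarith [mul_pos hc0 hs₀0]) (hJt a ha0 ha1) (hU0 x)
      (fun ρ hρ => by simpa using hJens a ha0 ha1 ρ hρ x)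
    refine this.trans (le_of_eq ?_)
    rw [hC₁]
    congr 2
    rw [hσeq, ha, sub_zero]; field_simp; ring
  -- Second Schur inequality. Hölder with exponents r, r' separates V from U^e; the radial estimate
  -- is then used with η = θ/r and τ = 1/r + e, and `hid` checks that the resulting exponent is
  -- a(p-1).
  have hS₂ : ∀ x, riesz α β (fun w => V w * U w ^ e) x ≤ C₂ * U x ^ (a * (p - 1)) := by
    intro x
    have hηβ : θ / r < β := by rw [div_lt_iff₀ hr0, hθ]; linarith
    have hid : 1 / r + e - (β - θ / r) / (q - θ) = a * (p - 1) := by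
      rw [hσeq, ha, he, hθ]
      have : (β - β * (r - 1) / r) / (β * s₀) = 1 / (r * s₀) := by field_simp; ring
      rw [this]
      have h2 : 1 / r - 1 / (r * s₀) = 1 / s₀ * (p - 1) := by
        rw [show p - 1 = (s₀ - 1) / r by rw [hs₀]; field_simp; ring]
        field_simp
      linarith
    have hlt : β - θ / r < (q - θ) * (1 / r + e) := by
      have : 0 < a * (p - 1) := by positivity
      rw [← hid, sub_pos, div_lt_iff₀ hσ0] at this
      linarith
    have := riesz_le_of_lintegral_pball_le (α := α) (β := β) (η := θ / r) (σ := q - θ)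
      (τ := 1 / r + e) (f := fun w => V w * U w ^ e) (x := x) (C := C₃) (Y := U x) hηβ hσ0 hlt
      hC₃t (hU0 x) ?_
    · rw [hid] at this; exact this
    intro ρ hρ
    set m := min (ENNReal.ofReal (ρ ^ (-(q - θ)))) (U x) with hm
    -- The mass of V^r obeys the same minimum as U: the Morrey hypothesis gives one branch, and the
    -- definition of U as a potential of V^r the other.
    have hV1 : ∫⁻ w in pball α ρ x, V w ^ r ≤ C₀ * (ENNReal.ofReal (ρ ^ (d + α - θ)) * m) := by
      rcases le_total (ENNReal.ofReal (ρ ^ (-(q - θ)))) (U x) with h | h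
      · rw [hm, min_eq_left h, ofReal_rpow_mul_rpow hρ]
        refine (hM ρ hρ x).trans ?_
        rw [show d + α - θ + -(q - θ) = d + α - q by ring]
        calc _ = 1 * ENNReal.ofReal (ρ ^ (d + α - q)) := (one_mul _).symm
          _ ≤ _ := by gcongr; exact le_max_left _ _
      · rw [hm, min_eq_right h]
        refine (lintegral_pball_le_rpow_mul_riesz (by linarith) (by linarith : θ < d + α)
          hρ x).trans ?_
        rw [ENNReal.ofReal_mul (by linarith), mul_assoc]
        gcongr
        exact le_max_right _ _
    calc ∫⁻ w in pball α ρ x, V w * U w ^ e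
        ≤ (∫⁻ w in pball α ρ x, V w ^ r) ^ (1 / r) *
          (∫⁻ w in pball α ρ x, (U w ^ e) ^ r') ^ (1 / r') :=
          ENNReal.lintegral_mul_le_Lp_mul_Lq _ hrr' hV.aemeasurable (hUm.pow_const _).aemeasurable
      _ ≤ (C₀ * (ENNReal.ofReal (ρ ^ (d + α - θ)) * m)) ^ (1 / r) *
          (J (e * r') * (ENNReal.ofReal (ρ ^ (d + α)) * m ^ (e * r'))) ^ (1 / r') := by
          gcongr
          simp_rw [← ENNReal.rpow_mul]
          exact hJens _ her0 her1 ρ hρ x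
      _ = C₀ ^ (1 / r) * J (e * r') ^ (1 / r') * ((ENNReal.ofReal (ρ ^ ((d + α - θ) * (1 / r))) *
          ENNReal.ofReal (ρ ^ ((d + α) * (1 / r')))) * (m ^ (1 / r) * m ^ e)) := by
          have hr1' : 0 ≤ 1 / r := by positivity
          have hr1'' : 0 ≤ 1 / r' := by positivity
          rw [ENNReal.mul_rpow_of_nonneg _ _ hr1', ENNReal.mul_rpow_of_nonneg _ _ hr1',
            ENNReal.mul_rpow_of_nonneg _ _ hr1'', ENNReal.mul_rpow_of_nonneg _ _ hr1'',
            ofReal_rpow_rpow hρ, ofReal_rpow_rpow hρ, ← ENNReal.rpow_mul m,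
            show e * r' * (1 / r') = e by field_simp]
          ring
      _ = _ := by
          rw [ofReal_rpow_mul_rpow hρ, ← ENNReal.rpow_add_of_nonneg _ _ (by positivity) he0.le]
          congr 4
          have := hrr'.inv_add_inv_eq_one
          rw [one_div, one_div]
          have h2 : r'⁻¹ = 1 - r⁻¹ := by linarith
          rw [h2]; field_simp; ring
  set K : ST d → ST d → ℝ≥0∞ := fun z w => V z ^ (1 / p) * rieszKernel α β z w with hK
  have hkm := measurable_rieszKernel (d := d) (α := α) β
  have hKm : Measurable (Function.uncurry K) :=
    ((hV.comp measurable_fst).pow_const _).mul hkm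
  have hkz : ∀ z, Measurable fun w => rieszKernel α β z w := fun z =>
    hkm.comp measurable_prodMk_left
  have hkw : ∀ w, Measurable fun z => rieszKernel α β z w := fun w =>
    hkm.comp measurable_prodMk_right
  set ψ : ST d → ℝ≥0∞ := fun z => C₁ * (V z ^ (1 / p) * U z ^ c) with hψ
  have hψm : Measurable ψ := by rw [hψ]; fun_prop
  have hK₁ : ∀ z, ∫⁻ w, K z w * U w ^ a ≤ ψ z := by
    intro z
    calc ∫⁻ w, K z w * U w ^ a = V z ^ (1 / p) * riesz α β (fun w => U w ^ a) z := by
          rw [riesz_eq_lintegral_kernel (hUm.pow_const _), ← lintegral_const_mul _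
            (by have := hkz z; fun_prop)]
          simp only [hK, mul_assoc]
      _ ≤ V z ^ (1 / p) * (C₁ * U z ^ c) := by gcongr; exact hS₁ z
      _ = _ := by rw [hψ]; ring
  -- The powers of V combine, 1/p + (p-1)/p = 1, and the power of U is c(p-1) = e; what remains is
  -- the potential estimated in `hS₂`.
  have hK₂ : ∀ w, ∫⁻ z, K z w * ψ z ^ (p - 1) ≤ B₀ * (U w ^ a) ^ (p - 1) := by
    intro w
    calc ∫⁻ z, K z w * ψ z ^ (p - 1)
        = C₁ ^ (p - 1) * riesz α β (fun w => V w * U w ^ e) w := by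
          rw [riesz_eq_lintegral_kernel (by fun_prop), ← lintegral_const_mul _
            (by have := hkz w; fun_prop)]
          congr 1; ext z
          simp only [hK, hψ]
          rw [ENNReal.mul_rpow_of_nonneg _ _ hp1.le, ENNReal.mul_rpow_of_nonneg _ _ hp1.le,
            ← ENNReal.rpow_mul, ← ENNReal.rpow_mul, rieszKernel_comm β z w]
          have h1 : V z ^ (1 / p) * V z ^ (1 / p * (p - 1)) = V z := by
            rw [← ENNReal.rpow_add_of_nonneg _ _ (by positivity) (by positivity)]
            rw [show 1 / p + 1 / p * (p - 1) = 1 by field_simp; ring, ENNReal.rpow_one]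
          calc _ = C₁ ^ (p - 1) * (rieszKernel α β w z * ((V z ^ (1 / p) *
                V z ^ (1 / p * (p - 1))) * U z ^ (c * (p - 1)))) := by ring
            _ = _ := by rw [h1]
      _ ≤ C₁ ^ (p - 1) * (C₂ * U w ^ (a * (p - 1))) := by gcongr; exact hS₂ w
      _ = _ := by rw [hB₀, ENNReal.rpow_mul]; ring
  -- If C₁ were 0, the potential of U^a would vanish at the origin although U is nowhere zero. The
  -- transposed test needs ψ ≠ 0, hence this.
  have hC₁0 : C₁ ≠ 0 := by
    intro h0
    have hle := fun x => hS₁ x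
    simp only [h0, zero_mul, nonpos_iff_eq_zero] at hle
    have h1 := lintegral_pball_le_rpow_mul_riesz (α := α) (f := fun w => U w ^ a)
        (by linarith) (by nlinarith : β < d + α) one_pos 0
    rw [hle 0, mul_zero, nonpos_iff_eq_zero, lintegral_eq_zero_iff' (by fun_prop)] at h1
    have h2 : ∀ᵐ w ∂volume.restrict (pball α 1 (0 : ST d)), False := by
      filter_upwards [h1] with w hw
      have : U w = 0 := by simpa [ha0, ha0.le, not_lt.2 ha0.le] using hw
      exact hU0 w this
    have h3 : volume (pball α 1 (0 : ST d)) = 0 := by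
      simpa [ae_iff] using h2
    rw [volume_pball one_pos] at h3
    simp [unitVol_ne_zero] at h3
  refine ⟨fun f hf => ?_, fun f hf => ?_⟩
  · have := schur_test hpq hKm (φ := fun w => U w ^ a) (ψ := ψ) (hUm.pow_const _) hψm
      (ae_of_all _ hK₁) (ae_of_all _ hK₂) ?_ hf
    · refine le_trans (le_of_eq ?_) (this.trans (by gcongr; exact le_max_left _ _))
      congr 1; ext z
      rw [riesz_eq_lintegral_kernel hf, ← lintegral_const_mul _ (by have := hkz z; fun_prop)]
      simp only [hK, mul_assoc]
    · filter_upwards [hUfin] with w hw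
      left
      simp [ENNReal.rpow_eq_zero_iff, ENNReal.rpow_eq_top_iff, hU0 w, hw]
  · have := schur_test_transpose hpq hKm (φ := fun w => U w ^ a) (ψ := ψ) (hUm.pow_const _) hψm
      (ae_of_all _ hK₁) (ae_of_all _ hK₂) ?_ hf
    · refine le_trans (le_of_eq ?_) (this.trans (by gcongr; exact le_max_right _ _))
      congr 1; ext z
      rw [riesz_eq_lintegral_kernel (by fun_prop)]
      congr 2; ext w
      simp only [hK]
      rw [rieszKernel_comm β z w]; ring
    -- Where V vanishes the weight ψ is 0 but so is the whole row of the kernel, which is the second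
    -- alternative of Schur's test.
    · have hVfin : ∀ᵐ z, V z ≠ ⊤ := by
        refine ae_of_forall_pball (α := α) (by linarith) fun ρ hρ => ?_
        have h2 : ∫⁻ y in pball α ρ 0, V y ^ r ≠ ⊤ :=
          ((hM ρ hρ 0).trans_lt ENNReal.ofReal_lt_top).ne
        filter_upwards [ae_lt_top hVr h2] with y hy h
        simp [h, hr0] at hy
      filter_upwards [hUfin, hVfin] with z hz hVz
      by_cases h0 : V z = 0
      · right; intro w; simp [hK, h0, hp0]
      · left
        have hne : V z ^ (1 / p) ≠ 0 := by
          simp [ENNReal.rpow_eq_zero_iff, h0, hVz]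
        have hne' : U z ^ c ≠ 0 := by
          simp [ENNReal.rpow_eq_zero_iff, hU0 z, hz]
        refine ⟨mul_ne_zero hC₁0 (mul_ne_zero hne hne'), ?_⟩
        exact ENNReal.mul_ne_top hC₁t (ENNReal.mul_ne_top
          (ENNReal.rpow_ne_top_of_nonneg (by positivity) hVz)
          (ENNReal.rpow_ne_top_of_nonneg hc0.le hz))

end

section
variable {d : ℕ} {α : ℝ}

theorem continuous_heatKernel (hd : 0 < d) {t : ℝ} (hα : 0 < α) (ht : 0 < t) :
    Continuous (heatKernel (d := d) α t) :=
  continuous_iff_continuousAt.2 fun x => (hasFDerivAt_heatKernel hd hα ht x).continuousAt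

theorem heatKernel_nonneg (hd : 0 < d) (hα : 0 < α) (hα2 : α < 2) {t : ℝ} (ht : 0 < t)
    (x : Sp d) : 0 ≤ heatKernel α t x := by
  rcases eq_or_ne x 0 with rfl | hx
  · refine integral_nonneg fun ξ => ?_
    simp only [inner_zero_left, mul_zero, Real.cos_zero, mul_one]
    exact (Real.exp_pos _).le
  · obtain ⟨C, -, h⟩ := exists_heatKernel_decay hd hα hα2
    exact (h t ht x hx).1

theorem measurable_heatKernel :
    Measurable fun z : ST d => heatKernel α z.1 z.2 := by
  refine (StronglyMeasurable.integral_prod_right' (f := fun q : ST d × Sp d =>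
    Real.exp (-q.1.1 * (2 * Real.pi * ‖q.2‖) ^ α) * Real.cos (2 * Real.pi * ⟪q.1.2, q.2⟫_ℝ))
    (Measurable.stronglyMeasurable ?_)).measurable
  fun_prop

theorem measurable_gradHeat :
    Measurable fun z : ST d => gradHeat α z.1 z.2 := by
  refine (StronglyMeasurable.integral_prod_right' (f := fun q : ST d × Sp d =>
    (-(2 * Real.pi) * (heatMult α q.1.1 q.2 * Real.sin (2 * Real.pi * ⟪q.1.2, q.2⟫_ℝ))) • q.2)
    (Measurable.stronglyMeasurable ?_)).measurable
  unfold heatMult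
  fun_prop

/-- The parabolic size `max (|t|^{1/α}) |x|` of a space-time point. -/
def pnorm (α : ℝ) (z : ST d) : ℝ := max (|z.1| ^ (1 / α)) ‖z.2‖

/-- For |x| ≥ t^{1/α} this is the spatial decay. For |x| ≤ t^{1/α} the parabolic size is t^{1/α} and
t · t^{-(d+α)/α} = t^{-d/α} is the sup bound; the gradient is analogous. -/
theorem exists_heatKernel_le_pnorm (hd : 0 < d) (hα : 0 < α) (hα2 : α < 2) :
    ∃ C : ℝ, 0 < C ∧ ∀ t : ℝ, 0 < t → ∀ x : Sp d,
      heatKernel α t x ≤ C * t * pnorm α (t, x) ^ (-(d + α)) ∧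
      ‖gradHeat α t x‖ ≤ C * t * pnorm α (t, x) ^ (-(d + 1 + α)) := by
  obtain ⟨C₁, hC₁, h₁⟩ := exists_heatKernel_decay hd hα hα2
  obtain ⟨C₂, hC₂, h₂⟩ := exists_heatKernel_sup_bound hd hα
  refine ⟨max C₁ C₂, lt_max_of_lt_left hC₁, fun t ht x => ?_⟩
  unfold pnorm
  simp only [abs_of_pos ht]
  rcases le_total ‖x‖ (t ^ (1 / α)) with h | h
  · rw [max_eq_left h, ← Real.rpow_mul ht.le, ← Real.rpow_mul ht.le, mul_assoc, mul_assoc,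
      ← Real.rpow_one_add' ht.le, ← Real.rpow_one_add' ht.le]
    · have e1 : 1 + 1 / α * -(d + α) = -(d : ℝ) / α := by field_simp; ring
      have e2 : 1 + 1 / α * -(d + 1 + α) = -((d : ℝ) + 1) / α := by field_simp; ring
      rw [e1, e2]
      exact ⟨((le_abs_self _).trans (h₂ t ht x).1).trans (by gcongr; exact le_max_right _ _),
        (h₂ t ht x).2.trans (by gcongr; exact le_max_right _ _)⟩
    · have : 1 + 1 / α * -(d + 1 + α) = -((d : ℝ) + 1) / α := by field_simp; ring
      rw [this]
      exact (div_neg_of_neg_of_pos (by linarith [(d.cast_nonneg : (0 : ℝ) ≤ d)]) hα).ne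
    · have : 1 + 1 / α * -(d + α) = -(d : ℝ) / α := by field_simp; ring
      rw [this]
      have : (0 : ℝ) < d := by exact_mod_cast hd
      exact (div_neg_of_neg_of_pos (by linarith) hα).ne
  · have hx : x ≠ 0 := by
      rintro rfl
      rw [norm_zero] at h
      exact absurd h (not_le.2 (Real.rpow_pos_of_pos ht _))
    rw [max_eq_right h]
    exact ⟨(h₁ t ht x hx).2.1.trans (by gcongr; exact le_max_left _ _),
      (h₁ t ht x hx).2.2.trans (by gcongr; exact le_max_left _ _)⟩

theorem integral_one_add_norm_smul {t : ℝ} (ht : 0 < t) (r : ℝ) :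
    ∫ x : Sp d, (1 + ‖(t ^ (-1 / α)) • x‖) ^ (-r) =
      t ^ (d / α) * ∫ x : Sp d, (1 + ‖x‖) ^ (-r) := by
  have hp : 0 < t ^ (-1 / α) := Real.rpow_pos_of_pos ht _
  rw [Measure.integral_comp_smul volume (fun x : Sp d => (1 + ‖x‖) ^ (-r)), smul_eq_mul]
  congr 1
  rw [finrank_euclideanSpace, Fintype.card_fin, ← Real.rpow_natCast, ← Real.rpow_mul ht.le,
    ← Real.rpow_neg ht.le, abs_of_pos (Real.rpow_pos_of_pos ht _)]
  congr 1
  ring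

theorem pnorm_rpow_le {t : ℝ} (ht : 0 < t) (x : Sp d) {r : ℝ} (hr : 0 ≤ r) :
    pnorm α (t, x) ^ (-r) ≤ 2 ^ r * t ^ (-r / α) * (1 + ‖(t ^ (-1 / α)) • x‖) ^ (-r) := by
  have hp : 0 < t ^ (1 / α) := Real.rpow_pos_of_pos ht _
  have e1 : t ^ (1 / α) * t ^ (-1 / α) = 1 := by
    rw [← Real.rpow_add ht]; ring_nf; exact Real.rpow_zero t
  have h1 : 2⁻¹ * (t ^ (1 / α) * (1 + ‖(t ^ (-1 / α)) • x‖)) ≤ pnorm α (t, x) := by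
    rw [norm_smul, Real.norm_of_nonneg (Real.rpow_nonneg ht.le _), mul_add, ← mul_assoc, e1]
    simp only [pnorm, abs_of_pos ht]
    have := le_max_left (t ^ (1 / α)) ‖x‖
    have := le_max_right (t ^ (1 / α)) ‖x‖
    linarith
  have h2 : 0 < 1 + ‖(t ^ (-1 / α)) • x‖ := by positivity
  calc pnorm α (t, x) ^ (-r) ≤ (2⁻¹ * (t ^ (1 / α) * (1 + ‖(t ^ (-1 / α)) • x‖))) ^ (-r) :=
        Real.rpow_le_rpow_of_nonpos (by positivity) h1 (by linarith)
    _ = _ := by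
        rw [Real.mul_rpow (by norm_num) (by positivity), Real.mul_rpow hp.le h2.le,
          ← Real.rpow_mul ht.le, Real.inv_rpow (by norm_num), Real.rpow_neg (by norm_num), inv_inv,
          mul_assoc]
        ring_nf

/-- The parabolic size is at least half of t^{1/α}(1 + |t^{-1/α}x|), so the pointwise bounds are
rescaled integrable functions, and the scaling produces the factor t^{-1/α} for the gradient. -/
theorem exists_heatKernel_integral_bound (hd : 0 < d) (hα : 0 < α) (hα2 : α < 2) :
    ∃ C : ℝ, 0 < C ∧ ∀ t : ℝ, 0 < t → Integrable (heatKernel (d := d) α t) ∧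
      Integrable (gradHeat (d := d) α t) ∧ ∫ x : Sp d, ‖gradHeat α t x‖ ≤ C * t ^ (-1 / α) := by
  obtain ⟨C, hC, h⟩ := exists_heatKernel_le_pnorm hd hα hα2
  have key : ∀ t : ℝ, 0 < t → ∀ r : ℝ, d < r → Integrable fun x : Sp d =>
      C * t * (2 ^ r * t ^ (-r / α) * (1 + ‖(t ^ (-1 / α)) • x‖) ^ (-r)) := by
    intro t ht r hr
    have h1 : Integrable fun x : Sp d => (1 + ‖x‖) ^ (-r) := by
      refine integrable_one_add_norm ?_
      rw [finrank_euclideanSpace, Fintype.card_fin]; exact hr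
    exact ((h1.comp_smul (Real.rpow_pos_of_pos ht _).ne').const_mul _).const_mul _
  have hm1 : ∀ t : ℝ, Measurable (heatKernel (d := d) α t) := fun t =>
    measurable_heatKernel.comp (by fun_prop : Measurable fun x : Sp d => (t, x))
  have hm2 : ∀ t : ℝ, Measurable (gradHeat (d := d) α t) := fun t =>
    measurable_gradHeat.comp (by fun_prop : Measurable fun x : Sp d => (t, x))
  have b2 : ∀ t : ℝ, 0 < t → ∀ x : Sp d, ‖gradHeat α t x‖ ≤ C * t * (2 ^ (d + 1 + α) *
      t ^ (-(d + 1 + α) / α) * (1 + ‖(t ^ (-1 / α)) • x‖) ^ (-(d + 1 + α))) := fun t ht x =>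
    (h t ht x).2.trans (by gcongr; exact pnorm_rpow_le ht x (by positivity))
  have i2 : ∀ t : ℝ, 0 < t → Integrable (gradHeat (d := d) α t) := fun t ht =>
    (key t ht (d + 1 + α) (by linarith)).mono' (hm2 t).aestronglyMeasurable
      (Eventually.of_forall (b2 t ht))
  have hpos : 0 ≤ ∫ x : Sp d, (1 + ‖x‖) ^ (-(d + 1 + α)) :=
    integral_nonneg fun x => by positivity
  refine ⟨C * 2 ^ (d + 1 + α) * ((∫ x : Sp d, (1 + ‖x‖) ^ (-(d + 1 + α))) + 1), by positivity,
    fun t ht => ⟨?_, i2 t ht, ?_⟩⟩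
  · refine (key t ht (d + α) (by linarith)).mono' (hm1 t).aestronglyMeasurable
      (Eventually.of_forall fun x => ?_)
    rw [Real.norm_of_nonneg (heatKernel_nonneg hd hα hα2 ht x)]
    exact (h t ht x).1.trans (by gcongr; exact pnorm_rpow_le ht x (by positivity))
  · refine (integral_mono (i2 t ht).norm (key t ht _ (by linarith)) (b2 t ht)).trans ?_
    rw [integral_const_mul, integral_const_mul, integral_one_add_norm_smul ht]
    have : t ^ (-1 / α) = t * (t ^ (-(d + 1 + α) / α) * t ^ (d / α)) := by
      rw [← Real.rpow_add ht, ← Real.rpow_one_add' ht.le]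
      · congr 1; field_simp; ring
      · have : 1 + (-(d + 1 + α) / α + d / α) = -1 / α := by field_simp; ring
        rw [this]; exact (div_neg_of_neg_of_pos (by norm_num) hα).ne
    rw [this]
    have : 0 ≤ C * 2 ^ (d + 1 + α) * (t * (t ^ (-(d + 1 + α) / α) * t ^ (d / α))) := by positivity
    nlinarith

theorem integrable_heatKernel (hd : 0 < d) (hα : 0 < α) (hα2 : α < 2) {t : ℝ} (ht : 0 < t) :
    Integrable (heatKernel (d := d) α t) := by
  obtain ⟨C, -, h⟩ := exists_heatKernel_integral_bound hd hα hα2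
  exact (h t ht).1

theorem integrable_gradHeat (hd : 0 < d) (hα : 0 < α) (hα2 : α < 2) {t : ℝ} (ht : 0 < t) :
    Integrable (gradHeat (d := d) α t) := by
  obtain ⟨C, -, h⟩ := exists_heatKernel_integral_bound hd hα hα2
  exact (h t ht).2.1

theorem fourier_even_eq_cosT {g : Sp d → ℝ} (hg : Integrable g) (he : ∀ ξ, g (-ξ) = g ξ)
    (x : Sp d) : 𝓕 (fun ξ => (g ξ : ℂ)) x = (cosT g x : ℂ) := by
  have hint : Integrable fun ξ : Sp d => Real.fourierChar (-⟪ξ, x⟫_ℝ) • (g ξ : ℂ) :=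
    (Real.fourierIntegral_convergent_iff x).2 hg.ofReal
  have hval : ∀ ξ : Sp d, Real.fourierChar (-⟪ξ, x⟫_ℝ) • (g ξ : ℂ) =
      ((g ξ * Real.cos (2 * Real.pi * ⟪x, ξ⟫_ℝ) : ℝ) : ℂ) -
      ((g ξ * Real.sin (2 * Real.pi * ⟪x, ξ⟫_ℝ) : ℝ) : ℂ) * Complex.I := by
    intro ξ
    rw [Circle.smul_def, Real.fourierChar_apply, Complex.exp_mul_I, smul_eq_mul, real_inner_comm,
      mul_neg, ← Complex.ofReal_cos, ← Complex.ofReal_sin, Real.cos_neg, Real.sin_neg]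
    push_cast
    ring
  have hs : ∫ ξ : Sp d, g ξ * Real.sin (2 * Real.pi * ⟪x, ξ⟫_ℝ) = 0 := by
    have := integral_neg_eq_self (fun ξ : Sp d => g ξ * Real.sin (2 * Real.pi * ⟪x, ξ⟫_ℝ)) volume
    simp only [he, inner_neg_right, mul_neg, Real.sin_neg, integral_neg] at this
    linarith
  have hsi : Integrable fun ξ : Sp d => g ξ * Real.sin (2 * Real.pi * ⟪x, ξ⟫_ℝ) := by
    refine hg.mul_bdd (c := 1) (by fun_prop) (Eventually.of_forall fun ξ => ?_)
    exact Real.abs_sin_le_one _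
  rw [Real.fourier_eq]
  simp_rw [hval]
  rw [integral_sub (integrable_cosT_integrand hg x).ofReal (hsi.ofReal.mul_const _),
    integral_mul_const, integral_complex_ofReal, integral_complex_ofReal, hs]
  simp [cosT]

theorem heatMult_neg (t : ℝ) (ξ : Sp d) : heatMult α t (-ξ) = heatMult α t ξ := by
  simp [heatMult]

theorem fourier_heatMult (hd : 0 < d) (hα : 0 < α) {t : ℝ} (ht : 0 < t) (x : Sp d) :
    𝓕 (fun ξ => (heatMult α t ξ : ℂ)) x = (heatKernel α t x : ℂ) :=
  fourier_even_eq_cosT (integrable_heatMult hd hα ht) (heatMult_neg t) x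

/-- Fourier inversion for the continuous integrable multiplier; its evenness removes the reflection
between the transform and its inverse. -/
theorem fourier_heatKernel (hd : 0 < d) (hα : 0 < α) (hα2 : α < 2) {t : ℝ} (ht : 0 < t)
    (ξ : Sp d) : 𝓕 (fun x => (heatKernel α t x : ℂ)) ξ = (heatMult α t ξ : ℂ) := by
  have e : 𝓕 (fun ξ : Sp d => (heatMult α t ξ : ℂ)) = fun x => (heatKernel α t x : ℂ) :=
    funext (fourier_heatMult hd hα ht)
  have h := Continuous.fourierInv_fourier_eq (f := fun ξ : Sp d => (heatMult α t ξ : ℂ))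
    (Complex.continuous_ofReal.comp (continuous_heatMult hα t)) (integrable_heatMult hd hα ht).ofReal
    (by rw [e]; exact (integrable_heatKernel hd hα hα2 ht).ofReal)
  rw [e] at h
  have := congrFun h (-ξ)
  rw [Real.fourierInv_eq_fourier_neg, neg_neg, heatMult_neg] at this
  exact this

theorem integral_heatKernel (hd : 0 < d) (hα : 0 < α) (hα2 : α < 2) {t : ℝ} (ht : 0 < t) :
    ∫ x : Sp d, heatKernel α t x = 1 := by
  have h := fourier_heatKernel hd hα hα2 ht (0 : Sp d)
  rw [Real.fourier_eq] at h
  simp only [inner_zero_right, neg_zero, AddChar.map_zero_eq_one, one_smul] at h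
  rw [integral_complex_ofReal] at h
  have h' : ∫ x : Sp d, heatKernel α t x = heatMult α t (0 : Sp d) := by exact_mod_cast h
  rw [h', heatMult]
  simp [Real.zero_rpow hα.ne']

/-- The Fourier transforms multiply to the multiplier at time s + t. Continuity of the convolution
allows inversion at every point rather than almost everywhere. -/
theorem integral_heatKernel_mul_heatKernel (hd : 0 < d) (hα : 0 < α) (hα2 : α < 2) {s t : ℝ}
    (hs : 0 < s) (ht : 0 < t) (x : Sp d) :
    ∫ y : Sp d, heatKernel α s y * heatKernel α t (x - y) = heatKernel α (s + t) x := by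
  set f : Sp d → ℂ := fun x => (heatKernel α s x : ℂ)
  set g : Sp d → ℂ := fun x => (heatKernel α t x : ℂ)
  have hf : Integrable f := (integrable_heatKernel hd hα hα2 hs).ofReal
  have hg : Integrable g := (integrable_heatKernel hd hα hα2 ht).ofReal
  have hgc : Continuous g := Complex.continuous_ofReal.comp (continuous_heatKernel hd hα ht)
  obtain ⟨C, hC, hb⟩ := exists_heatKernel_sup_bound hd hα
  have hbdd : BddAbove (Set.range fun x => ‖g x‖) := by
    refine ⟨C * t ^ (-d / α), ?_⟩
    rintro _ ⟨y, rfl⟩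
    simpa [g] using (hb t ht y).1
  set c := convolution f g (ContinuousLinearMap.mul ℂ ℂ) volume
  have hc1 : Continuous c := hbdd.continuous_convolution_right_of_integrable _ hf hgc
  have hc2 : Integrable c := hf.integrable_convolution _ hg
  have hc3 : 𝓕 c = fun ξ => (heatMult α (s + t) ξ : ℂ) := by
    ext ξ
    rw [Real.fourier_mul_convolution_eq hf hg, fourier_heatKernel hd hα hα2 hs,
      fourier_heatKernel hd hα hα2 ht, ← Complex.ofReal_mul]
    congr 1
    rw [heatMult, heatMult, heatMult, ← Real.exp_add]
    ring_nf
  have h := Continuous.fourierInv_fourier_eq hc1 hc2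
    (by rw [hc3]; exact (integrable_heatMult hd hα (by positivity)).ofReal)
  have h3 := congrFun h x
  have h4 : 𝓕⁻ (fun ξ : Sp d => (heatMult α (s + t) ξ : ℂ)) x =
      𝓕⁻ (fun ξ : Sp d => (heatMult α (s + t) ξ : ℂ)) (-x) := by
    rw [Real.fourierInv_eq_fourier_neg, Real.fourierInv_eq_fourier_neg,
      fourier_heatMult hd hα (by positivity), fourier_heatMult hd hα (by positivity)]
    simp [heatKernel, inner_neg_left, Real.cos_neg]
  rw [hc3, h4, Real.fourierInv_eq_fourier_neg, neg_neg, fourier_heatMult hd hα (by positivity)] at h3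
  have h5 : c x = ((∫ y : Sp d, heatKernel α s y * heatKernel α t (x - y) : ℝ) : ℂ) := by
    rw [← integral_complex_ofReal]
    simp [c, convolution, f, g]
  rw [h5] at h3
  exact_mod_cast h3.symm
end

/-! ### The potential kernels: norms, comparison with Riesz kernels, composition -/

section
variable {d : ℕ} {α lam : ℝ}

/-- The time factor `t^{s-1} e^{-λt} / Γ(s)`, `t > 0`, of the potential kernel. -/
def timeKernel (lam s t : ℝ) : ℝ :=
  if 0 < t then t ^ (s - 1) / Real.Gamma s * Real.exp (-lam * t) else 0

/-- The spatial gradient of the potential kernel. -/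
def gradPot (α lam s : ℝ) (z : ST d) : Sp d := timeKernel lam s z.1 • gradHeat α z.1 z.2

theorem potKernel_eq (s : ℝ) (z : ST d) :
    potKernel α lam s z = timeKernel lam s z.1 * heatKernel α z.1 z.2 := by
  unfold potKernel timeKernel
  split_ifs <;> simp

theorem timeKernel_nonneg {s : ℝ} (hs : 0 < s) (t : ℝ) : 0 ≤ timeKernel lam s t := by
  unfold timeKernel
  have := Real.Gamma_pos_of_pos hs
  split_ifs <;> positivity

theorem timeKernel_of_nonpos {s t : ℝ} (ht : t ≤ 0) : timeKernel lam s t = 0 := by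
  simp [timeKernel, ht.not_gt]

theorem measurable_timeKernel (lam s : ℝ) : Measurable (timeKernel lam s) := by
  unfold timeKernel
  exact Measurable.ite measurableSet_Ioi (by fun_prop) (by fun_prop)

theorem measurable_potKernel (α lam s : ℝ) : Measurable (potKernel (d := d) α lam s) := by
  have : potKernel (d := d) α lam s = fun z => timeKernel lam s z.1 * heatKernel α z.1 z.2 :=
    funext fun z => potKernel_eq s z
  rw [this]
  exact ((measurable_timeKernel lam s).comp measurable_fst).mul measurable_heatKernel

theorem measurable_gradPot (α lam s : ℝ) : Measurable (gradPot (d := d) α lam s) :=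
  ((measurable_timeKernel lam s).comp measurable_fst).smul measurable_gradHeat

theorem potKernel_nonneg (hd : 0 < d) (hα : 0 < α) (hα2 : α < 2) {s : ℝ} (hs : 0 < s) (z : ST d) :
    0 ≤ potKernel α lam s z := by
  rw [potKernel_eq]
  rcases lt_or_ge 0 z.1 with h | h
  · exact mul_nonneg (timeKernel_nonneg hs _) (heatKernel_nonneg hd hα hα2 h _)
  · simp [timeKernel_of_nonpos h]

theorem lintegral_rpow_mul_exp {s r : ℝ} (hs : 0 < s) (hr : 0 < r) :
    ∫⁻ t in Set.Ioi (0 : ℝ), ENNReal.ofReal (t ^ (s - 1) * Real.exp (-(r * t))) =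
      ENNReal.ofReal (r ^ (-s) * Real.Gamma s) := by
  have h := Real.integral_rpow_mul_exp_neg_mul_Ioi hs hr
  rw [one_div, Real.inv_rpow hr.le, ← Real.rpow_neg hr.le] at h
  have hpos : 0 < r ^ (-s) * Real.Gamma s :=
    mul_pos (Real.rpow_pos_of_pos hr _) (Real.Gamma_pos_of_pos hs)
  have hint : IntegrableOn (fun t : ℝ => t ^ (s - 1) * Real.exp (-(r * t))) (Set.Ioi 0) := by
    by_contra hcon
    rw [integral_undef hcon] at h
    exact hpos.ne h
  rw [← h, ofReal_integral_eq_lintegral_ofReal hint]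
  filter_upwards [self_mem_ae_restrict measurableSet_Ioi] with t ht
  have : 0 < t := ht
  positivity

theorem lintegral_timeKernel_eq (s : ℝ) (g : ℝ → ℝ≥0∞) :
    ∫⁻ t, ENNReal.ofReal (timeKernel lam s t) * g t = ∫⁻ t in Set.Ioi (0 : ℝ),
      ENNReal.ofReal (t ^ (s - 1) / Real.Gamma s * Real.exp (-lam * t)) * g t := by
  rw [← lintegral_indicator measurableSet_Ioi]
  congr 1; ext t
  by_cases ht : 0 < t <;> simp [timeKernel, ht]

theorem lintegral_timeKernel_mul_rpow {s a : ℝ} (hs : 0 < s) (ha : a < s) (hl : 0 < lam) :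
    ∫⁻ t, ENNReal.ofReal (timeKernel lam s t) * ENNReal.ofReal (t ^ (-a)) =
      ENNReal.ofReal (Real.Gamma (s - a) / Real.Gamma s * lam ^ (-(s - a))) := by
  have hG := Real.Gamma_pos_of_pos hs
  rw [lintegral_timeKernel_eq]
  have : ∀ t ∈ Set.Ioi (0 : ℝ), ENNReal.ofReal (t ^ (s - 1) / Real.Gamma s * Real.exp (-lam * t)) *
      ENNReal.ofReal (t ^ (-a)) = ENNReal.ofReal (Real.Gamma s)⁻¹ *
        ENNReal.ofReal (t ^ (s - a - 1) * Real.exp (-(lam * t))) := by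
    intro t (ht : 0 < t)
    rw [← ENNReal.ofReal_mul (by positivity), ← ENNReal.ofReal_mul (by positivity),
      show s - a - 1 = (s - 1) + -a by ring, Real.rpow_add ht]
    congr 1
    ring_nf
  rw [setLIntegral_congr_fun measurableSet_Ioi this, lintegral_const_mul _ (by fun_prop),
    lintegral_rpow_mul_exp (by linarith) hl, ← ENNReal.ofReal_mul (by positivity)]
  congr 1
  ring

theorem enorm_potKernel (hd : 0 < d) (hα : 0 < α) (hα2 : α < 2) {s : ℝ} (hs : 0 < s) (z : ST d) :
    ‖potKernel α lam s z‖ₑ =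
      ENNReal.ofReal (timeKernel lam s z.1) * ENNReal.ofReal (heatKernel α z.1 z.2) := by
  rw [Real.enorm_of_nonneg (potKernel_nonneg hd hα hα2 hs z), potKernel_eq,
    ENNReal.ofReal_mul (timeKernel_nonneg hs _)]

theorem enorm_gradPot {s : ℝ} (hs : 0 < s) (z : ST d) :
    ‖gradPot α lam s z‖ₑ =
      ENNReal.ofReal (timeKernel lam s z.1) * ‖gradHeat α z.1 z.2‖ₑ := by
  rw [gradPot, enorm_smul, Real.enorm_of_nonneg (timeKernel_nonneg hs _)]

theorem lintegral_timeKernel_mul (s : ℝ) {g : ST d → ℝ≥0∞} (hg : Measurable g) :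
    ∫⁻ z : ST d, ENNReal.ofReal (timeKernel lam s z.1) * g z =
      ∫⁻ t, ENNReal.ofReal (timeKernel lam s t) * ∫⁻ x, g (t, x) := by
  have hm := measurable_timeKernel lam s
  rw [Measure.volume_eq_prod, lintegral_prod _ (by fun_prop)]
  congr 1; ext t
  have h : Measurable fun x : Sp d => g (t, x) := by fun_prop
  dsimp only
  rw [lintegral_const_mul _ h]

theorem lintegral_timeKernel_mono {s : ℝ} {g h : ℝ → ℝ≥0∞} (H : ∀ t, 0 < t → g t ≤ h t) :
    ∫⁻ t, ENNReal.ofReal (timeKernel lam s t) * g t ≤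
      ∫⁻ t, ENNReal.ofReal (timeKernel lam s t) * h t := by
  refine lintegral_mono fun t => ?_
  dsimp only
  rcases lt_or_ge 0 t with ht | ht
  · gcongr; exact H t ht
  · simp [timeKernel_of_nonpos ht]

theorem lintegral_potKernel (hd : 0 < d) (hα : 0 < α) (hα2 : α < 2) {s : ℝ} (hs : 0 < s)
    (hl : 0 < lam) :
    ∫⁻ z : ST d, ‖potKernel α lam s z‖ₑ = ENNReal.ofReal (lam ^ (-s)) := by
  have hH : ∀ t, 0 < t → ∫⁻ x : Sp d, ENNReal.ofReal (heatKernel α t x) = 1 := by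
    intro t ht
    rw [← ofReal_integral_eq_lintegral_ofReal (integrable_heatKernel hd hα hα2 ht)
      (Eventually.of_forall (heatKernel_nonneg hd hα hα2 ht)), integral_heatKernel hd hα hα2 ht,
      ENNReal.ofReal_one]
  simp_rw [enorm_potKernel hd hα hα2 hs]
  rw [lintegral_timeKernel_mul s measurable_heatKernel.ennreal_ofReal]
  have h0 := lintegral_timeKernel_mul_rpow (a := 0) hs hs hl
  simp only [neg_zero, Real.rpow_zero, sub_zero, div_self (Real.Gamma_pos_of_pos hs).ne',
    one_mul, ENNReal.ofReal_one] at h0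
  rw [← h0]
  exact le_antisymm (lintegral_timeKernel_mono fun t ht => (hH t ht).le)
    (lintegral_timeKernel_mono fun t ht => (hH t ht).ge)

/-- The spatial L^1 norm of the gradient is of order t^{-1/α}, so a Gamma integral with exponent s -
1/α > 0 remains. Its decay in λ is what later absorbs the bounded part of the drift. -/
theorem exists_lintegral_gradPot_le (hd : 0 < d) (hα : 0 < α) (hα2 : α < 2) {s : ℝ}
    (hs : 1 / α < s) :
    ∃ C : ℝ, 0 < C ∧ ∀ lam : ℝ, 0 < lam →
      ∫⁻ z : ST d, ‖gradPot α lam s z‖ₑ ≤ ENNReal.ofReal (C * lam ^ (-(s - 1 / α))) := by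
  have hα' : 0 < 1 / α := by positivity
  have hs0 : 0 < s := hα'.trans hs
  obtain ⟨C, hC, h⟩ := exists_heatKernel_integral_bound hd hα hα2
  refine ⟨C * (Real.Gamma (s - 1 / α) / Real.Gamma s), ?_, fun lam hl => ?_⟩
  · have := Real.Gamma_pos_of_pos hs0
    have := Real.Gamma_pos_of_pos (sub_pos.2 hs)
    positivity
  simp_rw [enorm_gradPot hs0]
  rw [lintegral_timeKernel_mul s measurable_gradHeat.enorm, mul_assoc, ENNReal.ofReal_mul hC.le,
    ← lintegral_timeKernel_mul_rpow hs0 hs hl, ← lintegral_const_mul]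
  · calc _ ≤ ∫⁻ t, ENNReal.ofReal (timeKernel lam s t) *
          (ENNReal.ofReal C * ENNReal.ofReal (t ^ (-(1 / α)))) := by
          refine lintegral_timeKernel_mono fun t ht => ?_
          rw [← ofReal_integral_norm_eq_lintegral_enorm (h t ht).2.1, ← ENNReal.ofReal_mul hC.le]
          refine ENNReal.ofReal_le_ofReal ?_
          have := (h t ht).2.2
          rwa [neg_div] at this
      _ = _ := by congr 1; ext t; ring
  · have hm := measurable_timeKernel lam s
    fun_prop

/-- Every radius larger than the parabolic distance contributes to the kernel, and the integral over
these radii is explicit. -/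
theorem rieszKernel_ge (hα : 0 < α) {β : ℝ} (hβ : β < d + α) {z w : ST d}
    (hN : 0 < pnorm α (z - w)) :
    ENNReal.ofReal (pnorm α (z - w) ^ (β - (d + α)) / (d + α - β)) ≤ rieszKernel α β z w := by
  rw [show β - (d + α) = -(d + α - β) by ring, ← lintegral_Ioi_rpow (by linarith) hN]
  unfold rieszKernel
  have : Set.Ioi (pnorm α (z - w)) ⊆ Set.Ioi 0 := Set.Ioi_subset_Ioi hN.le
  refine le_trans ?_ (lintegral_mono_set this)
  refine setLIntegral_mono' measurableSet_Ioi fun ρ (hρ : _ < ρ) => ?_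
  have hρ0 : 0 < ρ := hN.trans hρ
  have hw : w ∈ pball α ρ z := by
    simp only [pnorm, max_lt_iff, Prod.fst_sub, Prod.snd_sub] at hρ
    refine ⟨?_, by rw [norm_sub_rev]; exact hρ.2.le⟩
    rw [abs_sub_comm]
    calc |z.1 - w.1| = (|z.1 - w.1| ^ (1 / α)) ^ α := by
          rw [← Real.rpow_mul (abs_nonneg _), one_div_mul_cancel hα.ne', Real.rpow_one]
      _ ≤ ρ ^ α := Real.rpow_le_rpow (by positivity) hρ.1.le hα.le
  simp only [Set.indicator_of_mem hw, Pi.one_apply, mul_one]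
  apply le_of_eq; congr 2; ring

theorem pnorm_pos {t : ℝ} (ht : 0 < t) (x : Sp d) : 0 < pnorm α (t, x) :=
  lt_max_of_lt_left (by rw [abs_of_pos ht]; exact Real.rpow_pos_of_pos ht _)

/-- The time factor contributes t^s, bounded by the parabolic size to the power αs; the exponential
is at most 1 and is dropped, so the bound does not depend on λ. -/
theorem timeKernel_mul_le (hα : 0 < α) (hl : 0 ≤ lam) {s C e : ℝ} (hs : 0 < s) (hC : 0 ≤ C) {t : ℝ}
    (ht : 0 < t) (x : Sp d) :
    timeKernel lam s t * (C * t * pnorm α (t, x) ^ e) ≤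
      C / Real.Gamma s * pnorm α (t, x) ^ (α * s + e) := by
  have hG := Real.Gamma_pos_of_pos hs
  have hN := pnorm_pos (α := α) ht x
  have h1 : t ^ s ≤ pnorm α (t, x) ^ (α * s) := by
    have : t ^ (1 / α) ≤ pnorm α (t, x) := by
      unfold pnorm; simp only [abs_of_pos ht]; exact le_max_left _ _
    calc t ^ s = (t ^ (1 / α)) ^ (α * s) := by
          rw [← Real.rpow_mul ht.le]; congr 1; field_simp
      _ ≤ _ := Real.rpow_le_rpow (by positivity) this (by positivity)
  have h2 : Real.exp (-lam * t) ≤ 1 := Real.exp_le_one_iff.2 (by nlinarith)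
  have h3 : t ^ s = t ^ (s - 1) * t := by
    rw [← Real.rpow_add_one' ht.le (by simpa using hs.ne')]; ring_nf
  rw [timeKernel, if_pos ht, Real.rpow_add hN]
  calc _ = C / Real.Gamma s * (t ^ s * pnorm α (t, x) ^ e) * Real.exp (-lam * t) := by
        rw [h3]; ring
    _ ≤ C / Real.Gamma s * (t ^ s * pnorm α (t, x) ^ e) * 1 := by gcongr
    _ ≤ _ := by rw [mul_one]; gcongr

/-- The kernel of order s is at most a multiple of the parabolic distance to the power αs - (d + α),
and its gradient has one power less. These are the homogeneities of the Riesz kernels of orders αs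
and αs - 1, and the constant is uniform in λ ≥ 0. -/
theorem exists_potKernel_le_rieszKernel (hd : 0 < d) (hα : 0 < α) (hα2 : α < 2) {s : ℝ}
    (hs : 0 < s) (hs' : α * s < d + α) :
    ∃ C : ℝ≥0∞, C ≠ ⊤ ∧ ∀ lam : ℝ, 0 ≤ lam → ∀ z w : ST d,
      ‖potKernel α lam s (z - w)‖ₑ ≤ C * rieszKernel α (α * s) z w ∧
      ‖gradPot α lam s (z - w)‖ₑ ≤ C * rieszKernel α (α * s - 1) z w := by
  obtain ⟨C, hC, h⟩ := exists_heatKernel_le_pnorm hd hα hα2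
  have hG := Real.Gamma_pos_of_pos hs
  have hp : 0 < d + α - α * s := by linarith
  have hp' : 0 < d + 1 + α - α * s := by linarith
  -- The last factor compensates the normalisations of the two Riesz kernels: it equals d + α - (αs
  -- - 1) and exceeds d + α - αs.
  refine ⟨ENNReal.ofReal (C / Real.Gamma s * (d + 1 + α - α * s)), ENNReal.ofReal_ne_top,
    fun lam hl z w => ?_⟩
  rcases lt_or_ge 0 (z.1 - w.1) with ht | ht
  · have hN := pnorm_pos (α := α) ht (z.2 - w.2)
    have h1 := (h _ ht (z.2 - w.2)).1
    have h2 := (h _ ht (z.2 - w.2)).2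
    have r1 := rieszKernel_ge hα (z := z) (w := w) (β := α * s) (by linarith) hN
    have r2 := rieszKernel_ge hα (z := z) (w := w) (β := α * s - 1) (by linarith) hN
    constructor
    · refine le_trans ?_ (mul_le_mul_right r1 _)
      rw [← ENNReal.ofReal_mul (by positivity),
        Real.enorm_of_nonneg (potKernel_nonneg hd hα hα2 hs _), potKernel_eq]
      refine ENNReal.ofReal_le_ofReal ?_
      refine (mul_le_mul_of_nonneg_left h1 (timeKernel_nonneg hs _)).trans ?_
      refine (timeKernel_mul_le hα hl hs hC.le ht _).trans ?_
      change _ ≤ _ * (pnorm α (z.1 - w.1, z.2 - w.2) ^ (α * s - (d + α)) / (d + α - α * s))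
      rw [mul_assoc]
      gcongr
      rw [mul_div_assoc', le_div_iff₀ hp, ← sub_eq_add_neg, mul_comm]
      gcongr
      linarith
    · refine le_trans ?_ (mul_le_mul_right r2 _)
      rw [← ENNReal.ofReal_mul (by positivity), gradPot, enorm_smul,
        Real.enorm_of_nonneg (timeKernel_nonneg hs _), ← ofReal_norm,
        ← ENNReal.ofReal_mul (timeKernel_nonneg hs _)]
      refine ENNReal.ofReal_le_ofReal ?_
      refine (mul_le_mul_of_nonneg_left h2 (timeKernel_nonneg hs _)).trans ?_
      refine (timeKernel_mul_le hα hl hs hC.le ht _).trans ?_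
      change _ ≤ _ * (pnorm α (z.1 - w.1, z.2 - w.2) ^ (α * s - 1 - (d + α)) / (d + α - (α * s - 1)))
      rw [mul_assoc]
      gcongr
      rw [mul_div_assoc', le_div_iff₀ (by linarith),
        show α * s + -(↑d + 1 + α) = α * s - 1 - (d + α) by ring]
      apply le_of_eq
      ring
  · simp [potKernel_eq, gradPot, timeKernel_of_nonpos ht]

/-- The exponentials combine to e^{-λT}, and after t = T τ the remaining integrand is a multiple of
the Beta density, whose total mass is 1. -/
theorem lintegral_timeKernel_mul_timeKernel {s r : ℝ} (hs : 0 < s) (hr : 0 < r) (T : ℝ) :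
    ∫⁻ t, ENNReal.ofReal (timeKernel lam s (T - t)) * ENNReal.ofReal (timeKernel lam r t) =
      ENNReal.ofReal (timeKernel lam (s + r) T) := by
  have hGs := Real.Gamma_pos_of_pos hs
  have hGr := Real.Gamma_pos_of_pos hr
  have hG := Real.Gamma_pos_of_pos (add_pos hs hr)
  rcases lt_or_ge 0 T with hT | hT
  · have e : ∀ t, ENNReal.ofReal (timeKernel lam s (T - t)) * ENNReal.ofReal (timeKernel lam r t) =
        ENNReal.ofReal (T ^ (s + r - 2) / Real.Gamma (s + r) * Real.exp (-lam * T)) *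
          ProbabilityTheory.betaPDF r s (T⁻¹ * t) := by
      intro t
      rcases le_or_gt t 0 with h0 | h0
      · rw [timeKernel_of_nonpos h0, ProbabilityTheory.betaPDF_eq_zero_of_nonpos]
        · simp
        · exact mul_nonpos_of_nonneg_of_nonpos (by positivity) h0
      rcases le_or_gt T t with h1 | h1
      · rw [timeKernel_of_nonpos (by linarith), ProbabilityTheory.betaPDF_eq_zero_of_one_le]
        · simp
        · rwa [inv_mul_eq_div, one_le_div hT]
      have h1' : 0 < T - t := by linarith
      rw [ProbabilityTheory.betaPDF_of_pos_lt_one (by positivity)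
        (by rwa [inv_mul_eq_div, div_lt_one hT]), ← ENNReal.ofReal_mul (timeKernel_nonneg hs _),
        ← ENNReal.ofReal_mul (by positivity), timeKernel, timeKernel, if_pos h0, if_pos h1']
      congr 1
      rw [ProbabilityTheory.beta, show 1 - T⁻¹ * t = T⁻¹ * (T - t) by field_simp,
        Real.mul_rpow (by positivity) h0.le, Real.mul_rpow (by positivity) h1'.le,
        Real.inv_rpow hT.le, Real.inv_rpow hT.le,
        show s + r - 2 = (s - 1) + (r - 1) by ring, Real.rpow_add hT,
        show -lam * T = -lam * (T - t) + -lam * t by ring, Real.exp_add, add_comm r s]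
      have := Real.rpow_pos_of_pos hT (s - 1)
      have := Real.rpow_pos_of_pos hT (r - 1)
      field_simp
    simp_rw [e]
    have hm : Measurable (ProbabilityTheory.betaPDF r s) :=
      (ProbabilityTheory.measurable_betaPDFReal r s).ennreal_ofReal
    rw [lintegral_const_mul _ (by fun_prop)]
    have hsc : ∫⁻ t, ProbabilityTheory.betaPDF r s (T⁻¹ * t) = ENNReal.ofReal T := by
      rw [← lintegral_map (g := fun t => T⁻¹ * t) hm (by fun_prop),
        Real.map_volume_mul_left (by positivity), lintegral_smul_measure,
        ProbabilityTheory.lintegral_betaPDF_eq_one hr hs, inv_inv, abs_of_pos hT, smul_eq_mul,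
        mul_one]
    rw [hsc, ← ENNReal.ofReal_mul (by positivity), timeKernel, if_pos hT,
      show s + r - 1 = (s + r - 2) + 1 by ring, Real.rpow_add_one hT.ne']
    congr 1
    ring
  · rw [timeKernel_of_nonpos hT, ENNReal.ofReal_zero, lintegral_eq_zero_iff]
    · refine Eventually.of_forall fun t => ?_
      rcases le_or_gt t 0 with h0 | h0
      · simp [timeKernel_of_nonpos h0]
      · simp [timeKernel_of_nonpos (show T - t ≤ 0 by linarith)]
    · have := measurable_timeKernel lam s
      have := measurable_timeKernel lam r
      fun_prop

/-- In space the semigroup law applies at each intermediate time, and in time the Beta integral;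
together they give A^{-s}A^{-r} = A^{-(s+r)} for the kernels. -/
theorem lintegral_potKernel_mul_potKernel (hd : 0 < d) (hα : 0 < α) (hα2 : α < 2) {s r : ℝ}
    (hs : 0 < s) (hr : 0 < r) (z : ST d) :
    ∫⁻ w, ‖potKernel α lam s (z - w)‖ₑ * ‖potKernel α lam r w‖ₑ =
      ‖potKernel α lam (s + r) z‖ₑ := by
  have hH : ∀ t, 0 < t → 0 < z.1 - t → ∫⁻ y : Sp d, ENNReal.ofReal (heatKernel α (z.1 - t) (z.2 - y)) *
      ENNReal.ofReal (heatKernel α t y) = ENNReal.ofReal (heatKernel α z.1 z.2) := by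
    intro t ht ht'
    have hsg := integral_heatKernel_mul_heatKernel hd hα hα2 ht ht' z.2
    rw [add_sub_cancel] at hsg
    rw [← hsg, ofReal_integral_eq_lintegral_ofReal]
    · congr 1; ext y
      rw [← ENNReal.ofReal_mul (heatKernel_nonneg hd hα hα2 ht' _), mul_comm]
    · obtain ⟨C, hC, hb⟩ := exists_heatKernel_sup_bound hd hα
      refine (integrable_heatKernel hd hα hα2 ht).mul_bdd (c := C * (z.1 - t) ^ (-d / α)) ?_
        (Eventually.of_forall fun y => (hb _ ht' _).1)
      exact ((continuous_heatKernel hd hα ht').comp (by fun_prop)).aestronglyMeasurable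
    · exact Eventually.of_forall fun y =>
        mul_nonneg (heatKernel_nonneg hd hα hα2 ht _) (heatKernel_nonneg hd hα hα2 ht' _)
  have hm1 := measurable_timeKernel lam s
  have hm2 := measurable_timeKernel lam r
  have hm3 := measurable_heatKernel (d := d) (α := α)
  have hm3' : Measurable fun w : ST d => heatKernel α (z - w).1 (z - w).2 :=
    hm3.comp (by fun_prop : Measurable fun w : ST d => z - w)
  simp_rw [enorm_potKernel hd hα hα2 hs, enorm_potKernel hd hα hα2 hr,
    enorm_potKernel hd hα hα2 (add_pos hs hr)]
  rw [← lintegral_timeKernel_mul_timeKernel hs hr, Measure.volume_eq_prod, lintegral_prod _ (by fun_prop)]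
  rw [← lintegral_mul_const _ (by fun_prop)]
  congr 1; ext t
  simp only [Prod.fst_sub, Prod.snd_sub]
  rcases le_or_gt t 0 with h0 | h0
  · simp [timeKernel_of_nonpos h0]
  rcases le_or_gt z.1 t with h1 | h1
  · simp [timeKernel_of_nonpos (sub_nonpos.2 h1)]
  rw [← hH t h0 (by linarith), ← lintegral_const_mul]
  · congr 1; ext y; ring
  · exact (hm3'.comp (by fun_prop : Measurable fun y : Sp d => (t, y))).ennreal_ofReal.mul
      (hm3.comp (by fun_prop : Measurable fun y : Sp d => (t, y))).ennreal_ofReal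

/-- In space the e-th power is estimated by the sup norm to the power e - 1 times the unit mass. The
exponent condition is exactly integrability at t = 0 of the resulting power of t. -/
theorem lintegral_potKernel_rpow_ne_top (hd : 0 < d) (hα : 0 < α) (hα2 : α < 2) {s e : ℝ}
    (hs : 0 < s) (hl : 0 < lam) (he : 1 ≤ e) (h : -1 < (s - 1) * e - d / α * (e - 1)) :
    ∫⁻ z : ST d, ‖potKernel α lam s z‖ₑ ^ e ≠ ⊤ := by
  obtain ⟨C, hC, hb⟩ := exists_heatKernel_sup_bound hd hα
  have hG := Real.Gamma_pos_of_pos hs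
  have hm1 := measurable_timeKernel lam s
  have hm3 := measurable_heatKernel (d := d) (α := α)
  have hm4 : ∀ t, Measurable fun x : Sp d => heatKernel α t x := fun t =>
    hm3.comp (by fun_prop : Measurable fun y : Sp d => (t, y))
  have hH : ∀ t, 0 < t → ∫⁻ x : Sp d, ENNReal.ofReal (heatKernel α t x) ^ e ≤
      ENNReal.ofReal ((C * t ^ (-d / α)) ^ (e - 1)) := by
    intro t ht
    calc _ ≤ ∫⁻ x : Sp d, ENNReal.ofReal ((C * t ^ (-d / α)) ^ (e - 1)) *
          ENNReal.ofReal (heatKernel α t x) := by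
          refine lintegral_mono fun x => ?_
          have h0 := heatKernel_nonneg hd hα hα2 ht x
          rw [ENNReal.ofReal_rpow_of_nonneg h0 (by linarith),
            ← ENNReal.ofReal_mul (by positivity)]
          refine ENNReal.ofReal_le_ofReal ?_
          calc heatKernel α t x ^ e = heatKernel α t x ^ (e - 1) * heatKernel α t x := by
                rw [← Real.rpow_add_one' h0 (by linarith)]; ring_nf
            _ ≤ _ := by
                gcongr
                exact (le_abs_self _).trans (hb t ht x).1
      _ = _ := by
          rw [lintegral_const_mul _ (hm4 t).ennreal_ofReal,
            ← ofReal_integral_eq_lintegral_ofReal (integrable_heatKernel hd hα hα2 ht)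
              (Eventually.of_forall (heatKernel_nonneg hd hα hα2 ht)),
            integral_heatKernel hd hα hα2 ht, ENNReal.ofReal_one, mul_one]
  simp_rw [enorm_potKernel hd hα hα2 hs, ENNReal.mul_rpow_of_nonneg _ _ (by linarith : 0 ≤ e)]
  rw [Measure.volume_eq_prod, lintegral_prod _ (by fun_prop)]
  have hfin := lintegral_rpow_mul_exp (s := (s - 1) * e - d / α * (e - 1) + 1) (r := lam * e)
    (by linarith) (by positivity)
  refine ne_top_of_le_ne_top (b := ENNReal.ofReal ((Real.Gamma s)⁻¹ ^ e * C ^ (e - 1)) *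
    ENNReal.ofReal ((lam * e) ^ (-((s - 1) * e - d / α * (e - 1) + 1)) *
      Real.Gamma ((s - 1) * e - d / α * (e - 1) + 1)))
    (ENNReal.mul_ne_top ENNReal.ofReal_ne_top ENNReal.ofReal_ne_top) ?_
  rw [← hfin, ← lintegral_const_mul _ (by fun_prop), ← lintegral_indicator measurableSet_Ioi]
  refine lintegral_mono fun t => ?_
  rcases le_or_gt t 0 with h0 | h0
  · simp [timeKernel_of_nonpos h0, ENNReal.zero_rpow_of_pos (by linarith : 0 < e)]
  rw [Set.indicator_of_mem (show t ∈ Set.Ioi 0 from h0)]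
  dsimp only
  rw [lintegral_const_mul _ ((hm4 t).ennreal_ofReal.pow_const _)]
  refine (mul_le_mul_right (hH t h0) _).trans (le_of_eq ?_)
  rw [ENNReal.ofReal_rpow_of_nonneg (timeKernel_nonneg hs _) (by linarith),
    ← ENNReal.ofReal_mul (by have := timeKernel_nonneg (lam := lam) hs t; positivity),
    ← ENNReal.ofReal_mul (by positivity), timeKernel, if_pos h0]
  congr 1
  rw [Real.mul_rpow (by positivity) (by positivity), Real.mul_rpow (by positivity) (by positivity),
    div_eq_mul_inv, Real.mul_rpow (by positivity) (by positivity), ← Real.rpow_mul h0.le,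
    ← Real.rpow_mul h0.le, ← Real.exp_mul,
    show (s - 1) * e - d / α * (e - 1) + 1 - 1 = (s - 1) * e + -d / α * (e - 1) by ring,
    Real.rpow_add h0]
  ring_nf
end

/-! ### Integral operators on L^p and their transposes -/

section
variable {d : ℕ}

instance instIsAddHaarMeasureST : (volume : Measure (ST d)).IsAddHaarMeasure :=
  inferInstanceAs (Measure.prod (volume : Measure ℝ) (volume : Measure (Sp d))).IsAddHaarMeasure

/-- The integral operator with kernel `k ≥ 0` is bounded on `L^p` with constant `B`. -/
def KerBound (p : ℝ) (k : ST d → ST d → ℝ≥0∞) (B : ℝ≥0∞) : Prop :=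
  ∀ f : ST d → ℝ≥0∞, Measurable f →
    ∫⁻ z, (∫⁻ w, k z w * f w) ^ p ≤ B ^ p * ∫⁻ w, f w ^ p

namespace KerBound
variable {p : ℝ} {k k₁ k₂ : ST d → ST d → ℝ≥0∞} {B B₁ B₂ : ℝ≥0∞}

theorem mono (h : KerBound p k₂ B₂) (hp : 0 ≤ p) (hk : ∀ z w, k₁ z w ≤ k₂ z w) (hB : B₂ ≤ B₁) :
    KerBound p k₁ B₁ := fun f hf =>
  (lintegral_mono fun z => ENNReal.rpow_le_rpow
    (lintegral_mono fun w => mul_le_mul_left (hk z w) _) hp).trans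
    ((h f hf).trans (mul_le_mul_left (ENNReal.rpow_le_rpow hB hp) _))

theorem add (h₁ : KerBound p k₁ B₁) (h₂ : KerBound p k₂ B₂) (hp : 1 ≤ p)
    (hk₁ : Measurable (Function.uncurry k₁)) (hk₂ : Measurable (Function.uncurry k₂)) :
    KerBound p (fun z w => k₁ z w + k₂ z w) (B₁ + B₂) := by
  intro f hf
  have hp0 : 0 < p := by linarith
  have m₁ : Measurable fun z => ∫⁻ w, k₁ z w * f w :=
    Measurable.lintegral_prod_right' (f := fun q : ST d × ST d => k₁ q.1 q.2 * f q.2)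
      (hk₁.mul (hf.comp measurable_snd))
  have m₂ : Measurable fun z => ∫⁻ w, k₂ z w * f w :=
    Measurable.lintegral_prod_right' (f := fun q : ST d × ST d => k₂ q.1 q.2 * f q.2)
      (hk₂.mul (hf.comp measurable_snd))
  have hs : ∀ z, ∫⁻ w, (k₁ z w + k₂ z w) * f w = (∫⁻ w, k₁ z w * f w) + ∫⁻ w, k₂ z w * f w := by
    intro z
    simp_rw [add_mul]
    exact lintegral_add_left ((hk₁.comp (by fun_prop : Measurable fun w => (z, w))).mul hf) _
  simp_rw [hs]
  have key := ENNReal.lintegral_Lp_add_le m₁.aemeasurable m₂.aemeasurable hp (μ := volume)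
  have r : ∀ {a b c : ℝ≥0∞}, a ≤ b ^ p * c → a ^ (1 / p) ≤ b * c ^ (1 / p) := by
    intro a b c h
    calc a ^ (1 / p) ≤ (b ^ p * c) ^ (1 / p) := ENNReal.rpow_le_rpow h (by positivity)
      _ = _ := by
        rw [ENNReal.mul_rpow_of_nonneg _ _ (by positivity), ← ENNReal.rpow_mul,
          mul_one_div_cancel hp0.ne', ENNReal.rpow_one]
  have := key.trans (add_le_add (r (h₁ f hf)) (r (h₂ f hf)))
  rw [← add_mul] at this
  have := ENNReal.rpow_le_rpow this hp0.le
  rwa [ENNReal.mul_rpow_of_nonneg _ _ hp0.le, ← ENNReal.rpow_mul, ← ENNReal.rpow_mul,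
    one_div_mul_cancel hp0.ne', ENNReal.rpow_one, ENNReal.rpow_one] at this

theorem const_mul (h : KerBound p k B) (hp : 0 ≤ p) (hk : Measurable (Function.uncurry k))
    (c : ℝ≥0∞) : KerBound p (fun z w => c * k z w) (c * B) := by
  intro f hf
  have hs : ∀ z, ∫⁻ w, c * k z w * f w = c * ∫⁻ w, k z w * f w := by
    intro z
    simp_rw [mul_assoc]
    exact lintegral_const_mul _ ((hk.comp (by fun_prop : Measurable fun w => (z, w))).mul hf)
  have m : Measurable fun z => ∫⁻ w, k z w * f w :=
    Measurable.lintegral_prod_right' (f := fun q : ST d × ST d => k q.1 q.2 * f q.2)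
      (hk.mul (hf.comp measurable_snd))
  simp_rw [hs, ENNReal.mul_rpow_of_nonneg _ _ hp]
  rw [lintegral_const_mul _ (m.pow_const p), mul_assoc]
  exact mul_le_mul_right (h f hf) _

/-- Schur's test with constant weights, which is Young's inequality. -/
theorem of_convolution {p' : ℝ} (hpq : p.HolderConjugate p') {κ : ST d → ℝ≥0∞} (hκ : Measurable κ) :
    KerBound p (fun z w => κ (z - w)) (∫⁻ z, κ z) := by
  intro f hf
  have hsplit : (∫⁻ z, κ z) ^ p = (∫⁻ z, κ z) * (∫⁻ z, κ z) ^ (p - 1) := by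
    conv_lhs => rw [show p = 1 + (p - 1) by ring]
    rw [ENNReal.rpow_add_of_nonneg _ _ zero_le_one hpq.sub_one_pos.le, ENNReal.rpow_one]
  refine schur_test hpq (K := fun z w => κ (z - w)) (φ := fun _ => 1)
    (ψ := fun _ => ∫⁻ z, κ z) (hκ.comp measurable_sub)
    measurable_const measurable_const (Eventually.of_forall fun z => ?_)
    (Eventually.of_forall fun w => ?_) (Eventually.of_forall fun w => Or.inl (by simp)) hf
  · simp only [mul_one]
    exact (lintegral_sub_left_eq_self κ z).le
  · rw [ENNReal.one_rpow, mul_one, lintegral_mul_const _ (by fun_prop),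
      lintegral_sub_right_eq_self κ w, hsplit]

theorem aemeasurable_le (h : KerBound p k B) {f : ST d → ℝ≥0∞} (hf : AEMeasurable f) :
    ∫⁻ z, (∫⁻ w, k z w * f w) ^ p ≤ B ^ p * ∫⁻ w, f w ^ p := by
  have e : ∀ z, ∫⁻ w, k z w * f w = ∫⁻ w, k z w * hf.mk f w := fun z =>
    lintegral_congr_ae (by filter_upwards [hf.ae_eq_mk] with w hw; rw [hw])
  have e' : ∫⁻ w, f w ^ p = ∫⁻ w, hf.mk f w ^ p :=
    lintegral_congr_ae (by filter_upwards [hf.ae_eq_mk] with w hw; rw [hw])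
  simp_rw [e, e']
  exact h _ hf.measurable_mk

end KerBound

section kerOp
variable {E : Type*} [NormedAddCommGroup E] [NormedSpace ℝ E] {P : ℝ≥0∞} {k : ST d → ST d → E}
  {B : ℝ≥0∞} {g : ST d → ℝ}

theorem lintegral_rpow_ne_top (hP : P ≠ 0) (hPt : P ≠ ⊤) {E : Type*} [NormedAddCommGroup E]
    {g : ST d → E} (hg : MemLp g P) : ∫⁻ z, ‖g z‖ₑ ^ P.toReal ≠ ⊤ :=
  (lintegral_rpow_enorm_lt_top_of_eLpNorm_lt_top hP hPt hg.2).ne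

theorem KerBound.lintegral_ne_top (hP : P ≠ 0) (hPt : P ≠ ⊤) {k : ST d → ST d → ℝ≥0∞}
    (h : KerBound P.toReal k B) (hB : B ≠ ⊤) (hg : MemLp g P) :
    ∫⁻ z, (∫⁻ w, k z w * ‖g w‖ₑ) ^ P.toReal ≠ ⊤ :=
  ne_top_of_le_ne_top (ENNReal.mul_ne_top (ENNReal.rpow_ne_top_of_nonneg ENNReal.toReal_nonneg hB)
    (lintegral_rpow_ne_top hP hPt hg)) (h.aemeasurable_le hg.1.enorm)

theorem KerBound.ae_lt_top (hP : P ≠ 0) (hPt : P ≠ ⊤) {k : ST d → ST d → ℝ≥0∞}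
    (hk : Measurable (Function.uncurry k))
    (h : KerBound P.toReal k B) (hB : B ≠ ⊤) (hg : MemLp g P) :
    ∀ᵐ z, ∫⁻ w, k z w * ‖g w‖ₑ < ⊤ := by
  have hm : AEMeasurable fun z => ∫⁻ w, k z w * ‖g w‖ₑ :=
    AEMeasurable.lintegral_prod_right' (f := fun q : ST d × ST d => k q.1 q.2 * ‖g q.2‖ₑ)
      (hk.aemeasurable.mul hg.1.comp_snd.enorm)
  have hp : 0 < P.toReal := ENNReal.toReal_pos hP hPt
  filter_upwards [ae_lt_top' (hm.pow_const _) (h.lintegral_ne_top hP hPt hB hg)] with z hz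
  exact (ENNReal.rpow_lt_top_iff_of_pos hp).1 hz

theorem aestronglyMeasurable_kernel_smul (hk : StronglyMeasurable (Function.uncurry k))
    (hg : AEStronglyMeasurable g) :
    AEStronglyMeasurable (fun q : ST d × ST d => g q.2 • k q.1 q.2) (volume.prod volume) :=
  hg.comp_snd.smul hk.aestronglyMeasurable

theorem ae_integrable_kernel_smul (hP : P ≠ 0) (hPt : P ≠ ⊤)
    (hk : StronglyMeasurable (Function.uncurry k))
    (h : KerBound P.toReal (fun z w => ‖k z w‖ₑ) B) (hB : B ≠ ⊤) (hg : MemLp g P) :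
    ∀ᵐ z, Integrable fun w => g w • k z w := by
  filter_upwards [h.ae_lt_top (k := fun z w => ‖k z w‖ₑ) hP hPt hk.enorm hB hg] with z hz
  refine ⟨hg.1.smul (hk.comp_measurable (by fun_prop : Measurable
    fun w => (z, w))).aestronglyMeasurable, ?_⟩
  refine lt_of_le_of_lt (lintegral_mono fun w => ?_) hz
  rw [enorm_smul, mul_comm]

theorem memLp_kernel (hP : P ≠ 0) (hPt : P ≠ ⊤) (hk : StronglyMeasurable (Function.uncurry k))
    (h : KerBound P.toReal (fun z w => ‖k z w‖ₑ) B) (hB : B ≠ ⊤) (hg : MemLp g P) :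
    MemLp (fun z => ∫ w, g w • k z w) P ∧
      eLpNorm (fun z => ∫ w, g w • k z w) P volume ≤ B * eLpNorm g P volume := by
  have hp : 0 < P.toReal := ENNReal.toReal_pos hP hPt
  have hle : eLpNorm (fun z => ∫ w, g w • k z w) P volume ≤ B * eLpNorm g P volume := by
    rw [eLpNorm_eq_lintegral_rpow_enorm_toReal hP hPt, eLpNorm_eq_lintegral_rpow_enorm_toReal hP hPt]
    have : ∫⁻ z, ‖∫ w, g w • k z w‖ₑ ^ P.toReal ≤ B ^ P.toReal * ∫⁻ w, ‖g w‖ₑ ^ P.toReal := by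
      refine le_trans (lintegral_mono fun z => ENNReal.rpow_le_rpow
        ((enorm_integral_le_lintegral_enorm _).trans (le_of_eq ?_)) hp.le)
        (h.aemeasurable_le hg.1.enorm)
      congr 1; ext w
      rw [enorm_smul, mul_comm]
    refine (ENNReal.rpow_le_rpow this (by positivity)).trans (le_of_eq ?_)
    rw [ENNReal.mul_rpow_of_nonneg _ _ (by positivity), ← ENNReal.rpow_mul,
      mul_one_div_cancel hp.ne', ENNReal.rpow_one]
  refine ⟨⟨(aestronglyMeasurable_kernel_smul hk hg.1).integral_prod_right', ?_⟩, hle⟩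
  exact hle.trans_lt (ENNReal.mul_lt_top hB.lt_top hg.2)

/-- A bounded integral operator on `L^p`. -/
def kerOp [Fact (1 ≤ P)] (hPt : P ≠ ⊤) (k : ST d → ST d → E)
    (hk : StronglyMeasurable (Function.uncurry k))
    (h : KerBound P.toReal (fun z w => ‖k z w‖ₑ) B) (hB : B ≠ ⊤) :
    LL d P →L[ℝ] Lp E P (volume : Measure (ST d)) :=
  have hP : P ≠ 0 := (zero_lt_one.trans_le (Fact.out : 1 ≤ P)).ne'
  LinearMap.mkContinuous
    { toFun := fun g => (memLp_kernel hP hPt hk h hB (Lp.memLp g)).1.toLp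
      map_add' := fun g₁ g₂ => by
        rw [← MemLp.toLp_add]
        refine MemLp.toLp_congr _ _ ?_
        filter_upwards [ae_integrable_kernel_smul hP hPt hk h hB (Lp.memLp g₁),
          ae_integrable_kernel_smul hP hPt hk h hB (Lp.memLp g₂)] with z h₁ h₂
        rw [Pi.add_apply, ← integral_add h₁ h₂]
        refine integral_congr_ae ?_
        filter_upwards [Lp.coeFn_add g₁ g₂] with w hw
        rw [hw, Pi.add_apply, add_smul]
      map_smul' := fun c g => by
        rw [RingHom.id_apply, ← MemLp.toLp_const_smul]
        refine MemLp.toLp_congr _ _ (Eventually.of_forall fun z => ?_)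
        simp only [Pi.smul_apply]
        rw [← integral_smul]
        refine integral_congr_ae ?_
        filter_upwards [Lp.coeFn_smul c g] with w hw
        rw [hw, Pi.smul_apply, smul_assoc] }
    B.toReal fun g => by
      simp only [LinearMap.coe_mk, AddHom.coe_mk, Lp.norm_toLp]
      rw [Lp.norm_def, ← ENNReal.toReal_mul]
      exact ENNReal.toReal_mono (ENNReal.mul_ne_top hB (Lp.eLpNorm_ne_top g))
        (memLp_kernel hP hPt hk h hB (Lp.memLp g)).2

theorem kerOp_apply_ae [Fact (1 ≤ P)] (hPt : P ≠ ⊤) (hk : StronglyMeasurable (Function.uncurry k))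
    (h : KerBound P.toReal (fun z w => ‖k z w‖ₑ) B) (hB : B ≠ ⊤) (g : LL d P) :
    kerOp hPt k hk h hB g =ᵐ[volume] fun z => ∫ w, g w • k z w :=
  MemLp.coeFn_toLp (memLp_kernel (zero_lt_one.trans_le (Fact.out : 1 ≤ P)).ne' hPt hk h hB
    (Lp.memLp g)).1

theorem norm_kerOp_le [Fact (1 ≤ P)] (hPt : P ≠ ⊤) (hk : StronglyMeasurable (Function.uncurry k))
    (h : KerBound P.toReal (fun z w => ‖k z w‖ₑ) B) (hB : B ≠ ⊤) :
    ‖kerOp hPt k hk h hB‖ ≤ B.toReal := by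
  unfold kerOp
  exact LinearMap.mkContinuous_norm_le _ ENNReal.toReal_nonneg _

theorem integrable_prod_kernel {P' : ℝ≥0∞} (hpq : P.toReal.HolderConjugate P'.toReal)
    {k : ST d → ST d → ℝ} (hk : StronglyMeasurable (Function.uncurry k))
    (hb : KerBound P.toReal (fun z w => ‖k z w‖ₑ) B) (hB : B ≠ ⊤) (hg : MemLp g P)
    {h : ST d → ℝ} (hh : MemLp h P') :
    Integrable (fun q : ST d × ST d => h q.1 * (g q.2 * k q.1 q.2)) (volume.prod volume) := by
  have t : ∀ {P : ℝ≥0∞}, 0 < P.toReal → P ≠ 0 ∧ P ≠ ⊤ := fun h => by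
    rw [ENNReal.toReal_pos_iff] at h; exact ⟨h.1.ne', h.2.ne⟩
  obtain ⟨hP, hPt⟩ := t hpq.pos
  obtain ⟨hP', hPt'⟩ := t hpq.symm.pos
  have hm : AEMeasurable fun z => ∫⁻ w, ‖k z w‖ₑ * ‖g w‖ₑ :=
    AEMeasurable.lintegral_prod_right' (f := fun q : ST d × ST d => ‖k q.1 q.2‖ₑ * ‖g q.2‖ₑ)
      (hk.enorm.aemeasurable.mul hg.1.comp_snd.enorm)
  have hmeas : AEStronglyMeasurable (fun q : ST d × ST d => h q.1 * (g q.2 * k q.1 q.2))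
      (volume.prod volume) := hh.1.comp_fst.mul (aestronglyMeasurable_kernel_smul hk hg.1)
  refine ⟨hmeas, ?_⟩
  rw [HasFiniteIntegral, lintegral_prod _ hmeas.enorm]
  have e : ∀ z, ∫⁻ w, ‖h z * (g w * k z w)‖ₑ = ‖h z‖ₑ * ∫⁻ w, ‖k z w‖ₑ * ‖g w‖ₑ := by
    intro z
    have hkz : Measurable fun w => ‖k z w‖ₑ :=
      hk.enorm.comp (by fun_prop : Measurable fun w => (z, w))
    rw [← lintegral_const_mul'' _ (by have := hg.1.enorm; fun_prop)]
    congr 1; ext w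
    rw [enorm_mul, enorm_mul]
    ring
  simp_rw [e]
  refine (ENNReal.lintegral_mul_le_Lp_mul_Lq volume hpq.symm hh.1.enorm hm).trans_lt ?_
  refine ENNReal.mul_lt_top (ENNReal.rpow_lt_top_of_nonneg (by have := hpq.symm.pos; positivity)
    (lintegral_rpow_ne_top hP' hPt' hh))
    (ENNReal.rpow_lt_top_of_nonneg (by have := hpq.pos; positivity)
      (hb.lintegral_ne_top hP hPt hB hg))

/-- Fubini, justified by Hölder between h and the operator applied to |g|. It is the device for
moving potentials from L^p functions onto test functions. -/
theorem integral_kernel_mul {P' : ℝ≥0∞} (hpq : P.toReal.HolderConjugate P'.toReal)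
    {k : ST d → ST d → ℝ} (hk : StronglyMeasurable (Function.uncurry k))
    (hb : KerBound P.toReal (fun z w => ‖k z w‖ₑ) B) (hB : B ≠ ⊤) (hg : MemLp g P)
    {h : ST d → ℝ} (hh : MemLp h P') :
    ∫ z, h z * ∫ w, g w * k z w = ∫ w, g w * ∫ z, k z w * h z := by
  have hi := integrable_prod_kernel hpq hk hb hB hg hh
  calc ∫ z, h z * ∫ w, g w * k z w = ∫ z, ∫ w, h z * (g w * k z w) := by
        simp_rw [integral_const_mul]
    _ = ∫ w, ∫ z, h z * (g w * k z w) := integral_integral_swap hi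
    _ = _ := by
        congr 1; ext w
        rw [← integral_const_mul]
        congr 1; ext z; ring

end kerOp
end

/-! ### Potentials and their weak gradients on L^p -/

/-- Admissible parameters. -/
structure Adm (d : ℕ) (α lam : ℝ) : Prop where
  d_pos : 0 < d
  one_lt : 1 < α
  lt_two : α < 2
  lam_pos : 0 < lam

section
variable {d : ℕ} {α lam : ℝ}

theorem Adm.pos (H : Adm d α lam) : 0 < α := zero_lt_one.trans H.one_lt

theorem stronglyMeasurable_potKernel_sub (α lam s : ℝ) :
    StronglyMeasurable (Function.uncurry fun z w : ST d => potKernel α lam s (z - w)) :=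
  ((measurable_potKernel α lam s).comp measurable_sub).stronglyMeasurable

theorem stronglyMeasurable_gradPot_sub (α lam s : ℝ) :
    StronglyMeasurable (Function.uncurry fun z w : ST d => gradPot α lam s (z - w)) :=
  ((measurable_gradPot α lam s).comp measurable_sub).stronglyMeasurable

theorem Adm.kerBound_pot (H : Adm d α lam) {s p p' : ℝ} (hs : 0 < s) (hpq : p.HolderConjugate p') :
    KerBound p (fun z w : ST d => ‖potKernel α lam s (z - w)‖ₑ) (ENNReal.ofReal (lam ^ (-s))) := by
  rw [← lintegral_potKernel H.d_pos H.pos H.lt_two hs H.lam_pos]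
  exact KerBound.of_convolution hpq (measurable_potKernel α lam s).enorm

theorem Adm.lintegral_gradPot_ne_top (H : Adm d α lam) {s : ℝ} (hs : 1 / α < s) :
    ∫⁻ z : ST d, ‖gradPot α lam s z‖ₑ ≠ ⊤ := by
  obtain ⟨C, -, h⟩ := exists_lintegral_gradPot_le H.d_pos H.pos H.lt_two hs
  exact ne_top_of_le_ne_top ENNReal.ofReal_ne_top (h lam H.lam_pos)

theorem kerBound_gradPot {s p p' : ℝ} (hpq : p.HolderConjugate p') :
    KerBound p (fun z w : ST d => ‖gradPot α lam s (z - w)‖ₑ)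
      (∫⁻ z : ST d, ‖gradPot α lam s z‖ₑ) :=
  KerBound.of_convolution hpq (measurable_gradPot α lam s).enorm

theorem Adm.integrable_potKernel (H : Adm d α lam) {s : ℝ} (hs : 0 < s) :
    Integrable (potKernel (d := d) α lam s) :=
  ⟨(measurable_potKernel α lam s).aestronglyMeasurable, by
    rw [HasFiniteIntegral, lintegral_potKernel H.d_pos H.pos H.lt_two hs H.lam_pos]
    exact ENNReal.ofReal_lt_top⟩

theorem Adm.integrable_gradPot (H : Adm d α lam) {s : ℝ} (hs : 1 / α < s) :
    Integrable (gradPot (d := d) α lam s) :=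
  ⟨(measurable_gradPot α lam s).aestronglyMeasurable, (H.lintegral_gradPot_ne_top hs).lt_top⟩

theorem pot_eq_smul (s : ℝ) (f : ST d → ℝ) :
    pot α lam s f = fun z => ∫ w, f w • potKernel α lam s (z - w) := by
  ext z
  simp only [pot, smul_eq_mul, mul_comm]

theorem pot_congr {s : ℝ} {f g : ST d → ℝ} (h : f =ᵐ[volume] g) :
    pot α lam s f = pot α lam s g := by
  ext z
  exact integral_congr_ae (by filter_upwards [h] with w hw; rw [hw])

theorem ne_zero_ne_top_of_holder {P P' : ℝ≥0∞} (hpq : P.toReal.HolderConjugate P'.toReal) :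
    P ≠ 0 ∧ P ≠ ⊤ := by
  have h := hpq.pos
  rw [ENNReal.toReal_pos_iff] at h
  exact ⟨h.1.ne', h.2.ne⟩

section Lp
variable {P P' : ℝ≥0∞} {f g h : ST d → ℝ} {s r : ℝ}

theorem Adm.memLp_pot (hpq : P.toReal.HolderConjugate P'.toReal) (H : Adm d α lam)
    (hs : 0 < s) (hf : MemLp f P) : MemLp (pot α lam s f) P := by
  obtain ⟨hP, hPt⟩ := ne_zero_ne_top_of_holder hpq
  rw [pot_eq_smul]
  exact (memLp_kernel hP hPt (stronglyMeasurable_potKernel_sub α lam s) (H.kerBound_pot hs hpq)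
    ENNReal.ofReal_ne_top hf).1

theorem Adm.ae_integrable_pot (hpq : P.toReal.HolderConjugate P'.toReal) (H : Adm d α lam)
    (hs : 0 < s) (hf : MemLp f P) :
    ∀ᵐ z, Integrable fun w => f w * potKernel α lam s (z - w) := by
  obtain ⟨hP, hPt⟩ := ne_zero_ne_top_of_holder hpq
  exact ae_integrable_kernel_smul hP hPt (stronglyMeasurable_potKernel_sub α lam s)
    (H.kerBound_pot hs hpq) ENNReal.ofReal_ne_top hf

theorem Adm.pot_sub (hpq : P.toReal.HolderConjugate P'.toReal) (H : Adm d α lam)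
    (hs : 0 < s) (hf : MemLp f P) (hg : MemLp g P) :
    pot α lam s (fun z => f z - g z) =ᵐ[volume] fun z => pot α lam s f z - pot α lam s g z := by
  filter_upwards [H.ae_integrable_pot hpq hs hf, H.ae_integrable_pot hpq hs hg] with z h₁ h₂
  simp only [pot_eq_smul, smul_eq_mul]
  rw [← integral_sub h₁ h₂]
  simp_rw [sub_mul]

theorem Adm.integral_pot_mul (hpq : P.toReal.HolderConjugate P'.toReal) (H : Adm d α lam)
    (hs : 0 < s) (hf : MemLp f P) (hh : MemLp h P') :
    ∫ z, pot α lam s f z * h z = ∫ w, f w * bwdPot α lam s h w := by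
  have := integral_kernel_mul hpq (stronglyMeasurable_potKernel_sub α lam s) (H.kerBound_pot hs hpq)
    ENNReal.ofReal_ne_top hf hh
  simp only [pot_eq_smul, smul_eq_mul, bwdPot]
  simp only [mul_comm (h _)] at this
  exact this

theorem Adm.lintegral_potKernel_sub_mul (H : Adm d α lam) (hs : 0 < s) (hr : 0 < r) (z v : ST d) :
    ∫⁻ w, ‖potKernel α lam s (z - w)‖ₑ * ‖potKernel α lam r (w - v)‖ₑ =
      ‖potKernel α lam (s + r) (z - v)‖ₑ := by
  rw [← lintegral_potKernel_mul_potKernel H.d_pos H.pos H.lt_two hs hr,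
    ← lintegral_sub_right_eq_self (fun w => ‖potKernel α lam s (z - v - w)‖ₑ *
      ‖potKernel α lam r w‖ₑ) v]
  simp only [sub_sub_sub_cancel_right]

theorem Adm.integral_potKernel_mul_potKernel (H : Adm d α lam) (hs : 0 < s) (hr : 0 < r) (z v : ST d) :
    ∫ w, potKernel α lam s (z - w) * potKernel α lam r (w - v) =
      potKernel α lam (s + r) (z - v) := by
  have n := fun {s : ℝ} (hs : 0 < s) (z : ST d) =>
    potKernel_nonneg (lam := lam) H.d_pos H.pos H.lt_two hs z
  have m := fun s : ℝ => measurable_potKernel (d := d) α lam s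
  rw [integral_eq_lintegral_of_nonneg_ae (Eventually.of_forall fun w => mul_nonneg (n hs _) (n hr _))
    (by have := m s; have := m r; fun_prop)]
  rw [← ENNReal.toReal_ofReal (n (add_pos hs hr) (z - v))]
  congr 1
  rw [← Real.enorm_of_nonneg (n (add_pos hs hr) _), ← H.lintegral_potKernel_sub_mul hs hr]
  congr 1; ext w
  rw [Real.enorm_of_nonneg (n hs _), Real.enorm_of_nonneg (n hr _), ← ENNReal.ofReal_mul (n hs _)]

/-- The absolute double integral at z is the potential of order s + r of |f|, finite for almost
every z; there Fubini and the kernel identity apply. -/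
theorem Adm.pot_pot (hpq : P.toReal.HolderConjugate P'.toReal) (H : Adm d α lam)
    (hs : 0 < s) (hr : 0 < r) (hf : MemLp f P) :
    pot α lam s (pot α lam r f) =ᵐ[volume] pot α lam (s + r) f := by
  obtain ⟨hP, hPt⟩ := ne_zero_ne_top_of_holder hpq
  have m := fun s : ℝ => measurable_potKernel (d := d) α lam s
  have hk : Measurable (Function.uncurry fun z w : ST d => ‖potKernel α lam (s + r) (z - w)‖ₑ) :=
    (stronglyMeasurable_potKernel_sub α lam (s + r)).enorm
  filter_upwards [(H.kerBound_pot (add_pos hs hr) hpq).ae_lt_top hP hPt hk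
    ENNReal.ofReal_ne_top hf] with z hz
  have hms : Measurable fun q : ST d × ST d =>
      potKernel α lam s (z - q.2) * potKernel α lam r (q.2 - q.1) := by
    have := m s; have := m r; fun_prop
  have hmeas : AEStronglyMeasurable (fun q : ST d × ST d =>
      f q.1 * (potKernel α lam s (z - q.2) * potKernel α lam r (q.2 - q.1)))
      (volume.prod volume) := hf.1.comp_fst.mul hms.aestronglyMeasurable
  have hint : Integrable (fun q : ST d × ST d =>
      f q.1 * (potKernel α lam s (z - q.2) * potKernel α lam r (q.2 - q.1)))
      (volume.prod volume) := by
    refine ⟨hmeas, ?_⟩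
    rw [HasFiniteIntegral, lintegral_prod _ hmeas.enorm]
    refine lt_of_le_of_lt (lintegral_mono fun v => le_of_eq ?_) hz
    simp only [enorm_mul]
    rw [lintegral_const_mul _ (by have := m s; have := m r; fun_prop), mul_comm,
      H.lintegral_potKernel_sub_mul hs hr]
  calc pot α lam s (pot α lam r f) z
      = ∫ w, ∫ v, f v * (potKernel α lam s (z - w) * potKernel α lam r (w - v)) := by
        simp only [pot]
        congr 1; ext w
        rw [← integral_const_mul]
        congr 1; ext v; ring
    _ = ∫ v, ∫ w, f v * (potKernel α lam s (z - w) * potKernel α lam r (w - v)) :=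
        (integral_integral_swap hint).symm
    _ = _ := by
        simp only [pot, integral_const_mul, H.integral_potKernel_mul_potKernel hs hr, mul_comm]

end Lp

/-- `∇ (λ + ∂_t + (-Δ)^{α/2})^{-s} f` as an absolutely convergent integral. -/
def gradConv (α lam s : ℝ) (f : ST d → ℝ) (z : ST d) : Sp d :=
  ∫ w, f w • gradPot α lam s (z - w)

theorem Adm.memLp_gradConv {P P' : ℝ≥0∞} (hpq : P.toReal.HolderConjugate P'.toReal)
    (H : Adm d α lam) {s : ℝ} (hs : 1 / α < s) {f : ST d → ℝ} (hf : MemLp f P) :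
    MemLp (gradConv α lam s f) P := by
  obtain ⟨hP, hPt⟩ := ne_zero_ne_top_of_holder hpq
  exact (memLp_kernel hP hPt (stronglyMeasurable_gradPot_sub α lam s) (kerBound_gradPot hpq)
    (H.lintegral_gradPot_ne_top hs) hf).1

/-- For each fixed t > 0 the spatial integration by parts is classical. The condition s > 1/α makes
the gradient kernel integrable, so the slices can be assembled by Fubini. -/
theorem Adm.integral_potKernel_mul_fderiv (H : Adm d α lam) {s : ℝ} (hs : 1 / α < s) {φ : ST d → ℝ}
    (hφ : ContDiff ℝ ∞ φ) (hc : HasCompactSupport φ) (e : Sp d) :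
    ∫ z, potKernel α lam s z * fderiv ℝ φ z (0, e) = -∫ z, ⟪gradPot α lam s z, e⟫_ℝ * φ z := by
  have hα := H.pos
  have hs0 : 0 < s := (by positivity : (0 : ℝ) < 1 / α).trans hs
  have hd1 : Differentiable ℝ φ := hφ.differentiable (by simp)
  have hfc : Continuous fun z => fderiv ℝ φ z (0, e) :=
    (hφ.continuous_fderiv (by simp)).clm_apply continuous_const
  obtain ⟨C₀, hC₀⟩ := hc.exists_bound_of_continuous hφ.continuous
  obtain ⟨C₁, hC₁⟩ := (hc.fderiv_apply (𝕜 := ℝ) (0, e)).exists_bound_of_continuous hfc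
  have i1 : Integrable fun z => potKernel α lam s z * fderiv ℝ φ z (0, e) :=
    (H.integrable_potKernel hs0).mul_bdd (c := C₁) hfc.aestronglyMeasurable (Eventually.of_forall hC₁)
  have i2 : Integrable fun z => ⟪gradPot α lam s z, e⟫_ℝ * φ z :=
    ((H.integrable_gradPot hs).inner_const e).mul_bdd (c := C₀) hφ.continuous.aestronglyMeasurable
      (Eventually.of_forall hC₀)
  rw [Measure.volume_eq_prod] at i1 i2 ⊢
  rw [integral_prod _ i1, integral_prod _ i2, ← integral_neg]
  congr 1; ext t
  simp only [potKernel_eq, gradPot, real_inner_smul_left, mul_assoc, integral_const_mul]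
  rw [← mul_neg]
  rcases le_or_gt t 0 with ht | ht
  · simp [timeKernel_of_nonpos ht]
  congr 1
  have hsl : ∀ x : Sp d, HasFDerivAt (fun x : Sp d => φ (t, x))
      ((fderiv ℝ φ (t, x)).comp (ContinuousLinearMap.inr ℝ ℝ (Sp d))) x := fun x =>
    (hd1 (t, x)).hasFDerivAt.comp x (hasFDerivAt_prodMk_right t x)
  have hH := fun x => hasFDerivAt_heatKernel H.d_pos hα ht x
  have e1 : ∀ x, fderiv ℝ φ (t, x) (0, e) = fderiv ℝ (fun x : Sp d => φ (t, x)) x e := by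
    intro x; rw [(hsl x).fderiv]; simp
  have e2 : ∀ x : Sp d, ⟪gradHeat α t x, e⟫_ℝ = fderiv ℝ (heatKernel α t) x e := by
    intro x; rw [(hH x).fderiv]; simp
  have hcs : Continuous fun x : Sp d => φ (t, x) := hφ.continuous.comp (by fun_prop)
  have hcs' : Continuous fun x : Sp d => fderiv ℝ φ (t, x) (0, e) := hfc.comp (by fun_prop)
  have hHi := integrable_heatKernel (d := d) H.d_pos hα H.lt_two ht
  simp only [e2]
  simp only [e1]
  refine integral_mul_fderiv_eq_neg_fderiv_mul_of_integrable ?_ ?_ ?_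
    (fun x _ => (hH x).differentiableAt) (fun x _ => (hsl x).differentiableAt)
  · simp only [← e2]
    exact ((integrable_gradHeat H.d_pos hα H.lt_two ht).inner_const e).mul_bdd (c := C₀)
      hcs.aestronglyMeasurable (Eventually.of_forall fun x => hC₀ _)
  · simp only [← e1]
    exact hHi.mul_bdd (c := C₁) hcs'.aestronglyMeasurable (Eventually.of_forall fun x => hC₁ _)
  · exact hHi.mul_bdd (c := C₀) hcs.aestronglyMeasurable (Eventually.of_forall fun x => hC₀ _)

/-- The potential is moved onto the test function by duality; there the derivative is shifted to the
translated kernel, and duality is applied once more in the opposite direction. -/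
theorem Adm.isWeakGrad_pot {P P' : ℝ≥0∞} (hpq : P.toReal.HolderConjugate P'.toReal)
    (H : Adm d α lam) {s : ℝ} (hs : 1 / α < s) {f : ST d → ℝ} (hf : MemLp f P) :
    IsWeakGrad (pot α lam s f) (gradConv α lam s f) := by
  obtain ⟨hP, hPt⟩ := ne_zero_ne_top_of_holder hpq
  have hα := H.pos
  have hs0 : 0 < s := (by positivity : (0 : ℝ) < 1 / α).trans hs
  have hP1 : 1 ≤ P := by
    rw [← ENNReal.ofReal_toReal hPt]
    exact ENNReal.one_le_ofReal.2 hpq.lt.le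
  refine ⟨(H.memLp_pot hpq hs0 hf).locallyIntegrable hP1,
    (H.memLp_gradConv hpq hs hf).locallyIntegrable hP1, fun φ e => ?_⟩
  have hφ := φ.contDiff
  have hc := φ.hasCompactSupport
  have hfc : Continuous fun z => fderiv ℝ φ z (0, e) :=
    (hφ.continuous_fderiv (by simp)).clm_apply continuous_const
  rw [H.integral_pot_mul hpq hs0 hf (hfc.memLp_of_hasCompactSupport (hc.fderiv_apply (𝕜 := ℝ) (0, e)))]
  have hke : StronglyMeasurable (Function.uncurry fun z w : ST d => ⟪gradPot α lam s (z - w), e⟫_ℝ) :=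
    (stronglyMeasurable_gradPot_sub α lam s).inner stronglyMeasurable_const
  have hkb : KerBound P.toReal (fun z w : ST d => ‖⟪gradPot α lam s (z - w), e⟫_ℝ‖ₑ)
      (‖e‖ₑ * ∫⁻ z : ST d, ‖gradPot α lam s z‖ₑ) := by
    refine ((kerBound_gradPot hpq).const_mul hpq.nonneg
      (stronglyMeasurable_gradPot_sub α lam s).enorm ‖e‖ₑ).mono hpq.nonneg (fun z w => ?_) le_rfl
    rw [← ofReal_norm, ← ofReal_norm, ← ofReal_norm, ← ENNReal.ofReal_mul (norm_nonneg _), mul_comm]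
    exact ENNReal.ofReal_le_ofReal (norm_inner_le_norm _ _)
  have hdual := integral_kernel_mul hpq hke hkb (ENNReal.mul_ne_top (by simp)
    (H.lintegral_gradPot_ne_top hs)) hf (hφ.continuous.memLp_of_hasCompactSupport (p := P') hc)
  have e1 : ∫ z, ⟪gradConv α lam s f z, e⟫_ℝ * φ z =
      ∫ z, φ z * ∫ w, f w * ⟪gradPot α lam s (z - w), e⟫_ℝ := by
    refine integral_congr_ae ?_
    filter_upwards [ae_integrable_kernel_smul hP hPt (stronglyMeasurable_gradPot_sub α lam s)
      (kerBound_gradPot hpq) (H.lintegral_gradPot_ne_top hs) hf] with z hz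
    rw [mul_comm, gradConv, real_inner_comm, ← integral_inner hz]
    simp only [real_inner_smul_right, real_inner_comm]
  rw [e1, hdual, ← integral_neg]
  congr 1; ext w
  rw [← mul_neg, bwdPot]
  congr 1
  have := H.integral_potKernel_mul_fderiv hs (φ := fun z => φ (z + w)) (hφ.comp (by fun_prop))
    (hc.comp_homeomorph (Homeomorph.addRight w)) e
  rw [← integral_sub_right_eq_self _ w] at this
  rw [← integral_sub_right_eq_self (fun z => ⟪gradPot α lam s z, e⟫_ℝ * φ (z + w)) w] at this
  simpa only [fderiv_comp_add_right, sub_add_cancel] using this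

/-- The difference of two weak gradients has zero integral against all test functions, in every
direction. -/
theorem IsWeakGrad.ae_eq {v : ST d → ℝ} {G₁ G₂ : ST d → Sp d} (h₁ : IsWeakGrad v G₁)
    (h₂ : IsWeakGrad v G₂) : G₁ =ᵐ[volume] G₂ := by
  have key := ae_eq_zero_of_integral_contDiff_smul_eq_zero (μ := volume) (h₁.2.1.sub h₂.2.1)
    fun φ hφ hc => by
      have i1 := h₁.2.1.integrable_smul_left_of_hasCompactSupport hφ.continuous hc
      have i2 := h₂.2.1.integrable_smul_left_of_hasCompactSupport hφ.continuous hc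
      refine ext_inner_right ℝ fun e => ?_
      have t1 := h₁.2.2 ⟨φ, hφ, hc, by simp⟩ e
      have t2 := h₂.2.2 ⟨φ, hφ, hc, by simp⟩ e
      rw [t1, neg_inj] at t2
      simp only [TestFunction.coe_mk] at t2
      simp only [Pi.sub_apply, smul_sub]
      rw [integral_sub i1 i2, inner_sub_left, inner_zero_left, sub_eq_zero,
        real_inner_comm, ← integral_inner i1, real_inner_comm, ← integral_inner i2]
      simpa only [real_inner_smul_right, real_inner_comm, mul_comm] using t2
  filter_upwards [key] with z hz
  exact sub_eq_zero.1 hz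

/-- A function orthogonal to the range of a translation-covariant operator on test functions which
has a convolution inverse vanishes. -/
theorem ae_eq_zero_of_forall_integral_mul_eq_zero {P P' : ℝ≥0∞}
    (hpq : P.toReal.HolderConjugate P'.toReal) {T : Test d → ST d → ℝ} {κ : ST d → ℝ}
    (hκ : Integrable κ) (hTm : ∀ φ, Measurable (T φ)) (hT : ∀ φ, MemLp (T φ) P')
    (htr : ∀ φ y, ∃ φ', T φ' = fun z => T φ (z - y))
    (hrep : ∀ φ, (fun z => ∫ y, κ y * T φ (z - y)) =ᵐ[volume] φ) {g : ST d → ℝ} (hg : MemLp g P)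
    (h0 : ∀ φ, ∫ z, g z * T φ z = 0) : g =ᵐ[volume] 0 := by
  obtain ⟨hP, hPt⟩ := ne_zero_ne_top_of_holder hpq
  obtain ⟨hP', hPt'⟩ := ne_zero_ne_top_of_holder hpq.symm
  have hP1 : 1 ≤ P := by
    rw [← ENNReal.ofReal_toReal hPt]
    exact ENNReal.one_le_ofReal.2 hpq.lt.le
  refine ae_eq_zero_of_integral_contDiff_smul_eq_zero (hg.locallyIntegrable hP1) fun ψ hψ hc => ?_
  set φ : Test d := ⟨ψ, hψ, hc, by simp⟩ with hφ
  have hmeas : AEStronglyMeasurable (fun q : ST d × ST d => κ q.1 * (g q.2 * T φ (q.2 - q.1)))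
      (volume.prod volume) := by
    refine hκ.1.comp_fst.mul (hg.1.comp_snd.mul ?_)
    exact ((hTm φ).comp (by fun_prop)).aestronglyMeasurable
  have hint : Integrable (fun q : ST d × ST d => κ q.1 * (g q.2 * T φ (q.2 - q.1)))
      (volume.prod volume) := by
    refine ⟨hmeas, ?_⟩
    rw [HasFiniteIntegral, lintegral_prod _ hmeas.enorm]
    set A := (∫⁻ z, ‖g z‖ₑ ^ P.toReal) ^ (1 / P.toReal) *
      (∫⁻ z, ‖T φ z‖ₑ ^ P'.toReal) ^ (1 / P'.toReal)
    have hA : A ≠ ⊤ := ENNReal.mul_ne_top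
      (ENNReal.rpow_ne_top_of_nonneg (by positivity) (lintegral_rpow_ne_top hP hPt hg))
      (ENNReal.rpow_ne_top_of_nonneg (by positivity) (lintegral_rpow_ne_top hP' hPt' (hT φ)))
    have hle : ∀ y, ∫⁻ z, ‖κ y * (g z * T φ (z - y))‖ₑ ≤ ‖κ y‖ₑ * A := by
      intro y
      simp only [enorm_mul]
      have hm : AEMeasurable fun z => ‖g z‖ₑ * ‖T φ (z - y)‖ₑ := by
        have := hTm φ; have := hg.1.enorm; fun_prop
      rw [lintegral_const_mul'' _ hm]
      gcongr
      refine (ENNReal.lintegral_mul_le_Lp_mul_Lq volume hpq hg.1.enorm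
        (by have := hTm φ; fun_prop)).trans (le_of_eq ?_)
      rw [lintegral_sub_right_eq_self (fun z => ‖T φ z‖ₑ ^ P'.toReal) y]
    refine (lintegral_mono hle).trans_lt ?_
    rw [lintegral_mul_const' _ _ hA]
    exact ENNReal.mul_lt_top hκ.2 hA.lt_top
  -- The test function is written as κ * Tψ; by Fubini the pairing becomes an average of pairings of
  -- g with translates of Tψ, which are again of the form Tφ' and give 0.
  calc ∫ z, ψ z • g z = ∫ z, ∫ y, κ y * (g z * T φ (z - y)) := by
        refine integral_congr_ae ?_
        filter_upwards [hrep φ] with z hz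
        have hz' : ∫ y, κ y * T φ (z - y) = ψ z := by rw [hz]; simp [hφ]
        rw [← hz', smul_eq_mul, mul_comm, ← integral_const_mul]
        congr 1; ext y; ring
    _ = ∫ y, ∫ z, κ y * (g z * T φ (z - y)) := (integral_integral_swap hint).symm
    _ = 0 := by
        refine integral_eq_zero_of_ae (Eventually.of_forall fun y => ?_)
        obtain ⟨φ', hφ'⟩ := htr φ y
        have := h0 φ'
        rw [hφ'] at this
        simp [integral_const_mul, this]
end

/-! ### Bounded continuous representatives for p > d + 1 -/

section
variable {d : ℕ} {α lam : ℝ} {P P' : ℝ≥0∞} {s : ℝ}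

theorem Adm.integrable_pot_of_lintegral_ne_top (hpq : P.toReal.HolderConjugate P'.toReal)
    (hK : ∫⁻ z : ST d, ‖potKernel α lam s z‖ₑ ^ P'.toReal ≠ ⊤) {f : ST d → ℝ} (hf : MemLp f P)
    (z : ST d) : Integrable (fun w => potKernel α lam s (z - w) * f w) ∧
      ‖pot α lam s f z‖ₑ ≤ (∫⁻ z : ST d, ‖potKernel α lam s z‖ₑ ^ P'.toReal) ^ (1 / P'.toReal) *
        eLpNorm f P volume := by
  obtain ⟨hP, hPt⟩ := ne_zero_ne_top_of_holder hpq
  have hm := measurable_potKernel (d := d) α lam s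
  have hle : ∫⁻ w, ‖potKernel α lam s (z - w) * f w‖ₑ ≤
      (∫⁻ z : ST d, ‖potKernel α lam s z‖ₑ ^ P'.toReal) ^ (1 / P'.toReal) *
        eLpNorm f P volume := by
    simp only [enorm_mul]
    refine (ENNReal.lintegral_mul_le_Lp_mul_Lq volume hpq.symm (by fun_prop) hf.1.enorm).trans
      (le_of_eq ?_)
    rw [eLpNorm_eq_lintegral_rpow_enorm_toReal hP hPt,
      lintegral_sub_left_eq_self (fun w => ‖potKernel α lam s w‖ₑ ^ P'.toReal) z]
  refine ⟨⟨(hm.comp (by fun_prop)).aestronglyMeasurable.mul hf.1, hle.trans_lt ?_⟩,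
    (enorm_integral_le_lintegral_enorm _).trans hle⟩
  exact ENNReal.mul_lt_top (ENNReal.rpow_lt_top_of_nonneg (by positivity) hK) hf.2

theorem Adm.continuous_pot_of_bounded (H : Adm d α lam) (hs : 0 < s) {g : ST d → ℝ}
    (hg : Continuous g) {C : ℝ} (hC : ∀ z, ‖g z‖ ≤ C) : Continuous (pot α lam s g) := by
  have e : pot α lam s g = fun z => ∫ y, potKernel α lam s y * g (z - y) := by
    ext z
    rw [pot, ← integral_sub_left_eq_self _ volume z]
    simp only [sub_sub_cancel]
  rw [e]
  refine continuous_of_dominated (bound := fun y => ‖potKernel α lam s y‖ * C) (fun z => ?_)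
    (fun z => Eventually.of_forall fun y => ?_) ((H.integrable_potKernel hs).norm.mul_const C)
    (Eventually.of_forall fun y => by fun_prop)
  · exact (measurable_potKernel α lam s).aestronglyMeasurable.mul
      (hg.comp (by fun_prop)).aestronglyMeasurable
  · rw [norm_mul]
    gcongr
    exact hC _

/-- Hölder with the kernel in L^{p'} controls the sup norm of the potential by the L^p norm of f, so
approximation of f by compactly supported continuous functions yields uniform convergence of
continuous functions. -/
theorem Adm.continuous_pot (hpq : P.toReal.HolderConjugate P'.toReal) (H : Adm d α lam)
    (hs : 0 < s) (hK : ∫⁻ z : ST d, ‖potKernel α lam s z‖ₑ ^ P'.toReal ≠ ⊤) {f : ST d → ℝ}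
    (hf : MemLp f P) : Continuous (pot α lam s f) := by
  obtain ⟨hP, hPt⟩ := ne_zero_ne_top_of_holder hpq
  set A := (∫⁻ z : ST d, ‖potKernel α lam s z‖ₑ ^ P'.toReal) ^ (1 / P'.toReal)
  have hA : A ≠ ⊤ := ENNReal.rpow_ne_top_of_nonneg (by positivity) hK
  refine continuous_of_uniform_approx_of_continuous fun u hu => ?_
  obtain ⟨ε, hε, hu⟩ := Metric.mem_uniformity_dist.1 hu
  have hε' : ENNReal.ofReal (ε / 2 / (A.toReal + 1)) ≠ 0 := by
    simp only [ne_eq, ENNReal.ofReal_eq_zero, not_le]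
    have : 0 ≤ A.toReal := ENNReal.toReal_nonneg
    positivity
  obtain ⟨g, hgc, hgn, hg, hgL⟩ := hf.exists_hasCompactSupport_eLpNorm_sub_le hPt hε'
  obtain ⟨C, hC⟩ := hgc.exists_bound_of_continuous hg
  refine ⟨pot α lam s g, H.continuous_pot_of_bounded hs hg hC, fun z => hu ?_⟩
  have h1 := Adm.integrable_pot_of_lintegral_ne_top hpq hK hf z
  have h2 := Adm.integrable_pot_of_lintegral_ne_top hpq hK hgL z
  have h3 := (Adm.integrable_pot_of_lintegral_ne_top hpq hK (hf.sub hgL) z).2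
  have e : pot α lam s (f - g) z = pot α lam s f z - pot α lam s g z := by
    simp only [pot]
    rw [← integral_sub h1.1 h2.1]
    simp only [Pi.sub_apply, mul_sub]
  rw [e] at h3
  have h4 := h3.trans (mul_le_mul_right hgn _)
  rw [dist_eq_norm]
  have h5 := ENNReal.toReal_mono (ENNReal.mul_ne_top hA ENNReal.ofReal_ne_top) h4
  rw [toReal_enorm, ENNReal.toReal_mul, ENNReal.toReal_ofReal (by positivity)] at h5
  refine h5.trans_lt ?_
  have : 0 ≤ A.toReal := ENNReal.toReal_nonneg
  rw [mul_div_assoc', div_lt_iff₀ (by linarith)]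
  nlinarith

/-- The two orders sum to 1, so they factor the resolvent, and the larger share exceeds 1/α, the
threshold at which one spatial derivative can be taken. -/
theorem ordU_pos (hα : 1 < α) (hP : 1 < P.toReal) : 1 / α < ordU α P ∧ 0 < ordF α P ∧
    ordU α P + ordF α P = 1 := by
  have h1 : 0 < 1 - 1 / α := by
    rw [sub_pos, div_lt_one (by linarith)]; exact hα
  have h2 : 0 < 1 - 1 / P.toReal := by
    rw [sub_pos, div_lt_one (by linarith)]; exact hP
  have h3 : 0 < 1 / P.toReal := by positivity
  unfold ordU ordF
  refine ⟨by nlinarith [mul_pos h1 h3], mul_pos h1 h2, by ring⟩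

theorem Adm.lintegral_potKernel_ordU_ne_top (hpq : P.toReal.HolderConjugate P'.toReal)
    (H : Adm d α lam) (hp : (d : ℝ) + 1 < P.toReal) :
    ∫⁻ z : ST d, ‖potKernel α lam (ordU α P) z‖ₑ ^ P'.toReal ≠ ⊤ := by
  have hα := H.pos
  have hs := (ordU_pos (P := P) H.one_lt hpq.lt).1
  refine lintegral_potKernel_rpow_ne_top H.d_pos hα H.lt_two ((by positivity : 0 < 1 / α).trans hs)
    H.lam_pos hpq.symm.lt.le ?_
  rw [hpq.conjugate_eq, ordU]
  have h1 : 0 < P.toReal - 1 := hpq.sub_one_pos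
  have h0 := hpq.pos
  set p := P.toReal
  -- The margin in the integrability condition at t = 0; its sign is that of p - 1 - d.
  have : (1 / α + (1 - 1 / α) * (1 / p) - 1) * (p / (p - 1)) - d / α * (p / (p - 1) - 1) - -1 =
      (p - 1 - d) / (α * (p - 1)) := by
    field_simp
    ring
  have h2 : 0 < (p - 1 - d) / (α * (p - 1)) := div_pos (by linarith) (by positivity)
  linarith

/-- For `p > d + 1` the potential of order `ordU α p` maps `L^p` to bounded continuous functions. -/
theorem Adm.exists_pot_bcf [Fact (1 ≤ P)] (hpq : P.toReal.HolderConjugate P'.toReal)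
    (H : Adm d α lam) (hp : (d : ℝ) + 1 < P.toReal) :
    ∃ (Φ : LL d P → ST d →ᵇ ℝ), (∀ w z, Φ w z = pot α lam (ordU α P) w z) ∧ Continuous Φ := by
  have hα := H.pos
  have hs := (ordU_pos (P := P) H.one_lt hpq.lt).1
  have hs0 : 0 < ordU α P := (by positivity : 0 < 1 / α).trans hs
  have hK := H.lintegral_potKernel_ordU_ne_top hpq hp
  set A := (∫⁻ z : ST d, ‖potKernel α lam (ordU α P) z‖ₑ ^ P'.toReal) ^ (1 / P'.toReal)
  have hA : A ≠ ⊤ := ENNReal.rpow_ne_top_of_nonneg (by positivity) hK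
  have hb : ∀ (w : LL d P) (z : ST d), ‖pot α lam (ordU α P) w z‖ ≤ A.toReal * ‖w‖ := by
    intro w z
    have := (Adm.integrable_pot_of_lintegral_ne_top hpq hK (Lp.memLp w) z).2
    have := ENNReal.toReal_mono (ENNReal.mul_ne_top hA (Lp.eLpNorm_ne_top w)) this
    rwa [toReal_enorm, ENNReal.toReal_mul, ← Lp.norm_def] at this
  refine ⟨fun w => BoundedContinuousFunction.ofNormedAddCommGroup (pot α lam (ordU α P) w)
    (H.continuous_pot hpq hs0 hK (Lp.memLp w)) _ (hb w), fun _ _ => rfl, ?_⟩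
  refine (LipschitzWith.of_dist_le_mul (K := A.toNNReal) fun w₁ w₂ => ?_).continuous
  rw [BoundedContinuousFunction.dist_le (by positivity)]
  intro z
  have e : pot α lam (ordU α P) (w₁ - w₂ : LL d P) z =
      pot α lam (ordU α P) w₁ z - pot α lam (ordU α P) w₂ z := by
    rw [pot_congr (Lp.coeFn_sub w₁ w₂)]
    simp only [pot]
    rw [← integral_sub (Adm.integrable_pot_of_lintegral_ne_top hpq hK (Lp.memLp w₁) z).1
      (Adm.integrable_pot_of_lintegral_ne_top hpq hK (Lp.memLp w₂) z).1]
    simp only [Pi.sub_apply, mul_sub]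
  have := hb (w₁ - w₂) z
  rw [e] at this
  rw [dist_eq_norm, dist_eq_norm]
  exact this
end

/-! ### The fractional Laplacian as a singular integral -/

section
variable {d : ℕ} {α : ℝ}

/-- In polar coordinates the integrand is r^{1-α} near 0 and r^{-1-α} at infinity; α < 2 and α > 0
are used respectively. -/
theorem integrable_norm_rpow_mul_min (hd : 0 < d) (hα : 0 < α) (hα2 : α < 2) :
    Integrable fun y : Sp d => ‖y‖ ^ (-(d + α)) * min 1 (‖y‖ ^ 2) := by
  have : Nontrivial (Sp d) := by
    have : Nonempty (Fin d) := ⟨⟨0, hd⟩⟩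
    infer_instance
  have hpow : ∀ r : ℝ, 0 < r → r ^ (d - 1) * r ^ (-(d + α)) = r ^ (-1 - α) := by
    intro r hr
    rw [← Real.rpow_natCast, ← Real.rpow_add hr, Nat.cast_sub hd]
    congr 1; push_cast; ring
  refine (integrable_fun_norm_addHaar volume
    (f := fun r : ℝ => r ^ (-(d + α)) * min 1 (r ^ 2))).2 ?_
  simp only [finrank_euclideanSpace, Fintype.card_fin, smul_eq_mul]
  rw [← Set.Ioc_union_Ioi_eq_Ioi (zero_le_one' ℝ)]
  refine IntegrableOn.union ?_ ?_
  · have h : IntegrableOn (fun r : ℝ => r ^ (1 - α)) (Set.Ioc 0 1) := by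
      rw [← intervalIntegrable_iff_integrableOn_Ioc_of_le zero_le_one]
      exact intervalIntegral.intervalIntegrable_rpow' (by linarith)
    refine h.congr_fun (fun r hr => ?_) measurableSet_Ioc
    dsimp only
    rw [← mul_assoc, hpow r hr.1, min_eq_right (pow_le_one₀ hr.1.le hr.2), ← Real.rpow_natCast r 2,
      ← Real.rpow_add hr.1]
    congr 1; push_cast; ring
  · refine (integrableOn_Ioi_rpow_of_lt (a := -1 - α) (by linarith) zero_lt_one).congr_fun
      (fun r (hr : 1 < r) => ?_) measurableSet_Ioi
    dsimp only
    rw [← mul_assoc, hpow r (by linarith), min_eq_left (one_le_pow₀ hr.le), mul_one]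

/-- The symmetric second difference in space. -/
def secDiff (φ : ST d → ℝ) (z : ST d) (y : Sp d) : ℝ := 2 * φ z - φ (z + (0, y)) - φ (z - (0, y))

/-- The singular integral defining the fractional Laplacian, up to a constant factor. -/
def sing (α : ℝ) (φ : ST d → ℝ) (z : ST d) : ℝ := ∫ y : Sp d, ‖y‖ ^ (-(d + α)) * secDiff φ z y

theorem exists_eq_zero_of_hasCompactSupport {φ : ST d → ℝ} (hc : HasCompactSupport φ) :
    ∃ R : ℝ, 0 < R ∧ ∀ t x, (R < |t| ∨ R < ‖x‖) → φ (t, x) = 0 := by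
  obtain ⟨R, hR⟩ := hc.isCompact.isBounded.subset_closedBall (0 : ST d)
  refine ⟨max R 1, by positivity, fun t x h => image_eq_zero_of_notMem_tsupport fun hm => ?_⟩
  have := mem_closedBall_zero_iff.1 (hR hm)
  have h1 : |t| ≤ R := (norm_fst_le (t, x)).trans this
  have h2 : ‖x‖ ≤ R := (norm_snd_le (t, x)).trans this
  have := le_max_left R 1
  rcases h with h | h <;> linarith

theorem exists_secDiff_le {φ : ST d → ℝ} (hφ : ContDiff ℝ ∞ φ) (hc : HasCompactSupport φ) :
    ∃ C : ℝ, 0 < C ∧ ∀ z y, |secDiff φ z y| ≤ C * min 1 (‖y‖ ^ 2) := by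
  obtain ⟨L, hL⟩ := ContDiff.lipschitzWith_of_hasCompactSupport (𝕂 := ℝ) (hc.fderiv (𝕜 := ℝ))
    (hφ.fderiv_right (m := 1) (by norm_cast)) one_ne_zero
  obtain ⟨M, hM⟩ := hc.exists_bound_of_continuous hφ.continuous
  have hM0 : 0 ≤ M := (norm_nonneg _).trans (hM 0)
  have hd1 : Differentiable ℝ φ := hφ.differentiable (by simp)
  refine ⟨4 * M + L + 1, by positivity, fun z y => ?_⟩
  have h1 : |secDiff φ z y| ≤ 4 * M := by
    have a := hM z; have b := hM (z + (0, y)); have c := hM (z - (0, y))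
    rw [Real.norm_eq_abs, abs_le] at a b c
    rw [secDiff, abs_le]
    constructor <;> linarith
  have h2 : |secDiff φ z y| ≤ L * ‖y‖ ^ 2 := by
    set v : ST d := (0, y)
    have hv : ‖v‖ = ‖y‖ := by simp [v]
    -- The second difference is the increment of u ↦ φ(u + v) - φ(u) from z to z - v, and the
    -- derivative of this map is bounded by L|v| because the derivative of φ is Lipschitz.
    have := Convex.norm_image_sub_le_of_norm_hasFDerivWithin_le (𝕜 := ℝ)
      (f := fun u => φ (u + v) - φ u) (f' := fun u => fderiv ℝ φ (u + v) - fderiv ℝ φ u)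
      (s := Set.univ) (C := L * ‖v‖) (x := z) (y := z - v) (fun u _ => ?_) (fun u _ => ?_)
      convex_univ (Set.mem_univ _) (Set.mem_univ _)
    · rw [sub_add_cancel, sub_sub_cancel_left, norm_neg, mul_assoc, ← sq, hv] at this
      refine le_trans (le_of_eq ?_) this
      rw [secDiff, Real.norm_eq_abs]
      congr 1; ring
    · exact (((hasFDerivAt_comp_add_right v).2 (hd1 (u + v)).hasFDerivAt).sub (hd1 u).hasFDerivAt).hasFDerivWithinAt
    · simpa [dist_eq_norm] using hL.dist_le_mul (u + v) u
  rcases le_total 1 (‖y‖ ^ 2) with h | h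
  · rw [min_eq_left h]; have : (0 : ℝ) ≤ L := L.2; linarith
  · rw [min_eq_right h]; nlinarith [sq_nonneg ‖y‖]

theorem continuous_secDiff {φ : ST d → ℝ} (hφ : Continuous φ) :
    Continuous fun q : ST d × Sp d => secDiff φ q.1 q.2 := by
  unfold secDiff
  fun_prop

/-- As a function of x the second difference lives in three balls, centred at 0, y and -y, of total
volume independent of y. This gives an L^1 bound in x uniform in t, although the singular integral
itself need not have compact support in space. -/
theorem exists_lintegral_secDiff_le {φ : ST d → ℝ} (hφ : ContDiff ℝ ∞ φ)
    (hc : HasCompactSupport φ) :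
    ∃ C : ℝ, 0 < C ∧ ∀ t y, ∫⁻ x, ‖secDiff φ (t, x) y‖ₑ ≤ ENNReal.ofReal (C * min 1 (‖y‖ ^ 2)) := by
  obtain ⟨C, hC, hb⟩ := exists_secDiff_le hφ hc
  obtain ⟨R, hR, h0⟩ := exists_eq_zero_of_hasCompactSupport hc
  set V := volume (Metric.closedBall (0 : Sp d) R)
  have hV : V ≠ ⊤ := measure_closedBall_lt_top.ne
  refine ⟨3 * (V.toReal + 1) * C, by positivity, fun t y => ?_⟩
  set U : Set (Sp d) := Metric.closedBall 0 R ∪ (Metric.closedBall (-y) R ∪ Metric.closedBall y R)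
  have hU : MeasurableSet U := Metric.isClosed_closedBall.measurableSet.union
    (Metric.isClosed_closedBall.measurableSet.union Metric.isClosed_closedBall.measurableSet)
  have hUV : volume U ≤ 3 * V := by
    refine (measure_union_le _ _).trans ((add_le_add_right (measure_union_le _ _) _).trans ?_)
    rw [Measure.addHaar_closedBall_center volume (-y), Measure.addHaar_closedBall_center volume y]
    apply le_of_eq; ring
  calc ∫⁻ x, ‖secDiff φ (t, x) y‖ₑ
      ≤ ∫⁻ x, U.indicator (fun _ => ENNReal.ofReal (C * min 1 (‖y‖ ^ 2))) x := by
        refine lintegral_mono fun x => ?_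
        by_cases hx : x ∈ U
        · rw [Set.indicator_of_mem hx, ← ofReal_norm]
          exact ENNReal.ofReal_le_ofReal (hb _ _)
        · simp only [U, Set.mem_union, Metric.mem_closedBall, dist_eq_norm, not_or, not_le, sub_zero,
            sub_neg_eq_add] at hx
          have e1 := h0 t x (Or.inr hx.1)
          have e2 := h0 t (x + y) (Or.inr hx.2.1)
          have e3 := h0 t (x - y) (Or.inr hx.2.2)
          simp [secDiff, e1, e2, e3]
    _ = ENNReal.ofReal (C * min 1 (‖y‖ ^ 2)) * volume U := by
        rw [lintegral_indicator hU, setLIntegral_const]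
    _ ≤ ENNReal.ofReal (C * min 1 (‖y‖ ^ 2)) * ENNReal.ofReal (3 * (V.toReal + 1)) := by
        gcongr
        refine hUV.trans ?_
        rw [ENNReal.ofReal_mul (by norm_num), ENNReal.ofReal_add (by positivity) zero_le_one,
          ENNReal.ofReal_toReal hV]
        simp only [ENNReal.ofReal_ofNat]
        gcongr
        exact le_self_add
    _ = _ := by
        rw [← ENNReal.ofReal_mul (by positivity)]
        congr 1; ring

theorem integrable_sing_integrand (hd : 0 < d) (hα : 0 < α) (hα2 : α < 2) {φ : ST d → ℝ}
    (hφ : ContDiff ℝ ∞ φ) (hc : HasCompactSupport φ) (z : ST d) :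
    Integrable fun y : Sp d => ‖y‖ ^ (-(d + α)) * secDiff φ z y := by
  obtain ⟨C, hC, hb⟩ := exists_secDiff_le hφ hc
  refine ((integrable_norm_rpow_mul_min hd hα hα2).const_mul C).mono' ?_
    (Eventually.of_forall fun y => ?_)
  · have := (continuous_secDiff hφ.continuous).measurable
    exact (by fun_prop : Measurable fun y : Sp d =>
      ‖y‖ ^ (-(d + α)) * secDiff φ z y).aestronglyMeasurable
  · rw [norm_mul, Real.norm_of_nonneg (by positivity), mul_left_comm]
    gcongr
    exact hb _ _

theorem continuous_sing (hd : 0 < d) (hα : 0 < α) (hα2 : α < 2) {φ : ST d → ℝ}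
    (hφ : ContDiff ℝ ∞ φ) (hc : HasCompactSupport φ) : Continuous (sing α φ) := by
  obtain ⟨C, hC, hb⟩ := exists_secDiff_le hφ hc
  refine continuous_of_dominated (fun z => (integrable_sing_integrand hd hα hα2 hφ hc z).1)
    (fun z => Eventually.of_forall fun y => ?_)
    ((integrable_norm_rpow_mul_min hd hα hα2).const_mul C) (Eventually.of_forall fun y => ?_)
  · rw [norm_mul, Real.norm_of_nonneg (by positivity), mul_left_comm]
    gcongr
    exact hb _ _
  · have := continuous_secDiff hφ.continuous
    fun_prop

theorem exists_sing_le (hd : 0 < d) (hα : 0 < α) (hα2 : α < 2) {φ : ST d → ℝ}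
    (hφ : ContDiff ℝ ∞ φ) (hc : HasCompactSupport φ) : ∃ C : ℝ, ∀ z, |sing α φ z| ≤ C := by
  obtain ⟨C, hC, hb⟩ := exists_secDiff_le hφ hc
  refine ⟨∫ y : Sp d, C * (‖y‖ ^ (-(d + α)) * min 1 (‖y‖ ^ 2)), fun z => ?_⟩
  rw [← Real.norm_eq_abs]
  refine norm_integral_le_of_norm_le ((integrable_norm_rpow_mul_min hd hα hα2).const_mul C)
    (Eventually.of_forall fun y => ?_)
  rw [norm_mul, Real.norm_of_nonneg (by positivity), mul_left_comm]
  gcongr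
  exact hb _ _

theorem integrable_prod_sing (hd : 0 < d) (hα : 0 < α) (hα2 : α < 2) {φ : ST d → ℝ}
    (hφ : ContDiff ℝ ∞ φ) (hc : HasCompactSupport φ) :
    ∃ C : ℝ≥0∞, C ≠ ⊤ ∧ ∀ t,
      Integrable (fun q : Sp d × Sp d => ‖q.2‖ ^ (-(d + α)) * secDiff φ (t, q.1) q.2)
        (volume.prod volume) ∧ ∫⁻ x, ‖sing α φ (t, x)‖ₑ ≤ C := by
  obtain ⟨C, hC, hb⟩ := exists_lintegral_secDiff_le hφ hc
  have hW := (integrable_norm_rpow_mul_min hd hα hα2).const_mul C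
  have hm := (continuous_secDiff hφ.continuous).measurable
  have hmq : ∀ t, Measurable fun q : Sp d × Sp d => ‖q.2‖ ^ (-(d + α)) * secDiff φ (t, q.1) q.2 :=
    fun t => by
      have : Measurable fun q : Sp d × Sp d => secDiff φ (t, q.1) q.2 :=
        hm.comp (by fun_prop : Measurable fun q : Sp d × Sp d => ((t, q.1), q.2))
      fun_prop
  have hle : ∀ t, ∫⁻ x, ∫⁻ y, ‖‖y‖ ^ (-(d + α)) * secDiff φ (t, x) y‖ₑ ≤
      ∫⁻ y : Sp d, ‖C * (‖y‖ ^ (-(d + α)) * min 1 (‖y‖ ^ 2))‖ₑ := by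
    intro t
    rw [lintegral_lintegral_swap (hmq t).enorm.aemeasurable]
    refine lintegral_mono fun y => ?_
    simp only [enorm_mul]
    have hmx : Measurable fun x : Sp d => secDiff φ (t, x) y :=
      hm.comp (by fun_prop : Measurable fun x : Sp d => ((t, x), y))
    rw [lintegral_const_mul _ hmx.enorm, mul_left_comm, ← enorm_mul C]
    gcongr
    refine (hb t y).trans (le_of_eq ?_)
    rw [Real.enorm_of_nonneg (by positivity)]
  refine ⟨_, hW.2.ne, fun t => ⟨⟨(hmq t).aestronglyMeasurable, ?_⟩, ?_⟩⟩
  · rw [HasFiniteIntegral, lintegral_prod _ (hmq t).enorm.aemeasurable]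
    exact (hle t).trans_lt hW.2
  · exact (lintegral_mono fun x => enorm_integral_le_lintegral_enorm _).trans (hle t)

theorem sing_eq_zero {φ : ST d → ℝ} {R : ℝ} (h0 : ∀ t x, (R < |t| ∨ R < ‖x‖) → φ (t, x) = 0)
    {t : ℝ} (ht : R < |t|) (x : Sp d) : sing α φ (t, x) = 0 := by
  refine integral_eq_zero_of_ae (Eventually.of_forall fun y => ?_)
  simp [secDiff, h0 t _ (Or.inl ht)]

/-- The Fourier symbol of the singular integral. -/
def singSymbol (α : ℝ) (ξ : Sp d) : ℝ :=
  ∫ y : Sp d, ‖y‖ ^ (-(d + α)) * (2 - 2 * Real.cos (2 * Real.pi * ⟪y, ξ⟫_ℝ))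

/-- The change of variables y ↦ c y: the factor c^{d+α} from the singular weight against c^{-d} from
Lebesgue measure leaves c^α. -/
theorem singSymbol_smul {c : ℝ} (hc : 0 < c) (ξ : Sp d) :
    singSymbol α (c • ξ) = c ^ α * singSymbol α ξ := by
  unfold singSymbol
  have h := Measure.integral_comp_smul (volume : Measure (Sp d)) (fun y : Sp d => ‖y‖ ^ (-(d + α)) *
    (2 - 2 * Real.cos (2 * Real.pi * ⟪y, ξ⟫_ℝ))) c
  have e : ∀ y : Sp d, ‖c • y‖ ^ (-(d + α)) * (2 - 2 * Real.cos (2 * Real.pi * ⟪c • y, ξ⟫_ℝ)) =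
      c ^ (-(d + α)) * (‖y‖ ^ (-(d + α)) * (2 - 2 * Real.cos (2 * Real.pi * ⟪y, c • ξ⟫_ℝ))) := by
    intro y
    rw [norm_smul, Real.norm_of_nonneg hc.le, Real.mul_rpow hc.le (norm_nonneg _),
      real_inner_smul_left, real_inner_smul_right, mul_assoc]
  simp_rw [e] at h
  rw [integral_const_mul, finrank_euclideanSpace, Fintype.card_fin, smul_eq_mul,
    abs_of_pos (by positivity)] at h
  have h1 : c ^ (d + α) * c ^ (-(d + α)) = 1 := by
    rw [← Real.rpow_add hc, add_neg_cancel, Real.rpow_zero]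
  calc _ = c ^ (d + α) * (c ^ (-(d + α)) * ∫ y : Sp d, ‖y‖ ^ (-(d + α)) *
        (2 - 2 * Real.cos (2 * Real.pi * ⟪y, c • ξ⟫_ℝ))) := by rw [← mul_assoc, h1, one_mul]
    _ = _ := by
        rw [h, ← mul_assoc, Real.rpow_add hc, Real.rpow_natCast]
        congr 1
        field_simp

/-- Vectors of equal length are exchanged by the reflection in the hyperplane orthogonal to their
difference, an isometry under which the integral is invariant. -/
theorem singSymbol_eq_of_norm_eq {ξ η : Sp d} (h : ‖ξ‖ = ‖η‖) :
    singSymbol α ξ = singSymbol α η := by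
  set A : Sp d ≃ₗᵢ[ℝ] Sp d := (ℝ ∙ (ξ - η))ᗮ.reflection
  have hA : A ξ = η := Submodule.reflection_sub h
  unfold singSymbol
  symm
  rw [← A.measurePreserving.integral_comp A.toHomeomorph.measurableEmbedding]
  congr 1; ext y
  rw [← hA, A.norm_map, A.inner_map_map]

/-- Homogeneity and rotation invariance leave only the constant J, the value at a unit vector. It is
positive since the integrand is nonnegative and not identically zero, as y = e₀/2 shows. -/
theorem exists_singSymbol_eq (hd : 0 < d) (hα : 0 < α) (hα2 : α < 2) :
    ∃ J : ℝ, 0 < J ∧ ∀ ξ : Sp d, singSymbol α ξ = J * ‖ξ‖ ^ α := by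
  set e₀ : Sp d := EuclideanSpace.single ⟨0, hd⟩ (1 : ℝ)
  have he : ‖e₀‖ = 1 := by simp [e₀]
  have hnn : ∀ y : Sp d, 0 ≤ ‖y‖ ^ (-(d + α)) * (2 - 2 * Real.cos (2 * Real.pi * ⟪y, e₀⟫_ℝ)) := by
    intro y
    have := Real.cos_le_one (2 * Real.pi * ⟪y, e₀⟫_ℝ)
    have : 0 ≤ 2 - 2 * Real.cos (2 * Real.pi * ⟪y, e₀⟫_ℝ) := by linarith
    positivity
  have hint : Integrable fun y : Sp d =>
      ‖y‖ ^ (-(d + α)) * (2 - 2 * Real.cos (2 * Real.pi * ⟪y, e₀⟫_ℝ)) := by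
    refine ((integrable_norm_rpow_mul_min hd hα hα2).const_mul (4 + (2 * Real.pi) ^ 2)).mono' ?_
      (Eventually.of_forall fun y => ?_)
    · exact (by fun_prop : Measurable fun y : Sp d => ‖y‖ ^ (-(d + α)) *
        (2 - 2 * Real.cos (2 * Real.pi * ⟪y, e₀⟫_ℝ))).aestronglyMeasurable
    · rw [Real.norm_of_nonneg (hnn y), mul_left_comm]
      gcongr
      have h1 := Real.neg_one_le_cos (2 * Real.pi * ⟪y, e₀⟫_ℝ)
      have h2 := Real.one_sub_sq_div_two_le_cos (x := 2 * Real.pi * ⟪y, e₀⟫_ℝ)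
      have h3 : ⟪y, e₀⟫_ℝ ^ 2 ≤ ‖y‖ ^ 2 := by
        rw [sq_le_sq, abs_norm]
        simpa [he] using abs_real_inner_le_norm y e₀
      have h4 : (2 * Real.pi) ^ 2 * ⟪y, e₀⟫_ℝ ^ 2 ≤ (2 * Real.pi) ^ 2 * ‖y‖ ^ 2 := by gcongr
      have h5 := sq_nonneg (2 * Real.pi)
      rcases le_total 1 (‖y‖ ^ 2) with h | h
      · rw [min_eq_left h]; linarith
      · rw [min_eq_right h]; nlinarith [sq_nonneg ‖y‖]
  have hJ : 0 < singSymbol α e₀ := by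
    refine (integral_pos_iff_support_of_nonneg hnn hint).2 ?_
    have hU : IsOpen {y : Sp d | Real.cos (2 * Real.pi * ⟪y, e₀⟫_ℝ) ≠ 1} :=
      isOpen_ne_fun (by fun_prop) continuous_const
    have hne : {y : Sp d | Real.cos (2 * Real.pi * ⟪y, e₀⟫_ℝ) ≠ 1}.Nonempty := by
      refine ⟨(2 : ℝ)⁻¹ • e₀, ?_⟩
      have : 2 * Real.pi * ⟪(2 : ℝ)⁻¹ • e₀, e₀⟫_ℝ = Real.pi := by
        rw [real_inner_smul_left, real_inner_self_eq_norm_sq, he]; ring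
      simp only [Set.mem_ofPred_eq, this, Real.cos_pi]
      norm_num
    refine (hU.measure_pos volume hne).trans_le (measure_mono fun y hy => ?_)
    simp only [Set.mem_ofPred_eq] at hy
    have hy0 : y ≠ 0 := by
      rintro rfl; simp at hy
    rw [Function.mem_support]
    refine mul_ne_zero (Real.rpow_pos_of_pos (norm_pos_iff.2 hy0) _).ne' fun h => hy ?_
    linarith
  refine ⟨singSymbol α e₀, hJ, fun ξ => ?_⟩
  rcases eq_or_ne ξ 0 with rfl | hξ
  · simp [singSymbol, Real.zero_rpow hα.ne']
  · have hn : 0 < ‖ξ‖ := norm_pos_iff.2 hξ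
    rw [← singSymbol_eq_of_norm_eq (ξ := ‖ξ‖ • e₀) (η := ξ) (by simp [norm_smul, he]),
      singSymbol_smul hn, mul_comm]
end

/-! ### Fourier transforms of spatial slices -/

section
variable {d : ℕ} {α : ℝ}

/-- The character `x ↦ e^{-2πi⟨x,ξ⟩}`. -/
def chr (ξ x : Sp d) : ℂ := Real.fourierChar (-⟪x, ξ⟫_ℝ)

theorem norm_chr (ξ x : Sp d) : ‖chr ξ x‖ = 1 := Circle.norm_coe _

theorem continuous_chr (ξ : Sp d) : Continuous (chr ξ) := by
  unfold chr
  exact continuous_subtype_val.comp (Real.continuous_fourierChar.comp (by fun_prop))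

theorem chr_add (ξ x y : Sp d) : chr ξ (x + y) = chr ξ x * chr ξ y := by
  simp [chr, inner_add_left, AddChar.map_add_eq_mul, mul_comm]

theorem chr_add_chr_neg (ξ y : Sp d) :
    chr ξ y + chr ξ (-y) = ((2 * Real.cos (2 * Real.pi * ⟪y, ξ⟫_ℝ) : ℝ) : ℂ) := by
  simp only [chr, Real.fourierChar_apply, inner_neg_left, neg_neg]
  push_cast
  rw [Complex.cos]
  have : -((2 : ℂ) * Real.pi * ⟪y, ξ⟫_ℝ) * Complex.I = 2 * Real.pi * -⟪y, ξ⟫_ℝ * Complex.I := by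
    ring
  rw [this]
  ring

theorem fourier_eq_chr (f : Sp d → ℂ) (ξ : Sp d) : 𝓕 f ξ = ∫ x, chr ξ x * f x := by
  rw [Real.fourier_eq]
  simp [chr, Circle.smul_def]

theorem integrable_chr_mul {f : Sp d → ℂ} (hf : Integrable f) (ξ : Sp d) :
    Integrable fun x => chr ξ x * f x :=
  hf.bdd_mul (c := 1) (continuous_chr ξ).aestronglyMeasurable
    (Eventually.of_forall fun x => (norm_chr ξ x).le)

theorem fourier_comp_add (f : Sp d → ℂ) (y ξ : Sp d) :
    ∫ x, chr ξ x * f (x + y) = chr ξ (-y) * ∫ x, chr ξ x * f x := by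
  rw [← integral_const_mul, ← integral_add_right_eq_self (fun x => chr ξ (-y) * (chr ξ x * f x)) y]
  congr 1; ext x
  rw [← mul_assoc, ← chr_add]
  congr 2; abel

section
variable {φ : ST d → ℝ}

theorem contDiff_slice (hφ : ContDiff ℝ ∞ φ) (t : ℝ) : ContDiff ℝ ∞ fun x : Sp d => φ (t, x) :=
  hφ.comp (by fun_prop)

theorem hasCompactSupport_slice (hc : HasCompactSupport φ) (t : ℝ) :
    HasCompactSupport fun x : Sp d => φ (t, x) := by
  obtain ⟨R, -, h0⟩ := exists_eq_zero_of_hasCompactSupport hc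
  refine HasCompactSupport.intro (isCompact_closedBall (0 : Sp d) R) fun x hx => h0 t x (Or.inr ?_)
  simpa using hx

theorem integrable_slice (hφ : Continuous φ) (hc : HasCompactSupport φ) (t : ℝ) :
    Integrable fun x : Sp d => φ (t, x) :=
  (hφ.comp (by fun_prop : Continuous fun x : Sp d => (t, x))).integrable_of_hasCompactSupport
    (hasCompactSupport_slice hc t)

/-- By Fubini the transform may be taken inside; each shift by ±y becomes a character and the second
difference becomes the factor 2 - 2cos(2π⟨y,ξ⟩). -/
theorem fourier_sing (hd : 0 < d) (hα : 0 < α) (hα2 : α < 2)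
    (hφ : ContDiff ℝ ∞ φ) (hc : HasCompactSupport φ) (t : ℝ) (ξ : Sp d) :
    𝓕 (fun x => (sing α φ (t, x) : ℂ)) ξ =
      (singSymbol α ξ : ℂ) * 𝓕 (fun x => (φ (t, x) : ℂ)) ξ := by
  obtain ⟨C, -, h⟩ := integrable_prod_sing hd hα hα2 hφ hc
  have hφi : Integrable fun x : Sp d => (φ (t, x) : ℂ) := (integrable_slice hφ.continuous hc t).ofReal
  have hi : Integrable (fun q : Sp d × Sp d => chr ξ q.1 *
      ((‖q.2‖ ^ (-(d + α)) * secDiff φ (t, q.1) q.2 : ℝ) : ℂ)) (volume.prod volume) :=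
    (h t).1.ofReal.bdd_mul (c := 1) ((continuous_chr ξ).comp continuous_fst).aestronglyMeasurable
      (Eventually.of_forall fun q => (norm_chr ξ q.1).le)
  rw [fourier_eq_chr, fourier_eq_chr]
  calc ∫ x, chr ξ x * (sing α φ (t, x) : ℂ)
      = ∫ x, ∫ y, chr ξ x * ((‖y‖ ^ (-(d + α)) * secDiff φ (t, x) y : ℝ) : ℂ) := by
        congr 1; ext x
        rw [integral_const_mul, integral_complex_ofReal]
        rfl
    _ = ∫ y, ∫ x, chr ξ x * ((‖y‖ ^ (-(d + α)) * secDiff φ (t, x) y : ℝ) : ℂ) :=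
        integral_integral_swap hi
    _ = ∫ y : Sp d, ((‖y‖ ^ (-(d + α)) * (2 - 2 * Real.cos (2 * Real.pi * ⟪y, ξ⟫_ℝ)) : ℝ) : ℂ) *
          ∫ x, chr ξ x * (φ (t, x) : ℂ) := by
        congr 1; ext y
        have e : ∀ x, chr ξ x * ((‖y‖ ^ (-(d + α)) * secDiff φ (t, x) y : ℝ) : ℂ) =
            ((‖y‖ ^ (-(d + α)) : ℝ) : ℂ) * (2 * (chr ξ x * (φ (t, x) : ℂ)) -
              chr ξ x * (φ (t, x + y) : ℂ) - chr ξ x * (φ (t, x + -y) : ℂ)) := by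
          intro x
          simp only [secDiff, Prod.mk_add_mk, Prod.mk_sub_mk, add_zero, sub_zero, ← sub_eq_add_neg]
          push_cast
          ring
        simp_rw [e]
        have i1 := integrable_chr_mul hφi ξ
        have i2 := integrable_chr_mul (hφi.comp_add_right y) ξ
        have i3 := integrable_chr_mul (hφi.comp_add_right (-y)) ξ
        have i12 : Integrable fun x => 2 * (chr ξ x * (φ (t, x) : ℂ)) - chr ξ x * (φ (t, x + y) : ℂ) :=
          (i1.const_mul 2).sub i2
        rw [integral_const_mul, integral_sub i12 i3,
          integral_sub (i1.const_mul 2) i2, integral_const_mul,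
          fourier_comp_add (fun x => (φ (t, x) : ℂ)), fourier_comp_add (fun x => (φ (t, x) : ℂ)),
          neg_neg]
        have := chr_add_chr_neg ξ y
        push_cast at this ⊢
        linear_combination -((‖y‖ ^ (-(d + α)) : ℝ) : ℂ) * (∫ x, chr ξ x * (φ (t, x) : ℂ)) * this
    _ = _ := by
        rw [integral_mul_const, integral_complex_ofReal]
        rfl

theorem integrable_fourier_slice (hφ : ContDiff ℝ ∞ φ) (hc : HasCompactSupport φ) (t : ℝ) (k : ℕ) :
    Integrable fun ξ : Sp d => ‖ξ‖ ^ k * ‖𝓕 (fun x => (φ (t, x) : ℂ)) ξ‖ := by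
  have h1 : HasCompactSupport fun x : Sp d => (φ (t, x) : ℂ) :=
    (hasCompactSupport_slice hc t).comp_left Complex.ofReal_zero
  have h2 : ContDiff ℝ ∞ fun x : Sp d => (φ (t, x) : ℂ) :=
    Complex.ofRealCLM.contDiff.comp (contDiff_slice hφ t)
  exact (𝓕 (h1.toSchwartzMap h2)).integrable_pow_mul volume k

theorem continuous_fourier_slice (hφ : Continuous φ) (hc : HasCompactSupport φ) (t : ℝ) :
    Continuous (𝓕 fun x : Sp d => (φ (t, x) : ℂ)) :=
  VectorFourier.fourierIntegral_continuous Real.continuous_fourierChar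
    (by exact continuous_inner) (integrable_slice hφ hc t).ofReal

theorem fourierInv_fourier_slice (hφ : ContDiff ℝ ∞ φ) (hc : HasCompactSupport φ) (t : ℝ)
    (x : Sp d) : 𝓕⁻ (𝓕 fun x : Sp d => (φ (t, x) : ℂ)) x = φ (t, x) := by
  have hi : Integrable (𝓕 fun x : Sp d => (φ (t, x) : ℂ)) := by
    refine (integrable_norm_iff
      (continuous_fourier_slice hφ.continuous hc t).aestronglyMeasurable).1 ?_
    simpa using integrable_fourier_slice hφ hc t 0
  rw [Continuous.fourierInv_fourier_eq _ (integrable_slice hφ.continuous hc t).ofReal hi]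
  exact Complex.continuous_ofReal.comp (contDiff_slice hφ t).continuous

/-- Both operators have proportional Fourier symbols on a slice. The singular integral form supplies
the joint continuity, boundedness and L^1 bounds that are not visible from the multiplier
definition. -/
theorem exists_fracLap_eq (hd : 0 < d) (hα : 0 < α) (hα2 : α < 2) :
    ∃ c : ℝ, (∀ ξ : Sp d, (2 * Real.pi * ‖ξ‖) ^ α = c * singSymbol α ξ) ∧
      ∀ φ : ST d → ℝ, ContDiff ℝ ∞ φ → HasCompactSupport φ → ∀ z,
        fracLap α (fun y => φ (z.1, y)) z.2 = c * sing α φ z := by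
  obtain ⟨J, hJ, hs⟩ := exists_singSymbol_eq hd hα hα2
  have hc1 : ∀ ξ : Sp d, (2 * Real.pi * ‖ξ‖) ^ α = (2 * Real.pi) ^ α / J * singSymbol α ξ := by
    intro ξ
    rw [hs, Real.mul_rpow (by positivity) (norm_nonneg _)]
    field_simp
  refine ⟨(2 * Real.pi) ^ α / J, hc1, fun φ hφ hc z => ?_⟩
  obtain ⟨C, hC, h⟩ := integrable_prod_sing hd hα hα2 hφ hc
  set c := (2 * Real.pi) ^ α / J
  set g : Sp d → ℂ := fun x => (c : ℂ) * (sing α φ (z.1, x) : ℂ)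
  have hsc : Continuous fun x : Sp d => sing α φ (z.1, x) :=
    (continuous_sing hd hα hα2 hφ hc).comp (by fun_prop)
  have hsi : Integrable fun x : Sp d => sing α φ (z.1, x) :=
    ⟨hsc.aestronglyMeasurable, (h z.1).2.trans_lt hC.lt_top⟩
  have hg : Continuous g := by fun_prop
  have hgi : Integrable g := hsi.ofReal.const_mul _
  have hgF : 𝓕 g = fun ξ : Sp d => (((2 * Real.pi * ‖ξ‖) ^ α : ℝ) : ℂ) *
      𝓕 (fun y : Sp d => (φ (z.1, y) : ℂ)) ξ := by
    ext ξ
    rw [hc1, Complex.ofReal_mul, mul_assoc, ← fourier_sing hd hα hα2 hφ hc, fourier_eq_chr,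
      fourier_eq_chr, ← integral_const_mul]
    congr 1; ext x
    simp only [g]
    ring
  have hFc := continuous_fourier_slice hφ.continuous hc z.1
  -- The symbol satisfies |ξ|^α ≤ 1 + |ξ|², and the transform of the slice is a Schwartz function.
  have hgFi : Integrable (𝓕 g) := by
    rw [hgF]
    refine (((integrable_fourier_slice hφ hc z.1 0).add
      (integrable_fourier_slice hφ hc z.1 2)).const_mul ((2 * Real.pi) ^ α)).mono' ?_
      (Eventually.of_forall fun ξ => ?_)
    · refine (Continuous.mul ?_ hFc).aestronglyMeasurable
      exact Complex.continuous_ofReal.comp ((by fun_prop : Continuous fun ξ : Sp d =>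
        2 * Real.pi * ‖ξ‖).rpow_const fun _ => Or.inr hα.le)
    · rw [norm_mul, Complex.norm_real, Real.norm_of_nonneg (by positivity),
        Real.mul_rpow (by positivity) (norm_nonneg _), mul_assoc, Pi.add_apply, ← add_mul]
      gcongr
      rw [pow_zero]
      rcases le_total ‖ξ‖ 1 with h1 | h1
      · have := Real.rpow_le_one (norm_nonneg ξ) h1 hα.le
        nlinarith [sq_nonneg ‖ξ‖]
      · have := Real.rpow_le_rpow_of_exponent_le h1 hα2.le
        rw [Real.rpow_two] at this
        linarith
  have key := congrFun (Continuous.fourierInv_fourier_eq hg hgi hgFi) z.2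
  rw [hgF] at key
  rw [fracLap, key]
  simp [g]

theorem hasDerivAt_fourier_slice (hφ : ContDiff ℝ ∞ φ) (hc : HasCompactSupport φ) (t : ℝ)
    (ξ : Sp d) : HasDerivAt (fun r => 𝓕 (fun x => (φ (r, x) : ℂ)) ξ)
      (𝓕 (fun x => (fderiv ℝ φ (t, x) (1, 0) : ℂ)) ξ) t := by
  simp only [fourier_eq_chr]
  have hfc : Continuous fun z => fderiv ℝ φ z (1, 0) :=
    (hφ.continuous_fderiv (by simp)).clm_apply continuous_const
  have hfs : HasCompactSupport fun z => fderiv ℝ φ z (1, 0) := hc.fderiv_apply (𝕜 := ℝ) (1, 0)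
  obtain ⟨M, hM⟩ := hfs.exists_bound_of_continuous hfc
  obtain ⟨R, hR, h0⟩ := exists_eq_zero_of_hasCompactSupport hfs
  have hd1 : Differentiable ℝ φ := hφ.differentiable (by simp)
  refine (hasDerivAt_integral_of_dominated_loc_of_deriv_le
    (F := fun r x => chr ξ x * (φ (r, x) : ℂ))
    (F' := fun r x => chr ξ x * (fderiv ℝ φ (r, x) (1, 0) : ℂ)) (s := Set.univ)
    (bound := (Metric.closedBall (0 : Sp d) R).indicator fun _ => M) Filter.univ_mem
    (Eventually.of_forall fun r =>
      (integrable_chr_mul (integrable_slice hφ.continuous hc r).ofReal ξ).1)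
    (integrable_chr_mul (integrable_slice hφ.continuous hc t).ofReal ξ)
    (integrable_chr_mul (integrable_slice hfc hfs t).ofReal ξ).1
    (Eventually.of_forall fun x r _ => ?_) ?_ (Eventually.of_forall fun x r _ => ?_)).2
  · rw [norm_mul, norm_chr, one_mul, Complex.norm_real]
    by_cases hx : x ∈ Metric.closedBall (0 : Sp d) R
    · rw [Set.indicator_of_mem hx]; exact hM _
    · rw [Set.indicator_of_notMem hx, h0 r x (Or.inr (by simpa using hx)), norm_zero]
  · exact (integrable_indicator_iff Metric.isClosed_closedBall.measurableSet).2
      (integrableOn_const measure_closedBall_lt_top.ne)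
  · have h1 : HasDerivAt (fun r => φ (r, x)) (fderiv ℝ φ (r, x) (1, 0)) r :=
      ((hd1 (r, x)).hasFDerivAt.comp r (hasFDerivAt_prodMk_left r x)).hasDerivAt.congr_deriv
        (by simp)
    exact h1.ofReal_comp.const_mul _
end
end

/-! ### The forward and backward operators on test functions and their inversion -/

section
variable {d : ℕ} {α lam : ℝ}

theorem exists_op_eq (hd : 0 < d) (hα : 0 < α) (hα2 : α < 2) :
    ∃ c : ℝ, (∀ ξ : Sp d, (2 * Real.pi * ‖ξ‖) ^ α = c * singSymbol α ξ) ∧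
      ∀ (lam : ℝ) (φ : Test d) (z : ST d),
        fwdOp α lam φ z = lam * φ z + fderiv ℝ φ z (1, 0) + c * sing α φ z ∧
        bwdOp α lam φ z = lam * φ z - fderiv ℝ φ z (1, 0) + c * sing α φ z := by
  obtain ⟨c, h1, h2⟩ := exists_fracLap_eq hd hα hα2
  refine ⟨c, h1, fun lam φ z => ?_⟩
  have hd1 : DifferentiableAt ℝ φ z := φ.contDiff.differentiable (by simp) z
  have h3 : HasDerivAt (fun r => φ (r, z.2)) (fderiv ℝ φ z (1, 0)) z.1 :=
    (HasFDerivAt.comp z.1 (f := fun r => (r, z.2)) hd1.hasFDerivAt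
      (hasFDerivAt_prodMk_left z.1 z.2)).hasDerivAt.congr_deriv (by simp)
  rw [fwdOp, bwdOp, h2 φ φ.contDiff φ.hasCompactSupport z, h3.deriv]
  exact ⟨rfl, rfl⟩

/-- The reflection of a test function. -/
def reflTest (φ : Test d) : Test d :=
  ⟨fun z => φ (-z), φ.contDiff.comp (by fun_prop),
    φ.hasCompactSupport.comp_homeomorph (Homeomorph.neg _), by simp⟩

/-- The translation of a test function. -/
def transTest (φ : Test d) (y : ST d) : Test d :=
  ⟨fun z => φ (z - y), φ.contDiff.comp (by fun_prop),
    φ.hasCompactSupport.comp_homeomorph (Homeomorph.subRight y), by simp⟩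

theorem coe_reflTest (φ : Test d) : (reflTest φ : ST d → ℝ) = fun z => φ (-z) := rfl

theorem coe_transTest (φ : Test d) (y : ST d) : (transTest φ y : ST d → ℝ) = fun z => φ (z - y) :=
  rfl

/-- Reflection in space-time reverses the time derivative and leaves the symmetric singular integral
unchanged. All facts about the backward operator are obtained from the forward one in this way. -/
theorem Adm.bwdOp_eq (H : Adm d α lam) (φ : Test d) (z : ST d) :
    bwdOp α lam φ z = fwdOp α lam (reflTest φ) (-z) := by
  obtain ⟨c, -, h⟩ := exists_op_eq H.d_pos H.pos H.lt_two
  rw [(h lam _ _).1, (h lam _ _).2]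
  have e1 : fderiv ℝ (reflTest φ) (-z) (1, 0) = -fderiv ℝ φ z (1, 0) := by
    have h1 : HasFDerivAt φ (fderiv ℝ φ z) (- -z) := by
      rw [neg_neg]; exact (φ.contDiff.differentiable (by simp) z).hasFDerivAt
    have h2 : HasFDerivAt (reflTest φ) _ (-z) := h1.comp (-z) (hasFDerivAt_id (-z)).neg
    rw [h2.fderiv]
    simp
  have e2 : sing α (reflTest φ) (-z) = sing α φ z := by
    unfold sing
    congr 1; ext y
    simp only [secDiff, coe_reflTest, neg_neg, neg_add_rev, neg_sub]
    rw [show -(0, y) + z = z - (0, y) by abel, show (0, y) - -z = z + (0, y) by abel]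
    ring
  rw [e1, e2]
  simp only [coe_reflTest, neg_neg]
  ring

theorem Adm.fwdOp_transTest (H : Adm d α lam) (φ : Test d) (y z : ST d) :
    fwdOp α lam (transTest φ y) z = fwdOp α lam φ (z - y) := by
  obtain ⟨c, -, h⟩ := exists_op_eq H.d_pos H.pos H.lt_two
  rw [(h lam _ _).1, (h lam _ _).1]
  have e1 : fderiv ℝ (transTest φ y) z = fderiv ℝ φ (z - y) := by
    rw [coe_transTest, fderiv_comp_sub]
  have e2 : sing α (transTest φ y) z = sing α φ (z - y) := by
    unfold sing
    congr 1; ext v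
    simp only [secDiff, coe_transTest]
    rw [show z + (0, v) - y = z - y + (0, v) by abel, show z - (0, v) - y = z - y - (0, v) by abel]
  rw [e1, e2, coe_transTest]

theorem Adm.bwdOp_transTest (H : Adm d α lam) (φ : Test d) (y z : ST d) :
    bwdOp α lam (transTest φ y) z = bwdOp α lam φ (z - y) := by
  have e : reflTest (transTest φ y) = transTest (reflTest φ) (-y) := by
    ext z
    simp only [coe_reflTest, coe_transTest]
    congr 1; abel
  rw [H.bwdOp_eq, H.bwdOp_eq, e, H.fwdOp_transTest]
  congr 1; abel

/-- The nonlocal operator keeps compact support in time, but in space only a bound in L^1, uniform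
in t, replaces it. -/
theorem Adm.fwdOp_props (H : Adm d α lam) (φ : Test d) :
    Continuous (fwdOp α lam φ) ∧ (∃ M : ℝ, ∀ z, ‖fwdOp α lam φ z‖ ≤ M) ∧
      (∃ A : ℝ≥0∞, A ≠ ⊤ ∧ ∀ t, ∫⁻ x, ‖fwdOp α lam φ (t, x)‖ₑ ≤ A) ∧
      ∃ R : ℝ, 0 < R ∧ ∀ t x, R < |t| → φ (t, x) = 0 ∧ fwdOp α lam φ (t, x) = 0 := by
  obtain ⟨c, -, h⟩ := exists_op_eq H.d_pos H.pos H.lt_two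
  have e : fwdOp α lam φ = fun z => lam * φ z + fderiv ℝ φ z (1, 0) + c * sing α φ z :=
    funext fun z => (h lam φ z).1
  have hφ := φ.contDiff
  have hc := φ.hasCompactSupport
  have hfc : Continuous fun z => fderiv ℝ φ z (1, 0) :=
    (hφ.continuous_fderiv (by simp)).clm_apply continuous_const
  have hfs : HasCompactSupport fun z => fderiv ℝ φ z (1, 0) := hc.fderiv_apply (𝕜 := ℝ) (1, 0)
  have hsc := continuous_sing H.d_pos H.pos H.lt_two hφ hc
  have hgc : Continuous fun z => lam * φ z + fderiv ℝ φ z (1, 0) := by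
    have := hφ.continuous; fun_prop
  have hgs : HasCompactSupport fun z => lam * φ z + fderiv ℝ φ z (1, 0) :=
    hc.mul_left.add hfs
  obtain ⟨R, hR, h0⟩ := exists_eq_zero_of_hasCompactSupport hc
  obtain ⟨R', hR', h0'⟩ := exists_eq_zero_of_hasCompactSupport hgs
  obtain ⟨M, hM⟩ := hgs.exists_bound_of_continuous hgc
  obtain ⟨S, hS⟩ := exists_sing_le H.d_pos H.pos H.lt_two hφ hc
  obtain ⟨C, hC, hs⟩ := integrable_prod_sing H.d_pos H.pos H.lt_two hφ hc
  refine ⟨by rw [e]; fun_prop, ⟨M + |c| * S, fun z => ?_⟩,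
    ⟨ENNReal.ofReal M * volume (Metric.closedBall (0 : Sp d) R') + ‖c‖ₑ * C, ?_, fun t => ?_⟩,
    max R R', lt_max_of_lt_left hR, fun t x ht => ?_⟩
  · rw [e]
    refine (norm_add_le _ _).trans (add_le_add (hM z) ?_)
    rw [norm_mul, Real.norm_eq_abs, Real.norm_eq_abs]
    gcongr
    exact hS z
  · exact ENNReal.add_ne_top.2 ⟨ENNReal.mul_ne_top ENNReal.ofReal_ne_top
      measure_closedBall_lt_top.ne, ENNReal.mul_ne_top (by simp) hC⟩
  · have m1 : Measurable fun x : Sp d => lam * φ (t, x) + fderiv ℝ φ (t, x) (1, 0) :=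
      (hgc.comp (by fun_prop : Continuous fun x : Sp d => (t, x))).measurable
    have m2 : Measurable fun x : Sp d => sing α φ (t, x) :=
      (hsc.comp (by fun_prop : Continuous fun x : Sp d => (t, x))).measurable
    calc ∫⁻ x, ‖fwdOp α lam φ (t, x)‖ₑ
        ≤ ∫⁻ x, (‖lam * φ (t, x) + fderiv ℝ φ (t, x) (1, 0)‖ₑ + ‖c‖ₑ * ‖sing α φ (t, x)‖ₑ) := by
          refine lintegral_mono fun x => ?_
          rw [e, ← enorm_mul]
          exact enorm_add_le _ _
      _ = (∫⁻ x, ‖lam * φ (t, x) + fderiv ℝ φ (t, x) (1, 0)‖ₑ) +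
            ‖c‖ₑ * ∫⁻ x, ‖sing α φ (t, x)‖ₑ := by
          rw [lintegral_add_left m1.enorm, lintegral_const_mul _ m2.enorm]
      _ ≤ _ := by
          refine add_le_add ?_ (mul_le_mul_right (hs t).2 _)
          rw [← setLIntegral_const, ← lintegral_indicator Metric.isClosed_closedBall.measurableSet]
          refine lintegral_mono fun x => ?_
          by_cases hx : x ∈ Metric.closedBall (0 : Sp d) R'
          · rw [Set.indicator_of_mem hx, ← ofReal_norm]
            exact ENNReal.ofReal_le_ofReal (hM _)
          · dsimp only
            rw [Set.indicator_of_notMem hx, h0' t x (Or.inr (by simpa using hx)), enorm_zero]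
  · have h1 : R < |t| := (le_max_left _ _).trans_lt ht
    have h2 : R' < |t| := (le_max_right _ _).trans_lt ht
    refine ⟨h0 t x (Or.inl h1), ?_⟩
    rw [e]
    dsimp only
    rw [h0' t x (Or.inl h2), sing_eq_zero h0 h1 x]
    simp

/-- Interpolation: the function is bounded, and integrable because its time support is bounded and
its slices have uniformly bounded L^1 norms. -/
theorem Adm.memLp_fwdOp (H : Adm d α lam) (φ : Test d) {P : ℝ≥0∞} (hP : 1 ≤ P.toReal) :
    MemLp (fwdOp α lam φ) P := by
  obtain ⟨hc, ⟨M, hM⟩, ⟨A, hA, h⟩, R, hR, h0⟩ := H.fwdOp_props φ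
  have hpos := ENNReal.toReal_pos_iff.1 (zero_lt_one.trans_le hP)
  refine ⟨hc.aestronglyMeasurable, ?_⟩
  rw [eLpNorm_lt_top_iff_lintegral_rpow_enorm_lt_top hpos.1.ne' hpos.2.ne]
  have h1 : ∫⁻ z, ‖fwdOp α lam φ z‖ₑ < ⊤ := by
    rw [Measure.volume_eq_prod, lintegral_prod _ hc.measurable.enorm.aemeasurable]
    calc ∫⁻ t, ∫⁻ x, ‖fwdOp α lam φ (t, x)‖ₑ ≤ ∫⁻ t, (Set.Icc (-R) R).indicator (fun _ => A) t := by
          refine lintegral_mono fun t => ?_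
          by_cases ht : t ∈ Set.Icc (-R) R
          · rw [Set.indicator_of_mem ht]; exact h t
          · have : R < |t| := by
              rw [Set.mem_Icc, ← abs_le] at ht; exact not_le.1 ht
            simp [(h0 t _ this).2]
      _ < ⊤ := by
          rw [lintegral_indicator measurableSet_Icc, setLIntegral_const]
          exact ENNReal.mul_lt_top hA.lt_top (by simp)
  calc ∫⁻ z, ‖fwdOp α lam φ z‖ₑ ^ P.toReal
      ≤ ∫⁻ z, ENNReal.ofReal M ^ (P.toReal - 1) * ‖fwdOp α lam φ z‖ₑ := by
        refine lintegral_mono fun z => ?_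
        calc ‖fwdOp α lam φ z‖ₑ ^ P.toReal
            = ‖fwdOp α lam φ z‖ₑ ^ (P.toReal - 1) * ‖fwdOp α lam φ z‖ₑ := by
              conv_lhs => rw [show P.toReal = (P.toReal - 1) + 1 by ring]
              rw [ENNReal.rpow_add_of_nonneg _ _ (by linarith) zero_le_one, ENNReal.rpow_one]
          _ ≤ _ := by
              refine mul_le_mul_left (ENNReal.rpow_le_rpow ?_ (by linarith)) _
              rw [← ofReal_norm]; exact ENNReal.ofReal_le_ofReal (hM z)
    _ < ⊤ := by
        rw [lintegral_const_mul _ hc.measurable.enorm]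
        exact ENNReal.mul_lt_top (ENNReal.rpow_lt_top_of_nonneg (by linarith)
          ENNReal.ofReal_ne_top) h1

theorem Adm.fourier_fwdOp_slice (H : Adm d α lam) (φ : Test d) (t : ℝ) (ξ : Sp d) :
    𝓕 (fun x => (fwdOp α lam φ (t, x) : ℂ)) ξ =
      ((lam + (2 * Real.pi * ‖ξ‖) ^ α : ℝ) : ℂ) * 𝓕 (fun x => (φ (t, x) : ℂ)) ξ +
        𝓕 (fun x => (fderiv ℝ φ (t, x) (1, 0) : ℂ)) ξ := by
  obtain ⟨c, hc1, h⟩ := exists_op_eq H.d_pos H.pos H.lt_two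
  have hφ := φ.contDiff
  have hc := φ.hasCompactSupport
  have hfc : Continuous fun z => fderiv ℝ φ z (1, 0) :=
    (hφ.continuous_fderiv (by simp)).clm_apply continuous_const
  have hfs : HasCompactSupport fun z => fderiv ℝ φ z (1, 0) := hc.fderiv_apply (𝕜 := ℝ) (1, 0)
  obtain ⟨C, hC, hs⟩ := integrable_prod_sing H.d_pos H.pos H.lt_two hφ hc
  have hsi : Integrable fun x : Sp d => sing α φ (t, x) :=
    ⟨((continuous_sing H.d_pos H.pos H.lt_two hφ hc).comp
      (by fun_prop : Continuous fun x : Sp d => (t, x))).aestronglyMeasurable,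
      (hs t).2.trans_lt hC.lt_top⟩
  have i1 : Integrable fun x : Sp d => (lam : ℂ) * (chr ξ x * (φ (t, x) : ℂ)) :=
    (integrable_chr_mul (integrable_slice hφ.continuous hc t).ofReal ξ).const_mul _
  have i2 : Integrable fun x : Sp d => chr ξ x * (fderiv ℝ φ (t, x) (1, 0) : ℂ) :=
    integrable_chr_mul (integrable_slice hfc hfs t).ofReal ξ
  have i3 : Integrable fun x : Sp d => (c : ℂ) * (chr ξ x * (sing α φ (t, x) : ℂ)) :=
    (integrable_chr_mul hsi.ofReal ξ).const_mul _
  have i12 : Integrable fun x : Sp d => (lam : ℂ) * (chr ξ x * (φ (t, x) : ℂ)) +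
      chr ξ x * (fderiv ℝ φ (t, x) (1, 0) : ℂ) := i1.add i2
  have hF := fourier_sing H.d_pos H.pos H.lt_two hφ hc t ξ
  rw [fourier_eq_chr, fourier_eq_chr] at hF
  rw [fourier_eq_chr, fourier_eq_chr, fourier_eq_chr, hc1]
  calc _ = ∫ x, ((lam : ℂ) * (chr ξ x * (φ (t, x) : ℂ)) +
        chr ξ x * (fderiv ℝ φ (t, x) (1, 0) : ℂ) + (c : ℂ) * (chr ξ x * (sing α φ (t, x) : ℂ))) := by
        congr 1; ext x
        rw [(h lam φ (t, x)).1]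
        push_cast
        ring
    _ = _ := by
        rw [integral_add i12 i3, integral_add i1 i2, integral_const_mul, integral_const_mul, hF]
        push_cast
        ring

/-- At fixed t the Fourier transform in x turns A into m + d/dt with m = λ + (2π|ξ|)^α, and the
potential of order 1 into an integral over the past with factor e^{-rm}. The integrand is then an
exact derivative whose boundary value is the transform of φ at time t, and inversion in x finishes.
-/
theorem Adm.pot_one_fwdOp (H : Adm d α lam) (φ : Test d) (z : ST d) :
    pot α lam 1 (fwdOp α lam φ) z = φ z := by
  obtain ⟨t, x₀⟩ := z
  obtain ⟨hac, ⟨M, hM⟩, ⟨A, hA, hAle⟩, R, hR, h0⟩ := H.fwdOp_props φ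
  have hφ := φ.contDiff
  have hc := φ.hasCompactSupport
  set a := fwdOp α lam φ with ha
  set U : Sp d → ℝ := fun x => pot α lam 1 a (t, x)
  have hUc : Continuous U :=
    (H.continuous_pot_of_bounded one_pos hac hM).comp (by fun_prop)
  have hU : ∀ x, U x = ∫ w : ST d, potKernel α lam 1 w * a (t - w.1, x - w.2) := by
    intro x
    simp only [U, pot]
    rw [← integral_sub_left_eq_self _ volume (t, x)]
    simp only [sub_sub_cancel]
    rfl
  have hKm := measurable_potKernel (d := d) α lam 1
  have ham := hac.measurable
  have hFm : Measurable fun q : ST d × Sp d => potKernel α lam 1 q.1 * a (t - q.1.1, q.2 - q.1.2) := by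
    fun_prop
  have hF₀ : Integrable (fun q : ST d × Sp d => potKernel α lam 1 q.1 * a (t - q.1.1, q.2 - q.1.2))
      (volume.prod volume) := by
    refine ⟨hFm.aestronglyMeasurable, ?_⟩
    rw [HasFiniteIntegral, lintegral_prod _ hFm.enorm.aemeasurable]
    have hle : ∀ w : ST d, ∫⁻ x, ‖potKernel α lam 1 w * a (t - w.1, x - w.2)‖ₑ ≤
        ‖potKernel α lam 1 w‖ₑ * A := by
      intro w
      have hm : Measurable fun x : Sp d => a (t - w.1, x - w.2) :=
        ham.comp (by fun_prop : Measurable fun x : Sp d => (t - w.1, x - w.2))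
      simp only [enorm_mul]
      rw [lintegral_const_mul _ hm.enorm,
        lintegral_sub_right_eq_self (fun x : Sp d => ‖a (t - w.1, x)‖ₑ) w.2]
      gcongr
      exact hAle _
    refine (lintegral_mono hle).trans_lt ?_
    rw [lintegral_mul_const _ hKm.enorm]
    exact ENNReal.mul_lt_top (H.integrable_potKernel one_pos).2 hA.lt_top
  have hUi : Integrable U := by
    have : U = fun x => ∫ w : ST d, potKernel α lam 1 w * a (t - w.1, x - w.2) := funext hU
    rw [this]
    exact hF₀.swap.integral_prod_left
  have hFU : ∀ ξ : Sp d, 𝓕 (fun x => (U x : ℂ)) ξ = 𝓕 (fun x => (φ (t, x) : ℂ)) ξ := by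
    intro ξ
    set m : ℝ := lam + (2 * Real.pi * ‖ξ‖) ^ α with hm
    set Φ : ℝ → ℂ := fun r => 𝓕 (fun x => (φ (r, x) : ℂ)) ξ
    set Φ' : ℝ → ℂ := fun r => 𝓕 (fun x => (fderiv ℝ φ (r, x) (1, 0) : ℂ)) ξ
    set G : ST d → ℂ := fun w => (timeKernel lam 1 w.1 : ℂ) * (m * Φ (t - w.1) + Φ' (t - w.1)) *
      (chr ξ w.2 * (heatKernel α w.1 w.2 : ℂ))
    have hF : Integrable (fun q : ST d × Sp d => chr ξ q.2 *
        ((potKernel α lam 1 q.1 * a (t - q.1.1, q.2 - q.1.2) : ℝ) : ℂ)) (volume.prod volume) :=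
      hF₀.ofReal.bdd_mul (c := 1) ((continuous_chr ξ).comp continuous_snd).aestronglyMeasurable
        (Eventually.of_forall fun q => (norm_chr ξ q.2).le)
    -- A translate by the spatial part of w costs a character, which then transforms the heat kernel
    -- into e^{-r(2π|ξ|)^α}.
    have hG : (fun w => ∫ x, chr ξ x *
        ((potKernel α lam 1 w * a (t - w.1, x - w.2) : ℝ) : ℂ)) = G := by
      ext w
      have := fourier_comp_add (fun x => (a (t - w.1, x) : ℂ)) (-w.2) ξ
      rw [neg_neg, ← fourier_eq_chr (fun x => (a (t - w.1, x) : ℂ)), ha, H.fourier_fwdOp_slice,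
        ← ha] at this
      calc _ = (potKernel α lam 1 w : ℂ) * ∫ x, chr ξ x * (a (t - w.1, x + -w.2) : ℂ) := by
            rw [← integral_const_mul]
            congr 1; ext x
            rw [← sub_eq_add_neg]
            push_cast
            ring
        _ = _ := by
            rw [this, potKernel_eq]
            simp only [G, Φ, Φ', hm]
            push_cast
            ring
    have hGi : Integrable G := by
      rw [← hG]; exact hF.integral_prod_left
    have hsl : ∀ r, ∫ y, G (r, y) = (Set.Ioi (0 : ℝ)).indicator (fun r =>
        Complex.exp (-(r * m)) * (m * Φ (t - r) + Φ' (t - r))) r := by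
      intro r
      rcases le_or_gt r 0 with hr | hr
      · rw [Set.indicator_of_notMem (by simpa using hr)]
        simp [G, timeKernel_of_nonpos hr]
      · rw [Set.indicator_of_mem (show r ∈ Set.Ioi 0 from hr)]
        simp only [G]
        rw [integral_const_mul, ← fourier_eq_chr, fourier_heatKernel H.d_pos H.pos H.lt_two hr,
          timeKernel, if_pos hr, heatMult, mul_right_comm, ← Complex.ofReal_mul]
        simp only [sub_self, Real.rpow_zero, Real.Gamma_one, div_one, one_mul]
        rw [← Real.exp_add, show -lam * r + -r * (2 * Real.pi * ‖ξ‖) ^ α = -(r * m) by rw [hm]; ring]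
        push_cast
        rfl
    -- The primitive -e^{-rm}Φ(t - r): differentiating Φ(t - r) in r gives the minus sign that makes
    -- both terms agree.
    have hder : ∀ r : ℝ, HasDerivAt (fun r : ℝ => -(Complex.exp (-(r * m)) * Φ (t - r)))
        (Complex.exp (-(r * m)) * (m * Φ (t - r) + Φ' (t - r))) r := by
      intro r
      have h1 : HasDerivAt (fun r : ℝ => Φ (t - r)) (-Φ' (t - r)) r := by
        exact ((hasDerivAt_fourier_slice hφ hc (t - r) ξ).scomp r
          ((hasDerivAt_id r).const_sub t)).congr_deriv (by simp [Φ'])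
      have h2 : HasDerivAt (fun r : ℝ => Complex.exp (-((r : ℂ) * m)))
          (Complex.exp (-(r * m)) * (-m)) r := by
        have : HasDerivAt (fun r : ℝ => -((r : ℂ) * m)) (-((1 : ℂ) * m)) r :=
          ((Complex.ofRealCLM.hasDerivAt (x := r)).mul_const (m : ℂ)).neg
        rw [one_mul] at this
        exact this.cexp
      refine (h2.mul h1).neg.congr_deriv ?_
      ring
    -- For r > t + R the time t - r lies outside the support of φ, so the primitive is eventually
    -- zero.
    have hlim : Tendsto (fun r : ℝ => -(Complex.exp (-(r * m)) * Φ (t - r))) atTop (𝓝 0) := by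
      refine tendsto_const_nhds.congr' ?_
      filter_upwards [eventually_gt_atTop (t + R)] with r hr
      have h1 : R < |t - r| := by rw [abs_sub_comm]; exact (by linarith : R < r - t).trans_le (le_abs_self _)
      have : Φ (t - r) = 0 := by
        simp only [Φ, fourier_eq_chr]
        simp [(h0 (t - r) _ h1).1]
      rw [this]; simp
    have hint : IntegrableOn (fun r : ℝ => Complex.exp (-(r * m)) * (m * Φ (t - r) + Φ' (t - r)))
        (Set.Ioi 0) := by
      rw [← integrable_indicator_iff measurableSet_Ioi]
      have := hGi.integral_prod_left
      simp_rw [hsl] at this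
      exact this
    calc 𝓕 (fun x => (U x : ℂ)) ξ
        = ∫ x, ∫ w : ST d, chr ξ x * ((potKernel α lam 1 w * a (t - w.1, x - w.2) : ℝ) : ℂ) := by
          rw [fourier_eq_chr]
          congr 1; ext x
          rw [hU, integral_const_mul, integral_complex_ofReal]
      _ = ∫ w : ST d, G w := by
          rw [← hG]; exact (integral_integral_swap hF).symm
      _ = ∫ r, ∫ y, G (r, y) := integral_prod _ hGi
      _ = ∫ r in Set.Ioi (0 : ℝ), Complex.exp (-(r * m)) * (m * Φ (t - r) + Φ' (t - r)) := by
          simp_rw [hsl]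
          rw [integral_indicator measurableSet_Ioi]
      _ = Φ t := by
          rw [integral_Ioi_of_hasDerivAt_of_tendsto' (fun r _ => hder r) hint hlim]
          simp
  have hFU' : 𝓕 (fun x => (U x : ℂ)) = 𝓕 (fun x => (φ (t, x) : ℂ)) := funext hFU
  have hFi : Integrable (𝓕 fun x : Sp d => (φ (t, x) : ℂ)) := by
    refine (integrable_norm_iff
      (continuous_fourier_slice hφ.continuous hc t).aestronglyMeasurable).1 ?_
    simpa using integrable_fourier_slice hφ hc t 0
  have key := congrFun (Continuous.fourierInv_fourier_eq (f := fun x => (U x : ℂ))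
    (Complex.continuous_ofReal.comp hUc) hUi.ofReal (by rw [hFU']; exact hFi)) x₀
  rw [hFU', fourierInv_fourier_slice hφ hc] at key
  exact_mod_cast key.symm

theorem Adm.bwdPot_one_bwdOp (H : Adm d α lam) (φ : Test d) (z : ST d) :
    bwdPot α lam 1 (bwdOp α lam φ) z = φ z := by
  have h := H.pot_one_fwdOp (reflTest φ) (-z)
  simp only [coe_reflTest, neg_neg] at h
  rw [← h, pot, bwdPot, ← integral_neg_eq_self]
  congr 1; ext w
  rw [H.bwdOp_eq, neg_neg]
  congr 2; abel

theorem Adm.continuous_bwdOp (H : Adm d α lam) (φ : Test d) : Continuous (bwdOp α lam φ) := by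
  have : bwdOp α lam φ = fun z => fwdOp α lam (reflTest φ) (-z) := funext (H.bwdOp_eq φ)
  rw [this]
  exact (H.fwdOp_props _).1.comp continuous_neg

theorem Adm.memLp_bwdOp (H : Adm d α lam) (φ : Test d) {P : ℝ≥0∞} (hP : 1 ≤ P.toReal) :
    MemLp (bwdOp α lam φ) P := by
  have : bwdOp α lam φ = fun z => fwdOp α lam (reflTest φ) (-z) := funext (H.bwdOp_eq φ)
  rw [this]
  exact (H.memLp_fwdOp _ hP).comp_measurePreserving (Measure.measurePreserving_neg volume)

/-- The operator A* commutes with translations and is inverted by convolution with the integrable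
reflected kernel of order 1, so the general orthogonality criterion applies. This is the uniqueness
statement for Av = f in L^p. -/
theorem Adm.ae_eq_zero_of_integral_bwdOp {P P' : ℝ≥0∞} (hpq : P.toReal.HolderConjugate P'.toReal)
    (H : Adm d α lam) {g : ST d → ℝ} (hg : MemLp g P)
    (h0 : ∀ φ : Test d, ∫ z, g z * bwdOp α lam φ z = 0) : g =ᵐ[volume] 0 := by
  refine ae_eq_zero_of_forall_integral_mul_eq_zero hpq (T := bwdOp α lam)
    (κ := fun y => potKernel α lam 1 (-y)) (H.integrable_potKernel one_pos).comp_neg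
    (fun φ => (H.continuous_bwdOp φ).measurable) (fun φ => H.memLp_bwdOp φ hpq.symm.lt.le)
    (fun φ y => ⟨transTest φ y, funext (H.bwdOp_transTest φ y)⟩)
    (fun φ => Eventually.of_forall fun z => ?_) hg h0
  dsimp only
  rw [← H.bwdPot_one_bwdOp φ z, bwdPot, ← integral_sub_left_eq_self _ volume z]
  simp only [neg_sub, sub_sub_cancel]
end

/-! ### Morrey weights and the kernels of R and Q -/

section
variable {d : ℕ} {α q : ℝ}

/-- A Morrey bound for `V` on parabolic balls. -/
def MorreyBd (α q : ℝ) (V : ST d → ℝ≥0∞) (N : ℝ≥0∞) : Prop :=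
  ∀ ρ : ℝ, 0 < ρ → ∀ x : ST d, ∫⁻ w in pball α ρ x, V w ^ (q / (α - 1)) ≤
    N ^ (q / (α - 1)) * ENNReal.ofReal (ρ ^ (d + α - q))

theorem MorreyBd.mono (hα : 1 < α) (hq : 0 < q) {V : ST d → ℝ≥0∞} {N N' : ℝ≥0∞}
    (h : MorreyBd α q V N) (hN : N ≤ N') : MorreyBd α q V N' := fun ρ hρ x =>
  (h ρ hρ x).trans (mul_le_mul_left (ENNReal.rpow_le_rpow hN
    (div_nonneg hq.le (by linarith))) _)

theorem MorreyBd.normalize (hα : 1 < α) (hq : 0 < q) {V : ST d → ℝ≥0∞} {N : ℝ≥0∞}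
    (hN : N ≠ 0) (hN' : N ≠ ⊤) (h : MorreyBd α q V N) {ρ : ℝ} (hρ : 0 < ρ) (x : ST d) :
    ∫⁻ w in pball α ρ x, (N⁻¹ * V w) ^ (q / (α - 1)) ≤ ENNReal.ofReal (ρ ^ (d + α - q)) := by
  have hr : 0 < q / (α - 1) := div_pos hq (by linarith)
  simp_rw [ENNReal.mul_rpow_of_nonneg _ _ hr.le]
  rw [lintegral_const_mul' _ _ (ENNReal.rpow_ne_top_of_nonneg hr.le (ENNReal.inv_ne_top.2 hN))]
  refine (mul_le_mul_right (h ρ hρ x) _).trans (le_of_eq ?_)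
  rw [← mul_assoc, ← ENNReal.mul_rpow_of_nonneg _ _ hr.le, ENNReal.inv_mul_cancel hN hN',
    ENNReal.one_rpow, one_mul]

variable {P P' : ℝ≥0∞}

theorem ordU_mul (hα : 1 < α) : α * ordU α P - 1 = (α - 1) / P.toReal := by
  have : α ≠ 0 := by linarith
  unfold ordU
  field_simp
  ring

theorem ordF_eq (hpq : P.toReal.HolderConjugate P'.toReal) :
    ordF α P = (1 - 1 / α) * (1 / P'.toReal) := by
  rw [ordF]
  congr 1
  have := hpq.inv_add_inv_eq_one
  rw [one_div, one_div]; linarith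

theorem ordF_mul (hα : 1 < α) (hpq : P.toReal.HolderConjugate P'.toReal) :
    α * ordF α P = (α - 1) / P'.toReal := by
  have : α ≠ 0 := by linarith
  rw [ordF_eq hpq]
  field_simp

/-- The gradient kernel is dominated by the Riesz kernel of order α·`ordU` - 1 = (α-1)/p. The trace
inequality is applied to V/N, and undoing this normalisation gives the factor N^{1/p}. -/
theorem exists_kerBound_gradPot_of_morreyBd (hd : 0 < d) (hα : 1 < α) (hα2 : α < 2)
    (hpq : P.toReal.HolderConjugate P'.toReal) (hq1 : 1 < q) (hq : q < d + α) :
    ∃ C : ℝ≥0∞, C ≠ ⊤ ∧ ∀ lam : ℝ, 0 < lam → ∀ V : ST d → ℝ≥0∞, Measurable V →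
      ∀ N : ℝ≥0∞, N ≠ 0 → N ≠ ⊤ → MorreyBd α q V N →
      KerBound P.toReal (fun z w => V z ^ (1 / P.toReal) * ‖gradPot α lam (ordU α P) (z - w)‖ₑ)
        (C * N ^ (1 / P.toReal)) := by
  have hp := hpq.pos
  set p := P.toReal
  have hk : 0 < α - 1 := by linarith
  have hD : (0 : ℝ) < d := by exact_mod_cast hd
  have hs := ordU_pos (P := P) hα hpq.lt
  have hs0 : 0 < ordU α P := (by have : 0 < α := by linarith
                                 positivity : 0 < 1 / α).trans hs.1
  have hUm := ordU_mul (P := P) hα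
  -- With β = (α-1)/p and r = q/(α-1), the Morrey exponent βpr of the trace inequality is q.
  -- Moreover r > 1, because q > 1 > α - 1.
  have hβp : (α - 1) / p * p * (q / (α - 1)) = q := by field_simp
  obtain ⟨C₁, hC₁, h₁⟩ := exists_potKernel_le_rieszKernel hd (by linarith) hα2 hs0
    (by nlinarith [hs.2.1, hs.2.2] : α * ordU α P < d + α)
  obtain ⟨B, hB, h₂⟩ := exists_riesz_trace_bound d hα.le hpq (div_pos hk hp)
    (r := q / (α - 1)) (by rw [lt_div_iff₀ hk]; linarith) (by rw [hβp]; exact hq)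
  refine ⟨C₁ * B ^ (1 / p), ENNReal.mul_ne_top hC₁ (ENNReal.rpow_ne_top_of_nonneg (by positivity) hB),
    fun lam hl V hV N hN hN' hM => ?_⟩
  have hk1 : KerBound p (fun z w : ST d => (N⁻¹ * V z) ^ (1 / p) * rieszKernel α ((α - 1) / p) z w)
      (B ^ (1 / p)) := by
    intro f hf
    have := (h₂ (fun w => N⁻¹ * V w) (hV.const_mul _) fun ρ hρ x => by
      rw [hβp]; exact hM.normalize hα (by linarith) hN hN' hρ x).1 f hf
    rw [← ENNReal.rpow_mul, one_div_mul_cancel hp.ne', ENNReal.rpow_one]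
    refine le_trans (le_of_eq ?_) this
    congr 1; ext z
    rw [riesz_eq_lintegral_kernel hf, ← lintegral_const_mul]
    · simp only [mul_assoc]
    · exact ((measurable_rieszKernel _).comp (by fun_prop : Measurable fun w : ST d => (z, w))).mul hf
  have hm : Measurable (Function.uncurry fun z w : ST d =>
      (N⁻¹ * V z) ^ (1 / p) * rieszKernel α ((α - 1) / p) z w) :=
    (by fun_prop : Measurable fun q : ST d × ST d => (N⁻¹ * V q.1) ^ (1 / p)).mul
      (measurable_rieszKernel _)
  refine (hk1.const_mul hp.le hm (C₁ * N ^ (1 / p))).mono hp.le (fun z w => ?_)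
    (le_of_eq (by ring))
  have hb := (h₁ lam hl.le z w).2
  rw [hUm] at hb
  calc V z ^ (1 / p) * ‖gradPot α lam (ordU α P) (z - w)‖ₑ
      ≤ V z ^ (1 / p) * (C₁ * rieszKernel α ((α - 1) / p) z w) := by gcongr
    _ = _ := by
      rw [ENNReal.mul_rpow_of_nonneg _ _ (by positivity : 0 ≤ 1 / p)]
      have : N ^ (1 / p) * N⁻¹ ^ (1 / p) = 1 := by
        rw [← ENNReal.mul_rpow_of_nonneg _ _ (by positivity), ENNReal.mul_inv_cancel hN hN',
          ENNReal.one_rpow]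
      calc _ = 1 * (C₁ * (V z ^ (1 / p) * rieszKernel α ((α - 1) / p) z w)) := by ring
        _ = _ := by rw [← this]; ring

/-- Here the weight acts before the potential, so the dual half of the trace inequality is used,
with the conjugate exponents interchanged and Riesz order α·`ordF` = (α-1)/p'. -/
theorem exists_kerBound_pot_of_morreyBd (hd : 0 < d) (hα : 1 < α) (hα2 : α < 2)
    (hpq : P.toReal.HolderConjugate P'.toReal) (hq1 : 1 < q) (hq : q < d + α) :
    ∃ C : ℝ≥0∞, C ≠ ⊤ ∧ ∀ lam : ℝ, 0 < lam → ∀ V : ST d → ℝ≥0∞, Measurable V →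
      ∀ N : ℝ≥0∞, N ≠ 0 → N ≠ ⊤ → MorreyBd α q V N →
      KerBound P.toReal (fun z w => ‖potKernel α lam (ordF α P) (z - w)‖ₑ * V w ^ (1 / P'.toReal))
        (C * N ^ (1 / P'.toReal)) := by
  have hp := hpq.pos
  have hp' := hpq.symm.pos
  set p := P.toReal
  have hk : 0 < α - 1 := by linarith
  have hD : (0 : ℝ) < d := by exact_mod_cast hd
  have hs := ordU_pos (P := P) hα hpq.lt
  have hFm := ordF_mul hα hpq
  set p' := P'.toReal
  have hβp : (α - 1) / p' * p' * (q / (α - 1)) = q := by field_simp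
  have hF1 : ordF α P < 1 := by
    have : 0 < 1 / α := by positivity
    linarith [hs.1, hs.2.2]
  obtain ⟨C₁, hC₁, h₁⟩ := exists_potKernel_le_rieszKernel hd (by linarith) hα2 hs.2.1
    (by nlinarith : α * ordF α P < d + α)
  obtain ⟨B, hB, h₂⟩ := exists_riesz_trace_bound d hα.le hpq.symm (div_pos hk hp')
    (r := q / (α - 1)) (by rw [lt_div_iff₀ hk]; linarith) (by rw [hβp]; exact hq)
  refine ⟨C₁ * B ^ (1 / p), ENNReal.mul_ne_top hC₁ (ENNReal.rpow_ne_top_of_nonneg (by positivity) hB),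
    fun lam hl V hV N hN hN' hM => ?_⟩
  have hmz : ∀ z : ST d, Measurable fun w => rieszKernel α ((α - 1) / p') z w := fun z =>
    (measurable_rieszKernel _).comp (by fun_prop : Measurable fun w : ST d => (z, w))
  have hk1 : KerBound p (fun z w : ST d => rieszKernel α ((α - 1) / p') z w * (N⁻¹ * V w) ^ (1 / p'))
      (B ^ (1 / p)) := by
    intro f hf
    have := (h₂ (fun w => N⁻¹ * V w) (hV.const_mul _) fun ρ hρ x => by
      rw [hβp]; exact hM.normalize hα (by linarith) hN hN' hρ x).2 f hf
    rw [← ENNReal.rpow_mul, one_div_mul_cancel hp.ne', ENNReal.rpow_one]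
    refine le_trans (le_of_eq ?_) this
    congr 1; ext z
    rw [riesz_eq_lintegral_kernel (by fun_prop)]
    simp only [mul_assoc]
  have hm : Measurable (Function.uncurry fun z w : ST d =>
      rieszKernel α ((α - 1) / p') z w * (N⁻¹ * V w) ^ (1 / p')) :=
    (measurable_rieszKernel _).mul
    (by fun_prop : Measurable fun q : ST d × ST d => (N⁻¹ * V q.2) ^ (1 / p'))
  refine (hk1.const_mul hp.le hm (C₁ * N ^ (1 / p'))).mono hp.le (fun z w => ?_)
    (le_of_eq (by ring))
  have hb := (h₁ lam hl.le z w).1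
  rw [hFm] at hb
  calc ‖potKernel α lam (ordF α P) (z - w)‖ₑ * V w ^ (1 / p')
      ≤ (C₁ * rieszKernel α ((α - 1) / p') z w) * V w ^ (1 / p') := by gcongr
    _ = _ := by
      rw [ENNReal.mul_rpow_of_nonneg _ _ (by positivity : 0 ≤ 1 / p')]
      have : N ^ (1 / p') * N⁻¹ ^ (1 / p') = 1 := by
        rw [← ENNReal.mul_rpow_of_nonneg _ _ (by positivity), ENNReal.mul_inv_cancel hN hN',
          ENNReal.one_rpow]
      calc _ = 1 * (C₁ * (V w ^ (1 / p') * rieszKernel α ((α - 1) / p') z w)) := by ring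
        _ = _ := by rw [← this]; ring

theorem cylinder_subset_pball {ρ : ℝ} (hρ : 0 < ρ) (z : ST d) : cylinder α ρ z ⊆ pball α ρ z := by
  intro w hw
  refine ⟨?_, hw.2.2⟩
  rw [abs_le]
  have := Real.rpow_pos_of_pos hρ α
  constructor <;> linarith [hw.1, hw.2.1]

theorem pball_subset_cylinder (hα : 1 ≤ α) {ρ : ℝ} (hρ : 0 < ρ) (z : ST d) :
    pball α ρ z ⊆ cylinder α (2 * ρ) (z.1 - ρ ^ α, z.2) := by
  intro w hw
  have h1 := abs_le.1 hw.1
  have h2 : 2 * ρ ^ α ≤ (2 * ρ) ^ α := by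
    rw [Real.mul_rpow (by norm_num) hρ.le]
    gcongr
    calc (2 : ℝ) = 2 ^ (1 : ℝ) := by simp
      _ ≤ 2 ^ α := Real.rpow_le_rpow_of_exponent_le (by norm_num) hα
  exact ⟨by dsimp only; linarith, by dsimp only; linarith, hw.2.trans (by linarith)⟩

/-- The Morrey norm uses cylinders forward in time. A two-sided ball of radius ρ lies in the forward
cylinder of radius 2ρ started ρ^α earlier, which costs only a constant, kept explicit so that
smallness carries over. -/
theorem morreyBd_of_morreyNorm_le (hα : 1 < α) (hq : 0 < q) {b : ST d → Sp d} {c : ℝ≥0∞}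
    (h : morreyNorm α q (fun z => ‖b z‖ ^ (1 / (α - 1))) ≤ c) :
    MorreyBd α q (fun z => ‖b z‖ₑ)
      ((c ^ q * (unitVol d * ENNReal.ofReal (2 ^ (d + α - q)))) ^ ((α - 1) / q)) := by
  intro ρ hρ x
  have hk : 0 < α - 1 := by linarith
  have e : ∀ w : ST d, ‖‖b w‖ ^ (1 / (α - 1))‖ₑ ^ q = ‖b w‖ₑ ^ (q / (α - 1)) := by
    intro w
    rw [Real.enorm_of_nonneg (by positivity), ← ENNReal.ofReal_rpow_of_nonneg (norm_nonneg _)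
      (by positivity), ofReal_norm, ← ENNReal.rpow_mul]
    congr 1; ring
  have hρ2 : 0 < 2 * ρ := by linarith
  set z : ST d := (x.1 - ρ ^ α, x.2)
  set I := ∫⁻ w in cylinder α (2 * ρ) z, ‖‖b w‖ ^ (1 / (α - 1))‖ₑ ^ q with hI
  set v := volume (cylinder α (2 * ρ) z)
  have hv1 : v ≤ unitVol d * ENNReal.ofReal ((2 * ρ) ^ (d + α)) := by
    rw [← volume_pball hρ2 z]
    exact measure_mono (cylinder_subset_pball hρ2 z)
  have hv0 : v ≠ 0 := by
    have : 0 < volume (pball α ρ x) := by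
      rw [volume_pball hρ]
      exact ENNReal.mul_pos unitVol_ne_zero (ENNReal.ofReal_pos.2 (by positivity)).ne'
    exact (this.trans_le (measure_mono (pball_subset_cylinder hα.le hρ x))).ne'
  have hvt : v ≠ ⊤ := ne_top_of_le_ne_top (ENNReal.mul_ne_top unitVol_ne_top ENNReal.ofReal_ne_top) hv1
  have h1 : ENNReal.ofReal (2 * ρ) * (I / v) ^ (1 / q) ≤ c := by
    refine le_trans ?_ h
    exact le_iSup_of_le (2 * ρ) (le_iSup_of_le hρ2 (le_iSup_of_le z le_rfl))
  have h2 : ENNReal.ofReal ((2 * ρ) ^ q) * (I / v) ≤ c ^ q := by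
    have := ENNReal.rpow_le_rpow h1 hq.le
    rwa [ENNReal.mul_rpow_of_nonneg _ _ hq.le, ← ENNReal.rpow_mul, one_div_mul_cancel hq.ne',
      ENNReal.rpow_one, ENNReal.ofReal_rpow_of_pos hρ2] at this
  calc ∫⁻ w in pball α ρ x, ‖b w‖ₑ ^ (q / (α - 1)) ≤ I := by
        rw [hI]; simp only [e]
        exact lintegral_mono_set (pball_subset_cylinder hα.le hρ x)
    _ = ENNReal.ofReal ((2 * ρ) ^ (-q)) * (ENNReal.ofReal ((2 * ρ) ^ q) * (I / v)) * v := by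
        rw [← mul_assoc, ofReal_rpow_mul_rpow hρ2, neg_add_cancel, Real.rpow_zero, ENNReal.ofReal_one,
          one_mul, ENNReal.div_mul_cancel hv0 hvt]
    _ ≤ ENNReal.ofReal ((2 * ρ) ^ (-q)) * c ^ q * (unitVol d * ENNReal.ofReal ((2 * ρ) ^ (d + α))) := by
        gcongr
    _ = (c ^ q * unitVol d) * (ENNReal.ofReal ((2 * ρ) ^ (-q)) * ENNReal.ofReal ((2 * ρ) ^ (d + α))) := by
        ring
    _ = _ := by
        rw [ofReal_rpow_mul_rpow hρ2, ← ENNReal.rpow_mul, div_mul_div_cancel₀ hq.ne',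
          div_self hk.ne', ENNReal.rpow_one, neg_add_eq_sub, Real.mul_rpow (by norm_num) hρ.le,
          ENNReal.ofReal_mul (by positivity)]
        ring

/-- Boundedness and L^1 control bound ∫ V^m for m = (d+α)/(α-1), the scale-invariant exponent;
Jensen on a ball then gives the Morrey bound since q < d + α. A bounded field with small integral
thus has small Morrey size. -/
theorem morreyBd_of_lintegral_le (hα : 1 < α) (hq : 0 < q) (hqD : q < d + α) {V : ST d → ℝ≥0∞}
    (hV : Measurable V) {M : ℝ≥0∞} (hVM : ∀ z, V z ≤ M) :
    MorreyBd α q V (((M ^ ((d + α) / (α - 1) - 1) * ∫⁻ z, V z) ^ (q / (d + α)) *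
      unitVol d ^ (1 - q / (d + α))) ^ ((α - 1) / q)) := by
  intro ρ hρ x
  have hk : 0 < α - 1 := by linarith
  have hD : 0 < d + α := by linarith [(d.cast_nonneg : (0 : ℝ) ≤ d)]
  set m := (d + α) / (α - 1) with hm
  have hm1 : 1 ≤ m := by
    rw [hm, le_div_iff₀ hk]; linarith [(d.cast_nonneg : (0 : ℝ) ≤ d)]
  have ha1 : q / (d + α) < 1 := (div_lt_one hD).2 hqD
  have e : ∀ w, V w ^ (q / (α - 1)) = (V w ^ m) ^ (q / (d + α)) := by
    intro w
    rw [← ENNReal.rpow_mul, hm]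
    congr 1; field_simp
  have hVm : ∫⁻ w in pball α ρ x, V w ^ m ≤ M ^ (m - 1) * ∫⁻ z, V z := by
    refine (setLIntegral_le_lintegral _ _).trans ?_
    rw [← lintegral_const_mul _ hV]
    refine lintegral_mono fun w => ?_
    calc V w ^ m = V w ^ (m - 1) * V w := by
          conv_lhs => rw [show m = (m - 1) + 1 by ring]
          rw [ENNReal.rpow_add_of_nonneg _ _ (by linarith) zero_le_one, ENNReal.rpow_one]
      _ ≤ _ := mul_le_mul_left (ENNReal.rpow_le_rpow (hVM w) (by linarith)) _
  simp_rw [e]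
  refine (lintegral_rpow_le_measure_mul (div_pos hq hD) ha1 (hV.pow_const m).aemeasurable).trans ?_
  rw [Measure.restrict_apply_univ, volume_pball hρ, ENNReal.mul_rpow_of_nonneg _ _ (by linarith),
    ofReal_rpow_rpow hρ, ← ENNReal.rpow_mul, div_mul_div_cancel₀ hq.ne', div_self hk.ne',
    ENNReal.rpow_one, show (d + α) * (1 - q / (d + α)) = d + α - q by field_simp]
  calc _ ≤ unitVol d ^ (1 - q / (d + α)) * ENNReal.ofReal (ρ ^ (d + α - q)) *
        (M ^ (m - 1) * ∫⁻ z, V z) ^ (q / (d + α)) :=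
        mul_le_mul_right (ENNReal.rpow_le_rpow hVm (by positivity)) _
    _ = _ := by ring
end

/-! ### The operators for a general drift factor and their truncation -/

section operators
variable {d : ℕ} {α lam : ℝ} {P P' : ℝ≥0∞} [Fact (1 ≤ P)]

/-- `R = A · ∇ (λ + ∂_t + (-Δ)^{α/2})^{-s}` on `L^p`, with `s = 1/α + (1 - 1/α)/p`. -/
def IsGradOp (α lam : ℝ) (A : ST d → Sp d) (R : LL d P →L[ℝ] LL d P) : Prop :=
  ∀ g : LL d P, R g =ᵐ[volume] fun z => ⟪A z, gradConv α lam (ordU α P) g z⟫_ℝ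

/-- `Q = (λ + ∂_t + (-Δ)^{α/2})^{-s} B` on `L^p`, with `s = (1 - 1/α)(1 - 1/p)`. -/
def IsPotOp (α lam : ℝ) (B : ST d → ℝ) (Q : LL d P →L[ℝ] LL d P) : Prop :=
  ∀ g : LL d P,
    (∀ᵐ z, Integrable (fun w => potKernel α lam (ordF α P) (z - w) * (B w * g w))) ∧
    Q g =ᵐ[volume] pot α lam (ordF α P) (fun w => B w * g w)

theorem IsGradOp.congr {A A' : ST d → Sp d} {R : LL d P →L[ℝ] LL d P} (h : IsGradOp α lam A R)
    (hA : A =ᵐ[volume] A') : IsGradOp α lam A' R := fun g => by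
  filter_upwards [h g, hA] with z h₁ h₂
  rw [h₁, h₂]

theorem IsPotOp.congr {B B' : ST d → ℝ} {Q : LL d P →L[ℝ] LL d P} (h : IsPotOp α lam B Q)
    (hB : B =ᵐ[volume] B') : IsPotOp α lam B' Q := fun g => by
  have e : (fun w => B w * g w) =ᵐ[volume] fun w => B' w * g w := by
    filter_upwards [hB] with w hw; rw [hw]
  refine ⟨?_, (h g).2.trans (Eventually.of_forall fun z => by rw [pot_congr e])⟩
  filter_upwards [(h g).1] with z hz
  refine hz.congr ?_
  filter_upwards [e] with w hw; rw [hw]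

theorem IsGradOp.add {A A' : ST d → Sp d} {R R' : LL d P →L[ℝ] LL d P} (h : IsGradOp α lam A R)
    (h' : IsGradOp α lam A' R') : IsGradOp α lam (A + A') (R + R') := fun g => by
  filter_upwards [h g, h' g, Lp.coeFn_add (R g) (R' g)] with z h₁ h₂ h₃
  rw [add_apply, h₃, Pi.add_apply, Pi.add_apply, h₁, h₂, inner_add_left]

theorem IsPotOp.add {B B' : ST d → ℝ} {Q Q' : LL d P →L[ℝ] LL d P} (h : IsPotOp α lam B Q)
    (h' : IsPotOp α lam B' Q') : IsPotOp α lam (B + B') (Q + Q') := fun g => by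
  have e : ∀ z, (fun w => potKernel α lam (ordF α P) (z - w) * ((B + B') w * g w)) =
      fun w => potKernel α lam (ordF α P) (z - w) * (B w * g w) +
        potKernel α lam (ordF α P) (z - w) * (B' w * g w) := fun z => by
    ext w; rw [Pi.add_apply]; ring
  constructor
  · filter_upwards [(h g).1, (h' g).1] with z h₁ h₂
    rw [e]; exact h₁.add h₂
  · filter_upwards [h g |>.2, h' g |>.2, (h g).1, (h' g).1, Lp.coeFn_add (Q g) (Q' g)]
      with z h₁ h₂ i₁ i₂ h₃
    rw [add_apply, h₃, Pi.add_apply, h₁, h₂, pot, pot, pot, e,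
      integral_add i₁ i₂]

theorem Adm.exists_isGradOp (hpq : P.toReal.HolderConjugate P'.toReal) (H : Adm d α lam)
    {A : ST d → Sp d} (hA : StronglyMeasurable A) {C : ℝ≥0∞} (hC : C ≠ ⊤)
    (h : KerBound P.toReal (fun z w => ‖A z‖ₑ * ‖gradPot α lam (ordU α P) (z - w)‖ₑ) C) :
    ∃ R : LL d P →L[ℝ] LL d P, IsGradOp α lam A R ∧ ‖R‖ ≤ C.toReal := by
  obtain ⟨hP, hPt⟩ := ne_zero_ne_top_of_holder hpq
  have hs := (ordU_pos H.one_lt hpq.lt).1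
  have hk : StronglyMeasurable (Function.uncurry fun z w : ST d =>
      ⟪A z, gradPot α lam (ordU α P) (z - w)⟫_ℝ) :=
    (hA.comp_measurable measurable_fst).inner (stronglyMeasurable_gradPot_sub α lam _)
  have hb : KerBound P.toReal (fun z w : ST d => ‖⟪A z, gradPot α lam (ordU α P) (z - w)⟫_ℝ‖ₑ) C :=
    h.mono hpq.nonneg (fun z w => by
      rw [← ofReal_norm, ← ofReal_norm, ← ofReal_norm, ← ENNReal.ofReal_mul (norm_nonneg _)]
      exact ENNReal.ofReal_le_ofReal (norm_inner_le_norm _ _)) le_rfl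
  refine ⟨kerOp hPt _ hk hb hC, fun g => ?_, norm_kerOp_le hPt hk hb hC⟩
  filter_upwards [kerOp_apply_ae hPt hk hb hC g, ae_integrable_kernel_smul hP hPt
    (stronglyMeasurable_gradPot_sub α lam (ordU α P)) (kerBound_gradPot hpq)
    (H.lintegral_gradPot_ne_top hs) (Lp.memLp g)] with z h₁ h₂
  rw [h₁, gradConv, ← integral_inner h₂]
  simp only [real_inner_smul_right, smul_eq_mul]

theorem exists_isPotOp (hpq : P.toReal.HolderConjugate P'.toReal)
    {B : ST d → ℝ} (hB : Measurable B) {C : ℝ≥0∞} (hC : C ≠ ⊤)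
    (h : KerBound P.toReal (fun z w => ‖potKernel α lam (ordF α P) (z - w)‖ₑ * ‖B w‖ₑ) C) :
    ∃ Q : LL d P →L[ℝ] LL d P, IsPotOp α lam B Q ∧ ‖Q‖ ≤ C.toReal := by
  obtain ⟨hP, hPt⟩ := ne_zero_ne_top_of_holder hpq
  have hk : StronglyMeasurable (Function.uncurry fun z w : ST d =>
      potKernel α lam (ordF α P) (z - w) * B w) :=
    (stronglyMeasurable_potKernel_sub α lam _).mul (hB.comp measurable_snd).stronglyMeasurable
  have hb : KerBound P.toReal (fun z w : ST d => ‖potKernel α lam (ordF α P) (z - w) * B w‖ₑ) C :=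
    h.mono hpq.nonneg (fun z w => (enorm_mul _ _).le) le_rfl
  have e : ∀ (g : LL d P) z w, g w • (potKernel α lam (ordF α P) (z - w) * B w) =
      potKernel α lam (ordF α P) (z - w) * (B w * g w) := fun g z w => by
    rw [smul_eq_mul]; ring
  refine ⟨kerOp hPt _ hk hb hC, fun g => ⟨?_, ?_⟩, norm_kerOp_le hPt hk hb hC⟩
  · have := ae_integrable_kernel_smul hP hPt hk hb hC (Lp.memLp g)
    simpa only [e] using this
  · have := kerOp_apply_ae hPt hk hb hC g
    simp only [e] at this
    exact this

theorem Adm.isOpR_of_isGradOp (hpq : P.toReal.HolderConjugate P'.toReal) (H : Adm d α lam)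
    {b : ST d → Sp d} {R : LL d P →L[ℝ] LL d P} (h : IsGradOp α lam (rootField P b) R) :
    IsOpR α lam b R := fun g =>
  ⟨_, H.isWeakGrad_pot hpq (ordU_pos H.one_lt hpq.lt).1 (Lp.memLp g), h g⟩

/-- Restriction of a function in `L^p` to a measurable set. -/
def restr {d : ℕ} {P : ℝ≥0∞} {S : Set (ST d)} (hS : MeasurableSet S) (g : LL d P) : LL d P :=
  ((Lp.memLp g).indicator hS).toLp

theorem coeFn_restr {d : ℕ} {P : ℝ≥0∞} {S : Set (ST d)} (hS : MeasurableSet S) (g : LL d P) :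
    restr hS g =ᵐ[volume] S.indicator g := MemLp.coeFn_toLp _

/-- Dominated convergence: each point eventually belongs to the sets. -/
theorem tendsto_restr (hPt : P ≠ ⊤) {S : ℕ → Set (ST d)} (hS : ∀ n, MeasurableSet (S n))
    (h : ∀ z, ∀ᶠ n in atTop, z ∈ S n) (g : LL d P) :
    Tendsto (fun n => restr (hS n) g) atTop (𝓝 g) := by
  have hP : P ≠ 0 := (zero_lt_one.trans_le (Fact.out : 1 ≤ P)).ne'
  have hp : 0 < P.toReal := ENNReal.toReal_pos hP hPt
  rw [Lp.tendsto_Lp_iff_tendsto_eLpNorm']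
  have hfin := lintegral_rpow_ne_top hP hPt (Lp.memLp g)
  have key : Tendsto (fun n => ∫⁻ z, ‖restr (hS n) g z - g z‖ₑ ^ P.toReal) atTop
      (𝓝 (∫⁻ _ : ST d, 0)) := by
    refine tendsto_lintegral_of_dominated_convergence' (fun z => ‖g z‖ₑ ^ P.toReal)
      (fun n => (((Lp.aestronglyMeasurable _).sub (Lp.aestronglyMeasurable g)).enorm.pow_const _))
      (fun n => ?_) hfin ?_
    · filter_upwards [coeFn_restr (hS n) g] with z hz
      refine ENNReal.rpow_le_rpow ?_ hp.le
      rw [hz]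
      by_cases hzS : z ∈ S n
      · simp [Set.indicator_of_mem hzS]
      · simp [Set.indicator_of_notMem hzS]
    · have : ∀ᵐ z, ∀ n, restr (hS n) g z = (S n).indicator g z :=
        ae_all_iff.2 fun n => coeFn_restr (hS n) g
      filter_upwards [this] with z hz
      refine tendsto_const_nhds.congr' ?_
      filter_upwards [h z] with n hn
      rw [hz n, Set.indicator_of_mem hn, sub_self, enorm_zero, ENNReal.zero_rpow_of_pos hp]
  rw [lintegral_zero] at key
  have e : ∀ n, eLpNorm (⇑(restr (hS n) g) - ⇑g) P volume =
      (∫⁻ z, ‖restr (hS n) g z - g z‖ₑ ^ P.toReal) ^ (1 / P.toReal) := fun n => by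
    rw [eLpNorm_eq_lintegral_rpow_enorm_toReal hP hPt]
    rfl
  simp_rw [e]
  have := (ENNReal.continuous_rpow_const (y := 1 / P.toReal)).tendsto 0 |>.comp key
  rwa [ENNReal.zero_rpow_of_pos (by positivity)] at this

/-- The factor A acts after the gradient, so cutting it off on S restricts the output. Combined with
`tendsto_restr` this yields strong convergence when the remaining difference D is small in norm. -/
theorem IsGradOp.apply_eq_of_indicator {S : Set (ST d)} (hS : MeasurableSet S)
    {A A' : ST d → Sp d} {R R' D : LL d P →L[ℝ] LL d P} (h : IsGradOp α lam A R)
    (h' : IsGradOp α lam A' R') (hD : IsGradOp α lam (A' - S.indicator A) D) (g : LL d P) :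
    R' g = restr hS (R g) + D g := by
  refine Lp.ext ?_
  filter_upwards [h g, h' g, hD g, Lp.coeFn_add (restr hS (R g)) (D g), coeFn_restr hS (R g)]
    with z h₁ h₂ h₃ h₄ h₅
  rw [h₄, Pi.add_apply, h₅, h₂, h₃, Pi.sub_apply, inner_sub_left]
  by_cases hz : z ∈ S
  · rw [Set.indicator_of_mem hz, Set.indicator_of_mem hz, h₁]; ring
  · rw [Set.indicator_of_notMem hz, Set.indicator_of_notMem hz, inner_zero_left]; ring

/-- The factor B acts before the potential, so cutting it off on S restricts the input instead. -/
theorem IsPotOp.apply_eq_of_indicator {S : Set (ST d)} (hS : MeasurableSet S)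
    {B B' : ST d → ℝ} {Q Q' D : LL d P →L[ℝ] LL d P} (h : IsPotOp α lam B Q)
    (h' : IsPotOp α lam B' Q') (hD : IsPotOp α lam (B' - S.indicator B) D) (g : LL d P) :
    Q' g = Q (restr hS g) + D g := by
  have e : (fun w => B w * restr hS g w) =ᵐ[volume] fun w => S.indicator B w * g w := by
    filter_upwards [coeFn_restr hS g] with w hw
    rw [hw]
    by_cases hz : w ∈ S
    · rw [Set.indicator_of_mem hz, Set.indicator_of_mem hz]
    · rw [Set.indicator_of_notMem hz, Set.indicator_of_notMem hz, mul_zero, zero_mul]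
  refine Lp.ext ?_
  filter_upwards [(h (restr hS g)).2, (h' g).2, (hD g).2, Lp.coeFn_add (Q (restr hS g)) (D g),
    (h (restr hS g)).1, (hD g).1] with z h₁ h₂ h₃ h₄ i₁ i₃
  rw [h₄, Pi.add_apply, h₂, h₁, h₃, pot, pot, pot, ← integral_add i₁ i₃]
  refine integral_congr_ae ?_
  filter_upwards [e] with w hw
  rw [hw, Pi.sub_apply]; ring

end operators

/-- Perturbation of fixed points under strong convergence of contractions. -/
theorem tendsto_of_one_add_mul_apply_eq {X : Type*} [NormedAddCommGroup X] [NormedSpace ℝ X]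
    {Rn Qn : ℕ → X →L[ℝ] X} {R Q : X →L[ℝ] X} {F w : X} {Fn wn : ℕ → X} {a : ℝ}
    (ha : a < 1) (hR : ∀ n, ‖Rn n‖ ≤ a) (hQ : ∀ n, ‖Qn n‖ ≤ a)
    (hRt : ∀ x, Tendsto (fun n => Rn n x) atTop (𝓝 (R x)))
    (hQt : ∀ x, Tendsto (fun n => Qn n x) atTop (𝓝 (Q x)))
    (hw : w + Q (R w) = F) (hwn : ∀ n, wn n + Qn n (Rn n (wn n)) = Fn n)
    (hF : Tendsto Fn atTop (𝓝 F)) : Tendsto wn atTop (𝓝 w) := by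
  have ha0 : 0 ≤ a := (norm_nonneg _).trans (hR 0)
  have haa : a * a < 1 := by nlinarith
  have bd : ∀ n, ‖wn n - w‖ ≤ (1 - a * a)⁻¹ *
      (‖Fn n - F‖ + (a * ‖Rn n w - R w‖ + ‖Qn n (R w) - Q (R w)‖)) := fun n => by
    -- Subtracting the two equations isolates the difference. The term containing it again has norm
    -- at most a² times the difference and is absorbed on the left; the others involve the operators
    -- only at the fixed vectors w and R w.
    have e : wn n - w = (Fn n - F) - Qn n (Rn n (wn n - w)) - Qn n (Rn n w - R w) -
        (Qn n (R w) - Q (R w)) := by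
      rw [← hwn n, ← hw]; simp only [map_sub]; abel
    have h1 : ‖Qn n (Rn n (wn n - w))‖ ≤ a * (a * ‖wn n - w‖) :=
      ((Qn n).le_of_opNorm_le (hQ n) _).trans
        (mul_le_mul_of_nonneg_left ((Rn n).le_of_opNorm_le (hR n) _) ha0)
    have h2 : ‖Qn n (Rn n w - R w)‖ ≤ a * ‖Rn n w - R w‖ := (Qn n).le_of_opNorm_le (hQ n) _
    have h3 : ‖wn n - w‖ ≤ ‖Fn n - F‖ + ‖Qn n (Rn n (wn n - w))‖ + ‖Qn n (Rn n w - R w)‖ +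
        ‖Qn n (R w) - Q (R w)‖ := by
      conv_lhs => rw [e]
      refine (norm_sub_le _ _).trans (add_le_add_left ?_ _)
      refine (norm_sub_le _ _).trans (add_le_add_left ?_ _)
      exact norm_sub_le _ _
    rw [inv_mul_eq_div, le_div_iff₀ (by linarith)]
    nlinarith
  rw [tendsto_iff_norm_sub_tendsto_zero]
  refine squeeze_zero (fun n => norm_nonneg _) bd ?_
  have t1 := tendsto_iff_norm_sub_tendsto_zero.1 hF
  have t2 := tendsto_iff_norm_sub_tendsto_zero.1 (hRt w)
  have t3 := tendsto_iff_norm_sub_tendsto_zero.1 (hQt (R w))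
  simpa using (t1.add ((t2.const_mul a).add t3)).const_mul (1 - a * a)⁻¹

/-! ### Distributional solutions and the equation w + QRw = F -/

section equation
variable {d : ℕ} {α lam : ℝ} {P P' : ℝ≥0∞}

/-- Moving A^{-s} onto A*φ gives (A*)^{-s}A*φ = (A*)^{1-s}φ, and 1 - s = `ordF α P`, so the pairing
is the one by which F represents the distribution. -/
theorem Adm.integral_pot_ordU_mul_bwdOp (hpq : P.toReal.HolderConjugate P'.toReal)
    (H : Adm d α lam) {T : Test d → ℝ} {F : LL d P} (h : IsNegBessel α lam (ordF α P) T F)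
    (φ : Test d) : ∫ z, pot α lam (ordU α P) F z * bwdOp α lam φ z = T φ := by
  have ho := ordU_pos H.one_lt hpq.lt
  have hs : 0 < ordU α P := by
    have := H.pos
    exact (by positivity : (0 : ℝ) < 1 / α).trans ho.1
  rw [H.integral_pot_mul hpq hs (Lp.memLp F) (H.memLp_bwdOp φ hpq.symm.lt.le), h φ, bwdPow,
    ← ho.2.2, add_sub_cancel_right]

/-- The orders add up to 1, and the potential of order 1, moved to the other side, inverts A* on
test functions. -/
theorem Adm.integral_pot_pot_mul_bwdOp (hpq : P.toReal.HolderConjugate P'.toReal)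
    (H : Adm d α lam) {h : ST d → ℝ} (hh : MemLp h P) (φ : Test d) :
    ∫ z, pot α lam (ordU α P) (pot α lam (ordF α P) h) z * bwdOp α lam φ z = ∫ z, h z * φ z := by
  have ho := ordU_pos H.one_lt hpq.lt
  have hs : 0 < ordU α P := by
    have := H.pos
    exact (by positivity : (0 : ℝ) < 1 / α).trans ho.1
  calc _ = ∫ z, pot α lam 1 h z * bwdOp α lam φ z := by
        refine integral_congr_ae ?_
        filter_upwards [H.pot_pot hpq hs ho.2.1 hh] with z hz
        rw [hz, ho.2.2]
    _ = _ := by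
        rw [H.integral_pot_mul hpq one_pos hh (H.memLp_bwdOp φ hpq.symm.lt.le)]
        simp only [H.bwdPot_one_bwdOp]

theorem Adm.integral_pot_sub_mul_bwdOp (hpq : P.toReal.HolderConjugate P'.toReal)
    (H : Adm d α lam) {T : Test d → ℝ} {F : LL d P} (h : IsNegBessel α lam (ordF α P) T F)
    {f : ST d → ℝ} (hf : MemLp f P) (φ : Test d) :
    ∫ z, pot α lam (ordU α P) (fun z => F z - pot α lam (ordF α P) f z) z * bwdOp α lam φ z =
      T φ - ∫ z, f z * φ z := by
  have ho := ordU_pos H.one_lt hpq.lt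
  have hs : 0 < ordU α P := by
    have := H.pos
    exact (by positivity : (0 : ℝ) < 1 / α).trans ho.1
  have m := H.memLp_pot hpq ho.2.1 hf
  have hb := H.memLp_bwdOp φ hpq.symm.lt.le
  have : ENNReal.HolderConjugate P P' := by
    exact ENNReal.HolderConjugate.of_toReal hpq
  have i₁ := (H.memLp_pot hpq hs (Lp.memLp F)).integrable_mul hb
  have i₂ := (H.memLp_pot hpq hs m).integrable_mul hb
  calc _ = ∫ z, (pot α lam (ordU α P) F * bwdOp α lam φ) z -
        (pot α lam (ordU α P) (pot α lam (ordF α P) f) * bwdOp α lam φ) z := by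
        refine integral_congr_ae ?_
        filter_upwards [H.pot_sub hpq hs (Lp.memLp F) m] with z hz
        rw [hz, Pi.mul_apply, Pi.mul_apply, sub_mul]
    _ = _ := by
        rw [integral_sub i₁ i₂]
        simp only [Pi.mul_apply]
        rw [H.integral_pot_ordU_mul_bwdOp hpq h, H.integral_pot_pot_mul_bwdOp hpq hf]

/-- Off the zeros of b the exponents 1 - 1/p and -1 + 1/p cancel, and at a zero both sides vanish.
This identity makes QRw = A^{-s'}(b·∇A^{-s}w). -/
theorem norm_rpow_mul_inner_rootField (b : ST d → Sp d) (z : ST d) (v : Sp d) :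
    ‖b z‖ ^ (1 - 1 / P.toReal) * ⟪rootField P b z, v⟫_ℝ = ⟪b z, v⟫_ℝ := by
  rcases eq_or_ne (b z) 0 with h | h
  · simp [rootField, h]
  · rw [rootField, real_inner_smul_left, ← mul_assoc, ← Real.rpow_add (norm_pos_iff.2 h)]
    simp

variable [Fact (1 ≤ P)]

theorem IsGradOp.inner_ae_eq {b : ST d → Sp d} {R : LL d P →L[ℝ] LL d P}
    (hR : IsGradOp α lam (rootField P b) R) (w : LL d P) :
    (fun z => ‖b z‖ ^ (1 - 1 / P.toReal) * R w z) =ᵐ[volume]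
      fun z => ⟪b z, gradConv α lam (ordU α P) w z⟫_ℝ := by
  filter_upwards [hR w] with z hz
  rw [hz, norm_rpow_mul_inner_rootField]

theorem memLp_inner_of_bounded {d : ℕ} {P : ℝ≥0∞} {b G : ST d → Sp d} (hb : AEStronglyMeasurable b) {m : ℝ}
    (hm : ∀ z, ‖b z‖ ≤ m) (hG : MemLp G P) : MemLp (fun z => ⟪b z, G z⟫_ℝ) P := by
  refine hG.of_le_mul (c := m) (hb.inner hG.1) (Eventually.of_forall fun z => ?_)
  exact (norm_inner_le_norm _ _).trans (mul_le_mul_of_nonneg_right (hm z) (norm_nonneg _))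

/-- Solutions of the fixed point equation solve the differential equation. -/
theorem Adm.isSolution_pot (hpq : P.toReal.HolderConjugate P'.toReal) (H : Adm d α lam)
    {b : ST d → Sp d} (hb : AEStronglyMeasurable b) {m : ℝ} (hm : ∀ z, ‖b z‖ ≤ m)
    {R Q : LL d P →L[ℝ] LL d P} (hR : IsGradOp α lam (rootField P b) R)
    (hQ : IsPotOp α lam (fun z => ‖b z‖ ^ (1 - 1 / P.toReal)) Q) {f : ST d → ℝ} {F w : LL d P}
    (hf : IsNegBessel α lam (ordF α P) (funDistr f) F) (hw : w + Q (R w) = F) :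
    IsSolution P α lam b f (pot α lam (ordU α P) w) := by
  have ho := ordU_pos H.one_lt hpq.lt
  have hs : 0 < ordU α P := by
    have := H.pos
    exact (by positivity : (0 : ℝ) < 1 / α).trans ho.1
  have hG := H.memLp_gradConv hpq ho.1 (Lp.memLp w)
  have hin := memLp_inner_of_bounded hb hm hG
  refine ⟨H.memLp_pot hpq hs (Lp.memLp w), _, H.isWeakGrad_pot hpq ho.1 (Lp.memLp w), hG,
    fun φ => ?_⟩
  -- The equation solved for w, with Q R w rewritten as A^{-s'}(b·∇u); applying A in the
  -- distributional sense to A^{-s}w then gives f - b·∇u.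
  have e : (w : ST d → ℝ) =ᵐ[volume] fun z => F z - pot α lam (ordF α P)
      (fun z => ⟪b z, gradConv α lam (ordU α P) w z⟫_ℝ) z := by
    have e1 : w = F - Q (R w) := by rw [← hw]; abel
    have e2 := Lp.coeFn_sub F (Q (R w))
    rw [← e1] at e2
    filter_upwards [e2, (hQ (R w)).2] with z h₁ h₂
    rw [h₁, Pi.sub_apply, h₂, pot_congr (hR.inner_ae_eq w)]
  rw [pot_congr e, H.integral_pot_sub_mul_bwdOp hpq hf hin, funDistr]
  ring

/-- Solutions of the differential equation solve the fixed point equation. -/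
theorem Adm.exists_of_isSolution (hpq : P.toReal.HolderConjugate P'.toReal) (H : Adm d α lam)
    {b : ST d → Sp d} (hb : AEStronglyMeasurable b) {m : ℝ} (hm : ∀ z, ‖b z‖ ≤ m)
    {R Q : LL d P →L[ℝ] LL d P} (hR : IsGradOp α lam (rootField P b) R)
    (hQ : IsPotOp α lam (fun z => ‖b z‖ ^ (1 - 1 / P.toReal)) Q) {f u : ST d → ℝ} {F : LL d P}
    (hf : IsNegBessel α lam (ordF α P) (funDistr f) F) (hu : IsSolution P α lam b f u) :
    ∃ w : LL d P, IsPosBessel α lam (ordU α P) u w ∧ w + Q (R w) = F := by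
  obtain ⟨huP, G, hG, hGP, heq⟩ := hu
  have ho := ordU_pos H.one_lt hpq.lt
  have hs : 0 < ordU α P := by
    have := H.pos
    exact (by positivity : (0 : ℝ) < 1 / α).trans ho.1
  have hin := memLp_inner_of_bounded hb hm hGP
  have hp := H.memLp_pot hpq ho.2.1 hin
  -- The only possible candidate, built from the weak gradient of u. Both u and A^{-s}w solve Av = f
  -- - b·∇u, so they agree by uniqueness for A.
  set w : LL d P := F - hp.toLp with hw
  have ew : (w : ST d → ℝ) =ᵐ[volume] fun z => F z - pot α lam (ordF α P)
      (fun z => ⟪b z, G z⟫_ℝ) z := by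
    filter_upwards [Lp.coeFn_sub F hp.toLp, hp.coeFn_toLp] with z h₁ h₂
    rw [h₁, Pi.sub_apply, h₂]
  have hwP := H.memLp_pot hpq hs (Lp.memLp w)
  have : ENNReal.HolderConjugate P P' := ENNReal.HolderConjugate.of_toReal hpq
  have hu : u =ᵐ[volume] pot α lam (ordU α P) w := by
    have := H.ae_eq_zero_of_integral_bwdOp hpq (huP.sub hwP) fun φ => by
      have hbw := H.memLp_bwdOp φ hpq.symm.lt.le
      have e1 := H.integral_pot_sub_mul_bwdOp hpq hf hin φ
      rw [← pot_congr ew, funDistr, ← heq φ, add_sub_cancel_right] at e1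
      simp only [Pi.sub_apply, sub_mul]
      have i₁ : Integrable fun z => u z * bwdOp α lam φ z := huP.integrable_mul hbw
      have i₂ : Integrable fun z => pot α lam (ordU α P) w z * bwdOp α lam φ z :=
        hwP.integrable_mul hbw
      rw [integral_sub i₁ i₂, e1, sub_self]
    filter_upwards [this] with z hz
    exact sub_eq_zero.1 hz
  refine ⟨w, hu, ?_⟩
  -- Uniqueness of the weak gradient replaces G by the gradient integral of w, after which the
  -- definition of w becomes the equation w + QRw = F.
  have hG' : G =ᵐ[volume] gradConv α lam (ordU α P) w := by
    refine hG.ae_eq ?_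
    obtain ⟨l₁, l₂, h₃⟩ := H.isWeakGrad_pot hpq ho.1 (Lp.memLp w)
    refine ⟨hG.1, l₂, fun φ e => ?_⟩
    rw [← h₃ φ e]
    exact integral_congr_ae (by filter_upwards [hu] with z hz; rw [hz])
  have hQR : Q (R w) = hp.toLp := by
    have e1 : pot α lam (ordF α P) (fun z => ⟪b z, gradConv α lam (ordU α P) w z⟫_ℝ) =
        pot α lam (ordF α P) (fun z => ⟪b z, G z⟫_ℝ) :=
      pot_congr (by filter_upwards [hG'] with z hz; rw [hz])
    refine Lp.ext ?_
    filter_upwards [(hQ (R w)).2, hp.coeFn_toLp] with z h₁ h₂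
    rw [h₁, h₂, pot_congr (hR.inner_ae_eq w), e1]
  rw [hQR, hw, sub_add_cancel]

end equation

/-! ### Weak solutions for p = 2 -/

section weak
variable {d : ℕ} {α lam : ℝ} {P P' : ℝ≥0∞}

theorem stronglyMeasurable_pot (s : ℝ) {f : ST d → ℝ} (hf : StronglyMeasurable f) :
    StronglyMeasurable (pot α lam s f) :=
  StronglyMeasurable.integral_prod_right
    (f := fun z w : ST d => potKernel α lam s (z - w) * f w)
    ((stronglyMeasurable_potKernel_sub α lam s).mul (hf.comp_measurable measurable_snd))

theorem Adm.memLp_fwdPow (hpq : P.toReal.HolderConjugate P'.toReal) (H : Adm d α lam) {s : ℝ}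
    (hs1 : s < 1) (φ : Test d) : MemLp (fwdPow α lam s φ) P :=
  H.memLp_pot hpq (sub_pos.2 hs1) (H.memLp_fwdOp φ hpq.lt.le)

/-- The functions `(λ + ∂_t + (-Δ)^{α/2})^s η` are total in the dual of `L^p`. -/
theorem Adm.ae_eq_zero_of_integral_fwdPow (hpq : P.toReal.HolderConjugate P'.toReal)
    (H : Adm d α lam) {s : ℝ} (hs0 : 0 < s) (hs1 : s < 1) {g : ST d → ℝ} (hg : MemLp g P)
    (h0 : ∀ φ : Test d, ∫ z, g z * fwdPow α lam s φ z = 0) : g =ᵐ[volume] 0 := by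
  refine ae_eq_zero_of_forall_integral_mul_eq_zero hpq (T := fwdPow α lam s)
    (κ := potKernel α lam s) (H.integrable_potKernel hs0)
    (fun φ => (stronglyMeasurable_pot _ (H.fwdOp_props φ).1.stronglyMeasurable).measurable)
    (fun φ => H.memLp_fwdPow hpq.symm hs1 φ)
    (fun φ y => ⟨transTest φ y, funext fun z => ?_⟩) (fun φ => ?_) hg h0
  · simp only [fwdPow, pot, H.fwdOp_transTest φ y]
    rw [← integral_add_right_eq_self _ y]
    refine integral_congr_ae (Eventually.of_forall fun w => ?_)
    simp only
    rw [add_sub_cancel_right, sub_sub, add_comm y w]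
  · have h := H.pot_pot hpq hs0 (sub_pos.2 hs1) (H.memLp_fwdOp φ hpq.lt.le)
    filter_upwards [h] with z hz
    rw [add_sub_cancel, H.pot_one_fwdOp] at hz
    rw [← hz, pot, ← integral_sub_left_eq_self _ volume z]
    simp only [sub_sub_cancel, fwdPow]

theorem ordU_two : ordU α 2 = 1 / 2 + 1 / (2 * α) := by
  unfold ordU
  rw [ENNReal.toReal_ofNat]
  ring

/-- Weak solutions are given by the fixed point equation. -/
theorem Adm.isWeakSolution_iff (H : Adm d α lam) (R Q : LL d 2 →L[ℝ] LL d 2) (F : LL d 2)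
    (u : ST d → ℝ) : IsWeakSolution α lam R Q F u ↔
      ∃ w : LL d 2, IsPosBessel α lam (ordU α 2) u w ∧ w + Q (R w) = F := by
  have hpq : (2 : ℝ≥0∞).toReal.HolderConjugate (2 : ℝ≥0∞).toReal := by
    rw [ENNReal.toReal_ofNat]; exact Real.HolderConjugate.two_two
  have ho := ordU_pos H.one_lt hpq.lt
  have hs : 0 < ordU α 2 := by
    have := H.pos
    exact (by positivity : (0 : ℝ) < 1 / α).trans ho.1
  have hs1 : ordU α 2 < 1 := by linarith [ho.2.1, ho.2.2]
  -- Passing the adjoint back across the inner product turns the weak formulation into orthogonality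
  -- of w + QRw - F to ζ.
  have e : ∀ w ζ : LL d 2, ⟪w, ζ⟫_ℝ + ⟪R w, ContinuousLinearMap.adjoint Q ζ⟫_ℝ = ⟪F, ζ⟫_ℝ ↔
      ⟪w + Q (R w) - F, ζ⟫_ℝ = 0 := fun w ζ => by
    rw [ContinuousLinearMap.adjoint_inner_right, ← inner_add_left, inner_sub_left, sub_eq_zero]
  unfold IsWeakSolution
  rw [← ordU_two]
  refine exists_congr fun w => and_congr_right fun _ => ⟨fun h => ?_, fun h η => ?_⟩
  -- The functions A^s η are total in L², so the orthogonal vector is zero.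
  · have h0 : (w + Q (R w) - F : LL d 2) =ᵐ[volume] (0 : ST d → ℝ) := by
      refine H.ae_eq_zero_of_integral_fwdPow hpq hs hs1 (Lp.memLp _) fun φ => ?_
      obtain ⟨ζ, hζ, hi⟩ := h φ
      rw [e, L2.inner_def] at hi
      rw [← hi]
      refine integral_congr_ae ?_
      filter_upwards [hζ] with z hz
      rw [hz]
      simp [mul_comm]
    exact sub_eq_zero.1 (Lp.eq_zero_iff_ae_eq_zero.2 h0)
  · refine ⟨(H.memLp_fwdPow hpq hs1 η).toLp, MemLp.coeFn_toLp _, ?_⟩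
    rw [e, h, sub_self, inner_zero_left]

end weak

/-! ### Truncation and mollification of the drift -/

section regularization
variable {d : ℕ} {γ : ST d → ℝ} {b : ST d → Sp d}

/-- Continuity of translations in L^1. -/
theorem tendsto_lintegral_translate_sub {g : ST d → Sp d} (hg : Integrable g) :
    Tendsto (fun y : ST d => ∫⁻ z, ‖g (z - y) - g z‖ₑ) (𝓝 0) (𝓝 0) := by
  have hg1 : MemLp g 1 := memLp_one_iff_integrable.2 hg
  let τ : ST d → C(ST d, ST d) := fun y => ⟨fun z => z - y, by fun_prop⟩
  have hτ : Continuous τ :=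
    ContinuousMap.curry ⟨fun a : ST d × ST d => a.2 - a.1, by fun_prop⟩ |>.continuous
  have hm : ∀ y, MeasurePreserving (τ y) volume volume := fun y =>
    measurePreserving_sub_right volume y
  have key := ((tendsto_const_nhds (x := hg1.toLp)).compMeasurePreservingLp (hτ.tendsto 0) hm (hm 0)
    ENNReal.one_ne_top)
  rw [Lp.tendsto_Lp_iff_tendsto_eLpNorm'] at key
  refine key.congr fun y => ?_
  rw [eLpNorm_one_eq_lintegral_enorm]
  refine lintegral_congr_ae ?_
  have t : ∀ y, Lp.compMeasurePreserving (τ y) (hm y) hg1.toLp =ᵐ[volume] fun z => g (z - y) :=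
    fun y => (Lp.coeFn_compMeasurePreserving _ (hm y)).trans
      ((hm y).quasiMeasurePreserving.ae_eq_comp hg1.coeFn_toLp)
  filter_upwards [t y, t 0] with z h₁ h₂
  rw [Pi.sub_apply, h₁, h₂, sub_zero]

theorem IsMollifier.integrable (hγ : IsMollifier γ) : Integrable γ := by
  by_contra h
  have := hγ.integral_eq_one
  rw [integral_undef h] at this
  exact zero_ne_one this

theorem IsMollifier.mollifier_nonneg (hγ : IsMollifier γ) {ε : ℝ} (hε : 0 < ε) (z : ST d) :
    0 ≤ mollifier γ ε z := mul_nonneg (by positivity) (hγ.nonneg _)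

theorem IsMollifier.mollifier_eq_zero (hγ : IsMollifier γ) {ε : ℝ} (hε : 0 < ε) {z : ST d}
    (hz : ε < ‖z‖) : mollifier γ ε z = 0 := by
  rw [mollifier, hγ.supp, mul_zero]
  rw [norm_smul, norm_inv, Real.norm_of_nonneg hε.le, inv_mul_eq_div, one_lt_div hε]
  exact hz

theorem IsMollifier.continuous_mollifier (hγ : IsMollifier γ) (ε : ℝ) :
    Continuous (mollifier γ ε) := by
  have := hγ.smooth.continuous
  unfold mollifier
  fun_prop

theorem IsMollifier.integrable_mollifier (hγ : IsMollifier γ) {ε : ℝ} (hε : 0 < ε) :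
    Integrable (mollifier γ ε) :=
  (hγ.integrable.comp_smul (inv_ne_zero hε.ne')).const_mul _

theorem IsMollifier.integral_mollifier (hγ : IsMollifier γ) {ε : ℝ} (hε : 0 < ε) :
    ∫ z, mollifier γ ε z = 1 := by
  unfold mollifier
  rw [integral_const_mul, Measure.integral_comp_inv_smul_of_nonneg volume γ hε.le,
    hγ.integral_eq_one]
  have : Module.finrank ℝ (ST d) = d + 1 := by simp [add_comm]
  rw [this, smul_eq_mul, mul_one, inv_mul_cancel₀ (by positivity)]

theorem IsMollifier.lintegral_mollifier (hγ : IsMollifier γ) {ε : ℝ} (hε : 0 < ε) :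
    ∫⁻ z, ‖mollifier γ ε z‖ₑ = 1 := by
  have := ofReal_integral_eq_lintegral_ofReal (hγ.integrable_mollifier hε)
    (Eventually.of_forall (hγ.mollifier_nonneg hε))
  rw [hγ.integral_mollifier hε, ENNReal.ofReal_one] at this
  rw [this]
  congr 1; ext z
  rw [Real.enorm_of_nonneg (hγ.mollifier_nonneg hε z)]

/-- The set on which the drift is kept by the truncation. -/
def truncSet (b : ST d → Sp d) (n : ℕ) : Set (ST d) := {z | |z.1| ≤ n ∧ ‖z.2‖ ≤ n ∧ ‖b z‖ ≤ n}

theorem truncField_eq (b : ST d → Sp d) (n : ℕ) :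
    truncField b n = (truncSet b n).indicator b := rfl

theorem measurableSet_truncSet (hb : StronglyMeasurable b) (n : ℕ) :
    MeasurableSet (truncSet b n) := by
  have h1 : Measurable fun z : ST d => |z.1| := by fun_prop
  have h2 : Measurable fun z : ST d => ‖z.2‖ := by fun_prop
  exact (measurableSet_le h1 measurable_const).inter
    ((measurableSet_le h2 measurable_const).inter
      (measurableSet_le hb.norm.measurable measurable_const))

theorem eventually_mem_truncSet (b : ST d → Sp d) (z : ST d) : ∀ᶠ n in atTop, z ∈ truncSet b n := by
  filter_upwards [tendsto_natCast_atTop_atTop.eventually_ge_atTop |z.1|,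
    tendsto_natCast_atTop_atTop.eventually_ge_atTop ‖z.2‖,
    tendsto_natCast_atTop_atTop.eventually_ge_atTop ‖b z‖] with n h₁ h₂ h₃
  exact ⟨h₁, h₂, h₃⟩

theorem norm_truncField_le (b : ST d → Sp d) (n : ℕ) (z : ST d) : ‖truncField b n z‖ ≤ n := by
  rw [truncField_eq]
  by_cases hz : z ∈ truncSet b n
  · rw [Set.indicator_of_mem hz]
    exact hz.2.2
  · rw [Set.indicator_of_notMem hz, norm_zero]
    positivity

theorem stronglyMeasurable_truncField (hb : StronglyMeasurable b) (n : ℕ) :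
    StronglyMeasurable (truncField b n) := hb.indicator (measurableSet_truncSet hb n)

theorem integrable_truncField (hb : StronglyMeasurable b) (n : ℕ) :
    Integrable (truncField b n) := by
  rw [truncField_eq, integrable_indicator_iff (measurableSet_truncSet hb n)]
  refine Measure.integrableOn_of_bounded (M := n) ?_ hb.aestronglyMeasurable ?_
  · refine ne_top_of_le_ne_top (b := volume (Metric.closedBall (0 : ST d) n))
      measure_closedBall_lt_top.ne (measure_mono fun z hz => ?_)
    rw [mem_closedBall_zero_iff, Prod.norm_def]
    exact max_le hz.1 hz.2.1
  · filter_upwards [ae_restrict_mem (measurableSet_truncSet hb n)] with z hz using hz.2.2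

theorem regField_eq (γ : ST d → ℝ) (b : ST d → Sp d) (ε : ℝ) (n : ℕ) (z : ST d) :
    regField γ b ε n z = ∫ y, mollifier γ ε y • truncField b n (z - y) := by
  rw [regField, ← integral_sub_left_eq_self _ volume z]
  simp only [sub_sub_cancel]

theorem regField_congr {b' : ST d → Sp d} (h : b =ᵐ[volume] b') (ε : ℝ) (n : ℕ) :
    regField γ b ε n = regField γ b' ε n := by
  ext1 z
  refine integral_congr_ae ?_
  filter_upwards [h] with w hw
  simp only [truncField, Set.indicator_apply, Set.mem_ofPred_eq, hw]

theorem IsMollifier.norm_regField_le (hγ : IsMollifier γ) (b : ST d → Sp d) {ε : ℝ} (hε : 0 < ε)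
    (n : ℕ) (z : ST d) : ‖regField γ b ε n z‖ ≤ n := by
  rw [regField_eq]
  have := norm_integral_le_of_norm_le (f := fun y => mollifier γ ε y • truncField b n (z - y))
    ((hγ.integrable_mollifier hε).mul_const (n : ℝ)) (Eventually.of_forall fun y => by
      rw [norm_smul, Real.norm_of_nonneg (hγ.mollifier_nonneg hε y)]
      exact mul_le_mul_of_nonneg_left (norm_truncField_le b n _) (hγ.mollifier_nonneg hε y))
  rwa [integral_mul_const, hγ.integral_mollifier hε, one_mul] at this

theorem IsMollifier.stronglyMeasurable_regField (hγ : IsMollifier γ) (hb : StronglyMeasurable b)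
    (ε : ℝ) (n : ℕ) : StronglyMeasurable (regField γ b ε n) := by
  refine StronglyMeasurable.integral_prod_right
    (f := fun z w : ST d => mollifier γ ε (z - w) • truncField b n w) ?_
  have hc := hγ.continuous_mollifier ε
  have h1 : Continuous fun q : ST d × ST d => mollifier γ ε (q.1 - q.2) := by fun_prop
  exact h1.stronglyMeasurable.smul
    ((stronglyMeasurable_truncField hb n).comp_measurable measurable_snd)

/-- The mollifier is a probability density supported in a ball of radius ε, so the error is an
average of translation errors over shifts of length at most ε. -/
theorem IsMollifier.lintegral_regField_sub_le (hγ : IsMollifier γ) (hb : StronglyMeasurable b)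
    {ε : ℝ} (hε : 0 < ε) (n : ℕ) {η : ℝ≥0∞}
    (hη : ∀ y : ST d, ‖y‖ ≤ ε → ∫⁻ z, ‖truncField b n (z - y) - truncField b n z‖ₑ ≤ η) :
    ∫⁻ z, ‖regField γ b ε n z - truncField b n z‖ₑ ≤ η := by
  have ht := stronglyMeasurable_truncField hb n
  have hc := hγ.continuous_mollifier ε
  have hmeas : Measurable fun q : ST d × ST d =>
      ‖mollifier γ ε q.2‖ₑ * ‖truncField b n (q.1 - q.2) - truncField b n q.1‖ₑ := by
    have h1 : StronglyMeasurable fun q : ST d × ST d => truncField b n (q.1 - q.2) :=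
      ht.comp_measurable (by fun_prop)
    have h2 : StronglyMeasurable fun q : ST d × ST d => truncField b n q.1 :=
      ht.comp_measurable measurable_fst
    have h3 : Continuous fun q : ST d × ST d => mollifier γ ε q.2 := by fun_prop
    exact h3.measurable.enorm.mul (h1.sub h2).enorm
  have hpt : ∀ z, ‖regField γ b ε n z - truncField b n z‖ₑ ≤
      ∫⁻ y, ‖mollifier γ ε y‖ₑ * ‖truncField b n (z - y) - truncField b n z‖ₑ := fun z => by
    have i₁ : Integrable fun y => mollifier γ ε y • truncField b n (z - y) := by
      have hm : StronglyMeasurable fun y : ST d => truncField b n (z - y) :=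
        ht.comp_measurable (by fun_prop)
      exact (hγ.integrable_mollifier hε).smul_bdd n hm.aestronglyMeasurable
        (Eventually.of_forall fun y => norm_truncField_le b n _)
    have i₂ : Integrable fun y => mollifier γ ε y • truncField b n z :=
      (hγ.integrable_mollifier hε).smul_const _
    have : regField γ b ε n z - truncField b n z =
        ∫ y, mollifier γ ε y • (truncField b n (z - y) - truncField b n z) := by
      simp only [smul_sub]
      rw [integral_sub i₁ i₂, integral_smul_const, hγ.integral_mollifier hε, one_smul, regField_eq]
    rw [this]
    refine (enorm_integral_le_lintegral_enorm _).trans (lintegral_mono fun y => ?_)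
    rw [enorm_smul]
  calc _ ≤ ∫⁻ z, ∫⁻ y, ‖mollifier γ ε y‖ₑ * ‖truncField b n (z - y) - truncField b n z‖ₑ :=
        lintegral_mono hpt
    _ = ∫⁻ y, ∫⁻ z, ‖mollifier γ ε y‖ₑ * ‖truncField b n (z - y) - truncField b n z‖ₑ :=
        lintegral_lintegral_swap hmeas.aemeasurable
    _ ≤ ∫⁻ y, ‖mollifier γ ε y‖ₑ * η := by
        refine lintegral_mono fun y => ?_
        simp only
        rw [lintegral_const_mul' _ _ enorm_ne_top]
        rcases le_or_gt ‖y‖ ε with hy | hy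
        · exact mul_le_mul_right (hη y hy) _
        · simp [hγ.mollifier_eq_zero hε hy]
    _ = η := by
        rw [lintegral_mul_const _ hc.measurable.enorm, hγ.lintegral_mollifier hε, one_mul]

theorem IsMollifier.exists_lintegral_regField_sub_le (hγ : IsMollifier γ)
    (hb : StronglyMeasurable b) (n : ℕ) {η : ℝ≥0∞} (hη : 0 < η) :
    ∃ δ : ℝ, 0 < δ ∧ ∀ ε, 0 < ε → ε ≤ δ →
      ∫⁻ z, ‖regField γ b ε n z - truncField b n z‖ₑ ≤ η := by
  have := (tendsto_lintegral_translate_sub (integrable_truncField hb n)).eventually_lt_const hη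
  obtain ⟨δ, hδ, h⟩ := Metric.eventually_nhds_iff.1 this
  refine ⟨δ / 2, by positivity, fun ε hε hεδ =>
    hγ.lintegral_regField_sub_le hb hε n fun y hy => (h ?_).le⟩
  rw [dist_zero_right]
  linarith

end regularization

/-! ### Hölder continuity of powers of the drift -/

section roots

/-- If the larger vector has length at most 2|x - y|, each term alone is small enough. Otherwise the
direction and the scalar factor are varied separately, and negative powers of |x| are compared with
those of |x - y|. -/
theorem norm_smul_rpow_sub_le {E : Type*} [NormedAddCommGroup E] [NormedSpace ℝ E] {a : ℝ}
    (ha : 0 < a) (ha1 : a ≤ 1) (x y : E) :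
    ‖‖x‖ ^ (-1 + a) • x - ‖y‖ ^ (-1 + a) • y‖ ≤ 4 * ‖x - y‖ ^ a := by
  wlog hxy : ‖y‖ ≤ ‖x‖ generalizing x y
  · rw [norm_sub_rev, norm_sub_rev x]
    exact this y x (le_of_not_ge hxy)
  have hn : ∀ v : E, ‖‖v‖ ^ (-1 + a) • v‖ = ‖v‖ ^ a := fun v => by
    rcases eq_or_ne v 0 with rfl | hv
    · simp [Real.zero_rpow ha.ne']
    · rw [norm_smul, Real.norm_of_nonneg (by positivity)]
      nth_rw 2 [← Real.rpow_one ‖v‖]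
      rw [← Real.rpow_add (norm_pos_iff.2 hv)]
      congr 1; ring
  set r := ‖x - y‖ with hr
  have hr0 : 0 ≤ r := norm_nonneg _
  rcases le_or_gt ‖x‖ (2 * r) with h | h
  · have h1 : ‖x‖ ^ a ≤ 2 * r ^ a := by
      calc ‖x‖ ^ a ≤ (2 * r) ^ a := Real.rpow_le_rpow (norm_nonneg _) h ha.le
        _ = 2 ^ a * r ^ a := Real.mul_rpow (by norm_num) hr0
        _ ≤ 2 * r ^ a := by
          gcongr
          calc (2 : ℝ) ^ a ≤ 2 ^ (1 : ℝ) := Real.rpow_le_rpow_of_exponent_le (by norm_num) ha1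
            _ = 2 := Real.rpow_one _
    have h2 : ‖y‖ ^ a ≤ ‖x‖ ^ a := Real.rpow_le_rpow (norm_nonneg _) hxy ha.le
    calc _ ≤ ‖x‖ ^ a + ‖y‖ ^ a := by rw [← hn x, ← hn y]; exact norm_sub_le _ _
      _ ≤ _ := by linarith
  · rcases hr0.eq_or_lt with h0 | h0
    · have : x = y := sub_eq_zero.1 (norm_eq_zero.1 h0.symm)
      subst this
      simp only [sub_self, norm_zero]
      positivity
    have hx : 0 < ‖x‖ := by linarith
    have hd : ‖x‖ - ‖y‖ ≤ r := norm_sub_norm_le x y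
    have hy : 0 < ‖y‖ := by linarith
    have k1 : ‖x‖ ^ (-1 + a) * r ≤ r ^ a := by
      calc ‖x‖ ^ (-1 + a) * r ≤ r ^ (-1 + a) * r := by
            refine mul_le_mul_of_nonneg_right ?_ hr0
            exact Real.rpow_le_rpow_of_nonpos h0 (by linarith) (by linarith)
        _ = r ^ a := by
            nth_rw 2 [← Real.rpow_one r]
            rw [← Real.rpow_add h0]; congr 1; ring
    have e : ‖x‖ ^ (-1 + a) • x - ‖y‖ ^ (-1 + a) • y =
        ‖x‖ ^ (-1 + a) • (x - y) - (‖y‖ ^ (-1 + a) - ‖x‖ ^ (-1 + a)) • y := by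
      rw [smul_sub, sub_smul]; abel
    have hmono : ‖x‖ ^ (-1 + a) ≤ ‖y‖ ^ (-1 + a) :=
      Real.rpow_le_rpow_of_nonpos hy hxy (by linarith)
    have e1 : ∀ v : E, 0 < ‖v‖ → ‖v‖ ^ (-1 + a) * ‖v‖ = ‖v‖ ^ a := fun v hv => by
      nth_rw 2 [← Real.rpow_one ‖v‖]
      rw [← Real.rpow_add hv]; congr 1; ring
    have k2 : (‖y‖ ^ (-1 + a) - ‖x‖ ^ (-1 + a)) * ‖y‖ ≤ r ^ a := by
      have h3 : ‖y‖ ^ a ≤ ‖x‖ ^ a := Real.rpow_le_rpow hy.le hxy ha.le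
      have h4 : 0 ≤ ‖x‖ ^ (-1 + a) := by positivity
      rw [← e1 y hy, ← e1 x hx] at h3
      nlinarith [mul_le_mul_of_nonneg_left hd h4]
    rw [e]
    refine (norm_sub_le _ _).trans ?_
    rw [norm_smul, norm_smul, Real.norm_of_nonneg (by positivity),
      Real.norm_of_nonneg (sub_nonneg.2 hmono), ← hr]
    have : 0 ≤ r ^ a := by positivity
    linarith

theorem abs_norm_rpow_sub_le {E : Type*} [NormedAddCommGroup E] {a : ℝ}
    (ha : 0 ≤ a) (ha1 : a ≤ 1) (x y : E) : |‖x‖ ^ a - ‖y‖ ^ a| ≤ ‖x - y‖ ^ a := by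
  have t : ∀ x y : E, ‖x‖ ^ a - ‖y‖ ^ a ≤ ‖x - y‖ ^ a := fun x y => by
    have h1 : ‖x‖ ≤ ‖x - y‖ + ‖y‖ := by
      simpa using norm_add_le (x - y) y
    have h2 := (Real.rpow_le_rpow (norm_nonneg _) h1 ha).trans
      (Real.rpow_add_le_add_rpow (norm_nonneg (x - y)) (norm_nonneg y) ha ha1)
    linarith
  rw [abs_sub_le_iff]
  exact ⟨t x y, by rw [norm_sub_rev]; exact t y x⟩

end roots

/-! ### Small Morrey norm, mollification error and large λ -/

section smallness
variable {d : ℕ} {α q : ℝ} {P P' : ℝ≥0∞}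

theorem tendsto_const_mul_rpow_zero {C : ℝ≥0∞} (hC : C ≠ ⊤) {a : ℝ} (ha : 0 < a) :
    Tendsto (fun N : ℝ≥0∞ => C * N ^ a) (𝓝 0) (𝓝 0) := by
  have h := ENNReal.Tendsto.const_mul (a := C)
    ((ENNReal.continuous_rpow_const (y := a)).tendsto 0) (Or.inr hC)
  rwa [ENNReal.zero_rpow_of_pos ha, mul_zero] at h

theorem exists_pos_of_eventually_nhds_zero {p : ℝ≥0∞ → Prop} (h : ∀ᶠ N in 𝓝 0, p N) :
    ∃ N : ℝ≥0∞, N ≠ 0 ∧ N ≠ ⊤ ∧ p N := by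
  have h1 : ∀ᶠ N in 𝓝[>] (0 : ℝ≥0∞), p N := h.filter_mono nhdsWithin_le_nhds
  have h2 : ∀ᶠ N in 𝓝[>] (0 : ℝ≥0∞), N < ⊤ :=
    (eventually_lt_nhds ENNReal.zero_lt_top).filter_mono nhdsWithin_le_nhds
  have h3 : ∀ᶠ N in 𝓝[>] (0 : ℝ≥0∞), 0 < N := self_mem_nhdsWithin
  obtain ⟨N, hN, hp, ht⟩ := (h3.and (h1.and h2)).exists
  exact ⟨N, (ne_of_gt hN), ht.ne, hp⟩

/-- Weights of small Morrey norm give kernels of small norm, uniformly in `λ`. -/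
theorem exists_kerBound_of_morreyBd (hd : 0 < d) (hα : 1 < α) (hα2 : α < 2)
    (hpq : P.toReal.HolderConjugate P'.toReal) (hq1 : 1 < q) (hq : q < d + α) {t : ℝ≥0∞}
    (ht : t ≠ 0) :
    ∃ N : ℝ≥0∞, N ≠ 0 ∧ N ≠ ⊤ ∧ ∀ V : ST d → ℝ≥0∞, Measurable V → MorreyBd α q V N →
      ∀ lam : ℝ, 0 < lam →
      KerBound P.toReal (fun z w => V z ^ (1 / P.toReal) * ‖gradPot α lam (ordU α P) (z - w)‖ₑ) t ∧
      KerBound P.toReal (fun z w => ‖potKernel α lam (ordF α P) (z - w)‖ₑ * V w ^ (1 / P'.toReal))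
        t := by
  obtain ⟨C₁, hC₁, h₁⟩ := exists_kerBound_gradPot_of_morreyBd hd hα hα2 hpq hq1 hq
  obtain ⟨C₂, hC₂, h₂⟩ := exists_kerBound_pot_of_morreyBd hd hα hα2 hpq hq1 hq
  have hp := hpq.pos
  have hp' := hpq.symm.pos
  have t0 : 0 < t := pos_iff_ne_zero.2 ht
  obtain ⟨N, hN0, hNt, hN₁, hN₂⟩ := exists_pos_of_eventually_nhds_zero
    (((tendsto_const_mul_rpow_zero hC₁ (one_div_pos.2 hp)).eventually_lt_const t0).and
      ((tendsto_const_mul_rpow_zero hC₂ (one_div_pos.2 hp')).eventually_lt_const t0))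
  exact ⟨N, hN0, hNt, fun V hV hVN lam hlam =>
    ⟨(h₁ lam hlam V hV N hN0 hNt hVN).mono hp.le (fun _ _ => le_rfl) hN₁.le,
      (h₂ lam hlam V hV N hN0 hNt hVN).mono hp.le (fun _ _ => le_rfl) hN₂.le⟩⟩

/-- The Morrey size produced by `morreyBd_of_lintegral_le` is a finite constant depending on M times
a positive power of the integral, so it falls below any prescribed N. -/
theorem exists_lintegral_le_morreyBd (hα : 1 < α) (hq0 : 0 < q) (hq : q < d + α) {M : ℝ≥0∞}
    (hM : M ≠ ⊤) {N : ℝ≥0∞} (hN : N ≠ 0) :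
    ∃ η : ℝ≥0∞, 0 < η ∧ ∀ V : ST d → ℝ≥0∞, Measurable V → (∀ z, V z ≤ M) → ∫⁻ z, V z ≤ η →
      MorreyBd α q V N := by
  have hD : 0 < d + α := by linarith
  have hk : 0 < α - 1 := by linarith
  have hm : 0 ≤ (d + α) / (α - 1) - 1 := by
    rw [sub_nonneg, le_div_iff₀ hk]; linarith [(d.cast_nonneg : (0 : ℝ) ≤ d)]
  have hx : 0 < q / (d + α) := by positivity
  have hx1 : 0 ≤ 1 - q / (d + α) := by rw [sub_nonneg, div_le_one hD]; exact hq.le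
  have hy : 0 < (α - 1) / q := by positivity
  set K : ℝ≥0∞ := ((M ^ ((d + α) / (α - 1) - 1)) ^ (q / (d + α)) *
    unitVol d ^ (1 - q / (d + α))) ^ ((α - 1) / q) with hK
  have hKt : K ≠ ⊤ := by
    refine ENNReal.rpow_ne_top_of_nonneg hy.le (ENNReal.mul_ne_top ?_ ?_)
    · exact ENNReal.rpow_ne_top_of_nonneg hx.le (ENNReal.rpow_ne_top_of_nonneg hm hM)
    · exact ENNReal.rpow_ne_top_of_nonneg hx1 unitVol_ne_top
  obtain ⟨η, hη0, -, hη⟩ := exists_pos_of_eventually_nhds_zero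
    ((tendsto_const_mul_rpow_zero hKt (mul_pos hx hy)).eventually_lt_const (pos_iff_ne_zero.2 hN))
  refine ⟨η, pos_iff_ne_zero.2 hη0, fun V hV hVM hVη =>
    (morreyBd_of_lintegral_le hα hq0 hq hV hVM).mono hα hq0 (le_trans ?_ hη.le)⟩
  calc _ ≤ ((M ^ ((d + α) / (α - 1) - 1) * η) ^ (q / (d + α)) *
        unitVol d ^ (1 - q / (d + α))) ^ ((α - 1) / q) := by gcongr
    _ = K * η ^ (q / (d + α) * ((α - 1) / q)) := by
        rw [hK, ENNReal.rpow_mul, ← ENNReal.mul_rpow_of_nonneg _ _ hy.le,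
          ENNReal.mul_rpow_of_nonneg _ _ hx.le]
        ring_nf

theorem enorm_rootField (hP : 0 < P.toReal) (b : ST d → Sp d) (z : ST d) :
    ‖rootField P b z‖ₑ = ‖b z‖ₑ ^ (1 / P.toReal) := by
  rw [← ofReal_norm (b z), ENNReal.ofReal_rpow_of_nonneg (norm_nonneg _) (by positivity),
    ← ofReal_norm]
  congr 1
  rcases eq_or_ne (b z) 0 with h | h
  · simp [rootField, h, hP.ne']
  · rw [rootField, norm_smul, Real.norm_of_nonneg (by positivity)]
    nth_rw 2 [← Real.rpow_one ‖b z‖]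
    rw [← Real.rpow_add (norm_pos_iff.2 h)]
    congr 1; ring

theorem one_sub_one_div_toReal (hpq : P.toReal.HolderConjugate P'.toReal) :
    1 - 1 / P.toReal = 1 / P'.toReal := by
  have := hpq.inv_add_inv_eq_one
  rw [one_div, one_div]
  linarith

theorem enorm_norm_rpow (hpq : P.toReal.HolderConjugate P'.toReal) (x : Sp d) :
    ‖‖x‖ ^ (1 - 1 / P.toReal)‖ₑ = ‖x‖ₑ ^ (1 / P'.toReal) := by
  have := hpq.symm.pos
  rw [one_sub_one_div_toReal hpq, Real.enorm_of_nonneg (by positivity), ← ofReal_norm x,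
    ENNReal.ofReal_rpow_of_nonneg (norm_nonneg _) (by positivity)]

theorem enorm_rootField_sub_le (hP : 1 ≤ P.toReal) (b b' : ST d → Sp d) (z : ST d) :
    ‖(rootField P b - rootField P b') z‖ₑ ≤ 4 * ‖b z - b' z‖ₑ ^ (1 / P.toReal) := by
  have hp : 0 < P.toReal := by linarith
  rw [← ofReal_norm (b z - b' z), ENNReal.ofReal_rpow_of_nonneg (norm_nonneg _) (by positivity),
    ← ofReal_norm, (by simp : (4 : ℝ≥0∞) = ENNReal.ofReal 4), ← ENNReal.ofReal_mul (by norm_num)]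
  exact ENNReal.ofReal_le_ofReal (norm_smul_rpow_sub_le (by positivity)
    ((div_le_one hp).2 hP) (b z) (b' z))

theorem enorm_norm_rpow_sub_le (hpq : P.toReal.HolderConjugate P'.toReal) (x y : Sp d) :
    ‖‖x‖ ^ (1 - 1 / P.toReal) - ‖y‖ ^ (1 - 1 / P.toReal)‖ₑ ≤ ‖x - y‖ₑ ^ (1 / P'.toReal) := by
  have := hpq.symm.pos
  rw [one_sub_one_div_toReal hpq, ← ofReal_norm (x - y),
    ENNReal.ofReal_rpow_of_nonneg (norm_nonneg _) (by positivity), ← ofReal_norm]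
  exact ENNReal.ofReal_le_ofReal (abs_norm_rpow_sub_le (by positivity)
    ((div_le_one this).2 hpq.symm.lt.le) x y)

/-- The mollification scales `δ_n` can be chosen so that replacing the truncated drift by its
mollification changes the kernels by at most `1 / (8 (n + 1))`, uniformly in `λ`. -/
theorem IsMollifier.exists_kerBound_regField (hd : 0 < d) (hα : 1 < α) (hα2 : α < 2)
    (hpq : P.toReal.HolderConjugate P'.toReal) (hq1 : 1 < q) (hq : q < d + α) {γ : ST d → ℝ}
    (hγ : IsMollifier γ) {b : ST d → Sp d} (hb : StronglyMeasurable b) :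
    ∃ δ : ℕ → ℝ, (∀ n, 0 < δ n) ∧ ∀ n ε, 0 < ε → ε ≤ δ n → ∀ lam : ℝ, 0 < lam →
      KerBound P.toReal (fun z w =>
        ‖(rootField P (regField γ b ε n) - rootField P (truncField b n)) z‖ₑ *
          ‖gradPot α lam (ordU α P) (z - w)‖ₑ) (ENNReal.ofReal (1 / (8 * (n + 1)))) ∧
      KerBound P.toReal (fun z w => ‖potKernel α lam (ordF α P) (z - w)‖ₑ *
        ‖‖regField γ b ε n w‖ ^ (1 - 1 / P.toReal) - ‖truncField b n w‖ ^ (1 - 1 / P.toReal)‖ₑ)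
        (ENNReal.ofReal (1 / (8 * (n + 1)))) := by
  suffices h : ∀ n : ℕ, ∃ δ : ℝ, 0 < δ ∧ ∀ ε, 0 < ε → ε ≤ δ → ∀ lam : ℝ, 0 < lam →
      KerBound P.toReal (fun z w =>
        ‖(rootField P (regField γ b ε n) - rootField P (truncField b n)) z‖ₑ *
          ‖gradPot α lam (ordU α P) (z - w)‖ₑ) (ENNReal.ofReal (1 / (8 * (n + 1)))) ∧
      KerBound P.toReal (fun z w => ‖potKernel α lam (ordF α P) (z - w)‖ₑ *
        ‖‖regField γ b ε n w‖ ^ (1 - 1 / P.toReal) - ‖truncField b n w‖ ^ (1 - 1 / P.toReal)‖ₑ)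
        (ENNReal.ofReal (1 / (8 * (n + 1)))) by
    choose δ h₁ h₂ using h
    exact ⟨δ, h₁, h₂⟩
  intro n
  -- The factor 32 = 4 · 8 leaves room for the Hölder constant 4 of the vector-valued root.
  obtain ⟨N, hN0, -, hN⟩ := exists_kerBound_of_morreyBd hd hα hα2 hpq hq1 hq
    (t := ENNReal.ofReal (1 / (32 * (n + 1)))) (ENNReal.ofReal_pos.2 (by positivity)).ne'
  -- Both the truncated field and its mollification are bounded by n, so their difference is bounded
  -- by 2n.
  obtain ⟨η, hη0, hη⟩ := exists_lintegral_le_morreyBd hα (by linarith) hq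
    (ENNReal.ofReal_ne_top (r := 2 * n)) hN0
  obtain ⟨δ, hδ0, hδ⟩ := hγ.exists_lintegral_regField_sub_le hb n hη0
  refine ⟨δ, hδ0, fun ε hε hεδ lam hlam => ?_⟩
  have hV : Measurable fun z => ‖regField γ b ε n z - truncField b n z‖ₑ :=
    ((hγ.stronglyMeasurable_regField hb ε n).sub (stronglyMeasurable_truncField hb n)).enorm
  obtain ⟨k₁, k₂⟩ := hN _ hV (hη _ hV (fun z => by
    rw [← ofReal_norm]
    refine ENNReal.ofReal_le_ofReal ((norm_sub_le _ _).trans ?_)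
    linarith [hγ.norm_regField_le b hε n z, norm_truncField_le b n z]) (hδ ε hε hεδ)) lam hlam
  constructor
  · have hm : Measurable (Function.uncurry fun z w : ST d =>
        ‖regField γ b ε n z - truncField b n z‖ₑ ^ (1 / P.toReal) *
          ‖gradPot α lam (ordU α P) (z - w)‖ₑ) :=
      ((hV.comp measurable_fst).pow_const _).mul (stronglyMeasurable_gradPot_sub α lam _).enorm
    refine (k₁.const_mul hpq.nonneg hm 4).mono hpq.nonneg (fun z w => ?_) ?_
    · rw [← mul_assoc]
      exact mul_le_mul_left (enorm_rootField_sub_le hpq.lt.le _ _ z) _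
    · rw [(by simp : (4 : ℝ≥0∞) = ENNReal.ofReal 4), ← ENNReal.ofReal_mul (by norm_num)]
      refine ENNReal.ofReal_le_ofReal (le_of_eq ?_)
      field_simp; norm_num
  · refine k₂.mono hpq.nonneg (fun z w => ?_) ?_
    · exact mul_le_mul_right (enorm_norm_rpow_sub_le hpq _ _) _
    · refine ENNReal.ofReal_le_ofReal ?_
      gcongr
      norm_num

/-- Under the smallness condition on the drift both kernels have norm at most `1 / 2`. -/
theorem exists_kerBound_drift (hd : 0 < d) (hα : 1 < α) (hα2 : α < 2)
    (hpq : P.toReal.HolderConjugate P'.toReal) (hq1 : 1 < q) (hq : q < d + α) :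
    ∃ (c : ℝ) (lam₀ : ℝ → ℝ), 0 < c ∧ (∀ M, 0 ≤ lam₀ M) ∧
      ∀ (bs bb : ST d → Sp d) (M : ℝ), StronglyMeasurable bs → StronglyMeasurable bb →
        (∀ z, ‖bb z‖ ≤ M) →
        morreyNorm α q (fun z => ‖bs z‖ ^ (1 / (α - 1))) < ENNReal.ofReal c →
        ∀ lam, lam₀ M < lam →
        KerBound P.toReal (fun z w =>
          ‖rootField P (bs + bb) z‖ₑ * ‖gradPot α lam (ordU α P) (z - w)‖ₑ)
          (ENNReal.ofReal (1 / 2)) ∧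
        KerBound P.toReal (fun z w => ‖potKernel α lam (ordF α P) (z - w)‖ₑ *
          ‖‖(bs + bb) w‖ ^ (1 - 1 / P.toReal)‖ₑ) (ENNReal.ofReal (1 / 2)) := by
  have hp := hpq.pos
  have hp' := hpq.symm.pos
  have ho := ordU_pos hα hpq.lt
  have hα0 : 0 < α := by linarith
  have hq0 : 0 < q := by linarith
  -- The singular and the bounded part of the drift are each allotted 1/4.
  obtain ⟨N, hN0, -, hN⟩ := exists_kerBound_of_morreyBd hd hα hα2 hpq hq1 hq
    (t := ENNReal.ofReal (1 / 4)) (ENNReal.ofReal_pos.2 (by norm_num)).ne'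
  have hκ : 0 < (α - 1) / q := div_pos (by linarith) hq0
  have hKt : (unitVol d * ENNReal.ofReal (2 ^ (d + α - q))) ^ ((α - 1) / q) ≠ ⊤ :=
    ENNReal.rpow_ne_top_of_nonneg hκ.le (ENNReal.mul_ne_top unitVol_ne_top ENNReal.ofReal_ne_top)
  obtain ⟨c, hc0, hct, hc⟩ := exists_pos_of_eventually_nhds_zero
    ((tendsto_const_mul_rpow_zero hKt (mul_pos hq0 hκ)).eventually_lt_const
      (pos_iff_ne_zero.2 hN0))
  obtain ⟨C, hC, hCg⟩ := exists_lintegral_gradPot_le (d := d) hd hα0 hα2 ho.1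
  -- The convolution norms of the gradient and potential kernels tend to 0 as λ → ∞, so a threshold
  -- depending on the bound M makes the contribution of the bounded part at most 1/4.
  have hl : ∀ M : ℝ, ∃ l : ℝ, 0 ≤ l ∧ ∀ lam, l < lam →
      |M| ^ (1 / P.toReal) * (C * lam ^ (-(ordU α P - 1 / α))) ≤ 1 / 4 ∧
      |M| ^ (1 / P'.toReal) * lam ^ (-ordF α P) ≤ 1 / 4 := fun M => by
    have t1 : Tendsto (fun lam : ℝ => |M| ^ (1 / P.toReal) * (C * lam ^ (-(ordU α P - 1 / α))))
        atTop (𝓝 0) := by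
      simpa using ((tendsto_rpow_neg_atTop (sub_pos.2 ho.1)).const_mul C).const_mul
        (|M| ^ (1 / P.toReal))
    have t2 : Tendsto (fun lam : ℝ => |M| ^ (1 / P'.toReal) * lam ^ (-ordF α P)) atTop (𝓝 0) := by
      simpa using (tendsto_rpow_neg_atTop ho.2.1).const_mul (|M| ^ (1 / P'.toReal))
    obtain ⟨l, hl⟩ := eventually_atTop.1 ((t1.eventually_le_const (by norm_num : (0 : ℝ) < 1 / 4)).and
      (t2.eventually_le_const (by norm_num : (0 : ℝ) < 1 / 4)))
    exact ⟨max l 0, le_max_right _ _, fun lam h => hl lam ((le_max_left _ _).trans h.le)⟩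
  choose lam₀ hl0 hl using hl
  refine ⟨c.toReal, lam₀, ENNReal.toReal_pos hc0 hct, hl0, fun bs bb M hbs hbb hM hms lam hlam => ?_⟩
  have hlam0 : 0 < lam := (hl0 M).trans_lt hlam
  rw [ENNReal.ofReal_toReal hct] at hms
  have hMn : |M| = M := abs_of_nonneg ((norm_nonneg _).trans (hM 0))
  obtain ⟨l₁, l₂⟩ := hl M lam hlam
  rw [hMn] at l₁ l₂
  have hM0 : 0 ≤ M := (norm_nonneg _).trans (hM 0)
  have hmb : MorreyBd α q (fun z => ‖bs z‖ₑ) N :=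
    (morreyBd_of_morreyNorm_le hα hq0 hms.le).mono hα hq0 (le_trans (le_of_eq (by
      rw [ENNReal.mul_rpow_of_nonneg _ _ hκ.le, ← ENNReal.rpow_mul, mul_comm])) hc.le)
  obtain ⟨k₁, k₂⟩ := hN _ hbs.enorm hmb lam hlam0
  have hbbe : ∀ {a : ℝ}, 0 < a → ∀ z, ‖bb z‖ₑ ^ a ≤ ENNReal.ofReal (M ^ a) := fun {a} ha z => by
    rw [← ofReal_norm, ENNReal.ofReal_rpow_of_nonneg (norm_nonneg _) ha.le]
    exact ENNReal.ofReal_le_ofReal (Real.rpow_le_rpow (norm_nonneg _) (hM z) ha.le)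
  -- Powers with exponent at most 1 are subadditive, which separates the two parts of the drift at
  -- the level of kernels.
  have hadd : ∀ {a : ℝ}, 0 < a → a ≤ 1 → ∀ z,
      ‖(bs + bb) z‖ₑ ^ a ≤ ‖bs z‖ₑ ^ a + ENNReal.ofReal (M ^ a) :=
    fun {a} ha ha1 z => calc
      ‖(bs + bb) z‖ₑ ^ a ≤ (‖bs z‖ₑ + ‖bb z‖ₑ) ^ a :=
        ENNReal.rpow_le_rpow (enorm_add_le _ _) ha.le
      _ ≤ ‖bs z‖ₑ ^ a + ‖bb z‖ₑ ^ a := ENNReal.rpow_add_le_add_rpow _ _ ha.le ha1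
      _ ≤ _ := add_le_add_right (hbbe ha z) _
  have hsum : ENNReal.ofReal (1 / 4) + ENNReal.ofReal (1 / 4) = ENNReal.ofReal (1 / 2) := by
    rw [← ENNReal.ofReal_add (by norm_num) (by norm_num)]; norm_num
  have mg := (stronglyMeasurable_gradPot_sub (d := d) α lam (ordU α P)).enorm
  have mp := (stronglyMeasurable_potKernel_sub (d := d) α lam (ordF α P)).enorm
  constructor
  · have k₃ := (kerBound_gradPot (d := d) (α := α) (lam := lam) (s := ordU α P) hpq).const_mul
      hp.le mg (ENNReal.ofReal (M ^ (1 / P.toReal)))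
    have hm : Measurable (Function.uncurry fun z w : ST d =>
        ‖bs z‖ₑ ^ (1 / P.toReal) * ‖gradPot α lam (ordU α P) (z - w)‖ₑ) :=
      ((hbs.enorm.comp measurable_fst).pow_const _).mul mg
    refine (k₁.add k₃ hpq.lt.le hm (mg.const_mul _)).mono hp.le (fun z w => ?_) ?_
    · rw [enorm_rootField hp, ← add_mul]
      exact mul_le_mul_left (hadd (by positivity) ((div_le_one hp).2 hpq.lt.le) z) _
    · rw [← hsum]
      refine add_le_add_right ?_ _
      refine (mul_le_mul_right (hCg lam hlam0) _).trans ?_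
      rw [← ENNReal.ofReal_mul (by positivity)]
      exact ENNReal.ofReal_le_ofReal l₁
  · have k₃ := (Adm.kerBound_pot ⟨hd, hα, hα2, hlam0⟩ ho.2.1 hpq).const_mul
      hp.le mp (ENNReal.ofReal (M ^ (1 / P'.toReal)))
    have hm : Measurable (Function.uncurry fun z w : ST d =>
        ‖potKernel α lam (ordF α P) (z - w)‖ₑ * ‖bs w‖ₑ ^ (1 / P'.toReal)) :=
      mp.mul ((hbs.enorm.comp measurable_snd).pow_const _)
    refine (k₂.add k₃ hpq.lt.le hm (mp.const_mul _)).mono hp.le (fun z w => ?_) ?_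
    · rw [enorm_norm_rpow hpq, mul_comm (ENNReal.ofReal _), ← mul_add]
      exact mul_le_mul_right (hadd (by positivity) ((div_le_one hp').2 hpq.symm.lt.le) w) _
    · rw [← hsum]
      refine add_le_add_right ?_ _
      rw [← ENNReal.ofReal_mul (by positivity)]
      exact ENNReal.ofReal_le_ofReal l₂

end smallness

/-! ### Assembly: regularized operators and resolvent algebra -/

section main
variable {d : ℕ} {α lam q : ℝ} {P P' : ℝ≥0∞}

theorem exists_holderConjugate (h1 : 1 < P) (ht : P ≠ ⊤) :
    ∃ P' : ℝ≥0∞, P.toReal.HolderConjugate P'.toReal := by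
  have h : 1 < P.toReal := by
    rw [← ENNReal.toReal_one]
    exact (ENNReal.toReal_lt_toReal ENNReal.one_ne_top ht).2 h1
  refine ⟨ENNReal.ofReal P.toReal.conjExponent, ?_⟩
  have := Real.HolderConjugate.conjExponent h
  rwa [ENNReal.toReal_ofReal this.symm.nonneg]

theorem morreyNorm_congr {v v' : ST d → ℝ} (h : v =ᵐ[volume] v') :
    morreyNorm α q v = morreyNorm α q v' := by
  unfold morreyNorm
  congr 1; ext ρ; congr 1; ext _; congr 1; ext z
  rw [lintegral_congr_ae (ae_restrict_of_ae (by
    filter_upwards [h] with w hw; rw [hw] : (fun w => ‖v w‖ₑ ^ q) =ᵐ[volume] fun w => ‖v' w‖ₑ ^ q))]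

theorem exists_stronglyMeasurable_bounded {bb : ST d → Sp d} (h : AEStronglyMeasurable bb) {M : ℝ}
    (hM : ∀ᵐ z, ‖bb z‖ ≤ M) :
    ∃ bb' : ST d → Sp d, StronglyMeasurable bb' ∧ bb =ᵐ[volume] bb' ∧ ∀ z, ‖bb' z‖ ≤ M := by
  have hM0 : 0 ≤ M := by
    obtain ⟨z, hz⟩ := hM.exists
    exact (norm_nonneg _).trans hz
  have hS : MeasurableSet {z | ‖h.mk bb z‖ ≤ M} :=
    measurableSet_le h.stronglyMeasurable_mk.norm.measurable measurable_const
  refine ⟨_, h.stronglyMeasurable_mk.indicator hS, ?_, fun z => ?_⟩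
  · filter_upwards [h.ae_eq_mk, hM] with z h₁ h₂
    rw [h₁] at h₂
    rw [Set.indicator_of_mem (s := {z | ‖h.mk bb z‖ ≤ M}) h₂, h₁]
  · by_cases hz : z ∈ {z | ‖h.mk bb z‖ ≤ M}
    · rw [Set.indicator_of_mem hz]; exact hz
    · rw [Set.indicator_of_notMem hz, norm_zero]; exact hM0

theorem rootField_truncField (b : ST d → Sp d) (n : ℕ) :
    rootField P (truncField b n) = (truncSet b n).indicator (rootField P b) := by
  ext1 z
  rw [truncField_eq]
  by_cases hz : z ∈ truncSet b n
  · rw [rootField, Set.indicator_of_mem hz, Set.indicator_of_mem hz, rootField]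
  · rw [rootField, Set.indicator_of_notMem hz, Set.indicator_of_notMem hz, smul_zero]

theorem norm_truncField_rpow {s : ℝ} (hs : s ≠ 0) (b : ST d → Sp d) (n : ℕ) :
    (fun z => ‖truncField b n z‖ ^ s) = (truncSet b n).indicator fun z => ‖b z‖ ^ s := by
  ext1 z
  rw [truncField_eq]
  by_cases hz : z ∈ truncSet b n
  · rw [Set.indicator_of_mem hz, Set.indicator_of_mem hz]
  · rw [Set.indicator_of_notMem hz, Set.indicator_of_notMem hz, norm_zero, Real.zero_rpow hs]

theorem stronglyMeasurable_rootField {b : ST d → Sp d} (hb : StronglyMeasurable b) :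
    StronglyMeasurable (rootField P b) :=
  (hb.norm.measurable.pow_const _).stronglyMeasurable.smul hb

variable [Fact (1 ≤ P)]

theorem IsPotOp.isOpQ {b : ST d → Sp d} {Q : LL d P →L[ℝ] LL d P}
    (h : IsPotOp α lam (fun z => ‖b z‖ ^ (1 - 1 / P.toReal)) Q) : IsOpQ α lam b Q := h

/-- Operators with the regularized drifts are uniformly bounded and converge strongly. -/
theorem Adm.exists_regularized_isGradOp (hpq : P.toReal.HolderConjugate P'.toReal)
    (H : Adm d α lam) {γ : ST d → ℝ} (hγ : IsMollifier γ) {b : ST d → Sp d}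
    (hb : StronglyMeasurable b) {R : LL d P →L[ℝ] LL d P} (hR : IsGradOp α lam (rootField P b) R)
    (hk : KerBound P.toReal (fun z w =>
      ‖rootField P b z‖ₑ * ‖gradPot α lam (ordU α P) (z - w)‖ₑ) (ENNReal.ofReal (1 / 2)))
    {ε : ℕ → ℝ}
    (hε : ∀ n : ℕ, KerBound P.toReal (fun z w =>
        ‖(rootField P (regField γ b (ε n) n) - rootField P (truncField b n)) z‖ₑ *
          ‖gradPot α lam (ordU α P) (z - w)‖ₑ) (ENNReal.ofReal (1 / (8 * (n + 1))))) :
    ∃ Rn : ℕ → LL d P →L[ℝ] LL d P,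
      (∀ n, IsGradOp α lam (rootField P (regField γ b (ε n) n)) (Rn n)) ∧ (∀ n, ‖Rn n‖ ≤ 5 / 8) ∧
      ∀ g, Tendsto (fun n => Rn n g) atTop (𝓝 (R g)) := by
  have hPt := (ne_zero_ne_top_of_holder hpq).2
  have hS := measurableSet_truncSet hb
  have hA := stronglyMeasurable_rootField (P := P) hb
  have hD : ∀ n, ∃ D : LL d P →L[ℝ] LL d P, IsGradOp α lam
      (rootField P (regField γ b (ε n) n) - rootField P (truncField b n)) D ∧
      ‖D‖ ≤ 1 / (8 * (n + 1)) := fun n => by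
    obtain ⟨D, h₁, h₂⟩ := H.exists_isGradOp hpq
      ((stronglyMeasurable_rootField (hγ.stronglyMeasurable_regField hb (ε n) n)).sub
        (stronglyMeasurable_rootField (stronglyMeasurable_truncField hb n)))
      ENNReal.ofReal_ne_top (hε n)
    rw [ENNReal.toReal_ofReal (by positivity)] at h₂
    exact ⟨D, h₁, h₂⟩
  choose D hD₁ hD₂ using hD
  have hT : ∀ n, ∃ T : LL d P →L[ℝ] LL d P, IsGradOp α lam (rootField P (truncField b n)) T ∧
      ‖T‖ ≤ 1 / 2 := fun n => by
    obtain ⟨T, h₁, h₂⟩ := H.exists_isGradOp hpq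
      (stronglyMeasurable_rootField (stronglyMeasurable_truncField hb n))
      ENNReal.ofReal_ne_top (hk.mono (B₁ := ENNReal.ofReal (1 / 2)) hpq.nonneg (fun z w => by
        rw [rootField_truncField]
        refine mul_le_mul_left ?_ _
        exact enorm_indicator_le_enorm_self _ _) le_rfl)
    rw [ENNReal.toReal_ofReal (by positivity)] at h₂
    exact ⟨T, h₁, h₂⟩
  choose T hT₁ hT₂ using hT
  have hRn : ∀ n, IsGradOp α lam (rootField P (regField γ b (ε n) n)) (T n + D n) := fun n => by
    simpa only [add_sub_cancel] using (hT₁ n).add (hD₁ n)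
  refine ⟨fun n => T n + D n, hRn, fun n => ?_, fun g => ?_⟩
  · refine (norm_add_le _ _).trans ((add_le_add (hT₂ n) (hD₂ n)).trans ?_)
    have : 1 / (8 * ((n : ℝ) + 1)) ≤ 1 / 8 := by
      gcongr
      linarith [(n.cast_nonneg : (0 : ℝ) ≤ n)]
    linarith
  -- The regularized operator is the restriction of R g to the truncation set plus a mollification
  -- error of norm at most 1/(8(n+1)); both parts converge.
  · have e : ∀ n, (T n + D n) g = restr (hS n) (R g) + D n g := fun n =>
      hR.apply_eq_of_indicator (hS n) (hRn n) (by
        have := hD₁ n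
        rwa [rootField_truncField] at this) g
    simp only [e]
    have h0 : Tendsto (fun n => D n g) atTop (𝓝 0) := by
      refine squeeze_zero_norm (fun n => (D n).le_of_opNorm_le (hD₂ n) g) ?_
      have : Tendsto (fun n : ℕ => 1 / ((n : ℝ) + 1)) atTop (𝓝 0) :=
        tendsto_one_div_add_atTop_nhds_zero_nat
      have h2 := (this.const_mul (1 / 8)).mul_const ‖g‖
      rw [mul_zero, zero_mul] at h2
      refine h2.congr fun n => ?_
      rw [one_div_mul_one_div]
    simpa using (tendsto_restr hPt hS (eventually_mem_truncSet b) (R g)).add h0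

/-- Here the truncation cuts off the argument of Q, so strong convergence follows from the
continuity of Q and the L^p convergence of the restricted arguments. -/
theorem exists_regularized_isPotOp (hpq : P.toReal.HolderConjugate P'.toReal)
    {γ : ST d → ℝ} (hγ : IsMollifier γ) {b : ST d → Sp d}
    (hb : StronglyMeasurable b) {Q : LL d P →L[ℝ] LL d P}
    (hQ : IsPotOp α lam (fun z => ‖b z‖ ^ (1 - 1 / P.toReal)) Q)
    (hk : KerBound P.toReal (fun z w => ‖potKernel α lam (ordF α P) (z - w)‖ₑ *
      ‖‖b w‖ ^ (1 - 1 / P.toReal)‖ₑ) (ENNReal.ofReal (1 / 2)))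
    {ε : ℕ → ℝ}
    (hε : ∀ n : ℕ, KerBound P.toReal (fun z w => ‖potKernel α lam (ordF α P) (z - w)‖ₑ *
        ‖‖regField γ b (ε n) n w‖ ^ (1 - 1 / P.toReal) -
          ‖truncField b n w‖ ^ (1 - 1 / P.toReal)‖ₑ) (ENNReal.ofReal (1 / (8 * (n + 1))))) :
    ∃ Qn : ℕ → LL d P →L[ℝ] LL d P,
      (∀ n, IsPotOp α lam (fun z => ‖regField γ b (ε n) n z‖ ^ (1 - 1 / P.toReal)) (Qn n)) ∧
      (∀ n, ‖Qn n‖ ≤ 5 / 8) ∧ ∀ g, Tendsto (fun n => Qn n g) atTop (𝓝 (Q g)) := by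
  have hPt := (ne_zero_ne_top_of_holder hpq).2
  have hS := measurableSet_truncSet hb
  have hs : 1 - 1 / P.toReal ≠ 0 := by
    rw [one_sub_one_div_toReal hpq]
    exact (one_div_pos.2 hpq.symm.pos).ne'
  have mt : ∀ n, Measurable fun z => ‖truncField b n z‖ ^ (1 - 1 / P.toReal) := fun n =>
    (stronglyMeasurable_truncField hb n).norm.measurable.pow_const _
  have hD : ∀ n, ∃ D : LL d P →L[ℝ] LL d P, IsPotOp α lam
      ((fun z => ‖regField γ b (ε n) n z‖ ^ (1 - 1 / P.toReal)) -
        fun z => ‖truncField b n z‖ ^ (1 - 1 / P.toReal)) D ∧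
      ‖D‖ ≤ 1 / (8 * (n + 1)) := fun n => by
    obtain ⟨D, h₁, h₂⟩ := exists_isPotOp hpq
      (((hγ.stronglyMeasurable_regField hb (ε n) n).norm.measurable.pow_const _).sub (mt n))
      ENNReal.ofReal_ne_top (hε n)
    rw [ENNReal.toReal_ofReal (by positivity)] at h₂
    exact ⟨D, h₁, h₂⟩
  choose D hD₁ hD₂ using hD
  have hT : ∀ n, ∃ T : LL d P →L[ℝ] LL d P,
      IsPotOp α lam (fun z => ‖truncField b n z‖ ^ (1 - 1 / P.toReal)) T ∧
      ‖T‖ ≤ 1 / 2 := fun n => by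
    obtain ⟨T, h₁, h₂⟩ := exists_isPotOp hpq (mt n)
      ENNReal.ofReal_ne_top (hk.mono (B₁ := ENNReal.ofReal (1 / 2)) hpq.nonneg (fun z w => by
        rw [congrFun (norm_truncField_rpow hs b n) w]
        refine mul_le_mul_right ?_ _
        exact enorm_indicator_le_enorm_self (fun z => ‖b z‖ ^ (1 - 1 / P.toReal)) _) le_rfl)
    rw [ENNReal.toReal_ofReal (by positivity)] at h₂
    exact ⟨T, h₁, h₂⟩
  choose T hT₁ hT₂ using hT
  have hQn : ∀ n, IsPotOp α lam (fun z => ‖regField γ b (ε n) n z‖ ^ (1 - 1 / P.toReal))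
      (T n + D n) := fun n => by
    simpa only [add_sub_cancel] using (hT₁ n).add (hD₁ n)
  have hQn' : ∀ n, ‖T n + D n‖ ≤ 5 / 8 := fun n => by
    refine (norm_add_le _ _).trans ((add_le_add (hT₂ n) (hD₂ n)).trans ?_)
    have : 1 / (8 * ((n : ℝ) + 1)) ≤ 1 / 8 := by
      gcongr
      linarith [(n.cast_nonneg : (0 : ℝ) ≤ n)]
    linarith
  refine ⟨fun n => T n + D n, hQn, hQn', fun g => ?_⟩
  have e : ∀ n, (T n + D n) g = Q (restr (hS n) g) + D n g := fun n =>
    hQ.apply_eq_of_indicator (hS n) (hQn n) (by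
      have := hD₁ n
      rwa [norm_truncField_rpow hs] at this) g
  simp only [e]
  have h0 : Tendsto (fun n => D n g) atTop (𝓝 0) := by
    refine squeeze_zero_norm (fun n => (D n).le_of_opNorm_le (hD₂ n) g) ?_
    have : Tendsto (fun n : ℕ => 1 / ((n : ℝ) + 1)) atTop (𝓝 0) :=
      tendsto_one_div_add_atTop_nhds_zero_nat
    have h2 := (this.const_mul (1 / 8)).mul_const ‖g‖
    rw [mul_zero, zero_mul] at h2
    refine h2.congr fun n => ?_
    rw [one_div_mul_one_div]
  simpa using ((Q.continuous.tendsto g).comp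
    (tendsto_restr hPt hS (eventually_mem_truncSet b) g)).add h0

theorem isUnit_one_add_mul {X : Type*} [NormedAddCommGroup X] [NormedSpace ℝ X] [CompleteSpace X]
    {S T : X →L[ℝ] X} (h : ‖S‖ * ‖T‖ < 1) :
    IsUnit (1 + S * T) ∧ HasSum (fun k : ℕ => (-(S * T)) ^ k) (Ring.inverse (1 + S * T)) := by
  have hn : ‖-(S * T)‖ < 1 := by
    rw [norm_neg]; exact (norm_mul_le _ _).trans_lt h
  have h1 := isUnit_one_sub_of_norm_lt_one hn
  have h2 := hasSum_geom_series_inverse _ hn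
  rw [sub_neg_eq_add] at h1 h2
  exact ⟨h1, h2⟩

theorem inverse_apply_add {X : Type*} [NormedAddCommGroup X] [NormedSpace ℝ X]
    {S T : X →L[ℝ] X} (h : IsUnit (1 + S * T)) (x : X) :
    Ring.inverse (1 + S * T) x + S (T (Ring.inverse (1 + S * T) x)) = x :=
  congrArg (fun L : X →L[ℝ] X => L x) (Ring.mul_inverse_cancel _ h)

theorem eq_inverse_apply {X : Type*} [NormedAddCommGroup X] [NormedSpace ℝ X]
    {S T : X →L[ℝ] X} (h : IsUnit (1 + S * T)) {w x : X} (hw : w + S (T w) = x) :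
    w = Ring.inverse (1 + S * T) x := by
  have := congrArg (fun L : X →L[ℝ] X => L w) (Ring.inverse_mul_cancel _ h)
  rw [← hw]
  exact this.symm

/-- The identity (1 + ST)^{-1} = 1 - S(1 + TS)^{-1}T, verified by checking that the right side
solves the equation; it is the source of the second formula for u. -/
theorem inverse_apply_eq_sub {X : Type*} [NormedAddCommGroup X] [NormedSpace ℝ X]
    {S T : X →L[ℝ] X} (h : IsUnit (1 + S * T)) (h' : IsUnit (1 + T * S)) (x : X) :
    Ring.inverse (1 + S * T) x = x - S (Ring.inverse (1 + T * S) (T x)) := by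
  symm
  refine eq_inverse_apply h ?_
  have := inverse_apply_add h' (T x)
  set y := Ring.inverse (1 + T * S) (T x)
  rw [map_sub, ← this, add_sub_cancel_right]
  abel

/-- The operators of the drift. -/
theorem Adm.exists_drift_ops (hpq : P.toReal.HolderConjugate P'.toReal) (H : Adm d α lam)
    {b : ST d → Sp d} (hb : StronglyMeasurable b)
    (h₁ : KerBound P.toReal (fun z w =>
      ‖rootField P b z‖ₑ * ‖gradPot α lam (ordU α P) (z - w)‖ₑ) (ENNReal.ofReal (1 / 2)))
    (h₂ : KerBound P.toReal (fun z w => ‖potKernel α lam (ordF α P) (z - w)‖ₑ *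
      ‖‖b w‖ ^ (1 - 1 / P.toReal)‖ₑ) (ENNReal.ofReal (1 / 2))) :
    ∃ R Q : LL d P →L[ℝ] LL d P, IsGradOp α lam (rootField P b) R ∧
      IsPotOp α lam (fun z => ‖b z‖ ^ (1 - 1 / P.toReal)) Q ∧ ‖R‖ * ‖Q‖ < 1 := by
  obtain ⟨R, hR, nR⟩ := H.exists_isGradOp hpq (stronglyMeasurable_rootField hb)
    ENNReal.ofReal_ne_top h₁
  obtain ⟨Q, hQ, nQ⟩ := exists_isPotOp hpq (hb.norm.measurable.pow_const _)
    ENNReal.ofReal_ne_top h₂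
  refine ⟨R, Q, hR, hQ, ?_⟩
  rw [ENNReal.toReal_ofReal (by norm_num)] at nR nQ
  nlinarith [norm_nonneg R, norm_nonneg Q]

end main

end StableDrift

end

set_option maxHeartbeats 1000000 in
theorem theorem1 (d : ℕ) (hd : 2 ≤ d) (α : ℝ) (hα₁ : 1 < α) (hα₂ : α < 2)
    (q : ℝ) (hq₁ : 1 < q) (hq₂ : q < d + α) :
    ∃ (c : ℝ≥0∞ → ℝ) (lam₀ : ℝ≥0∞ → ℝ → ℝ), (∀ p, 0 < c p) ∧ (∀ p M, 0 ≤ lam₀ p M) ∧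
      ∀ (bs bb : ST d → Sp d) (M : ℝ),
        AEStronglyMeasurable bs → AEStronglyMeasurable bb → (∀ᵐ z, ‖bb z‖ ≤ M) →
        -- (i) and (ii)
        (∀ (p : ℝ≥0∞) [Fact (1 ≤ p)], 1 < p → p ≠ ⊤ →
          morreyNorm α q (fun z => ‖bs z‖ ^ (1 / (α - 1))) < ENNReal.ofReal (c p) →
          ∀ γ : ST d → ℝ, IsMollifier γ → ∃ δ : ℕ → ℝ, (∀ n, 0 < δ n) ∧
          ∀ lam : ℝ, lam₀ p M < lam →
            ∃ R Q : LL d p →L[ℝ] LL d p,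
              IsOpR α lam (bs + bb) R ∧ IsOpQ α lam (bs + bb) Q ∧ ‖R‖ * ‖Q‖ < 1 ∧
              IsUnit (1 + Q * R) ∧ IsUnit (1 + R * Q) ∧
              HasSum (fun k : ℕ => (-(Q * R)) ^ k) (Ring.inverse (1 + Q * R)) ∧
              ∀ (f : Distr d) (F : LL d p), IsNegBessel α lam (ordF α p) f F →
                ∃ (u : ST d → ℝ) (w : LL d p),
                  w = Ring.inverse (1 + Q * R) F ∧ IsPosBessel α lam (ordU α p) u w ∧
                  (∃ v : ST d → ℝ, IsFreeResolvent p α lam f v ∧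
                    u =ᵐ[volume] fun z => v z -
                      pot α lam (ordU α p) (Q (Ring.inverse (1 + R * Q) (R F))) z) ∧
                  ((d : ℝ) + 1 < p.toReal → ∃ uc : ST d →ᵇ ℝ, u =ᵐ[volume] uc) ∧
                  ∀ ε : ℕ → ℝ, (∀ n, 0 < ε n ∧ ε n ≤ δ n) →
                  ∀ (fn : ℕ → ST d → ℝ) (Fn : ℕ → LL d p),
                    (∀ n, MemLp (fn n) ⊤) →
                    (∀ n, IsNegBessel α lam (ordF α p) (funDistr (fn n)) (Fn n)) →
                    Tendsto Fn atTop (𝓝 F) →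
                    (∀ n, ∃ un : ST d → ℝ,
                      IsSolution p α lam (regField γ (bs + bb) (ε n) n) (fn n) un) ∧
                    ∀ un : ℕ → ST d → ℝ,
                      (∀ n, IsSolution p α lam (regField γ (bs + bb) (ε n) n) (fn n) (un n)) →
                      (∃ wn : ℕ → LL d p, (∀ n, IsPosBessel α lam (ordU α p) (un n) (wn n)) ∧
                        Tendsto wn atTop (𝓝 w)) ∧
                      ((d : ℝ) + 1 < p.toReal →
                        ∃ (ucn : ℕ → ST d →ᵇ ℝ) (uc : ST d →ᵇ ℝ),
                          (∀ n, un n =ᵐ[volume] ucn n) ∧ u =ᵐ[volume] uc ∧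
                          Tendsto ucn atTop (𝓝 uc))) ∧
        -- (iii)
        (morreyNorm α q (fun z => ‖bs z‖ ^ (1 / (α - 1))) < ENNReal.ofReal (c 2) →
          ∀ lam : ℝ, lam₀ 2 M < lam →
            ∃ R Q : LL d 2 →L[ℝ] LL d 2,
              IsOpR α lam (bs + bb) R ∧ IsOpQ α lam (bs + bb) Q ∧ IsUnit (1 + Q * R) ∧
              ∀ (f : Distr d) (F : LL d 2), IsNegBessel α lam (ordF α 2) f F →
                ∃ u : ST d → ℝ,
                  IsPosBessel α lam (ordU α 2) u (Ring.inverse (1 + Q * R) F) ∧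
                  IsWeakSolution α lam R Q F u ∧
                  ∀ v : ST d → ℝ, IsWeakSolution α lam R Q F v → v =ᵐ[volume] u) := by
  have hd0 : 0 < d := by omega
  -- The constants have to be functions of p fixed before the drift is given; outside 1 < p < ∞ they
  -- take the dummy values 1 and 0.
  have key : ∀ p : ℝ≥0∞, ∃ (c : ℝ) (lam₀ : ℝ → ℝ), 0 < c ∧ (∀ M, 0 ≤ lam₀ M) ∧
      (1 < p → p ≠ ⊤ → ∀ (bs bb : ST d → Sp d) (M : ℝ),
        StronglyMeasurable bs → StronglyMeasurable bb → (∀ z, ‖bb z‖ ≤ M) →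
        morreyNorm α q (fun z => ‖bs z‖ ^ (1 / (α - 1))) < ENNReal.ofReal c →
        ∀ lam, lam₀ M < lam →
        KerBound p.toReal (fun z w =>
          ‖rootField p (bs + bb) z‖ₑ * ‖gradPot α lam (ordU α p) (z - w)‖ₑ)
          (ENNReal.ofReal (1 / 2)) ∧
        KerBound p.toReal (fun z w => ‖potKernel α lam (ordF α p) (z - w)‖ₑ *
          ‖‖(bs + bb) w‖ ^ (1 - 1 / p.toReal)‖ₑ) (ENNReal.ofReal (1 / 2))) := by
    intro p
    by_cases hp : 1 < p ∧ p ≠ ⊤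
    · obtain ⟨p', hpq⟩ := exists_holderConjugate hp.1 hp.2
      obtain ⟨c, lam₀, hc, hl, h⟩ := exists_kerBound_drift hd0 hα₁ hα₂ hpq hq₁ hq₂
      exact ⟨c, lam₀, hc, hl, fun _ _ => h⟩
    · exact ⟨1, fun _ => 0, one_pos, fun _ => le_rfl, fun h₁ h₂ => absurd ⟨h₁, h₂⟩ hp⟩
  choose c lam₀ hc hl hker using key
  refine ⟨c, lam₀, hc, hl, fun bs bb M hbs hbb hM => ?_⟩
  -- The drift is replaced by a strongly measurable version whose bounded part is bounded
  -- everywhere. The Morrey norm, the regularized fields and the relations characterizing R and Q do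
  -- not see the change.
  obtain ⟨bb', hbb', ebb, hM'⟩ := exists_stronglyMeasurable_bounded hbb hM
  obtain ⟨bs', hbs', ebs⟩ : ∃ bs', StronglyMeasurable bs' ∧ bs =ᵐ[volume] bs' :=
    ⟨_, hbs.stronglyMeasurable_mk, hbs.ae_eq_mk⟩
  have eb : bs' + bb' =ᵐ[volume] bs + bb := (ebs.add ebb).symm
  have hb := hbs'.add hbb'
  have em : morreyNorm α q (fun z => ‖bs z‖ ^ (1 / (α - 1))) =
      morreyNorm α q (fun z => ‖bs' z‖ ^ (1 / (α - 1))) :=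
    morreyNorm_congr (by filter_upwards [ebs] with z hz; rw [hz])
  have eroot : ∀ p, rootField p (bs' + bb') =ᵐ[volume] rootField p (bs + bb) := fun p => by
    filter_upwards [eb] with z hz
    simp only [rootField, hz]
  have epow : ∀ s : ℝ, (fun z => ‖(bs' + bb') z‖ ^ s) =ᵐ[volume] fun z => ‖(bs + bb) z‖ ^ s :=
    fun s => by filter_upwards [eb] with z hz; rw [hz]
  rw [em]
  refine ⟨fun p _ hp1 hpt hm γ hγ => ?_, fun hm lam hlam => ?_⟩
  · obtain ⟨p', hpq⟩ := exists_holderConjugate hp1 hpt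
    -- The mollification scales are fixed before λ, which is possible because the kernel bounds in
    -- `hreg` are uniform in λ.
    obtain ⟨δ, hδ, hreg⟩ := hγ.exists_kerBound_regField hd0 hα₁ hα₂ hpq hq₁ hq₂ hb
    refine ⟨δ, hδ, fun lam hlam => ?_⟩
    have H : Adm d α lam := ⟨hd0, hα₁, hα₂, (hl p M).trans_lt hlam⟩
    have ho := ordU_pos hα₁ hpq.lt
    have hs : 0 < ordU α p := by
      have := H.pos
      exact (by positivity : (0 : ℝ) < 1 / α).trans ho.1
    obtain ⟨k₁, k₂⟩ := hker p hp1 hpt bs' bb' M hbs' hbb' hM' hm lam hlam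
    obtain ⟨R, Q, hR, hQ, hRQ⟩ := H.exists_drift_ops hpq hb k₁ k₂
    obtain ⟨u₁, hsum⟩ := isUnit_one_add_mul (S := Q) (T := R) (by rwa [mul_comm])
    obtain ⟨u₂, -⟩ := isUnit_one_add_mul hRQ
    refine ⟨R, Q, H.isOpR_of_isGradOp hpq (hR.congr (eroot p)), (hQ.congr (epow _)).isOpQ, hRQ, u₁,
      u₂, hsum, fun f F hF => ?_⟩
    have hw := inverse_apply_add u₁ F
    refine ⟨pot α lam (ordU α p) (Ring.inverse (1 + Q * R) F), _, rfl, EventuallyEq.rfl,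
      ⟨pot α lam (ordU α p) F, ⟨H.memLp_pot hpq hs (Lp.memLp F),
        H.integral_pot_ordU_mul_bwdOp hpq hF⟩, ?_⟩, fun hpd => ?_, fun ε hε fn Fn _ hfn hFn => ?_⟩
    -- The free resolvent of f is A^{-s}F, and the resolvent identity followed by linearity of
    -- A^{-s} gives the second formula.
    · rw [inverse_apply_eq_sub u₁ u₂ F, pot_congr (Lp.coeFn_sub _ _)]
      exact H.pot_sub hpq hs (Lp.memLp _) (Lp.memLp _)
    · obtain ⟨Φ, hΦ, -⟩ := H.exists_pot_bcf hpq hpd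
      exact ⟨Φ _, Eventually.of_forall fun z => (hΦ _ z).symm⟩
    · obtain ⟨Rn, hRn, nRn, tRn⟩ := H.exists_regularized_isGradOp hpq hγ hb hR k₁
        fun n => (hreg n (ε n) (hε n).1 (hε n).2 lam H.lam_pos).1
      obtain ⟨Qn, hQn, nQn, tQn⟩ := exists_regularized_isPotOp hpq hγ hb hQ k₂
        fun n => (hreg n (ε n) (hε n).1 (hε n).2 lam H.lam_pos).2
      have hrm : ∀ n, AEStronglyMeasurable (regField γ (bs' + bb') (ε n) n) := fun n =>
        (hγ.stronglyMeasurable_regField hb (ε n) n).aestronglyMeasurable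
      have hrb := fun n => hγ.norm_regField_le (bs' + bb') (hε n).1 n
      simp only [regField_congr eb.symm]
      refine ⟨fun n => ?_, fun un hun => ?_⟩
      -- Existence for each n: both regularized operators have norm at most 5/8, and 25/64 < 1.
      · have hn := (isUnit_one_add_mul (S := Qn n) (T := Rn n) (by
          nlinarith [nRn n, nQn n, norm_nonneg (Rn n), norm_nonneg (Qn n)])).1
        exact ⟨_, H.isSolution_pot hpq (hrm n) (hrb n) (hRn n) (hQn n) (hfn n)
          (inverse_apply_add hn (Fn n))⟩
      -- An arbitrary family of solutions is of the form A^{-s}w_n with w_n solving the regularized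
      -- equation, so the perturbation argument applies to it.
      · choose wn hwn hwn' using fun n =>
          H.exists_of_isSolution hpq (hrm n) (hrb n) (hRn n) (hQn n) (hfn n) (hun n)
        have ht : Tendsto wn atTop (𝓝 (Ring.inverse (1 + Q * R) F)) :=
          tendsto_of_one_add_mul_apply_eq (by norm_num) nRn nQn tRn tQn hw hwn' hFn
        refine ⟨⟨wn, hwn, ht⟩, fun hpd => ?_⟩
        obtain ⟨Φ, hΦ, hΦc⟩ := H.exists_pot_bcf hpq hpd
        exact ⟨fun n => Φ (wn n), Φ _, fun n => (hwn n).trans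
          (Eventually.of_forall fun z => (hΦ _ z).symm),
          Eventually.of_forall fun z => (hΦ _ z).symm, (hΦc.tendsto _).comp ht⟩
  · have hpq : (2 : ℝ≥0∞).toReal.HolderConjugate (2 : ℝ≥0∞).toReal := by
      rw [ENNReal.toReal_ofNat]; exact Real.HolderConjugate.two_two
    have H : Adm d α lam := ⟨hd0, hα₁, hα₂, (hl 2 M).trans_lt hlam⟩
    obtain ⟨k₁, k₂⟩ := hker 2 ENNReal.one_lt_two ENNReal.ofNat_ne_top bs' bb' M hbs' hbb' hM' hm
      lam hlam
    obtain ⟨R, Q, hR, hQ, hRQ⟩ := H.exists_drift_ops hpq hb k₁ k₂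
    obtain ⟨u₁, -⟩ := isUnit_one_add_mul (S := Q) (T := R) (by rwa [mul_comm])
    refine ⟨R, Q, H.isOpR_of_isGradOp hpq (hR.congr (eroot 2)), (hQ.congr (epow _)).isOpQ, u₁,
      fun f F _ => ⟨_, EventuallyEq.rfl,
        (H.isWeakSolution_iff R Q F _).2 ⟨_, EventuallyEq.rfl, inverse_apply_add u₁ F⟩,
        fun v hv => ?_⟩⟩
    -- Any weak solution comes from a solution of w + QRw = F, which is unique since 1 + QR is
    -- invertible.
    obtain ⟨w, hvw, hw⟩ := (H.isWeakSolution_iff R Q F v).1 hv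
    rw [← eq_inverse_apply u₁ hw]
    exact hvw
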